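/- Let $d\ge 1$, $M(v)=(2\pi)^{-d/2}e^{-|v|^2/2}$ and $\mu(v)=1+|v|^2$ for $v\in\mathbb R^d$. For $f=f(x,v)$ on $\mathbb R^d\times\mathbb R^d$ put $$\mathbf L f=\Delta_v f+\tfrac14(2d-|v|^2)f,\qquad \mathbf B=-v\cdot\nabla_x+\mathbf L,\qquad a^f(x)=\int \sqrt{M(v)}\,f(x,v)\,dv,\qquad b^f(x)=\int v\sqrt{M(v)}\,f(x,v)\,dv ,$$ and consider the Cauchy problem $$\partial_t f=\mathbf B f+b^f\cdot v\sqrt M+h\quad(t>0),\qquad f(0)=f_0 .\tag{1}$$ A solution of (1) is a function $f\in C([0,\infty);L^2(\mathbb R^d\times\mathbb R^d))$ that satisfies (1) weakly, i.e. against all test functions $\psi\in C_c^\infty(\mathbb R^d\times\mathbb R^d)$ and integrated over $[0,t]$ for every $t\ge0$; the source $h$ is always such that $(1+|v|)\sqrt M\,h$ is integrable on $(0,T)\times K\times\mathbb R^d_v$ for all $T>0$ and all compact $K\subset\mathbb R^d_x$. Problem (1) has exactly one solution for every $f_0\in L^2$ and every measurable $h$ with $\mu^{-1/2}h\in L^2((0,T)\times\mathbb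 R^d\times\mathbb R^d)$ for all $T>0$. Let $e^{\mathbf Bt}f_0$ denote the value at time $t$ of the solution with $h=0$ (so the term $b\cdot v\sqrt M$ is included in the dynamics). The Duhamel term $\int_0^t e^{\mathbf B(t-s)}h(s)\,ds$ denotes the solution of (1) with $f_0=0$ and source $h$; if $h\in L^1_{loc}([0,\infty);L^2)$, the Bochner integral $\int_0^t e^{\mathbf B(t-s)}h(s)\,ds$ in $L^2$ is such a solution. Let $1\le q\le 2$, let $m\ge0$ be an integer and $$\sigma_{d,q,m}=\frac d2\Big(\frac1q-\frac12\Big)+\frac m2 .$$ There is a constant $C>0$ depending only on $d,q,m$ such that the following holds for all multi-indices $\beta\le\alpha$ with $|\alpha|-|\beta|=m$, where $\partial^\alpha,\partial^\beta$ are weak derivatives in $x$ and $\|g\|_{L^2_v(L^q)}=\big(\int\|g(\cdot,v)\|_{L^q_x}^2dv\big)^{1/2}$. (i) If $f_0\in L^2$, $\partial^\alpha f_0\in L^2$ and $\partial^\beta f_0\in L^2_v(L^q)$, then $\partial^\alpha e^{\mathbf Bt}f_0\in L^2$ and $$\|\partial^\alpha e^{\mathbf Bt}f_0\|_{L^2}\le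 C(1+t)^{-\sigma_{d,q,m}}\big(\|\partial^\beta f_0\|_{L^2_v(L^q)}+\|\partial^\alpha f_0\|_{L^2}\big),\qquad t>0 .$$ (ii) Suppose that for almost every $t>0$ one has $\mu^{-1/2}\partial^\alpha h(t)\in L^2$, $\mu^{-1/2}\partial^\beta h(t)\in L^2_v(L^q)$, and $a^{h(t)}(x)=0$, $b^{h(t)}(x)=0$ for almost every $x$ (with $\partial^\alpha h$, $\partial^\beta h$ jointly measurable). If $u$ is a solution of (1) with $f_0=0$ and source $h$, that is $u(t)=\int_0^te^{\mathbf B(t-s)}h(s)\,ds$, then for every $t\ge0$ $$\|\partial^\alpha u(t)\|_{L^2}^2\le C\int_0^t(1+t-s)^{-2\sigma_{d,q,m}}\Big(\|\mu^{-1/2}\partial^\beta h(s)\|_{L^2_v(L^q)}^2+\|\mu^{-1/2}\partial^\alpha h(s)\|_{L^2}^2\Big)ds ,$$ where, if the right-hand side is finite, $\partial^\alpha u(t)\in L^2$ is part of the conclusion (there is nothing to prove if it is infinite). -/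

import Mathlib

open MeasureTheory Set
open scoped ContDiff ENNReal Laplacian

namespace FokkerPlanck

/-- Positions and velocities: the Euclidean space `ℝ^d`. -/
abbrev Vec (d : ℕ) : Type := EuclideanSpace ℝ (Fin d)

/-- Phase space `ℝ^d × ℝ^d`; a point is `z = (x, v)`. -/
abbrev Phase (d : ℕ) : Type := Vec d × Vec d

/-- The real Hilbert space `L²(ℝ^d × ℝ^d)`. -/
abbrev L2 (d : ℕ) : Type := Lp ℝ 2 (volume : Measure (Phase d))

/-- The global Maxwellian `M(v) = (2π)^{-d/2} exp (-|v|²/2)`. -/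
noncomputable def maxwellian {d : ℕ} (v : Vec d) : ℝ :=
  1 / (2 * Real.pi) ^ ((d : ℝ) / 2) * Real.exp (-‖v‖ ^ 2 / 2)

/-- `√M`. -/
noncomputable def sqrtM {d : ℕ} (v : Vec d) : ℝ := Real.sqrt (maxwellian v)

/-- The weight `μ(v) = 1 + |v|²`. -/
noncomputable def mu {d : ℕ} (v : Vec d) : ℝ := 1 + ‖v‖ ^ 2

/-- Multiplication by `μ(v)^{-1/2}`. -/
noncomputable def invSqrtMuMul {d : ℕ} (f : Phase d → ℝ) : Phase d → ℝ :=
  fun z => (mu z.2) ^ (-(1 / 2 : ℝ)) * f z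

/-- The moment `a(x) = ⟨√M, f(x, ·)⟩`. -/
noncomputable def density {d : ℕ} (f : Phase d → ℝ) (x : Vec d) : ℝ :=
  ∫ v : Vec d, sqrtM v * f (x, v)

/-- The (vector) moment `b(x) = ⟨v √M, f(x, ·)⟩`. -/
noncomputable def momentum {d : ℕ} (f : Phase d → ℝ) (x : Vec d) : Vec d :=
  ∫ v : Vec d, (sqrtM v * f (x, v)) • v

/-- The term `b · v √M` of the equation, where `b` is the moment of `f`. -/
noncomputable def momentumTerm {d : ℕ} (f : Phase d → ℝ) (z : Phase d) : ℝ :=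
  inner ℝ (momentum f z.1) z.2 * sqrtM z.2

/-- `L f = Δ_v f + (1/4) (2d - |v|²) f`. -/
noncomputable def opL {d : ℕ} (f : Phase d → ℝ) (z : Phase d) : ℝ :=
  Δ (fun v : Vec d => f (z.1, v)) z.2 + (1 / 4) * (2 * (d : ℝ) - ‖z.2‖ ^ 2) * f z

/-- `v · ∇_x f`. -/
noncomputable def transport {d : ℕ} (f : Phase d → ℝ) (z : Phase d) : ℝ :=
  fderiv ℝ f z (z.2, 0)

/-- Test functions: smooth with compact support. -/
def IsTest {d : ℕ} (ψ : Phase d → ℝ) : Prop :=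
  ContDiff ℝ ∞ ψ ∧ HasCompactSupport ψ

/-- `∂_{x_i}`. -/
noncomputable def xPartial {d : ℕ} (i : Fin d) (ψ : Phase d → ℝ) : Phase d → ℝ :=
  fun z => fderiv ℝ ψ z (EuclideanSpace.single i 1, 0)

/-- `∂_x^α = ∂_{x_1}^{α_1} ⋯ ∂_{x_d}^{α_d}` for a multi-index `α`. -/
noncomputable def xDeriv {d : ℕ} (α : Fin d → ℕ) (ψ : Phase d → ℝ) : Phase d → ℝ :=
  (List.finRange d).foldr (fun i g => (xPartial i)^[α i] g) ψ

/-- `g` is the weak derivative `∂_x^α f` on `ℝ^d × ℝ^d`. -/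
def IsWeakXDeriv {d : ℕ} (α : Fin d → ℕ) (f g : Phase d → ℝ) : Prop :=
  LocallyIntegrable f ∧ LocallyIntegrable g ∧
    ∀ ψ : Phase d → ℝ, IsTest ψ →
      ∫ z, f z * xDeriv α ψ z = (-1) ^ (∑ i, α i) * ∫ z, g z * ψ z

/-- The norm of `L²_v(L^q_x)`, with values in `[0, ∞]`. -/
noncomputable def mixedNorm {d : ℕ} (q : ℝ) (f : Phase d → ℝ) : ℝ≥0∞ :=
  (∫⁻ v : Vec d, (eLpNorm (fun x : Vec d => f (x, v)) (ENNReal.ofReal q) volume) ^ 2) ^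
    (1 / 2 : ℝ)

/-- The source is such that it can be tested and has moments against `√M` and `v √M`:
`(1 + |v|) √M h` is integrable on `(0, T) × K × ℝ^d` for all `T` and all compact `K`. -/
def SourceIntegrable {d : ℕ} (h : ℝ → Phase d → ℝ) : Prop :=
  ∀ (T : ℝ) (K : Set (Vec d)), IsCompact K →
    IntegrableOn (fun p : ℝ × Phase d => (1 + ‖p.2.2‖) * sqrtM p.2.2 * h p.1 p.2)
      (Ioc 0 T ×ˢ (K ×ˢ univ)) volume

/-- `u ∈ C([0, ∞); L²)` is a weak solution of the Cauchy problem
`∂_t u = -v · ∇_x u + L u + b · v √M + h`, `u(0) = f₀`, where `b` is the moment of `u`.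
The equation is tested against `ψ(x, v)` and integrated in time; `L` is formally self-adjoint
and `-v · ∇_x` formally skew-adjoint. -/
structure IsWeakSolution {d : ℕ} (f₀ : L2 d) (h : ℝ → Phase d → ℝ) (u : ℝ → L2 d) : Prop where
  source : SourceIntegrable h
  continuousOn : ContinuousOn u (Ici 0)
  weak_eq : ∀ ψ : Phase d → ℝ, IsTest ψ → ∀ t : ℝ, 0 ≤ t →
    ∫ z, u t z * ψ z = (∫ z, f₀ z * ψ z) +
      ∫ s in (0 : ℝ)..t, ∫ z,
        (u s z * (transport ψ z + opL ψ z) + momentumTerm (u s) z * ψ z + h s z * ψ z)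

open Classical in
/-- The solution operator `e^{𝐁t}` of the Cauchy problem without source: `f₀` is sent to the value
at time `t` of the solution with initial datum `f₀` and `h = 0`. -/
noncomputable def solutionOperator {d : ℕ} (t : ℝ) (f₀ : L2 d) : L2 d :=
  if hf : ∃ u : ℝ → L2 d, IsWeakSolution f₀ 0 u then hf.choose t else 0

/-- The index of rate `σ_{d,q,m} = (d/2) (1/q - 1/2) + m/2`. -/
noncomputable def sigma (d : ℕ) (q : ℝ) (m : ℕ) : ℝ :=
  (d : ℝ) / 2 * (1 / q - 1 / 2) + (m : ℝ) / 2

end FokkerPlanck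

/-!
# Decay for the linearized kinetic Fokker–Planck equation with momentum term

After a Fourier transform in the position variable and an expansion in Hermite functions of the
velocity variable, the equation decouples into one linear equation for each frequency `ξ`. There
`L` is minus the degree, multiplication by `v` is the sum of the lowering and raising operators,
and the momentum term removes the damping of degree one. Restricting to degrees at most `N` gives a
bounded generator, so that the group, the energy identities and the variation of constants formula
are elementary; the passage to the limit `N → ∞` only has to control the leak out of degree `N`,
where the damping is strong.

*Hypocoercivity.* The damping acts on the degrees at least two. Transport couples neighbouring
degrees, and a small multiple of a cross term between the degrees `0`, `1`, `2`, added to the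
energy, transfers the damping to the degrees `0` and `1` with the strength `|ξ|² / (1 + |ξ|²)`
(`lyap_rate_le`). This gives decay at this rate for each frequency (`norm_flow_sq_le`).

*Weighted sources.* A source `h` with `μ^{-1/2} h` in `L²` is of the form `g₀ + ∑ vᵢ gᵢ` with `g₀`,
`gᵢ` in `L²`. Pairing a solution with the backward semigroup started from the solution itself, the
factors `vᵢ` cost one half power of the degree, which the dissipation of the backward semigroup
pays for. On the degrees `0` and `1` there is no dissipation: either the `L²` norm pays, at the
price of a factor `1 + T`, or the source has no such components (`a_priori`). The first alternative
gives uniqueness and, by approximation with bounded sources, existence (`exists_unique_solution`).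
The second applies to sources without density and momentum (`srcCo_eq_zero`). In both cases the
derivatives are carried by the test functions, so that no regularity of the solution is
presupposed.

*Mixed norms.* For `|ξ| ≥ 1` the factor `e^{-ct|ξ|²/(1+|ξ|²)}` decays exponentially and the norm of
`∂^α` is used. For `|ξ| ≤ 1` it is dominated by a heat multiplier, and the smoothing of the heat
flow from `L^q` to derivatives in `L²`, obtained by duality with Schwartz functions from Hölder's
inequality in `x` and the Cauchy–Schwarz inequality in `v`, gives the power of `1 + t`
(`exists_decay`). Together with the decay at each frequency this yields `exists_decay_homogeneous`
and `exists_decay_duhamel`.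
-/

namespace FokkerPlanck

open Filter Topology InnerProductSpace
open ContinuousLinearMap hiding sum_apply smul_apply add_apply sub_apply zero_apply
open SchwartzMap hiding sum_apply smul_apply add_apply sub_apply zero_apply
open Complex (I norm_real ofReal_mul continuous_ofReal coe_smul ofRealCLM conj_ofReal ofReal_re
  add_re ofReal_sum conj_I norm_I ofReal_pow sub_re reCLM conj_re reCLM_apply conj_conj ofReal_add
  mul_re)
open intervalIntegral (integral_of_le integral_eq_sub_of_hasDerivAt
  tendsto_integral_filter_of_dominated_convergence integral_hasDerivAt_right)
open Real (exp norm_of_nonneg norm_eq_abs exp_pos sqrt_nonneg exp_nonneg mul_self_sqrt exp_add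
  sqrt_mul exp_le_one_iff rpow_mul sq_sqrt exp_le_exp continuous_exp rpow_natCast mul_rpow
  rpow_neg sqrt_eq_rpow)
open Finset (sum_congr mul_sum sum_add_distrib sum_mul sum_le_sum sum_le_sum_of_subset_of_nonneg
  mem_filter sum_nonneg sum_union sum_const_zero sum_neg_distrib sum_insert sum_comm)
open ENNReal (ofReal)
open scoped FourierTransform LineDeriv Real

noncomputable section

variable {d : ℕ}

/-! ### Ladder operators on a graded Hilbert space -/

section Ladder

variable {E : Type*} [NormedAddCommGroup E] [InnerProductSpace ℂ E] [CompleteSpace E]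

/-- Multi-indices. -/
abbrev Idx (d : ℕ) : Type := Fin d → ℕ

/-- The degree `|n| = n₁ + ⋯ + n_d` of a multi-index. -/
def deg (n : Idx d) : ℕ := ∑ i, n i

/-- The finite set of multi-indices of degree at most `N`. -/
def lev (d N : ℕ) : Finset (Idx d) :=
  (Fintype.piFinset fun _ => Finset.range (N + 1)).filter fun n => deg n ≤ N

/-- The finite set of multi-indices of degree exactly `j`. -/
def sph (d j : ℕ) : Finset (Idx d) := (lev d j).filter fun n => deg n = j

lemma le_deg (n : Idx d) (i : Fin d) : n i ≤ deg n :=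
  Finset.single_le_sum (f := n) (fun _ _ => Nat.zero_le _) (Finset.mem_univ i)

@[simp] lemma mem_lev {N : ℕ} {n : Idx d} : n ∈ lev d N ↔ deg n ≤ N := by
  simp only [lev, mem_filter, Fintype.mem_piFinset, Finset.mem_range, and_iff_right_iff_imp]
  intro h i
  have := le_deg n i
  omega

@[simp] lemma mem_sph {j : ℕ} {n : Idx d} : n ∈ sph d j ↔ deg n = j := by
  simp only [sph, mem_filter, mem_lev]; omega

@[simp] lemma deg_add_single (n : Idx d) (i : Fin d) : deg (n + Pi.single i 1) = deg n + 1 := by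
  simp [deg, sum_add_distrib, Pi.single_apply]

lemma sub_add_single {n : Idx d} {i : Fin d} (h : n i ≠ 0) :
    n - Pi.single i 1 + Pi.single i 1 = n := by
  funext j
  by_cases hj : j = i
  · subst hj; simp; omega
  · simp [hj]

lemma sub_single_add_one {n : Idx d} {i : Fin d} (h : n i ≠ 0) :
    ((n - Pi.single i 1 : Idx d) i : ℝ) + 1 = n i := by
  have := congrFun (sub_add_single h) i
  simp only [Pi.add_apply, Pi.single_eq_same] at this
  exact_mod_cast this

lemma deg_sub_single {n : Idx d} {i : Fin d} (h : n i ≠ 0) :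
    deg (n - Pi.single i 1) + 1 = deg n := by
  rw [← deg_add_single _ i, sub_add_single h]

lemma deg_eq_zero {n : Idx d} : deg n = 0 ↔ n = 0 := by
  simp [deg, funext_iff]

variable (b : HilbertBasis (Idx d) ℂ E)
variable (N : ℕ) (i : Fin d) (ξ : Vec d)

lemma clm_ext_basis {F : Type*} [NormedAddCommGroup F] [NormedSpace ℂ F] {S T : E →L[ℂ] F}
    (h : ∀ n, S (b n) = T (b n)) : S = T := by
  refine ContinuousLinearMap.ext_on (Submodule.dense_iff_topologicalClosure_eq_top.2 b.dense_span) ?_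
  rintro _ ⟨n, rfl⟩; exact h n

/-- The finite-rank operator that is diagonal in the basis `b`, with eigenvalues `c n` for `n ∈ s`
and `0` for the other indices. -/
def diagOp (s : Finset (Idx d)) (c : (Idx d) → ℝ) : E →L[ℂ] E :=
  ∑ n ∈ s, (c n : ℂ) • rankOne ℂ (b n) (b n)

/-- The annihilation operator in direction `i`, restricted to degrees at most `N`. -/
def lowOp (N : ℕ) (i : Fin d) : E →L[ℂ] E :=
  ∑ n ∈ lev d N, (√(n i) : ℂ) • rankOne ℂ (b (n - Pi.single i 1)) (b n)

lemma inner_self_ofReal (f : E) : inner ℂ f f = ((‖f‖ ^ 2 : ℝ) : ℂ) := by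
  rw [inner_self_eq_norm_sq_to_K]; norm_cast

lemma inner_basis (m n : Idx d) : inner ℂ (b m) (b n) = if m = n then (1 : ℂ) else 0 :=
  orthonormal_iff_ite.1 b.orthonormal m n

lemma diagOp_basis (s : Finset (Idx d)) (c : (Idx d) → ℝ) (m : Idx d) :
    diagOp b s c (b m) = if m ∈ s then (c m : ℂ) • b m else 0 := by
  simp [diagOp, sum_apply, inner_basis]

lemma adjoint_diagOp (s : Finset (Idx d)) (c : (Idx d) → ℝ) :
    adjoint (diagOp b s c) = diagOp b s c := by
  simp [diagOp, map_sum, map_smulₛₗ, -coe_smul]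

lemma inner_diagOp (s : Finset (Idx d)) (c : (Idx d) → ℝ) (f : E) :
    inner ℂ f (diagOp b s c f) = ((∑ n ∈ s, c n * ‖inner ℂ (b n) f‖ ^ 2 : ℝ) : ℂ) := by
  simp only [diagOp, sum_apply, inner_sum, smul_apply, rankOne_apply,
    inner_smul_right, ofReal_sum, ofReal_mul, ofReal_pow]
  refine sum_congr rfl fun n _ => ?_
  rw [← inner_conj_symm f (b n), Complex.mul_conj']

lemma lowOp_basis (m : Idx d) :
    lowOp b N i (b m) =
      if deg m ≤ N then (√(m i) : ℂ) • b (m - Pi.single i 1) else 0 := by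
  simp [lowOp, sum_apply, inner_basis]

lemma raiseOp_basis (m : Idx d) :
    adjoint (lowOp b N i) (b m) =
      if deg m + 1 ≤ N then (√(m i + 1) : ℂ) • b (m + Pi.single i 1) else 0 := by
  have key : ∀ n ∈ lev d N, ((√(n i) : ℂ) • rankOne ℂ (b n) (b (n - Pi.single i 1))) (b m)
      = if n = m + Pi.single i 1 then (√(m i + 1) : ℂ) • b (m + Pi.single i 1) else 0 := by
    intro n _
    rw [smul_apply, rankOne_apply, inner_basis]
    by_cases hn : n i = 0
    · have : n ≠ m + Pi.single i 1 := by rintro rfl; simp at hn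
      simp [hn, this]
    · by_cases h : n = m + Pi.single i 1
      · subst h; simp
      · have : n - Pi.single i 1 ≠ m := by rintro rfl; exact h (sub_add_single hn).symm
        simp [h, this]
  have : adjoint (lowOp b N i) = ∑ n ∈ lev d N,
      ((√(n i) : ℂ) • rankOne ℂ (b n) (b (n - Pi.single i 1))) := by
    simp [lowOp, map_sum, map_smulₛₗ, -coe_smul]
  rw [this, sum_apply, sum_congr rfl key, Finset.sum_ite_eq']
  simp

/-- `a_i^† a_i` is diagonal with eigenvalues `n_i`. -/
lemma adjoint_lowOp_comp_lowOp :
    adjoint (lowOp b N i) ∘L lowOp b N i = diagOp b (lev d N) fun n => n i := by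
  refine clm_ext_basis b fun m => ?_
  rw [comp_apply, lowOp_basis, diagOp_basis]
  by_cases h : deg m ≤ N
  · simp only [h, if_true, mem_lev, map_smul, raiseOp_basis]
    by_cases hm : m i = 0
    · simp [hm]
    · have h1 := deg_sub_single hm
      rw [if_pos (by omega), sub_add_single hm, sub_single_add_one hm, smul_smul, ← ofReal_mul,
        mul_self_sqrt (Nat.cast_nonneg _)]
  · simp [h]

lemma norm_lowOp_sq (f : E) :
    ‖lowOp b N i f‖ ^ 2 = ∑ n ∈ lev d N, (n i : ℝ) * ‖inner ℂ (b n) f‖ ^ 2 := by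
  have h := inner_diagOp b (lev d N) (fun n => (n i : ℝ)) f
  rw [← adjoint_lowOp_comp_lowOp, comp_apply, adjoint_inner_right,
    inner_self_ofReal] at h
  exact_mod_cast h

/-- The canonical commutation relations. -/
lemma lowOp_commutator {N : ℕ} {m : Idx d} (hm : deg m + 1 ≤ N) (i j : Fin d) :
    lowOp b N i (adjoint (lowOp b N j) (b m)) =
      adjoint (lowOp b N j) (lowOp b N i (b m)) + if i = j then b m else 0 := by
  rw [raiseOp_basis, lowOp_basis, if_pos hm, if_pos (by omega), map_smul, map_smul, lowOp_basis,
    if_pos (by simpa using hm), raiseOp_basis]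
  have hle : deg (m - Pi.single i 1) ≤ deg m := sum_le_sum fun k _ => by simp
  rw [if_pos (by omega)]
  by_cases hij : i = j
  · subst hij
    have h1 : ((m + Pi.single i 1 : Idx d) i : ℝ) = m i + 1 := by simp
    rw [add_tsub_cancel_right, if_pos rfl, h1, smul_smul, ← ofReal_mul, mul_self_sqrt (by positivity)]
    by_cases hmi : m i = 0
    · simp [hmi]
    · rw [sub_single_add_one hmi, sub_add_single hmi, smul_smul, ← ofReal_mul,
        mul_self_sqrt (by positivity)]
      push_cast
      rw [add_smul, one_smul]
  · have h1 : (m + Pi.single j 1 : Idx d) i = m i := by simp [hij]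
    have h2 : (m - Pi.single i 1 : Idx d) j = m j := by simp [Ne.symm hij]
    rw [if_neg hij, add_zero, h1, h2]
    by_cases hmi : m i = 0
    · simp [hmi]
    · have : m + Pi.single j 1 - Pi.single i 1 = m - Pi.single i 1 + Pi.single j 1 := by
        funext k
        have : k = i → m k ≠ 0 := by rintro rfl; exact hmi
        simp only [Pi.add_apply, Pi.sub_apply, Pi.single_apply]
        split_ifs <;> omega
      rw [this, smul_smul, smul_smul, mul_comm]

/-- The contracted annihilation operator `a(ξ) = ∑ ξ_i a_i`, restricted to degrees at most `N`. -/
def aOp (N : ℕ) (ξ : Vec d) : E →L[ℂ] E := ∑ i, (ξ i : ℂ) • lowOp b N i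

/-- The orthogonal projection onto degree `j`. -/
def pOp (j : ℕ) : E →L[ℂ] E := diagOp b (sph d j) fun _ => 1

/-- The orthogonal projection onto degrees at most `N`. -/
def piOp (N : ℕ) : E →L[ℂ] E := diagOp b (lev d N) fun _ => 1

/-- The damping rates of the linearized operator: the degree, but `0` in degree `1`, where the
momentum term compensates the damping. -/
def lam (n : Idx d) : ℝ := if deg n = 1 then 0 else deg n

/-- The truncation to degrees at most `N` of `-i ξ · v + L + P₁` in Hermite coordinates. -/
def genOp (N : ℕ) (ξ : Vec d) : E →L[ℂ] E :=
  (-I) • (aOp b N ξ + adjoint (aOp b N ξ)) - diagOp b (lev d N) lam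

lemma lam_nonneg (n : Idx d) : 0 ≤ lam n := by
  unfold lam; split_ifs <;> positivity

lemma adjoint_aOp :
    adjoint (aOp b N ξ) = ∑ i, (ξ i : ℂ) • adjoint (lowOp b N i) := by
  simp [aOp, map_sum, map_smulₛₗ, -coe_smul]

lemma pOp_basis (j : ℕ) (m : Idx d) : pOp b j (b m) = if deg m = j then b m else 0 := by
  simp [pOp, diagOp_basis]

lemma piOp_basis (m : Idx d) : piOp b N (b m) = if deg m ≤ N then b m else 0 := by
  simp [piOp, diagOp_basis]

lemma pOp_aOp (N j : ℕ) (ξ : Vec d) : pOp b j ∘L aOp b N ξ = aOp b N ξ ∘L pOp b (j + 1) := by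
  refine clm_ext_basis b fun m => ?_
  simp only [comp_apply, aOp, sum_apply, smul_apply, map_sum, map_smul,
    lowOp_basis, pOp_basis]
  refine sum_congr rfl fun i _ => ?_
  by_cases hm : m i = 0
  · simp only [hm, Nat.cast_zero, Real.sqrt_zero, Complex.ofReal_zero, zero_smul, ite_self, map_zero]
    split_ifs <;> simp [lowOp_basis, hm]
  · have := deg_sub_single hm
    by_cases h1 : deg m = j + 1
    · have h2 : deg (m - Pi.single i 1) = j := by omega
      by_cases h3 : deg m ≤ N
      · simp [h1, h2, h1 ▸ h3, lowOp_basis, pOp_basis]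
      · simp [h1, h1 ▸ h3, lowOp_basis]
    · have h2 : deg (m - Pi.single i 1) ≠ j := by omega
      split_ifs <;> simp [h1, h2, pOp_basis]

lemma aOp_pOp_zero : aOp b N ξ ∘L pOp b 0 = 0 := by
  refine clm_ext_basis b fun m => ?_
  rw [comp_apply, pOp_basis]
  split_ifs with h
  · rw [deg_eq_zero] at h
    subst h
    simp [aOp, sum_apply, lowOp_basis]
  · simp

lemma adjoint_pOp (j : ℕ) : adjoint (pOp b j) = pOp b j := adjoint_diagOp b _ _

lemma adjoint_piOp : adjoint (piOp b N) = piOp b N := adjoint_diagOp b _ _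

lemma pOp_adjoint_aOp (N j : ℕ) (ξ : Vec d) :
    pOp b (j + 1) ∘L adjoint (aOp b N ξ) = adjoint (aOp b N ξ) ∘L pOp b j := by
  have := congrArg adjoint (pOp_aOp b N j ξ)
  rw [adjoint_comp, adjoint_comp, adjoint_pOp, adjoint_pOp] at this
  exact this.symm

lemma pOp_zero_adjoint_aOp : pOp b 0 ∘L adjoint (aOp b N ξ) = 0 := by
  have := congrArg adjoint (aOp_pOp_zero b N ξ)
  rwa [adjoint_comp, adjoint_pOp, map_zero] at this

lemma norm_aOp_sq_le (f : E) :
    ‖aOp b N ξ f‖ ^ 2 ≤ ‖ξ‖ ^ 2 * ∑ n ∈ lev d N, (deg n : ℝ) * ‖inner ℂ (b n) f‖ ^ 2 := by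
  have h1 : ‖aOp b N ξ f‖ ≤ ∑ i, ‖ξ i‖ * ‖lowOp b N i f‖ := by
    rw [aOp, sum_apply]
    refine (norm_sum_le _ _).trans_eq (sum_congr rfl fun i _ => ?_)
    rw [smul_apply, norm_smul, norm_real]
  have h2 := Finset.sum_mul_sq_le_sq_mul_sq Finset.univ (fun i => ‖ξ i‖) fun i => ‖lowOp b N i f‖
  refine (pow_le_pow_left₀ (norm_nonneg _) h1 2).trans (h2.trans_eq ?_)
  rw [EuclideanSpace.norm_sq_eq]
  congr 1
  simp_rw [norm_lowOp_sq, deg]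
  rw [sum_comm]
  refine sum_congr rfl fun n _ => ?_
  push_cast
  rw [sum_mul]

/-- The commutation relation of `a(ξ)` and its adjoint, away from the truncation. -/
lemma aOp_commutator {N : ℕ} {m : Idx d} (hm : deg m + 1 ≤ N) (ξ : Vec d) :
    aOp b N ξ (adjoint (aOp b N ξ) (b m)) =
      adjoint (aOp b N ξ) (aOp b N ξ (b m)) + ((‖ξ‖ ^ 2 : ℝ) : ℂ) • b m := by
  rw [adjoint_aOp]
  simp only [aOp, sum_apply, smul_apply, map_sum, map_smul,
    lowOp_commutator b hm, smul_add, sum_add_distrib, Finset.smul_sum]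
  congr 1
  · rw [sum_comm]
    refine sum_congr rfl fun i _ => sum_congr rfl fun j _ => ?_
    rw [smul_smul, smul_smul, mul_comm]
  · rw [EuclideanSpace.norm_sq_eq]
    push_cast
    rw [Finset.sum_smul]
    refine sum_congr rfl fun i _ => ?_
    simp [smul_smul, ← sq, -coe_smul, ← ofReal_pow, sq_abs]

lemma norm_diagOp_one_sq (s : Finset (Idx d)) (f : E) :
    ‖diagOp b s (fun _ => 1) f‖ ^ 2 = ∑ n ∈ s, ‖inner ℂ (b n) f‖ ^ 2 := by
  have h := inner_diagOp b s (fun _ => 1) f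
  have h2 : diagOp b s (fun _ => 1) ∘L diagOp b s (fun _ => 1) = diagOp b s (fun _ => 1) := by
    refine clm_ext_basis b fun m => ?_
    by_cases hm : m ∈ s <;> simp [diagOp_basis, hm]
  rw [← h2, comp_apply, ← adjoint_inner_left, adjoint_diagOp, inner_self_ofReal] at h
  simp only [one_mul] at h
  exact_mod_cast h

lemma norm_pOp_sq (j : ℕ) (f : E) : ‖pOp b j f‖ ^ 2 = ∑ n ∈ sph d j, ‖inner ℂ (b n) f‖ ^ 2 :=
  norm_diagOp_one_sq b _ f

lemma norm_piOp_sq (f : E) : ‖piOp b N f‖ ^ 2 = ∑ n ∈ lev d N, ‖inner ℂ (b n) f‖ ^ 2 :=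
  norm_diagOp_one_sq b _ f

lemma inner_basis_diagOp (s : Finset (Idx d)) (c : (Idx d) → ℝ) (n : Idx d) (f : E) :
    inner ℂ (b n) (diagOp b s c f) = if n ∈ s then (c n : ℂ) * inner ℂ (b n) f else 0 := by
  rw [← adjoint_inner_left, adjoint_diagOp, diagOp_basis]
  split_ifs <;> simp [inner_smul_left, -coe_smul]

/-- `‖a(ξ)^† f‖² = ‖a(ξ) f‖² + |ξ|² ‖f‖²` for `f` of degree below the truncation. -/
lemma norm_adjoint_aOp_sq {N j : ℕ} (hj : j + 1 ≤ N) (ξ : Vec d) (f : E) :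
    ‖adjoint (aOp b N ξ) (pOp b j f)‖ ^ 2 =
      ‖aOp b N ξ (pOp b j f)‖ ^ 2 + ‖ξ‖ ^ 2 * ‖pOp b j f‖ ^ 2 := by
  have h : aOp b N ξ ∘L adjoint (aOp b N ξ) ∘L pOp b j =
      adjoint (aOp b N ξ) ∘L aOp b N ξ ∘L pOp b j + ((‖ξ‖ ^ 2 : ℝ) : ℂ) • pOp b j := by
    refine clm_ext_basis b fun m => ?_
    simp only [comp_apply, add_apply, smul_apply, pOp_basis]
    split_ifs with hm
    · exact aOp_commutator b (by omega) ξ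
    · simp
  have h1 := congrArg (fun T : E →L[ℂ] E => inner ℂ (pOp b j f) (T f)) h
  simp only [comp_apply, add_apply, smul_apply, inner_add_right, inner_smul_right] at h1
  rw [adjoint_inner_right, inner_self_ofReal, ← adjoint_inner_left,
    inner_self_ofReal, inner_self_ofReal] at h1
  exact_mod_cast h1

end Ladder

/-! ### Hypocoercivity at a fixed frequency -/

section Energy

variable {E : Type*} [NormedAddCommGroup E] [InnerProductSpace ℂ E] [CompleteSpace E]
variable (b : HilbertBasis (Idx d) ℂ E)
variable (N : ℕ) (ξ : Vec d)

/-- The dissipation `∑_{|n| ≤ N} λ_n |⟨e_n, f⟩|²`. -/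
def dissip (N : ℕ) (f : E) : ℝ := ∑ n ∈ lev d N, lam n * ‖inner ℂ (b n) f‖ ^ 2

lemma dissip_nonneg (f : E) : 0 ≤ dissip b N f :=
  sum_nonneg fun n _ => mul_nonneg (lam_nonneg n) (sq_nonneg _)

lemma continuous_dissip : Continuous (dissip b N) := by
  unfold dissip; fun_prop

lemma re_inner_genOp (f : E) :
    (inner ℂ f (genOp b N ξ f)).re = -dissip b N f := by
  have h : (inner ℂ f ((aOp b N ξ + adjoint (aOp b N ξ)) f)).im = 0 := by
    rw [add_apply, inner_add_right, adjoint_inner_right, ← inner_conj_symm f (aOp b N ξ f)]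
    simp only [Complex.add_im, Complex.conj_im, neg_add_cancel]
  rw [genOp, sub_apply, smul_apply, inner_sub_right, inner_smul_right, inner_diagOp]
  simp only [sub_re, mul_re, Complex.neg_re, Complex.I_re, Complex.neg_im,
    Complex.I_im, h, ofReal_re, dissip]
  ring

lemma pOp_pOp (j k : ℕ) (f : E) : pOp b j (pOp b k f) = if j = k then pOp b k f else 0 := by
  have : pOp b j ∘L pOp b k = if j = k then pOp b k else 0 := by
    refine clm_ext_basis b fun m => ?_
    rw [comp_apply, pOp_basis]
    by_cases h : j = k <;> by_cases h2 : deg m = k <;> simp [pOp_basis, h, h2]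
    intro h3; exact absurd h3.symm h
  have h := DFunLike.congr_fun this f
  simp only [comp_apply] at h
  rw [h]; split_ifs <;> simp

lemma pOp_diagOp_lam {N j : ℕ} (hj : j ≤ N) (f : E) :
    pOp b j (diagOp b (lev d N) lam f) = (((if j = 1 then 0 else j : ℝ)) : ℂ) • pOp b j f := by
  have : pOp b j ∘L diagOp b (lev d N) lam = (((if j = 1 then 0 else j : ℝ)) : ℂ) • pOp b j := by
    refine clm_ext_basis b fun m => ?_
    rw [comp_apply, diagOp_basis, smul_apply, pOp_basis]
    by_cases h : deg m = j
    · subst h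
      rw [if_pos (by simpa using hj), if_pos rfl, map_smul, pOp_basis, if_pos rfl, lam]
    · split_ifs <;> simp [pOp_basis, h]
  exact DFunLike.congr_fun this f

lemma pOp_aOp_apply (N j : ℕ) (ξ : Vec d) (f : E) :
    pOp b j (aOp b N ξ f) = aOp b N ξ (pOp b (j + 1) f) :=
  DFunLike.congr_fun (pOp_aOp b N j ξ) f

lemma pOp_adjoint_aOp_apply (N j : ℕ) (ξ : Vec d) (f : E) :
    pOp b (j + 1) (adjoint (aOp b N ξ) f) = adjoint (aOp b N ξ) (pOp b j f) :=
  DFunLike.congr_fun (pOp_adjoint_aOp b N j ξ) f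

lemma pOp_zero_adjoint_aOp_apply (f : E) :
    pOp b 0 (adjoint (aOp b N ξ) f) = 0 :=
  DFunLike.congr_fun (pOp_zero_adjoint_aOp b N ξ) f

lemma aOp_pOp_zero_apply (f : E) : aOp b N ξ (pOp b 0 f) = 0 :=
  DFunLike.congr_fun (aOp_pOp_zero b N ξ) f

lemma pOp_zero_genOp (f : E) :
    pOp b 0 (genOp b N ξ f) = (-I) • aOp b N ξ (pOp b 1 f) := by
  simp [genOp, pOp_aOp_apply, pOp_zero_adjoint_aOp_apply, pOp_diagOp_lam]

lemma pOp_one_genOp {N : ℕ} (hN : 1 ≤ N) (ξ : Vec d) (f : E) :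
    pOp b 1 (genOp b N ξ f) =
      (-I) • (aOp b N ξ (pOp b 2 f) + adjoint (aOp b N ξ) (pOp b 0 f)) := by
  simp [genOp, pOp_aOp_apply, pOp_adjoint_aOp_apply b N 0, pOp_diagOp_lam b hN]

lemma pOp_two_genOp {N : ℕ} (hN : 2 ≤ N) (ξ : Vec d) (f : E) :
    pOp b 2 (genOp b N ξ f) =
      (-I) • (aOp b N ξ (pOp b 3 f) + adjoint (aOp b N ξ) (pOp b 1 f))
        - (2 : ℂ) • pOp b 2 f := by
  have h : ((if (2 : ℕ) = 1 then 0 else ((2 : ℕ) : ℝ) : ℝ) : ℂ) = 2 := by norm_num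
  rw [genOp, sub_apply, map_sub, pOp_diagOp_lam b hN, h, smul_apply, map_smul, add_apply, map_add,
    pOp_aOp_apply, pOp_adjoint_aOp_apply b N 1]

/-- The operator of the cross term `⟨f₁, a f₂⟩ + ⟨f₀, a f₁⟩` that couples neighbouring degrees. -/
def crossOp (N : ℕ) (ξ : Vec d) : E →L[ℂ] E :=
  aOp b N ξ ∘L (pOp b 1 + pOp b 2)

/-- The cross term `Re i(⟨f₁, a f₂⟩ + ⟨f₀, a f₁⟩)`: its time derivative controls the
conserved moments, which the dissipation does not see. -/
def crossTerm (N : ℕ) (ξ : Vec d) (f : E) : ℝ :=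
  (I * inner ℂ f (crossOp b N ξ f)).re

/-- The time derivative of the cross term along `f' = A_N(ξ) f`. -/
def crossRate (N : ℕ) (ξ : Vec d) (f : E) : ℝ :=
  (I * (inner ℂ f (crossOp b N ξ (genOp b N ξ f)) +
    inner ℂ (genOp b N ξ f) (crossOp b N ξ f))).re

lemma inner_aOp_pOp_succ (N j : ℕ) (ξ : Vec d) (f g : E) :
    inner ℂ f (aOp b N ξ (pOp b (j + 1) g)) = inner ℂ (pOp b j f) (aOp b N ξ (pOp b (j + 1) g)) := by
  have : aOp b N ξ (pOp b (j + 1) g) = pOp b j (aOp b N ξ (pOp b (j + 1) g)) := by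
    rw [pOp_aOp_apply, pOp_pOp, if_pos rfl]
  conv_lhs => rw [this]
  rw [← adjoint_inner_left, adjoint_pOp]

lemma norm_aOp_pOp_sq_le (N j : ℕ) (ξ : Vec d) (f : E) :
    ‖aOp b N ξ (pOp b j f)‖ ^ 2 ≤ j * (‖ξ‖ ^ 2 * ‖pOp b j f‖ ^ 2) := by
  refine (norm_aOp_sq_le b N ξ _).trans ?_
  rw [mul_left_comm]
  refine mul_le_mul_of_nonneg_left ?_ (sq_nonneg _)
  rw [norm_pOp_sq, mul_sum]
  have h : ∀ n, (deg n : ℝ) * ‖inner ℂ (b n) (pOp b j f)‖ ^ 2 =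
      if n ∈ sph d j then (j : ℝ) * ‖inner ℂ (b n) f‖ ^ 2 else 0 := by
    intro n
    rw [pOp, inner_basis_diagOp]
    split_ifs with h
    · rw [mem_sph.1 h]; simp
    · simp
  simp_rw [h, ← Finset.sum_filter]
  refine sum_le_sum_of_subset_of_nonneg (fun n hn => ?_) fun _ _ _ => by positivity
  exact (mem_filter.1 hn).2

lemma crossRate_eq {N : ℕ} (hN : 2 ≤ N) (ξ : Vec d) (f : E) :
    crossRate b N ξ f = ‖ξ‖ ^ 2 * (‖pOp b 0 f‖ ^ 2 + ‖pOp b 1 f‖ ^ 2)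
      - ‖aOp b N ξ (pOp b 2 f)‖ ^ 2
      + (inner ℂ (adjoint (aOp b N ξ) (pOp b 1 f)) (aOp b N ξ (pOp b 3 f))).re
      + 2 * (inner ℂ (pOp b 1 f) (aOp b N ξ (pOp b 2 f))).im := by
  have e1 := norm_adjoint_aOp_sq b (j := 1) (N := N) (by omega) ξ f
  have e0 := norm_adjoint_aOp_sq b (j := 0) (N := N) (by omega) ξ f
  rw [aOp_pOp_zero_apply, norm_zero] at e0
  set a := aOp b N ξ
  have s : ∀ g, crossOp b N ξ g = a (pOp b (0 + 1) g) + a (pOp b (1 + 1) g) := fun g => by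
    simp [crossOp, a]
  rw [crossRate, s, s, inner_add_right, inner_add_right,
    inner_aOp_pOp_succ b N 0 ξ f (genOp b N ξ f), inner_aOp_pOp_succ b N 1 ξ f (genOp b N ξ f),
    inner_aOp_pOp_succ b N 0 ξ (genOp b N ξ f) f, inner_aOp_pOp_succ b N 1 ξ (genOp b N ξ f) f,
    zero_add, show 1 + 1 = 2 from rfl, pOp_zero_genOp,
    pOp_one_genOp b (by omega), pOp_two_genOp b hN]
  simp only [map_smul, map_sub, map_add, inner_smul_right, inner_smul_left, inner_sub_right,
    inner_add_right, inner_add_left]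
  rw [← adjoint_inner_left (aOp b N ξ) (aOp b N ξ (pOp b 2 f)),
    ← adjoint_inner_left (aOp b N ξ) (adjoint (aOp b N ξ) (pOp b 0 f)),
    ← adjoint_inner_left (aOp b N ξ) (aOp b N ξ (pOp b 3 f)),
    ← adjoint_inner_left (aOp b N ξ) (adjoint (aOp b N ξ) (pOp b 1 f))]
  simp only [inner_self_ofReal]
  change _ = ‖ξ‖ ^ 2 * (‖pOp b 0 f‖ ^ 2 + ‖pOp b 1 f‖ ^ 2) - ‖a (pOp b 2 f)‖ ^ 2
      + (inner ℂ (adjoint a (pOp b 1 f)) (a (pOp b 3 f))).re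
      + 2 * (inner ℂ (pOp b 1 f) (a (pOp b 2 f))).im
  simp only [a] at e0 e1 ⊢
  rw [e0, e1]
  simp only [mul_re, add_re, Complex.add_im, sub_re, Complex.sub_im,
    Complex.mul_im, Complex.I_re, Complex.I_im, Complex.neg_re, Complex.neg_im, ofReal_re,
    Complex.ofReal_im, map_neg, conj_I, Complex.re_ofNat, Complex.im_ofNat]
  ring

/-- `m(ξ) = |ξ|² / (1 + |ξ|²)`, the frequency dependence of the decay rate. -/
def rate (ξ : Vec d) : ℝ := ‖ξ‖ ^ 2 / (1 + ‖ξ‖ ^ 2)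

lemma rate_nonneg : 0 ≤ rate ξ := by unfold rate; positivity

lemma rate_le_one : rate ξ ≤ 1 := by
  unfold rate; rw [div_le_one (by positivity)]; linarith

/-- The Lyapunov functional: the energy corrected by a multiple of the cross term. -/
def lyap (N : ℕ) (ξ : Vec d) (f : E) : ℝ :=
  ‖f‖ ^ 2 - 1 / 5 * (1 / (1 + ‖ξ‖ ^ 2)) * crossTerm b N ξ f

lemma sum_norm_sq_le (s : Finset (Idx d)) (f : E) :
    ∑ n ∈ s, ‖inner ℂ (b n) f‖ ^ 2 ≤ ‖f‖ ^ 2 :=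
  b.orthonormal.sum_inner_products_le f

lemma norm_diagOp_one_le (s : Finset (Idx d)) (f : E) : ‖diagOp b s (fun _ => 1) f‖ ≤ ‖f‖ :=
  le_of_sq_le_sq (norm_diagOp_one_sq b s f ▸ sum_norm_sq_le b s f) (norm_nonneg _)

lemma disjoint_sph {j k : ℕ} (h : j ≠ k) : Disjoint (sph d j) (sph d k) := by
  rw [Finset.disjoint_left]; intro n; simp only [mem_sph]; omega

lemma mul_norm_pOp_sq {j : ℕ} (hj : 2 ≤ j) (f : E) :
    j * ‖pOp b j f‖ ^ 2 = ∑ n ∈ sph d j, lam n * ‖inner ℂ (b n) f‖ ^ 2 := by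
  rw [norm_pOp_sq, mul_sum]
  refine sum_congr rfl fun n hn => ?_
  rw [lam, mem_sph.1 hn, if_neg (by omega)]

lemma sum_sph_le (f : E) :
    ‖pOp b 0 f‖ ^ 2 + ‖pOp b 1 f‖ ^ 2 + ‖pOp b 2 f‖ ^ 2 ≤ ‖f‖ ^ 2 := by
  refine le_trans (le_of_eq ?_) (sum_norm_sq_le b (sph d 0 ∪ sph d 1 ∪ sph d 2) f)
  rw [sum_union (Finset.disjoint_union_left.2 ⟨disjoint_sph (by decide), disjoint_sph (by decide)⟩),
    sum_union (disjoint_sph (by decide)), norm_pOp_sq, norm_pOp_sq, norm_pOp_sq]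

lemma two_three_le_dissip {N : ℕ} (hN : 3 ≤ N) (f : E) :
    2 * ‖pOp b 2 f‖ ^ 2 + 3 * ‖pOp b 3 f‖ ^ 2 ≤ dissip b N f := by
  have h2 := mul_norm_pOp_sq b le_rfl f
  have h3 := mul_norm_pOp_sq b (by decide : 2 ≤ 3) f
  push_cast at h2 h3
  rw [h2, h3, ← sum_union (disjoint_sph (by decide))]
  refine sum_le_sum_of_subset_of_nonneg (fun n hn => ?_) fun n _ _ =>
    mul_nonneg (lam_nonneg n) (sq_nonneg _)
  simp only [Finset.mem_union, mem_sph, mem_lev] at hn ⊢; omega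

lemma norm_sq_le_dissip {N : ℕ} {f : E} (hf : piOp b N f = f) :
    ‖f‖ ^ 2 ≤ ‖pOp b 0 f‖ ^ 2 + ‖pOp b 1 f‖ ^ 2 + dissip b N f / 2 := by
  have h : ‖f‖ ^ 2 = ∑ n ∈ lev d N, ‖inner ℂ (b n) f‖ ^ 2 := by rw [← norm_piOp_sq, hf]
  rw [norm_pOp_sq, norm_pOp_sq, h, dissip, Finset.sum_div, ← sum_union (disjoint_sph (by decide)),
    ← Finset.sum_filter_add_sum_filter_not (lev d N) fun n => deg n ≤ 1]
  refine add_le_add ?_ ?_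
  · refine sum_le_sum_of_subset_of_nonneg (fun n hn => ?_) fun n _ _ => sq_nonneg _
    simp only [mem_filter, Finset.mem_union, mem_sph, mem_lev] at hn ⊢; omega
  · refine (sum_le_sum fun n hn => ?_).trans
      (sum_le_sum_of_subset_of_nonneg (Finset.filter_subset _ _)
        fun n _ _ => div_nonneg (mul_nonneg (lam_nonneg n) (sq_nonneg _)) (by norm_num))
    have h2 : 2 ≤ deg n := not_le.1 (mem_filter.1 hn).2
    have h3 : (2 : ℝ) ≤ lam n := by rw [lam, if_neg (by omega)]; exact_mod_cast h2
    nlinarith [sq_nonneg ‖inner ℂ (b n) f‖]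

lemma abs_crossTerm_le (f : E) :
    |1 / (1 + ‖ξ‖ ^ 2) * crossTerm b N ξ f| ≤ ‖f‖ ^ 2 := by
  set x0 := ‖pOp b 0 f‖
  set x1 := ‖pOp b 1 f‖
  set x2 := ‖pOp b 2 f‖
  set r := ‖ξ‖ with hr
  have hω : 0 < 1 + r ^ 2 := by positivity
  have h1 : |crossTerm b N ξ f| ≤ x0 * ‖aOp b N ξ (pOp b 1 f)‖ + x1 * ‖aOp b N ξ (pOp b 2 f)‖ := by
    have : crossTerm b N ξ f = (I * (inner ℂ (pOp b 0 f) (aOp b N ξ (pOp b 1 f)) +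
        inner ℂ (pOp b 1 f) (aOp b N ξ (pOp b 2 f)))).re := by
      rw [← inner_aOp_pOp_succ b N 0, ← inner_aOp_pOp_succ b N 1, ← inner_add_right, crossTerm,
        crossOp, comp_apply, add_apply, map_add]
    rw [this]
    refine (Complex.abs_re_le_norm _).trans ?_
    rw [norm_mul, norm_I, one_mul]
    exact (norm_add_le _ _).trans (add_le_add (norm_inner_le_norm _ _) (norm_inner_le_norm _ _))

  have hy2 : ‖aOp b N ξ (pOp b 2 f)‖ ≤ (1 + r ^ 2) * x2 := by
    refine le_of_sq_le_sq ((norm_aOp_pOp_sq_le b N 2 ξ f).trans ?_) (by positivity)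
    push_cast
    nlinarith [sq_nonneg x2, mul_nonneg (sq_nonneg x2) (sq_nonneg r),
      mul_nonneg (sq_nonneg x2) (sq_nonneg (r ^ 2))]
  have hy1' : ‖aOp b N ξ (pOp b 1 f)‖ ≤ (1 + r ^ 2) * (x1 / 2) := by
    refine le_of_sq_le_sq ((norm_aOp_pOp_sq_le b N 1 ξ f).trans ?_) (by positivity)
    push_cast
    nlinarith [mul_nonneg (sq_nonneg x1) (sq_nonneg (1 - r ^ 2))]
  have hs := sum_sph_le b f
  rw [abs_mul, abs_of_pos (by positivity), div_mul_eq_mul_div, one_mul, div_le_iff₀ hω]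
  have hx0 : 0 ≤ x0 := norm_nonneg _
  have hx1 : 0 ≤ x1 := norm_nonneg _
  calc |crossTerm b N ξ f| ≤ x0 * ((1 + r ^ 2) * (x1 / 2)) + x1 * ((1 + r ^ 2) * x2) := by
        refine h1.trans (add_le_add ?_ ?_) <;> gcongr
    _ = (x0 * (x1 / 2) + x1 * x2) * (1 + r ^ 2) := by ring
    _ ≤ ‖f‖ ^ 2 * (1 + r ^ 2) := by
        gcongr
        nlinarith [sq_nonneg (x0 - x1), sq_nonneg (x1 - x2), sq_nonneg x0, sq_nonneg x2]

lemma lyap_le (f : E) : lyap b N ξ f ≤ 6 / 5 * ‖f‖ ^ 2 := by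
  have := (abs_le.1 (abs_crossTerm_le b N ξ f)).1
  rw [lyap, mul_assoc]; linarith

lemma le_lyap (f : E) : 4 / 5 * ‖f‖ ^ 2 ≤ lyap b N ξ f := by
  have := (abs_le.1 (abs_crossTerm_le b N ξ f)).2
  rw [lyap, mul_assoc]; linarith

/-- The Lyapunov inequality. The damping acts on degrees `≥ 2`; the cross term transfers it to the
degrees `0` and `1`, with the strength `m(ξ)`. -/
lemma lyap_rate_le {N : ℕ} (hN : 3 ≤ N) (ξ : Vec d) {f : E} (hf : piOp b N f = f) :
    -2 * dissip b N f - 1 / 5 * (1 / (1 + ‖ξ‖ ^ 2)) * crossRate b N ξ f ≤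
      -(dissip b N f / 2) - rate ξ / 12 * lyap b N ξ f := by
  have hD := two_three_le_dissip b hN f
  have hfD := norm_sq_le_dissip b hf
  have hE := lyap_le b N ξ f
  have hD0 := dissip_nonneg b N f
  have hm0 := rate_nonneg ξ
  have hm1 := rate_le_one ξ
  -- it remains to compare quadratic forms in `√D` and in the norms of the parts of degree `≤ 3`
  set D := dissip b N f
  set x0 := ‖pOp b 0 f‖
  set x1 := ‖pOp b 1 f‖
  set x2 := ‖pOp b 2 f‖
  set x3 := ‖pOp b 3 f‖
  set r := ‖ξ‖ with hr
  have hω : 0 < 1 + r ^ 2 := by positivity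
  have hy2 : ‖aOp b N ξ (pOp b 2 f)‖ ^ 2 ≤ 2 * (r ^ 2 * x2 ^ 2) := by
    simpa using norm_aOp_pOp_sq_le b N 2 ξ f
  have hy3 : ‖aOp b N ξ (pOp b 3 f)‖ ^ 2 ≤ 3 * (r ^ 2 * x3 ^ 2) := by
    simpa using norm_aOp_pOp_sq_le b N 3 ξ f
  have hy1 : ‖adjoint (aOp b N ξ) (pOp b 1 f)‖ ^ 2 ≤ 2 * (r ^ 2 * x1 ^ 2) := by
    rw [norm_adjoint_aOp_sq b (by omega)]
    have := norm_aOp_pOp_sq_le b N 1 ξ f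
    push_cast at this
    linarith
  have t3 : -(r ^ 2 * x1 ^ 2 / 4 + 6 * (r ^ 2 * x3 ^ 2)) ≤
      (inner ℂ (adjoint (aOp b N ξ) (pOp b 1 f)) (aOp b N ξ (pOp b 3 f))).re := by
    have h1 := (abs_le.1 ((Complex.abs_re_le_norm _).trans
      (norm_inner_le_norm (𝕜 := ℂ) (adjoint (aOp b N ξ) (pOp b 1 f)) (aOp b N ξ (pOp b 3 f))))).1
    nlinarith [sq_nonneg (‖adjoint (aOp b N ξ) (pOp b 1 f)‖ - 4 * ‖aOp b N ξ (pOp b 3 f)‖)]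
  have t2 : -(r ^ 2 * x1 ^ 2 / 4 + 8 * x2 ^ 2) ≤
      2 * (inner ℂ (pOp b 1 f) (aOp b N ξ (pOp b 2 f))).im := by
    have h1 := (abs_le.1 ((Complex.abs_im_le_norm _).trans
      (norm_inner_le_norm (𝕜 := ℂ) (pOp b 1 f) (aOp b N ξ (pOp b 2 f))))).1
    have h2 : 2 * (x1 * ‖aOp b N ξ (pOp b 2 f)‖) ≤ r ^ 2 * x1 ^ 2 / 4 + 8 * x2 ^ 2 := by
      refine le_of_sq_le_sq ?_ (by positivity)
      have : (2 * (x1 * ‖aOp b N ξ (pOp b 2 f)‖)) ^ 2 ≤ 8 * (r ^ 2 * x1 ^ 2 * x2 ^ 2) := by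
        have := mul_le_mul_of_nonneg_left hy2 (sq_nonneg x1)
        nlinarith
      nlinarith [sq_nonneg (r ^ 2 * x1 ^ 2 / 4 - 8 * x2 ^ 2)]
    linarith
  have hQ : r ^ 2 / 2 * (x0 ^ 2 + x1 ^ 2) - 5 * ((1 + r ^ 2) * D) ≤ crossRate b N ξ f := by
    rw [crossRate_eq b (by omega)]
    have : r ^ 2 * (2 * x2 ^ 2 + 3 * x3 ^ 2) ≤ r ^ 2 * D := by gcongr
    nlinarith [sq_nonneg x3, sq_nonneg x2, mul_nonneg (sq_nonneg r) (sq_nonneg x2),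
      mul_nonneg (sq_nonneg r) (sq_nonneg x3), mul_nonneg (sq_nonneg r) (sq_nonneg x0)]
  have hQ' : rate ξ / 2 * (x0 ^ 2 + x1 ^ 2) - 5 * D ≤ 1 / (1 + r ^ 2) * crossRate b N ξ f := by
    have := mul_le_mul_of_nonneg_left hQ (by positivity : 0 ≤ 1 / (1 + r ^ 2))
    refine le_trans (le_of_eq ?_) this
    rw [rate, ← hr]; field_simp
  have hmE : rate ξ / 12 * lyap b N ξ f ≤ rate ξ / 10 * (x0 ^ 2 + x1 ^ 2 + D / 2) := by
    have := mul_le_mul_of_nonneg_left (hE.trans (mul_le_mul_of_nonneg_left hfD (by norm_num)))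
      (by positivity : 0 ≤ rate ξ / 12)
    linarith
  have : rate ξ * D ≤ 1 * D := by gcongr
  rw [mul_assoc]
  linarith

end Energy

/-! ### Truncated semigroups at a fixed frequency, and their limit -/

section Semigroup

variable {E : Type*} [NormedAddCommGroup E] [InnerProductSpace ℂ E] [CompleteSpace E]
variable (b : HilbertBasis (Idx d) ℂ E)
variable (N : ℕ) (ξ : Vec d)

/-- The semigroup generated by the truncated operator `A_N(ξ)`. -/
def semi (N : ℕ) (ξ : Vec d) (t : ℝ) : E →L[ℂ] E :=
  NormedSpace.exp (t • genOp b N ξ)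

lemma semi_zero (f : E) : semi b N ξ 0 f = f := by simp [semi]

lemma hasDerivAt_semi (f : E) (t : ℝ) :
    HasDerivAt (fun s => semi b N ξ s f) (genOp b N ξ (semi b N ξ t f)) t :=
  HasFDerivAt.comp_hasDerivAt (x := t) (f := semi b N ξ)
    (l := fun T : E →L[ℂ] E => T f)
    (l' := (ContinuousLinearMap.apply ℂ E f).restrictScalars ℝ)
    ((ContinuousLinearMap.apply ℂ E f).restrictScalars ℝ).hasFDerivAt
    (hasDerivAt_exp_smul_const' (genOp b N ξ) t)

lemma continuous_semi_apply (f : E) : Continuous fun s => semi b N ξ s f :=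
  continuous_iff_continuousAt.2 fun t => (hasDerivAt_semi b N ξ f t).continuousAt

lemma hasDerivAt_norm_sq {g : ℝ → E} {g' : E} {t : ℝ} (h : HasDerivAt g g' t) :
    HasDerivAt (fun s => ‖g s‖ ^ 2) (2 * (inner ℂ (g t) g').re) t := by
  have h1 := (h.inner ℂ h)
  have h2 := (reCLM.hasFDerivAt.comp_hasDerivAt t h1)
  have h3 : (reCLM ∘ fun s => inner ℂ (g s) (g s)) = fun s => ‖g s‖ ^ 2 := by
    funext s; simp [inner_self_ofReal, ← ofReal_pow]
  rw [h3] at h2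
  refine h2.congr_deriv ?_
  have h4 : (inner ℂ g' (g t)).re = (inner ℂ (g t) g').re := by
    rw [← inner_conj_symm, conj_re]
  simp only [reCLM_apply, add_re, h4, two_mul]

lemma hasDerivAt_norm_semi_sq (f : E) (t : ℝ) :
    HasDerivAt (fun s => ‖semi b N ξ s f‖ ^ 2) (-2 * dissip b N (semi b N ξ t f)) t := by
  convert hasDerivAt_norm_sq (hasDerivAt_semi b N ξ f t) using 1
  rw [re_inner_genOp]; ring

lemma antitone_norm_semi_sq (f : E) :
    Antitone fun s => ‖semi b N ξ s f‖ ^ 2 :=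
  antitone_of_hasDerivAt_nonpos (fun t => hasDerivAt_norm_semi_sq b N ξ f t) fun t => by
    have := dissip_nonneg b N (semi b N ξ t f)
    simp only [Pi.zero_apply]; linarith

lemma norm_semi_le {t : ℝ} (ht : 0 ≤ t) (f : E) :
    ‖semi b N ξ t f‖ ≤ ‖f‖ := by
  have := antitone_norm_semi_sq b N ξ f ht
  simp only [semi_zero] at this
  exact le_of_sq_le_sq this (norm_nonneg _)

lemma integral_dissip_semi_le (t : ℝ) (f : E) :
    ∫ s in 0..t, dissip b N (semi b N ξ s f) ≤ ‖f‖ ^ 2 / 2 := by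
  have h := integral_eq_sub_of_hasDerivAt (a := 0) (b := t)
    (fun s _ => hasDerivAt_norm_semi_sq b N ξ f s) (Continuous.intervalIntegrable
      (((continuous_dissip b N).comp (continuous_semi_apply b N ξ f)).const_mul _) _ _)
  rw [intervalIntegral.integral_const_mul] at h
  simp only [semi_zero] at h
  nlinarith [sq_nonneg ‖semi b N ξ t f‖]

lemma piOp_genOp : Commute (piOp b N) (genOp b N ξ) := by
  have h1 : piOp b N ∘L aOp b N ξ = aOp b N ξ := by
    refine clm_ext_basis b fun m => ?_
    simp only [comp_apply, aOp, sum_apply, smul_apply, map_sum, map_smul, lowOp_basis]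
    refine sum_congr rfl fun i _ => ?_
    split_ifs with h
    · have : deg (m - Pi.single i 1) ≤ deg m := sum_le_sum fun k _ => by simp
      rw [map_smul, piOp_basis, if_pos (by omega)]
    · simp
  have h2 : aOp b N ξ ∘L piOp b N = aOp b N ξ := by
    refine clm_ext_basis b fun m => ?_
    rw [comp_apply, piOp_basis]
    split_ifs with h
    · rfl
    · simp [aOp, lowOp_basis, h]
  have h3 := congrArg adjoint h1
  have h4 := congrArg adjoint h2
  rw [adjoint_comp, adjoint_piOp] at h3 h4
  have h5 : piOp b N ∘L diagOp b (lev d N) lam = diagOp b (lev d N) lam ∘L piOp b N := by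
    refine clm_ext_basis b fun m => ?_
    rw [comp_apply, comp_apply, piOp_basis, diagOp_basis]
    by_cases h : deg m ≤ N
    · simp only [mem_lev, h, if_true, map_smul, piOp_basis, diagOp_basis]
    · simp [h]
  change piOp b N * genOp b N ξ = genOp b N ξ * piOp b N
  rw [genOp, mul_sub, sub_mul, mul_smul_comm, smul_mul_assoc, mul_add, add_mul]
  simp only [ContinuousLinearMap.mul_def]
  rw [h1, h2, h3, h4, h5]

lemma piOp_semi (t : ℝ) (f : E) :
    piOp b N (semi b N ξ t f) = semi b N ξ t (piOp b N f) := by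
  have h : Commute (piOp b N) (semi b N ξ t) :=
    ((piOp_genOp b N ξ).smul_right t).exp_right
  exact DFunLike.congr_fun h.eq f

lemma piOp_piOp (f : E) : piOp b N (piOp b N f) = piOp b N f := by
  have : piOp b N ∘L piOp b N = piOp b N := by
    refine clm_ext_basis b fun m => ?_
    by_cases h : deg m ≤ N <;> simp [piOp_basis, h]
  exact DFunLike.congr_fun this f

lemma hasDerivAt_lyap_semi (f : E) (t : ℝ) :
    HasDerivAt (fun s => lyap b N ξ (semi b N ξ s f))
      (-2 * dissip b N (semi b N ξ t f) -
        1 / 5 * (1 / (1 + ‖ξ‖ ^ 2)) * crossRate b N ξ (semi b N ξ t f)) t := by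
  refine (hasDerivAt_norm_semi_sq b N ξ f t).sub (HasDerivAt.const_mul _ ?_)
  have h := hasDerivAt_semi b N ξ f t
  have h1 : HasDerivAt (fun s => crossOp b N ξ (semi b N ξ s f))
      (crossOp b N ξ (genOp b N ξ (semi b N ξ t f))) t :=
    ((crossOp b N ξ).restrictScalars ℝ).hasFDerivAt.comp_hasDerivAt t h
  exact reCLM.hasFDerivAt.comp_hasDerivAt t ((h.inner ℂ h1).const_mul I)

lemma lyap_semi_add_integral_le {N : ℕ} (hN : 3 ≤ N) (ξ : Vec d) {t : ℝ} (ht : 0 ≤ t) {f : E}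
    (hf : piOp b N f = f) :
    exp (rate ξ / 12 * t) * lyap b N ξ (semi b N ξ t f) +
      ∫ s in 0..t, exp (rate ξ / 12 * s) * dissip b N (semi b N ξ s f) / 2 ≤
    6 / 5 * ‖f‖ ^ 2 := by
  set g : ℝ → ℝ := fun s => exp (rate ξ / 12 * s) * dissip b N (semi b N ξ s f) / 2
  have hg : Continuous g := by
    have : Continuous fun s => dissip b N (semi b N ξ s f) :=
      (continuous_dissip b N).comp (continuous_semi_apply b N ξ f)
    fun_prop
  have hexp : ∀ s, HasDerivAt (fun s => exp (rate ξ / 12 * s))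
      (exp (rate ξ / 12 * s) * (rate ξ / 12)) s := fun s => by
    simpa using ((hasDerivAt_id s).const_mul (rate ξ / 12)).exp
  have hd : ∀ s, HasDerivAt (fun s => exp (rate ξ / 12 * s) * lyap b N ξ (semi b N ξ s f) +
      ∫ σ in 0..s, g σ)
      (exp (rate ξ / 12 * s) * (rate ξ / 12) * lyap b N ξ (semi b N ξ s f) +
        exp (rate ξ / 12 * s) * (-2 * dissip b N (semi b N ξ s f) -
        1 / 5 * (1 / (1 + ‖ξ‖ ^ 2)) * crossRate b N ξ (semi b N ξ s f)) + g s) s := fun s =>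
    ((hexp s).mul (hasDerivAt_lyap_semi b N ξ f s)).add
      (integral_hasDerivAt_right (hg.intervalIntegrable _ _)
        (hg.stronglyMeasurableAtFilter _ _) hg.continuousAt)
  have hanti := antitone_of_hasDerivAt_nonpos hd fun s => by
    have h1 := lyap_rate_le b hN ξ (f := semi b N ξ s f) (by rw [piOp_semi, hf])
    have h2 := mul_le_mul_of_nonneg_left h1 (exp_pos (rate ξ / 12 * s)).le
    simp only [Pi.zero_apply, g]
    linarith
  have h0 := hanti ht
  simp only [mul_zero, Real.exp_zero, one_mul, semi_zero, intervalIntegral.integral_same,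
    add_zero] at h0
  exact h0.trans (lyap_le b N ξ f)

/-- Exponential decay of the truncated semigroups, uniformly in the truncation. -/
lemma norm_semi_sq_le {N : ℕ} (hN : 3 ≤ N) (ξ : Vec d) {t : ℝ} (ht : 0 ≤ t) {f : E}
    (hf : piOp b N f = f) :
    ‖semi b N ξ t f‖ ^ 2 ≤ 3 / 2 * exp (-(rate ξ / 12 * t)) * ‖f‖ ^ 2 := by
  have h := lyap_semi_add_integral_le b hN ξ ht hf
  have h1 : 0 ≤ ∫ s in 0..t, exp (rate ξ / 12 * s) * dissip b N (semi b N ξ s f) / 2 :=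
    intervalIntegral.integral_nonneg ht fun s _ => by
      have := dissip_nonneg b N (semi b N ξ s f); positivity
  have h2 := le_lyap b N ξ (semi b N ξ t f)
  have h3 : exp (rate ξ / 12 * t) * ‖semi b N ξ t f‖ ^ 2 ≤ 3 / 2 * ‖f‖ ^ 2 := by
    have := mul_le_mul_of_nonneg_left h2 (exp_pos (rate ξ / 12 * t)).le
    linarith
  rw [Real.exp_neg, mul_right_comm, ← div_eq_mul_inv, le_div_iff₀' (exp_pos _)]
  exact h3

/-- The exponentially weighted dissipation is integrable in time. -/
lemma integral_exp_dissip_semi_le {N : ℕ} (hN : 3 ≤ N) (ξ : Vec d) {t : ℝ} (ht : 0 ≤ t) {f : E}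
    (hf : piOp b N f = f) :
    ∫ s in 0..t, exp (rate ξ / 12 * s) * dissip b N (semi b N ξ s f) ≤
      12 / 5 * ‖f‖ ^ 2 := by
  have h := lyap_semi_add_integral_le b hN ξ ht hf
  rw [intervalIntegral.integral_div] at h
  have h2 := le_lyap b N ξ (semi b N ξ t f)
  have : 0 ≤ exp (rate ξ / 12 * t) * lyap b N ξ (semi b N ξ t f) :=
    mul_nonneg (exp_pos _).le (le_trans (by positivity) h2)
  linarith

lemma adjoint_genOp : adjoint (genOp b N ξ) = genOp b N (-ξ) := by
  have : aOp b N (-ξ) = -aOp b N ξ := by simp [aOp, -coe_smul]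
  rw [genOp, genOp, this, map_sub, adjoint_diagOp, map_smulₛₗ, map_add, adjoint_adjoint, map_neg]
  simp only [map_neg, conj_I, neg_neg]
  congr 1
  rw [← neg_add, smul_neg, neg_smul, neg_neg, add_comm]

lemma adjoint_semi (t : ℝ) : adjoint (semi b N ξ t) = semi b N (-ξ) t := by
  rw [semi, ← star_eq_adjoint, NormedSpace.star_exp, star_smul, star_trivial, star_eq_adjoint,
    adjoint_genOp]
  rfl

/-- The value of the full operator `A(ξ)` on a basis vector. -/
def fullGen (ξ : Vec d) (n : Idx d) : E :=
  (-I) • ∑ i, (ξ i : ℂ) • ((√(n i) : ℂ) • b (n - Pi.single i 1) +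
    (√(n i + 1) : ℂ) • b (n + Pi.single i 1)) - (lam n : ℂ) • b n

lemma aOp_basis (n : Idx d) :
    aOp b N ξ (b n) = ∑ i, (ξ i : ℂ) •
      if deg n ≤ N then (√(n i) : ℂ) • b (n - Pi.single i 1) else 0 := by
  simp only [aOp, sum_apply, smul_apply, lowOp_basis]

lemma adjoint_aOp_basis (n : Idx d) :
    adjoint (aOp b N ξ) (b n) = ∑ i, (ξ i : ℂ) •
      if deg n + 1 ≤ N then (√(n i + 1) : ℂ) • b (n + Pi.single i 1) else 0 := by
  simp only [adjoint_aOp, sum_apply, smul_apply, raiseOp_basis]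

lemma genOp_basis {N : ℕ} {n : Idx d} (hn : deg n + 1 ≤ N) (ξ : Vec d) :
    genOp b N ξ (b n) = fullGen b ξ n := by
  rw [genOp, sub_apply, smul_apply, add_apply, adjoint_aOp_basis, aOp_basis, diagOp_basis,
    if_pos (by simp; omega), fullGen]
  simp only [if_pos hn, if_pos (show deg n ≤ N by omega), smul_add, sum_add_distrib]

/-- The part of `A(ξ)` that leaves the degrees at most `N`. -/
def leakOp (N : ℕ) (ξ : Vec d) : E →L[ℂ] E :=
  (-I) • (adjoint (aOp b (N + 1) ξ) ∘L pOp b N)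

lemma genOp_comp_piOp {M N : ℕ} (h : N + 1 ≤ M) (ξ : Vec d) :
    genOp b M ξ ∘L piOp b N = genOp b N ξ ∘L piOp b N + leakOp b N ξ := by
  refine clm_ext_basis b fun m => ?_
  rw [comp_apply, add_apply, comp_apply, piOp_basis, leakOp, smul_apply, comp_apply, pOp_basis]
  split_ifs with h1 h2 h2
  · rw [genOp_basis b (by omega)]
    simp only [genOp, sub_apply, smul_apply, add_apply, aOp_basis, adjoint_aOp_basis,
      diagOp_basis, mem_lev, h2, le_refl, if_true,
      if_neg (Nat.not_succ_le_self N), smul_zero, sum_const_zero, add_zero, fullGen]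
    simp only [smul_add, sum_add_distrib]
    abel
  · rw [genOp_basis b (by omega), genOp_basis b (by omega)]; simp
  · omega
  · simp

lemma inner_leakOp (f g : E) :
    inner ℂ f (leakOp b N ξ g) = inner ℂ (pOp b (N + 1) f) (leakOp b N ξ g) := by
  have : leakOp b N ξ g = pOp b (N + 1) (leakOp b N ξ g) := by
    simp only [leakOp, smul_apply, comp_apply, map_smul, pOp_adjoint_aOp_apply, pOp_pOp, if_true]
  conv_lhs => rw [this]
  rw [← adjoint_inner_left, adjoint_pOp]

lemma norm_leakOp_sq_le (f : E) :
    ‖leakOp b N ξ f‖ ^ 2 ≤ (N + 1) * (‖ξ‖ ^ 2 * ‖pOp b N f‖ ^ 2) := by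
  rw [leakOp, smul_apply, norm_smul, norm_neg, norm_I, one_mul, comp_apply,
    norm_adjoint_aOp_sq b le_rfl]
  have := norm_aOp_pOp_sq_le b (N + 1) N ξ f
  linarith

lemma pOp_le_dissip {M j : ℕ} (h : j ≤ M) (hj : 2 ≤ j) (f : E) :
    j * ‖pOp b j f‖ ^ 2 ≤ dissip b M f := by
  rw [mul_norm_pOp_sq b hj]
  refine sum_le_sum_of_subset_of_nonneg (fun n hn => ?_) fun n _ _ =>
    mul_nonneg (lam_nonneg n) (sq_nonneg _)
  simp only [mem_sph, mem_lev] at hn ⊢; omega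

/-- Two truncations differ by `O(|ξ| N^{-1/2})` on degrees at most `N`: the energy of the
difference is fed only through the leak at degree `N`, which the dissipation controls. -/
lemma norm_semi_sub_sq_le {M N : ℕ} (hN : 2 ≤ N) (h : N + 1 ≤ M) (ξ : Vec d) {t : ℝ} (ht : 0 ≤ t)
    {f : E} (hf : piOp b N f = f) :
    ‖semi b M ξ t f - semi b N ξ t f‖ ^ 2 ≤ ‖ξ‖ ^ 2 / (4 * N) * ‖f‖ ^ 2 := by
  have hN0 : (0 : ℝ) < N := by exact_mod_cast (by omega : 0 < N)
  set w : ℝ → E := fun s => semi b M ξ s f - semi b N ξ s f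
  have hw : ∀ s, HasDerivAt w (genOp b M ξ (w s) + leakOp b N ξ (semi b N ξ s f)) s := by
    intro s
    refine ((hasDerivAt_semi b M ξ f s).sub (hasDerivAt_semi b N ξ f s)).congr_deriv ?_
    have := DFunLike.congr_fun (genOp_comp_piOp b h ξ) (semi b N ξ s f)
    simp only [comp_apply, add_apply, piOp_semi, hf] at this
    simp only [w, map_sub]
    rw [this]; abel
  have hd := fun s => (hasDerivAt_norm_sq (hw s)).add
    ((hasDerivAt_norm_semi_sq b N ξ f s).const_mul (‖ξ‖ ^ 2 / (4 * N)))
  have hanti := antitone_of_hasDerivAt_nonpos hd fun s => by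
    simp only [Pi.zero_apply]
    set g := semi b N ξ s f
    rw [inner_add_right, add_re, re_inner_genOp, inner_leakOp]
    have h1 := (Complex.re_le_norm _).trans
      (norm_inner_le_norm (𝕜 := ℂ) (pOp b (N + 1) (w s)) (leakOp b N ξ g))
    have h2 := norm_leakOp_sq_le b N ξ g
    have h3 := pOp_le_dissip b h (by omega) (w s)
    have h4 := pOp_le_dissip b le_rfl hN g
    push_cast at h3
    set x := ‖pOp b (N + 1) (w s)‖
    set l := ‖leakOp b N ξ g‖
    have h5 : ‖ξ‖ ^ 2 / (4 * N) * (N * ‖pOp b N g‖ ^ 2) ≤ ‖ξ‖ ^ 2 / (4 * N) * dissip b N g := by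
      gcongr
    have h6 : ‖ξ‖ ^ 2 / (4 * N) * (N * ‖pOp b N g‖ ^ 2) = ‖ξ‖ ^ 2 * ‖pOp b N g‖ ^ 2 / 4 := by
      field_simp
    have h7 : 2 * (x * l) ≤ 2 * ((N + 1) * x ^ 2) + ‖ξ‖ ^ 2 * ‖pOp b N g‖ ^ 2 / 2 := by
      have h8 : l ^ 2 / (N + 1) ≤ ‖ξ‖ ^ 2 * ‖pOp b N g‖ ^ 2 := by
        rw [div_le_iff₀ (by positivity)]; linarith
      have h9 : 0 ≤ (2 * (N + 1) * x - l) ^ 2 / (2 * (N + 1)) := by positivity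
      have h10 : (2 * (N + 1) * x - l) ^ 2 / (2 * (N + 1)) =
        2 * ((N + 1) * x ^ 2) - 2 * (x * l) + l ^ 2 / (N + 1) / 2 := by field_simp; ring
      linarith
    linarith
  have h0 := hanti ht
  simp only [w, semi_zero, sub_self, norm_zero, Pi.add_apply] at h0
  have : 0 ≤ ‖ξ‖ ^ 2 / (4 * N) * ‖semi b N ξ t f‖ ^ 2 := by positivity
  linarith

lemma tendsto_piOp (f : E) : Tendsto (fun N => piOp b N f) atTop (𝓝 f) := by
  have h := b.hasSum_repr f
  have hlev : Tendsto (fun N => lev d N) atTop atTop := by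
    refine tendsto_atTop.2 fun s => ?_
    filter_upwards [eventually_ge_atTop (s.sup deg)] with N hN n hn
    exact mem_lev.2 ((Finset.le_sup hn).trans hN)
  refine (h.comp hlev).congr fun N => ?_
  simp [piOp, diagOp, b.repr_apply_apply]

lemma tendsto_pOp (f : E) : Tendsto (fun N => ‖pOp b (N + 1) f‖) atTop (𝓝 0) := by
  have h : ∀ N, pOp b (N + 1) f = piOp b (N + 1) f - piOp b N f := by
    intro N
    have : pOp b (N + 1) = piOp b (N + 1) - piOp b N := by
      refine clm_ext_basis b fun m => ?_
      rw [sub_apply, pOp_basis, piOp_basis, piOp_basis]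
      split_ifs <;> first | omega | simp
    rw [this, sub_apply]
  simp_rw [h]
  have := ((tendsto_piOp b f).comp (tendsto_add_atTop_nat 1)).sub (tendsto_piOp b f)
  rw [sub_self] at this
  exact tendsto_zero_iff_norm_tendsto_zero.1 this

lemma tendsto_sub_piOp (f : E) : Tendsto (fun N => ‖f - piOp b N f‖) atTop (𝓝 0) := by
  simpa using ((tendsto_const_nhds (x := f)).sub (tendsto_piOp b f)).norm

/-- The projection of the dynamics at level `M` solves the equation at level `N` up to a leak
from degree `N` to `N + 1` of size `√N`, against a damping of size `N`; hence the gain `1 / √N`. -/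
lemma norm_semi_sub_le {M N : ℕ} (hN : 2 ≤ N) (h : N ≤ M) (ξ : Vec d) {t : ℝ} (ht : 0 ≤ t)
    (f : E) :
    ‖semi b M ξ t f - semi b N ξ t f‖ ≤
      ‖ξ‖ / √N * ‖f‖ + 2 * ‖f - piOp b N f‖ := by
  rcases h.eq_or_lt with rfl | h
  · simp; positivity
  have hN0 : (0 : ℝ) < N := by exact_mod_cast (by omega : 0 < N)
  have h1 : ‖semi b M ξ t (piOp b N f) - semi b N ξ t (piOp b N f)‖ ≤ ‖ξ‖ / √N * ‖f‖ := by
    refine le_of_sq_le_sq ((norm_semi_sub_sq_le b hN h ξ ht (piOp_piOp b N f)).trans ?_)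
      (by positivity)
    have h2 : ‖piOp b N f‖ ≤ ‖f‖ := norm_diagOp_one_le b _ f
    rw [mul_pow, div_pow, sq_sqrt hN0.le]
    gcongr
    linarith
  have e : semi b M ξ t f - semi b N ξ t f =
      (semi b M ξ t (piOp b N f) - semi b N ξ t (piOp b N f)) +
        (semi b M ξ t (f - piOp b N f) - semi b N ξ t (f - piOp b N f)) := by
    simp only [map_sub]; abel
  rw [e]
  refine (norm_add_le _ _).trans (add_le_add h1 ((norm_sub_le _ _).trans ?_))
  have := norm_semi_le b M ξ ht (f - piOp b N f)
  have := norm_semi_le b N ξ ht (f - piOp b N f)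
  linarith

lemma tendsto_semi_bound (r : ℝ) (f : E) :
    Tendsto (fun N : ℕ => r / √N * ‖f‖ + 2 * ‖f - piOp b N f‖) atTop (𝓝 0) := by
  have h1 : Tendsto (fun N : ℕ => r / √(N : ℝ) * ‖f‖) atTop (𝓝 (0 * ‖f‖)) :=
    ((tendsto_const_nhds.div_atTop (Real.tendsto_sqrt_atTop.comp
      tendsto_natCast_atTop_atTop))).mul_const _
  simpa using h1.add ((tendsto_sub_piOp b f).const_mul 2)

lemma cauchySeq_semi {t : ℝ} (ht : 0 ≤ t) (f : E) :
    CauchySeq fun N => semi b N ξ t f := by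
  have hb := tendsto_semi_bound b ‖ξ‖ f
  refine Metric.cauchySeq_iff'.2 fun ε hε => ?_
  obtain ⟨N, hN2, hN⟩ := ((eventually_ge_atTop 2).and
    (hb.eventually (gt_mem_nhds hε))).exists
  refine ⟨N, fun M hM => ?_⟩
  rw [dist_eq_norm]
  exact (norm_semi_sub_le b hN2 hM ξ ht f).trans_lt hN

/-- The pointwise limit of the truncated semigroups (at time `max t 0`). -/
def flowFun (ξ : Vec d) (t : ℝ) (f : E) : E :=
  limUnder atTop fun N => semi b N ξ (max t 0) f

lemma tendsto_flowFun (t : ℝ) (f : E) :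
    Tendsto (fun N => semi b N ξ (max t 0) f) atTop (𝓝 (flowFun b ξ t f)) :=
  (cauchySeq_semi b ξ (le_max_right _ _) f).tendsto_limUnder

/-- The semigroup generated by `A(ξ) = -i ξ · v + L + P₁` (frozen for `t ≤ 0`). -/
def flow (ξ : Vec d) (t : ℝ) : E →L[ℂ] E :=
  continuousLinearMapOfTendsto (fun N : ℕ => semi b N ξ (max t 0)) (f := flowFun b ξ t)
    (tendsto_pi_nhds.2 (tendsto_flowFun b ξ t))

lemma tendsto_flow (t : ℝ) (f : E) :
    Tendsto (fun N => semi b N ξ (max t 0) f) atTop (𝓝 (flow b ξ t f)) :=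
  tendsto_flowFun b ξ t f

lemma norm_flow_le (t : ℝ) (f : E) : ‖flow b ξ t f‖ ≤ ‖f‖ :=
  le_of_tendsto (tendsto_flow b ξ t f).norm
    (.of_forall fun N => norm_semi_le b N ξ (le_max_right _ _) f)

lemma tendsto_semi_piOp (t : ℝ) (f : E) :
    Tendsto (fun N => semi b N ξ (max t 0) (piOp b N f)) atTop (𝓝 (flow b ξ t f)) := by
  have h : Tendsto (fun N => semi b N ξ (max t 0) (f - piOp b N f)) atTop (𝓝 0) :=
    squeeze_zero_norm (fun N => norm_semi_le b N ξ (le_max_right _ _) _) (tendsto_sub_piOp b f)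
  have := (tendsto_flow b ξ t f).sub h
  simpa using this

/-- Exponential decay at the frequency-dependent rate `m(ξ)`. -/
lemma norm_flow_sq_le {t : ℝ} (ht : 0 ≤ t) (f : E) :
    ‖flow b ξ t f‖ ^ 2 ≤ 3 / 2 * exp (-(rate ξ / 12 * t)) * ‖f‖ ^ 2 := by
  refine le_of_tendsto_of_tendsto ((tendsto_semi_piOp b ξ t f).norm.pow 2)
    (((tendsto_piOp b f).norm.pow 2).const_mul _) ?_
  filter_upwards [eventually_ge_atTop 3] with N hN
  rw [max_eq_left ht]
  exact norm_semi_sq_le b hN ξ ht (piOp_piOp b N f)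



lemma continuous_genOp : Continuous fun ξ : Vec d => genOp b N ξ := by
  have h : Continuous fun ξ : Vec d => aOp b N ξ := by unfold aOp; fun_prop
  have h2 : Continuous fun ξ : Vec d => adjoint (aOp b N ξ) :=
    (adjoint (𝕜 := ℂ) (E := E) (F := E)).continuous.comp h
  have h3 : Continuous fun ξ : Vec d => (-I) • (aOp b N ξ + adjoint (aOp b N ξ)) :=
    (h.add h2).const_smul (-I)
  exact h3.sub continuous_const

lemma continuous_semi : Continuous fun p : Vec d × ℝ => semi b N p.1 p.2 := by
  letI : NormedAlgebra ℚ (E →L[ℂ] E) := NormedAlgebra.restrictScalars ℚ ℝ _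
  exact NormedSpace.exp_continuous.comp
    (continuous_snd.smul ((continuous_genOp b N).comp continuous_fst))

lemma continuous_flow_apply (f : E) : Continuous fun p : Vec d × ℝ => flow b p.1 p.2 f := by
  refine continuous_iff_continuousAt.2 fun p₀ => ?_
  have hb := tendsto_semi_bound b (‖p₀.1‖ + 1) f
  have hev : ∀ᶠ p : Vec d × ℝ in 𝓝 p₀, ‖p.1‖ < ‖p₀.1‖ + 1 :=
    (continuous_fst.norm.continuousAt (x := p₀)).eventually (gt_mem_nhds (lt_add_one _))
  refine continuousAt_of_locally_uniform_approx_of_continuousAt fun u hu => ?_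
  obtain ⟨ε, hε, hεu⟩ := Metric.mem_uniformity_dist.1 hu
  obtain ⟨N, hN2, hN⟩ := ((eventually_ge_atTop 2).and
    (hb.eventually (gt_mem_nhds hε))).exists
  refine ⟨_, hev, fun p => semi b N p.1 (max p.2 0) f, ?_, fun p hp => hεu ?_⟩
  · exact (((continuous_semi b N).comp (by fun_prop :
      Continuous fun p : Vec d × ℝ => (p.1, max p.2 0))).clm_apply continuous_const).continuousAt
  · rw [dist_eq_norm]
    refine lt_of_le_of_lt ?_ hN
    refine le_of_tendsto ((tendsto_flow b p.1 p.2 f).sub_const _).norm ?_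
    filter_upwards [eventually_ge_atTop N] with M hM
    refine (norm_semi_sub_le b hN2 hM p.1 (le_max_right _ _) f).trans ?_
    have : ‖p.1‖ ≤ ‖p₀.1‖ + 1 := hp.le
    gcongr

lemma continuous_flow : Continuous fun p : (Vec d × ℝ) × E => flow b p.1.1 p.1.2 p.2 := by
  refine continuous_prod_of_continuous_lipschitzWith' (fun p : (Vec d × ℝ) × E =>
    flow b p.1.1 p.1.2 p.2) 1 (fun p => ?_) (continuous_flow_apply b)
  exact AddMonoidHomClass.lipschitz_of_bound_nnnorm (flow b p.1 p.2) 1 fun f => by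
    rw [one_mul]; exact norm_flow_le b _ _ f

/-- The generator of `flow`, in weak form: if `χ = A(ξ)^† ψ` coordinatewise then
`⟨ψ, flow t f⟩ = ⟨ψ, f⟩ + ∫₀ᵗ ⟨χ, flow s f⟩ ds`. -/
lemma inner_flow {ψ χ : E} (h : ∀ n, inner ℂ χ (b n) = inner ℂ ψ (fullGen b ξ n))
    {t : ℝ} (ht : 0 ≤ t) (f : E) :
    inner ℂ ψ (flow b ξ t f) = inner ℂ ψ f + ∫ s in 0..t, inner ℂ χ (flow b ξ s f) := by
  set g : ℕ → ℝ → E := fun N s => semi b N ξ s (piOp b N f)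
  have hgpi : ∀ N s, piOp b N (g N s) = g N s := fun N s => by
    simp only [g]; rw [piOp_semi, piOp_piOp]
  -- the truncated dynamics satisfies the identity up to the leak
  have hadj : ∀ N, ∀ f' : E, piOp b N f' = f' →
      inner ℂ ψ (genOp b N ξ f') = inner ℂ χ f' - inner ℂ ψ (leakOp b N ξ f') := by
    intro N f' hf'
    have h1 : (innerSL ℂ ψ) ∘L (genOp b (N + 1) ξ ∘L piOp b N) = (innerSL ℂ χ) ∘L piOp b N := by
      refine clm_ext_basis b fun m => ?_
      simp only [comp_apply, piOp_basis]
      split_ifs with hm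
      · rw [genOp_basis b (by omega)]; exact (h m).symm
      · simp
    rw [genOp_comp_piOp b le_rfl] at h1
    have h2 := DFunLike.congr_fun h1 f'
    simp only [comp_apply, add_apply, hf', innerSL_apply_apply, inner_add_right] at h2
    rw [← h2]; ring
  have hderiv : ∀ N s, HasDerivAt (fun s => inner ℂ ψ (g N s))
      (inner ℂ χ (g N s) - inner ℂ ψ (leakOp b N ξ (g N s))) s := by
    intro N s
    rw [← hadj N _ (hgpi N s)]
    simpa using (hasDerivAt_const s ψ).inner ℂ (hasDerivAt_semi b N ξ (piOp b N f) s)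
  have hcont : ∀ N, Continuous (g N) := fun N => continuous_semi_apply b N ξ _
  have hid : ∀ N, inner ℂ ψ (g N t) = inner ℂ ψ (piOp b N f) +
      ((∫ s in 0..t, inner ℂ χ (g N s)) -
        ∫ s in 0..t, inner ℂ ψ (leakOp b N ξ (g N s))) := by
    intro N
    have c1 : Continuous fun s => inner ℂ χ (g N s) := by have := hcont N; fun_prop
    have c2 : Continuous fun s => inner ℂ ψ (leakOp b N ξ (g N s)) := by
      have := hcont N; fun_prop
    have := integral_eq_sub_of_hasDerivAt (a := 0) (b := t)
      (fun s _ => hderiv N s) ((c1.sub c2).intervalIntegrable _ _)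
    rw [intervalIntegral.integral_sub (c1.intervalIntegrable _ _) (c2.intervalIntegrable _ _)]
      at this
    rw [this]
    simp [g, semi_zero]
  have hleak : Tendsto (fun N => ∫ s in 0..t, inner ℂ ψ (leakOp b N ξ (g N s))) atTop
      (𝓝 0) := by
    have hb : Tendsto (fun N => ‖pOp b (N + 1) ψ‖ * (‖ξ‖ * (t + ‖f‖ ^ 2))) atTop
        (𝓝 (0 * (‖ξ‖ * (t + ‖f‖ ^ 2)))) := (tendsto_pOp b ψ).mul_const _
    rw [zero_mul] at hb
    refine squeeze_zero_norm' ?_ hb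
    filter_upwards [eventually_ge_atTop 2] with N hN
    have hN1 : (1 : ℝ) ≤ N := by exact_mod_cast (by omega : 1 ≤ N)
    have c4 : Continuous fun s => dissip b N (g N s) := (continuous_dissip b N).comp (hcont N)
    have c3 : Continuous fun s => ‖pOp b (N + 1) ψ‖ * (‖ξ‖ * (1 + dissip b N (g N s))) := by
      fun_prop
    refine (intervalIntegral.norm_integral_le_of_norm_le ht
      (.of_forall fun s _ => ?_) (c3.intervalIntegrable _ _)).trans ?_
    · rw [inner_leakOp]
      refine (norm_inner_le_norm _ _).trans ?_
      gcongr
      have h1 := norm_leakOp_sq_le b N ξ (g N s)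
      have h2 := pOp_le_dissip b le_rfl hN (g N s)
      have h3 := dissip_nonneg b N (g N s)
      refine le_of_sq_le_sq (h1.trans ?_) (by positivity)
      rw [mul_pow, mul_left_comm]
      gcongr
      nlinarith [sq_nonneg ‖pOp b N (g N s)‖, sq_nonneg (dissip b N (g N s))]
    · rw [intervalIntegral.integral_const_mul, intervalIntegral.integral_const_mul,
        intervalIntegral.integral_add (by simp) (c4.intervalIntegrable _ _)]
      have h5 := integral_dissip_semi_le b N ξ t (piOp b N f)
      have h6 := pow_le_pow_left₀ (norm_nonneg _) (norm_diagOp_one_le b (lev d N) f) 2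
      change ‖piOp b N f‖ ^ 2 ≤ _ at h6
      gcongr
      · simp
      · change ∫ s in 0..t, dissip b N (semi b N ξ s (piOp b N f)) ≤ _
        nlinarith [sq_nonneg ‖f‖]
  have hconv : ∀ s, 0 ≤ s → Tendsto (fun N => g N s) atTop (𝓝 (flow b ξ s f)) := by
    intro s hs
    have := tendsto_semi_piOp b ξ s f
    rwa [max_eq_left hs] at this
  have hint : Tendsto (fun N => ∫ s in 0..t, inner ℂ χ (g N s)) atTop
      (𝓝 (∫ s in 0..t, inner ℂ χ (flow b ξ s f))) := by
    refine tendsto_integral_filter_of_dominated_convergence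
      (fun _ => ‖χ‖ * ‖f‖) ?_ ?_ (by simp) ?_
    · refine .of_forall fun N => Continuous.aestronglyMeasurable ?_
      have := hcont N; fun_prop
    · refine .of_forall fun N => .of_forall fun s hs => ?_
      rw [uIoc_of_le ht] at hs
      refine (norm_inner_le_norm _ _).trans ?_
      gcongr
      exact (norm_semi_le b N ξ hs.1.le _).trans (norm_diagOp_one_le b _ f)
    · refine .of_forall fun s hs => ?_
      rw [uIoc_of_le ht] at hs
      exact tendsto_const_nhds.inner (hconv s hs.1.le)
  refine tendsto_nhds_unique (tendsto_const_nhds.inner (hconv t ht)) ?_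
  simp_rw [hid]
  have := (tendsto_const_nhds (x := ψ)).inner (𝕜 := ℂ) (tendsto_piOp b f)
  simpa using this.add (hint.sub hleak)

end Semigroup

/-! ### Duhamel integrals of contraction families -/

section Duhamel

variable {H : Type*} [NormedAddCommGroup H] [InnerProductSpace ℂ H] [CompleteSpace H]

lemma integral_integral_triangle {F : Type*} [NormedAddCommGroup F] [NormedSpace ℝ F]
    {f : ℝ → ℝ → F} {t : ℝ} (ht : 0 ≤ t)
    (hf : Integrable (fun p : ℝ × ℝ => f p.1 p.2)
      ((volume.restrict (Ioc 0 t)).prod (volume.restrict (Ioc 0 t)))) :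
    ∫ s in 0..t, ∫ r in s..t, f s r = ∫ r in 0..t, ∫ s in 0..r, f s r := by
  have hm : MeasurableSet {p : ℝ × ℝ | p.1 < p.2} := measurableSet_lt measurable_fst measurable_snd
  have h := integral_integral_swap
    (f := fun s r => ({p : ℝ × ℝ | p.1 < p.2}.indicator (fun p => f p.1 p.2) (s, r)))
    (μ := volume.restrict (Ioc 0 t)) (ν := volume.restrict (Ioc 0 t)) (hf.indicator hm)
  rw [integral_of_le ht, integral_of_le ht]
  convert h using 1
  · refine setIntegral_congr_fun measurableSet_Ioc fun s hs => ?_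
    have : (fun r => {p : ℝ × ℝ | p.1 < p.2}.indicator (fun p => f p.1 p.2) (s, r)) =
        (Ioi s).indicator (fun r => f s r) := by
      funext r; by_cases h : s < r <;> simp [indicator, h]
    simp only [this]
    rw [integral_of_le hs.2, setIntegral_indicator measurableSet_Ioi,
      Ioc_inter_Ioi, max_eq_right hs.1.le]
  · refine setIntegral_congr_fun measurableSet_Ioc fun r hr => ?_
    have : (fun s => {p : ℝ × ℝ | p.1 < p.2}.indicator (fun p => f p.1 p.2) (s, r)) =
        (Iio r).indicator (fun s => f s r) := by
      funext s; by_cases h : s < r <;> simp [indicator, h]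
    simp only [this]
    rw [integral_of_le hr.1.le, setIntegral_indicator measurableSet_Iio,
      integral_Ioc_eq_integral_Ioo]
    congr 2
    ext x; simp only [mem_Ioo, mem_inter_iff, mem_Ioc, mem_Iio]
    constructor
    · rintro ⟨h1, h2⟩; exact ⟨⟨h1, h2.le.trans hr.2⟩, h2⟩
    · rintro ⟨⟨h1, _⟩, h2⟩; exact ⟨h1, h2⟩

/-- A strongly continuous family of contractions. -/
structure IsContraction (S : ℝ → H →L[ℂ] H) : Prop where
  cont : Continuous fun p : ℝ × H => S p.1 p.2
  norm_le : ∀ t f, ‖S t f‖ ≤ ‖f‖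

/-- The Duhamel integral `∫₀ᵗ S(t - s) r(s) ds`. -/
def duhamel (S : ℝ → H →L[ℂ] H) (r : ℝ → H) (t : ℝ) : H :=
  ∫ s in 0..t, S (t - s) (r s)

variable {S : ℝ → H →L[ℂ] H} (hS : IsContraction S) {r : ℝ → H}
include hS

lemma IsContraction.aestronglyMeasurable {μ : Measure ℝ} {τ : ℝ → ℝ} (hτ : Continuous τ)
    (hr : AEStronglyMeasurable r μ) : AEStronglyMeasurable (fun s => S (τ s) (r s)) μ :=
  hS.cont.comp_aestronglyMeasurable (hτ.aestronglyMeasurable.prodMk hr)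

lemma IsContraction.integrable {μ : Measure ℝ} {τ : ℝ → ℝ} (hτ : Continuous τ)
    (hr : Integrable r μ) : Integrable (fun s => S (τ s) (r s)) μ :=
  hr.mono (hS.aestronglyMeasurable hτ hr.1) (.of_forall fun s => hS.norm_le _ _)

lemma continuousOn_duhamel (hr : ∀ T : ℝ, IntegrableOn r (Ioc 0 T)) :
    ContinuousOn (duhamel S r) (Ici 0) := by
  intro t₀ ht₀
  have key : ContinuousAt (fun t => ∫ s in Ioc (0 : ℝ) (t₀ + 1),
      (Iic t).indicator (fun s => S (t - s) (r s)) s) t₀ := by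
    refine continuousAt_of_dominated (bound := fun s => ‖r s‖) ?_ ?_ (hr _).norm ?_
    · refine .of_forall fun t => ?_
      exact (hS.aestronglyMeasurable (continuous_const.sub continuous_id) (hr _).1).indicator
        measurableSet_Iic
    · refine .of_forall fun t => .of_forall fun s => ?_
      exact (norm_indicator_le_norm_self _ _).trans (hS.norm_le _ _)
    · have : ∀ᵐ s ∂volume.restrict (Ioc (0 : ℝ) (t₀ + 1)), s ≠ t₀ :=
        ae_restrict_of_ae (Measure.ae_ne volume t₀)
      filter_upwards [this] with s hs
      rcases lt_or_gt_of_ne hs with h | h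
      · have : (fun t => S (t - s) (r s)) =ᶠ[𝓝 t₀]
            fun t => (Iic t).indicator (fun s => S (t - s) (r s)) s := by
          filter_upwards [lt_mem_nhds h] with t ht
          rw [indicator_of_mem (by exact ht.le)]
        refine ContinuousAt.congr ?_ this
        exact (hS.cont.comp (by fun_prop : Continuous fun t : ℝ => (t - s, r s))).continuousAt
      · have : (fun _ => (0 : H)) =ᶠ[𝓝 t₀]
            fun t => (Iic t).indicator (fun s => S (t - s) (r s)) s := by
          filter_upwards [gt_mem_nhds h] with t ht
          rw [indicator_of_notMem (by simpa using ht)]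
        exact continuousAt_const.congr this
  refine (key.continuousWithinAt (s := Ici 0)).congr_of_eventuallyEq ?_ ?_
  · have : ∀ᶠ t in 𝓝[Ici 0] t₀, t < t₀ + 1 :=
      nhdsWithin_le_nhds (gt_mem_nhds (by linarith))
    filter_upwards [this, self_mem_nhdsWithin] with t ht ht0
    rw [duhamel, integral_of_le ht0, setIntegral_indicator measurableSet_Iic,
      Ioc_inter_Iic, min_eq_right ht.le]
  · rw [duhamel, integral_of_le ht₀, setIntegral_indicator measurableSet_Iic,
      Ioc_inter_Iic, min_eq_right (by linarith)]

/-- The Duhamel integral solves the inhomogeneous equation in the weak sense, as soon as the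
contractions solve the homogeneous one. -/
lemma inner_duhamel {ψ χ : H} (hr : ∀ T : ℝ, IntegrableOn r (Ioc 0 T))
    (hw : ∀ f t, 0 ≤ t → inner ℂ ψ (S t f) = inner ℂ ψ f + ∫ s in 0..t, inner ℂ χ (S s f))
    {t : ℝ} (ht : 0 ≤ t) :
    inner ℂ ψ (duhamel S r t) = (∫ s in 0..t, inner ℂ ψ (r s)) +
      ∫ s in 0..t, inner ℂ χ (duhamel S r s) := by
  have hi : ∀ t : ℝ, ∀ s, 0 ≤ s → IntervalIntegrable (fun σ => S (t - σ) (r σ)) volume 0 s :=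
    fun t s hs => (intervalIntegrable_iff_integrableOn_Ioc_of_le hs).2
      (hS.integrable (continuous_const.sub continuous_id) (hr s))
  have hin : ∀ φ : H, ∀ t, 0 ≤ t → inner ℂ φ (duhamel S r t) =
      ∫ s in 0..t, inner ℂ φ (S (t - s) (r s)) := fun φ t ht =>
    ((innerSL ℂ φ).intervalIntegral_comp_comm (hi t t ht)).symm
  have hir : IntervalIntegrable r volume 0 t :=
    (intervalIntegrable_iff_integrableOn_Ioc_of_le ht).2 (hr t)
  have hprod : Integrable (fun p : ℝ × ℝ => inner ℂ χ (S (p.2 - p.1) (r p.1)))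
      ((volume.restrict (Ioc 0 t)).prod (volume.restrict (Ioc 0 t))) := by
    have h1 : Integrable (fun p : ℝ × ℝ => ‖χ‖ * ‖r p.1‖)
      ((volume.restrict (Ioc 0 t)).prod (volume.restrict (Ioc 0 t))) :=
      ((hr t).norm.comp_fst _).const_mul _
    refine h1.mono' ((innerSL ℂ χ).continuous.comp_aestronglyMeasurable
      (hS.cont.comp_aestronglyMeasurable (.prodMk ?_ (hr t).1.comp_fst))) (.of_forall fun p =>
        (norm_inner_le_norm _ _).trans (by gcongr; exact hS.norm_le _ _))
    exact (continuous_snd.sub continuous_fst).aestronglyMeasurable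
  have h2 : ∀ s ∈ uIcc 0 t, inner ℂ ψ (S (t - s) (r s)) =
      inner ℂ ψ (r s) + ∫ σ in s..t, inner ℂ χ (S (σ - s) (r s)) := by
    intro s hs
    rw [uIcc_of_le ht] at hs
    rw [hw _ _ (sub_nonneg.2 hs.2)]
    congr 1
    have := intervalIntegral.integral_comp_sub_right (a := s) (b := t)
      (fun σ => inner ℂ χ (S σ (r s))) s
    rw [this, sub_self]
  rw [hin ψ t ht, intervalIntegral.integral_congr h2]
  have h3 : IntervalIntegrable (fun s => inner ℂ ψ (r s)) volume 0 t :=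
    ⟨hir.1.const_inner ψ, hir.2.const_inner ψ⟩
  have h4 : IntervalIntegrable (fun s => inner ℂ ψ (S (t - s) (r s))) volume 0 t :=
    ⟨(hi t t ht).1.const_inner ψ, (hi t t ht).2.const_inner ψ⟩
  have h5 : IntervalIntegrable (fun s => ∫ σ in s..t, inner ℂ χ (S (σ - s) (r s))) volume 0 t := by
    refine (h4.sub h3).congr ?_
    intro s hs
    have := h2 s (uIoc_subset_uIcc hs)
    simp [this]
  rw [intervalIntegral.integral_add h3 h5, integral_integral_triangle ht hprod]
  congr 1
  refine intervalIntegral.integral_congr fun s hs => ?_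
  rw [uIcc_of_le ht] at hs
  exact (hin χ s hs.1).symm

end Duhamel

/-! ### Operators acting on the fibers of `L²(ℝ^d; E)` -/

section Fiber

variable {E : Type*} [NormedAddCommGroup E] [InnerProductSpace ℂ E] [CompleteSpace E]

variable (d E) in
/-- Square integrable functions of the frequency with values in the velocity space `E`. -/
abbrev FL2 : Type _ := Lp E 2 (volume : Measure (Vec d))

/-- A bounded measurable family of operators on the fibers. -/
structure IsField (T : Vec d → E →L[ℂ] E) : Prop where
  meas : ∀ x : Vec d → E, AEStronglyMeasurable x volume →
    AEStronglyMeasurable (fun k => T k (x k)) volume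
  bound : ∃ C : ℝ, ∀ k x, ‖T k x‖ ≤ C * ‖x‖

lemma IsField.memLp {T : Vec d → E →L[ℂ] E} (hT : IsField T) {x : Vec d → E}
    (hx : MemLp x 2 volume) : MemLp (fun k => T k (x k)) 2 volume := by
  obtain ⟨C, hC⟩ := hT.bound
  exact hx.of_le_mul (hT.meas x hx.1) (.of_forall fun k => hC k (x k))

lemma eLpNorm_two_sq {F α : Type*} {m : MeasurableSpace α} {μ : Measure α} [NormedAddCommGroup F]
    (f : α → F) : eLpNorm f 2 μ ^ 2 = ∫⁻ a, ‖f a‖ₑ ^ 2 ∂μ := by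
  simpa using eLpNorm_nnreal_pow_eq_lintegral (f := f) (μ := μ) (p := 2) two_ne_zero

lemma Lp.enorm_sq_eq {F α : Type*} {m : MeasurableSpace α} {μ : Measure α} [NormedAddCommGroup F]
    (f : Lp F 2 μ) : ‖f‖ₑ ^ 2 = ∫⁻ a, ‖f a‖ₑ ^ 2 ∂μ := by rw [Lp.enorm_def, eLpNorm_two_sq]

lemma Lp.norm_sq_eq {F α : Type*} {m : MeasurableSpace α} {μ : Measure α} [NormedAddCommGroup F]
    (x : Lp F 2 μ) : ‖x‖ ^ 2 = ∫ k, ‖x k‖ ^ 2 ∂μ := by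
  rw [Lp.norm_def, (Lp.memLp x).eLpNorm_eq_integral_rpow_norm two_ne_zero ENNReal.ofNat_ne_top,
    ENNReal.toReal_ofReal (by positivity)]
  simp only [ENNReal.toReal_ofNat, Real.rpow_ofNat]
  rw [← Real.rpow_mul_natCast (integral_nonneg fun k => by positivity)]
  norm_num

lemma Lp.integrable_norm_sq {F α : Type*} {m : MeasurableSpace α} {μ : Measure α}
    [NormedAddCommGroup F] (x : Lp F 2 μ) : Integrable (fun k => ‖x k‖ ^ 2) μ :=
  (Lp.memLp x).integrable_norm_pow two_ne_zero

/-- The operator on `L²(ℝ^d; E)` acting by `T k` on the fiber over `k`. -/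
def fiberOp (T : Vec d → E →L[ℂ] E) (hT : IsField T) : FL2 d E →L[ℂ] FL2 d E :=
  LinearMap.mkContinuousOfExistsBound
    { toFun := fun x => (hT.memLp (Lp.memLp x)).toLp _
      map_add' := fun x y => by
        rw [← MemLp.toLp_add]
        refine MemLp.toLp_congr _ _ ?_
        filter_upwards [Lp.coeFn_add x y] with k hk
        change T k ((x + y : FL2 d E) k) = _
        rw [hk, Pi.add_apply, map_add, Pi.add_apply]
      map_smul' := fun c x => by
        rw [RingHom.id_apply, ← MemLp.toLp_const_smul]
        refine MemLp.toLp_congr _ _ ?_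
        filter_upwards [Lp.coeFn_smul c x] with k hk
        change T k ((c • x : FL2 d E) k) = _
        rw [hk, Pi.smul_apply, map_smul, Pi.smul_apply] }
    (by
      obtain ⟨C, hC⟩ := hT.bound
      refine ⟨C, fun x => Lp.norm_le_mul_norm_of_ae_le_mul ?_⟩
      filter_upwards [MemLp.coeFn_toLp (hT.memLp (Lp.memLp x))] with k hk
      change ‖(MemLp.toLp _ (hT.memLp (Lp.memLp x)) : FL2 d E) k‖ ≤ _
      rw [hk]; exact hC k _)

lemma coeFn_fiberOp {T : Vec d → E →L[ℂ] E} (hT : IsField T) (x : FL2 d E) :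
    fiberOp T hT x =ᵐ[volume] fun k => T k (x k) :=
  MemLp.coeFn_toLp (hT.memLp (Lp.memLp x))

lemma norm_fiberOp_le {T : Vec d → E →L[ℂ] E} (hT : IsField T) {C : ℝ}
    (hC : ∀ k x, ‖T k x‖ ≤ C * ‖x‖) (x : FL2 d E) : ‖fiberOp T hT x‖ ≤ C * ‖x‖ := by
  refine Lp.norm_le_mul_norm_of_ae_le_mul ?_
  filter_upwards [coeFn_fiberOp hT x] with k hk
  rw [hk]; exact hC k _

lemma inner_FL2 (x y : FL2 d E) : inner ℂ x y = ∫ k, inner ℂ (x k) (y k) := L2.inner_def x y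

/-- A strongly continuous family of contractions on each fiber. -/
structure IsFiberFlow (T : Vec d → ℝ → E →L[ℂ] E) : Prop where
  cont : Continuous fun p : (Vec d × ℝ) × E => T p.1.1 p.1.2 p.2
  bound : ∀ k t x, ‖T k t x‖ ≤ ‖x‖

variable {T : Vec d → ℝ → E →L[ℂ] E} (hT : IsFiberFlow T)
include hT

lemma IsFiberFlow.isField (t : ℝ) : IsField fun k => T k t where
  meas x hx := by
    have h : AEStronglyMeasurable (fun k : Vec d => ((k, t), x k)) volume :=
      (by fun_prop : Continuous fun k : Vec d => (k, t)).aestronglyMeasurable.prodMk hx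
    exact hT.cont.comp_aestronglyMeasurable h
  bound := ⟨1, fun k x => by simpa using hT.bound k t x⟩

/-- The family of operators on `L²(ℝ^d; E)` acting by `T k t` on the fibers. -/
def fiberFlow (hT : IsFiberFlow T) (t : ℝ) : FL2 d E →L[ℂ] FL2 d E :=
  fiberOp (fun k => T k t) (hT.isField t)

lemma coeFn_fiberFlow (t : ℝ) (x : FL2 d E) :
    fiberFlow hT t x =ᵐ[volume] fun k => T k t (x k) := coeFn_fiberOp _ x

lemma isContraction_fiberFlow : IsContraction (fiberFlow hT) := by
  have hn : ∀ t f, ‖fiberFlow hT t f‖ ≤ ‖f‖ := fun t f => by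
    simpa [fiberFlow] using
      norm_fiberOp_le (hT.isField t) (C := 1) (fun k x => by simpa using hT.bound k t x) f
  have hc : ∀ f, Continuous fun t => fiberFlow hT t f := by
    intro f
    refine continuous_iff_continuousAt.2 fun t₀ => ?_
    have h1 : ∀ t, ‖fiberFlow hT t f - fiberFlow hT t₀ f‖ ^ 2 =
        ∫ k, ‖T k t (f k) - T k t₀ (f k)‖ ^ 2 := by
      intro t
      rw [Lp.norm_sq_eq]
      refine integral_congr_ae ?_
      filter_upwards [Lp.coeFn_sub (fiberFlow hT t f) (fiberFlow hT t₀ f),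
        coeFn_fiberFlow hT t f, coeFn_fiberFlow hT t₀ f] with k h1 h2 h3
      rw [h1, Pi.sub_apply, h2, h3]
    have h2 : Continuous fun t => ∫ k, ‖T k t (f k) - T k t₀ (f k)‖ ^ 2 := by
      refine continuous_of_dominated (bound := fun k => 4 * ‖f k‖ ^ 2) ?_ ?_ ?_ ?_
      · intro t
        exact ((((hT.isField t).meas f (Lp.aestronglyMeasurable f)).sub
          ((hT.isField t₀).meas f (Lp.aestronglyMeasurable f))).norm).pow 2
      · refine fun t => .of_forall fun k => ?_
        rw [norm_of_nonneg (by positivity)]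
        have := norm_sub_le (T k t (f k)) (T k t₀ (f k))
        nlinarith [hT.bound k t (f k), hT.bound k t₀ (f k), norm_nonneg (f k),
          norm_nonneg (T k t (f k) - T k t₀ (f k))]
      · exact (Lp.integrable_norm_sq f).const_mul 4
      · refine .of_forall fun k => ?_
        have : Continuous fun t => T k t (f k) :=
          hT.cont.comp (by fun_prop : Continuous fun t : ℝ => ((k, t), f k))
        fun_prop
    have h3 : Tendsto (fun t => ‖fiberFlow hT t f - fiberFlow hT t₀ f‖ ^ 2) (𝓝 t₀) (𝓝 0) := by
      simp only [h1]
      convert h2.tendsto t₀ using 2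
      simp
    have h4 := h3.sqrt
    simp only [Real.sqrt_sq (norm_nonneg _), Real.sqrt_zero] at h4
    exact tendsto_iff_norm_sub_tendsto_zero.2 h4
  refine ⟨continuous_prod_of_continuous_lipschitzWith' _ 1 (fun t => ?_) hc, hn⟩
  exact AddMonoidHomClass.lipschitz_of_bound_nnnorm _ 1 fun f => by rw [one_mul]; exact hn t f

/-- A weak evolution equation on almost every fiber integrates to one on `L²(ℝ^d; E)`. -/
lemma inner_fiberFlow {ψ χ f : FL2 d E} {t : ℝ} (ht : 0 ≤ t)
    (hw : ∀ᵐ k, inner ℂ (ψ k) (T k t (f k)) =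
      inner ℂ (ψ k) (f k) + ∫ s in 0..t, inner ℂ (χ k) (T k s (f k))) :
    inner ℂ ψ (fiberFlow hT t f) =
      inner ℂ ψ f + ∫ s in 0..t, inner ℂ χ (fiberFlow hT s f) := by
  have hin : ∀ (φ : FL2 d E) t, inner ℂ φ (fiberFlow hT t f) = ∫ k, inner ℂ (φ k) (T k t (f k)) := by
    intro φ t
    rw [inner_FL2]
    refine integral_congr_ae ?_
    filter_upwards [coeFn_fiberFlow hT t f] with k hk
    rw [hk]
  have hprod : Integrable (fun p : ℝ × Vec d => inner ℂ (χ p.2) (T p.2 p.1 (f p.2)))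
      ((volume.restrict (Ioc 0 t)).prod volume) := by
    have h1 : Integrable (fun p : ℝ × Vec d => ‖χ p.2‖ * ‖f p.2‖)
        ((volume.restrict (Ioc 0 t)).prod volume) :=
      (MemLp.integrable_mul (Lp.memLp χ).norm (Lp.memLp f).norm).comp_snd _
    refine h1.mono' ((Lp.aestronglyMeasurable χ).comp_snd.inner
      (hT.cont.comp_aestronglyMeasurable (.prodMk (f := fun p : ℝ × Vec d => (p.2, p.1)) ?_
        (Lp.aestronglyMeasurable f).comp_snd))) (.of_forall fun p =>
        (norm_inner_le_norm _ _).trans (by gcongr; exact hT.bound _ _ _))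
    exact continuous_swap.aestronglyMeasurable
  rw [hin, integral_congr_ae hw, inner_FL2, integral_add (L2.integrable_inner ψ f)]
  · congr 1
    rw [integral_of_le ht]
    simp only [hin, integral_of_le ht]
    exact (integral_integral_swap hprod).symm
  · simp only [integral_of_le ht]
    exact hprod.integral_prod_right

end Fiber

/-! ### Schwartz functions: Gaussians, tensor products, density of test functions -/

section IterProd

variable {X Y : Type*}

/-- The product of powers `P₁^{α₁} ⋯ P_d^{α_d}` of a family of maps, applied to `x`. -/
def iterProd (P : Fin d → X → X) (α : Idx d) (x : X) : X :=
  (List.finRange d).foldr (fun i g => (P i)^[α i] g) x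

lemma iterProd_map {P : Fin d → X → X} {Q : Fin d → Y → Y} {f : X → Y}
    (h : ∀ i x, f (P i x) = Q i (f x)) (α : Idx d) (x : X) :
    f (iterProd P α x) = iterProd Q α (f x) := by
  unfold iterProd
  induction List.finRange d with
  | nil => rfl
  | cons i l ih =>
    rw [List.foldr_cons, List.foldr_cons, ← ih]
    exact Function.Semiconj.iterate_right (h i) (α i) _

lemma iterProd_comm {P : Fin d → X → X} {Q : X → X} (h : ∀ i, Function.Commute Q (P i))
    (α : Idx d) : Function.Commute Q (iterProd P α) :=
  fun x => iterProd_map (fun i x => h i x) α x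

lemma iterProd_add {P : Fin d → X → X} (h : ∀ i j, Function.Commute (P i) (P j))
    (α β : Idx d) (x : X) : iterProd P (α + β) x = iterProd P α (iterProd P β x) := by
  unfold iterProd
  induction List.finRange d generalizing x with
  | nil => rfl
  | cons i l ih =>
    have hc : ∀ γ : Idx d, Function.Commute (P i)
        (fun x => l.foldr (fun i g => (P i)^[γ i] g) x) := by
      intro γ x
      clear ih
      induction l with
      | nil => rfl
      | cons j l ih =>
        simp only [List.foldr_cons]
        simp only at ih
        rw [← ih]
        exact ((h i j).iterate_right (γ j)) _
    rw [List.foldr_cons, List.foldr_cons, List.foldr_cons, ih, Pi.add_apply,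
      Function.iterate_add_apply]
    congr 1
    exact ((hc α).iterate_left (β i)) _

lemma iterProd_single (P : Fin d → X → X) (i : Fin d) (x : X) :
    iterProd P (Pi.single i 1) x = P i x := by
  unfold iterProd
  have key : ∀ l : List (Fin d), l.Nodup →
      l.foldr (fun j g => (P j)^[(Pi.single i 1 : Idx d) j] g) x = if i ∈ l then P i x else x := by
    intro l hl
    induction l with
    | nil => simp
    | cons j l ih =>
      rw [List.nodup_cons] at hl
      rw [List.foldr_cons, ih hl.2]
      by_cases hj : j = i
      · subst hj; simp [hl.1]
      · simp [hj, Ne.symm hj]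
  rw [key _ (List.nodup_finRange d), if_pos (List.mem_finRange i)]

lemma iterProd_zero (P : Fin d → X → X) (x : X) : iterProd P 0 x = x := by
  unfold iterProd
  induction List.finRange d with
  | nil => rfl
  | cons i l ih => simp [ih]

lemma iterProd_add_single {P : Fin d → X → X} (h : ∀ i j, Function.Commute (P i) (P j))
    (α : Idx d) (i : Fin d) (x : X) :
    iterProd P (α + Pi.single i 1) x = P i (iterProd P α x) := by
  rw [add_comm, iterProd_add h, iterProd_single]

end IterProd

section General

variable {V : Type*} [NormedAddCommGroup V] [NormedSpace ℝ V]

/-- A real Schwartz function seen as a complex one. -/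
def toC (φ : 𝓢(V, ℝ)) : 𝓢(V, ℂ) := φ.postcompCLM ofRealCLM

@[simp] lemma toC_apply (φ : 𝓢(V, ℝ)) (x : V) : toC φ x = (φ x : ℂ) := rfl

lemma norm_iteratedFDeriv_comp_clm_le {W F : Type*} [NormedAddCommGroup W] [NormedSpace ℝ W]
    [NormedAddCommGroup F] [NormedSpace ℝ F]
    (L : V →L[ℝ] W) (hL : ‖L‖ ≤ 1) {f : W → F} (hf : ContDiff ℝ ∞ f) (n : ℕ) (x : V) :
    ‖iteratedFDeriv ℝ n (fun y => f (L y)) x‖ ≤ ‖iteratedFDeriv ℝ n f (L x)‖ := by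
  have h := L.iteratedFDeriv_comp_right (f := f) hf x (i := n) (mod_cast le_top)
  have h2 : (fun y => f (L y)) = f ∘ L := rfl
  rw [h2, h]
  refine (ContinuousMultilinearMap.norm_compContinuousLinearMap_le _ _).trans ?_
  refine mul_le_of_le_one_right (norm_nonneg _) ?_
  exact Finset.prod_le_one (fun _ _ => norm_nonneg _) fun _ _ => hL

/-- Smooth cutoff functions: multiplication by them approximates the identity on the
Schwartz space. -/
lemma exists_cutoff [FiniteDimensional ℝ V] : ∃ χ : ℕ → V → ℝ,
    (∀ R, ContDiff ℝ ∞ (χ R)) ∧ (∀ R, HasCompactSupport (χ R)) ∧ (∀ R x, ‖χ R x‖ ≤ 1) ∧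
    (∀ x, Tendsto (fun R => χ R x) atTop (𝓝 1)) ∧
    ∀ Φ : 𝓢(V, ℂ), Tendsto (fun R => smulLeftCLM ℂ (fun z => (χ R z : ℂ)) Φ) atTop (𝓝 Φ) := by
  let χ₀ : ContDiffBump (0 : V) := ⟨1, 2, one_pos, one_lt_two⟩
  let L : ℕ → V →L[ℝ] V := fun R => ((R : ℝ) + 1)⁻¹ • ContinuousLinearMap.id ℝ V
  have hL : ∀ R, ‖L R‖ ≤ 1 := by
    intro R
    simp only [L]
    rw [norm_smul, norm_inv, norm_of_nonneg (by positivity)]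
    refine mul_le_one₀ (inv_le_one_of_one_le₀ (by linarith [R.cast_nonneg (α := ℝ)])) (norm_nonneg _)
      norm_id_le
  have hsm : ContDiff ℝ ∞ (χ₀ : V → ℝ) := χ₀.contDiff
  let χ : ℕ → V → ℝ := fun R z => χ₀ (L R z)
  have hχs : ∀ R, ContDiff ℝ ∞ (χ R) := fun R => hsm.comp (L R).contDiff
  have hone : ∀ (R : ℕ) z, ‖z‖ < R + 1 → χ R z = 1 := by
    intro R z hz
    refine χ₀.one_of_mem_closedBall ?_
    rw [mem_closedBall_zero_iff]
    simp only [L, smul_apply, id_apply, norm_smul, norm_inv]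
    rw [norm_of_nonneg (by positivity), inv_mul_le_iff₀ (by positivity)]
    simpa [χ₀] using hz.le
  have hχc : ∀ R, HasCompactSupport (χ R) := by
    intro R
    refine HasCompactSupport.of_support_subset_isCompact
      (isCompact_closedBall (0 : V) (2 * (R + 1))) ?_
    intro z hz
    have h1 : L R z ∈ Function.support χ₀ := hz
    rw [χ₀.support_eq, mem_ball_zero_iff] at h1
    simp only [L, smul_apply, id_apply, norm_smul, norm_inv] at h1
    rw [norm_of_nonneg (by positivity), inv_mul_lt_iff₀ (by positivity)] at h1
    rw [mem_closedBall_zero_iff]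
    have : χ₀.rOut = 2 := rfl
    rw [this] at h1
    linarith
  refine ⟨χ, hχs, hχc, fun R x => ?_, fun x => ?_, fun Φ => ?_⟩
  · rw [norm_of_nonneg χ₀.nonneg]; exact χ₀.le_one
  · refine tendsto_const_nhds.congr' ?_
    obtain ⟨N, hN⟩ := exists_nat_gt ‖x‖
    filter_upwards [eventually_ge_atTop N] with R hR
    refine (hone R x ?_).symm
    have : (N : ℝ) ≤ R := by exact_mod_cast hR
    linarith
  · -- all derivatives of `1 - χ` are bounded
    let η : V → ℂ := fun z => 1 - (χ₀ z : ℂ)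
    have hηs : ContDiff ℝ ∞ η := contDiff_const.sub (ofRealCLM.contDiff.comp hsm)
    have hηb : ∀ i : ℕ, ∃ C : ℝ, 0 ≤ C ∧ ∀ z, ‖iteratedFDeriv ℝ i η z‖ ≤ C := by
      intro i
      have h1 : ContDiff ℝ ∞ fun z => (χ₀ z : ℂ) := ofRealCLM.contDiff.comp hsm
      have h2 : HasCompactSupport fun z => (χ₀ z : ℂ) :=
        χ₀.hasCompactSupport.comp_left (g := fun r : ℝ => (r : ℂ)) (by simp)
      obtain ⟨C, hC⟩ := (h2.iteratedFDeriv (𝕜 := ℝ) i).exists_bound_of_continuous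
        (h1.continuous_iteratedFDeriv (m := i) (mod_cast le_top))
      refine ⟨1 + |C|, by positivity, fun z => ?_⟩
      have h3 : iteratedFDeriv ℝ i η z =
          iteratedFDeriv ℝ i (fun _ : V => (1 : ℂ)) z - iteratedFDeriv ℝ i (fun z => (χ₀ z : ℂ)) z :=
        iteratedFDeriv_sub_apply contDiffAt_const (h1.contDiffAt.of_le (mod_cast le_top))
      rw [h3]
      refine (norm_sub_le _ _).trans (add_le_add ?_ ((hC z).trans (le_abs_self C)))
      rcases Nat.eq_zero_or_pos i with rfl | hi
      · simp
      · rw [iteratedFDeriv_const_of_ne hi.ne']; simp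
    choose C hC0 hC using hηb
    rw [(schwartz_withSeminorms ℝ V ℂ).tendsto_nhds]
    rintro ⟨k, n⟩ ε hε
    let M : ℝ := ∑ i ∈ Finset.range (n + 1),
      (n.choose i : ℝ) * C i * SchwartzMap.seminorm ℝ (k + 1) (n - i) Φ
    have hM : 0 ≤ M := sum_nonneg fun i _ =>
      mul_nonneg (mul_nonneg (Nat.cast_nonneg _) (hC0 i)) (apply_nonneg _ _)
    have hlim : Tendsto (fun R : ℕ => ((R : ℝ) + 1)⁻¹ * M) atTop (𝓝 0) := by
      have h : Tendsto (fun R : ℕ => (R : ℝ) + 1) atTop atTop :=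
        tendsto_atTop_add_const_right _ _ tendsto_natCast_atTop_atTop
      simpa using h.inv_tendsto_atTop.mul_const M
    filter_upwards [hlim.eventually (gt_mem_nhds hε)] with R hR
    refine lt_of_le_of_lt ?_ hR
    have htg : Function.HasTemperateGrowth fun z => (χ R z : ℂ) :=
      ((hχc R).comp_left (g := fun r : ℝ => (r : ℂ)) (by simp)).hasTemperateGrowth
        (ofRealCLM.contDiff.comp (hχs R))
    change SchwartzMap.seminorm ℝ k n _ ≤ _
    refine SchwartzMap.seminorm_le_bound ℝ k n _ (by positivity) fun z => ?_
    have hfun : ⇑(smulLeftCLM ℂ (fun z => (χ R z : ℂ)) Φ - Φ) = fun z => -(η (L R z) * Φ z) := by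
      funext z
      rw [sub_apply, smulLeftCLM_apply_apply htg]
      simp only [η, χ, smul_eq_mul]; ring
    rw [hfun]
    by_cases hz : ‖z‖ < R + 1
    · have : (fun z => -(η (L R z) * Φ z)) =ᶠ[𝓝 z] fun _ => 0 := by
        have : ∀ᶠ y in 𝓝 z, ‖y‖ < R + 1 := continuous_norm.continuousAt.eventually (gt_mem_nhds hz)
        filter_upwards [this] with y hy
        have := hone R y hy
        simp only [χ] at this
        simp [η, this]
      rw [(this.iteratedFDeriv ℝ n).eq_of_nhds]
      have h0 : iteratedFDeriv ℝ n (fun _ : V => (0 : ℂ)) z = 0 := by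
        simp [iteratedFDeriv_fun_zero]
      rw [h0]; simp; positivity
    · push Not at hz
      have hneg : iteratedFDeriv ℝ n (fun z => -(η (L R z) * Φ z)) z =
          -iteratedFDeriv ℝ n (fun z => η (L R z) * Φ z) z := iteratedFDeriv_neg_apply
      rw [hneg, norm_neg]
      have hprod := norm_iteratedFDeriv_mul_le (N := ∞) (hηs.comp (L R).contDiff) (Φ.smooth ⊤) z
        (n := n) (mod_cast le_top)
      have h1 : 1 ≤ ((R : ℝ) + 1)⁻¹ * ‖z‖ := by
        rw [← div_eq_inv_mul, one_le_div (by positivity)]; exact hz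
      calc ‖z‖ ^ k * ‖iteratedFDeriv ℝ n (fun z => η (L R z) * Φ z) z‖
          ≤ ‖z‖ ^ k * ∑ i ∈ Finset.range (n + 1), (n.choose i : ℝ) *
              ‖iteratedFDeriv ℝ i (η ∘ L R) z‖ * ‖iteratedFDeriv ℝ (n - i) Φ z‖ :=
            mul_le_mul_of_nonneg_left hprod (by positivity)
        _ ≤ ((R : ℝ) + 1)⁻¹ * ‖z‖ * (‖z‖ ^ k * ∑ i ∈ Finset.range (n + 1), (n.choose i : ℝ) *
              C i * ‖iteratedFDeriv ℝ (n - i) Φ z‖) := by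
            refine (le_mul_of_one_le_left ?_ h1).trans ?_
            · exact mul_nonneg (by positivity) (sum_nonneg fun i _ => by positivity)
            · gcongr with i hi
              exact (norm_iteratedFDeriv_comp_clm_le (L R) (hL R) hηs i z).trans (hC i _)
        _ ≤ ((R : ℝ) + 1)⁻¹ * M := by
            rw [mul_assoc]
            refine mul_le_mul_of_nonneg_left ?_ (by positivity)
            rw [← mul_assoc, ← pow_succ', mul_sum]
            refine sum_le_sum fun i _ => ?_
            rw [mul_left_comm]
            refine mul_le_mul_of_nonneg_left ?_ (mul_nonneg (Nat.cast_nonneg _) (hC0 i))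
            exact SchwartzMap.le_seminorm ℝ _ _ Φ z

/-- A continuous functional on the Schwartz space that vanishes on real test functions is zero. -/
lemma schwartz_functional_ext [FiniteDimensional ℝ V] {ℓ : 𝓢(V, ℂ) →L[ℂ] ℂ}
    (h : ∀ φ : 𝓢(V, ℝ), HasCompactSupport φ → ℓ (toC φ) = 0) : ℓ = 0 := by
  obtain ⟨χ, hχs, hχc, -, -, hχ⟩ := exists_cutoff (V := V)
  ext Φ
  have h1 := (ℓ.continuous.tendsto Φ).comp (hχ Φ)
  refine tendsto_nhds_unique h1 ?_
  refine tendsto_const_nhds.congr fun R => ?_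
  have htg : Function.HasTemperateGrowth fun z => (χ R z : ℂ) :=
    ((hχc R).comp_left (g := fun r : ℝ => (r : ℂ)) (by simp)).hasTemperateGrowth
      (ofRealCLM.contDiff.comp (hχs R))
  have hre : HasCompactSupport fun z => χ R z * (Φ z).re := (hχc R).mul_right
  have him : HasCompactSupport fun z => χ R z * (Φ z).im := (hχc R).mul_right
  have hres : ContDiff ℝ ∞ fun z => χ R z * (Φ z).re :=
    (hχs R).mul (reCLM.contDiff.comp (Φ.smooth ⊤))
  have hims : ContDiff ℝ ∞ fun z => χ R z * (Φ z).im :=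
    (hχs R).mul (Complex.imCLM.contDiff.comp (Φ.smooth ⊤))
  have hsplit : smulLeftCLM ℂ (fun z => (χ R z : ℂ)) Φ =
      toC (hre.toSchwartzMap hres) + I • toC (him.toSchwartzMap hims) := by
    ext z
    rw [smulLeftCLM_apply_apply htg]
    change (χ R z : ℂ) • Φ z =
      ((χ R z * (Φ z).re : ℝ) : ℂ) + I • ((χ R z * (Φ z).im : ℝ) : ℂ)
    rw [smul_eq_mul, smul_eq_mul]
    conv_lhs => rw [← Complex.re_add_im (Φ z)]
    push_cast; ring
  have h2 : ℓ (smulLeftCLM ℂ (fun z => (χ R z : ℂ)) Φ) = 0 := by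
    have e1 : ℓ (toC (hre.toSchwartzMap hres)) = 0 := h (hre.toSchwartzMap hres) hre
    have e2 : ℓ (toC (him.toSchwartzMap hims)) = 0 := h (him.toSchwartzMap hims) him
    rw [hsplit, map_add, map_smul, e1, e2, smul_zero, add_zero]
  exact h2.symm

end General

section Gaussian

variable {V : Type*} [NormedAddCommGroup V] [InnerProductSpace ℝ V]

/-- The Gaussian `exp (-c |v|²)` as a Schwartz function. -/
def gaussianS {c : ℝ} (hc : 0 < c) : 𝓢(V, ℝ) where
  toFun v := exp (-(c * ‖v‖ ^ 2))
  smooth' := Real.contDiff_exp.comp (contDiff_const.mul (contDiff_norm_sq ℝ)).neg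
  decay' k n := by
    have htg : Function.HasTemperateGrowth fun v : V => -(c * ‖v‖ ^ 2) := by
      have := Function.hasTemperateGrowth_norm_sq (H := V)
      fun_prop
    obtain ⟨l, C, hC0, hC⟩ := htg.norm_iteratedFDeriv_le_uniform n
    let p := k + l * n
    refine ⟨n.factorial * (C + 1) ^ n * (p.factorial * exp (1 + 1 / (4 * c))), fun v => ?_⟩
    let D : ℝ := (C + 1) * (1 + ‖v‖) ^ l
    have hD1 : 1 ≤ D := by
      have : (1 : ℝ) ≤ (1 + ‖v‖) ^ l := one_le_pow₀ (by linarith [norm_nonneg v])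
      change 1 ≤ (C + 1) * (1 + ‖v‖) ^ l
      nlinarith
    have h := norm_iteratedFDeriv_comp_le (n := n) (N := ∞) (g := exp)
      (f := fun v : V => -(c * ‖v‖ ^ 2)) Real.contDiff_exp htg.1 (mod_cast le_top) v
      (C := exp (-(c * ‖v‖ ^ 2))) (D := D)
      (fun i _ => by
        rw [norm_iteratedFDeriv_eq_norm_iteratedDeriv, iteratedDeriv_eq_iterate,
          Real.iter_deriv_exp, norm_of_nonneg (exp_pos _).le])
      (fun i hi hin => by
        refine (hC i hin v).trans ((?_ : _ ≤ D).trans (le_self_pow₀ hD1 (by omega)))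
        exact mul_le_mul_of_nonneg_right (by linarith) (by positivity))
    change ‖v‖ ^ k * ‖iteratedFDeriv ℝ n (exp ∘ fun v : V => -(c * ‖v‖ ^ 2)) v‖ ≤ _
    have hpow : (1 + ‖v‖) ^ p ≤ p.factorial * exp (1 + ‖v‖) := by
      have := Real.pow_div_factorial_le_exp (1 + ‖v‖) (by positivity) p
      rwa [div_le_iff₀' (by positivity)] at this
    have hexp : exp (1 + ‖v‖) * exp (-(c * ‖v‖ ^ 2)) ≤ exp (1 + 1 / (4 * c)) := by
      rw [← exp_add]
      refine exp_le_exp.2 ?_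
      have : ‖v‖ - c * ‖v‖ ^ 2 ≤ 1 / (4 * c) := by
        rw [le_div_iff₀ (by positivity)]
        nlinarith [sq_nonneg (2 * c * ‖v‖ - 1)]
      linarith
    calc ‖v‖ ^ k * ‖iteratedFDeriv ℝ n (exp ∘ fun v : V => -(c * ‖v‖ ^ 2)) v‖
        ≤ (1 + ‖v‖) ^ k * (n.factorial * exp (-(c * ‖v‖ ^ 2)) * D ^ n) := by
          gcongr; linarith
      _ = n.factorial * (C + 1) ^ n * ((1 + ‖v‖) ^ p * exp (-(c * ‖v‖ ^ 2))) := by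
          simp only [D, p, mul_pow, pow_add, pow_mul]; ring
      _ ≤ n.factorial * (C + 1) ^ n * (p.factorial * exp (1 + 1 / (4 * c))) := by
          refine mul_le_mul_of_nonneg_left ?_ (by positivity)
          refine (mul_le_mul_of_nonneg_right hpow (exp_pos _).le).trans ?_
          rw [mul_assoc]
          exact mul_le_mul_of_nonneg_left hexp (by positivity)

@[simp] lemma gaussianS_apply {c : ℝ} (hc : 0 < c) (v : V) :
    gaussianS hc v = exp (-(c * ‖v‖ ^ 2)) := rfl

end Gaussian

section Tensor

variable {V W : Type*} [NormedAddCommGroup V] [NormedSpace ℝ V] [NormedAddCommGroup W]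
  [NormedSpace ℝ W]

/-- The tensor product `(x, v) ↦ g(x) h(v)` of two Schwartz functions. -/
def tens (g : 𝓢(V, ℂ)) (h : 𝓢(W, ℂ)) : 𝓢(V × W, ℂ) where
  toFun z := g z.1 * h z.2
  smooth' := ((g.smooth ⊤).comp contDiff_fst).mul ((h.smooth ⊤).comp contDiff_snd)
  decay' k n := by
    refine ⟨∑ i ∈ Finset.range (n + 1), (n.choose i : ℝ) *
      (SchwartzMap.seminorm ℝ k i g * SchwartzMap.seminorm ℝ 0 (n - i) h +
        SchwartzMap.seminorm ℝ 0 i g * SchwartzMap.seminorm ℝ k (n - i) h), fun z => ?_⟩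
    have hprod := norm_iteratedFDeriv_mul_le (N := ∞) ((g.smooth ⊤).comp contDiff_fst)
      ((h.smooth ⊤).comp contDiff_snd) z (n := n) (mod_cast le_top)
    refine (mul_le_mul_of_nonneg_left hprod (by positivity)).trans ?_
    rw [mul_sum]
    refine sum_le_sum fun i _ => ?_
    have h1 := norm_iteratedFDeriv_comp_clm_le (ContinuousLinearMap.fst ℝ V W)
      (ContinuousLinearMap.norm_fst_le ℝ V W) (g.smooth ⊤) i z
    have h2 := norm_iteratedFDeriv_comp_clm_le (ContinuousLinearMap.snd ℝ V W)
      (ContinuousLinearMap.norm_snd_le ℝ V W) (h.smooth ⊤) (n - i) z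
    have hz : ‖z‖ ^ k ≤ ‖z.1‖ ^ k + ‖z.2‖ ^ k := by
      rw [Prod.norm_def]
      rcases max_cases ‖z.1‖ ‖z.2‖ with ⟨h, _⟩ | ⟨h, _⟩ <;> rw [h] <;>
        linarith [pow_nonneg (norm_nonneg z.1) k, pow_nonneg (norm_nonneg z.2) k]
    have a1 := SchwartzMap.le_seminorm ℝ k i g z.1
    have a2 := SchwartzMap.le_seminorm ℝ 0 i g z.1
    have a3 := SchwartzMap.le_seminorm ℝ k (n - i) h z.2
    have a4 := SchwartzMap.le_seminorm ℝ 0 (n - i) h z.2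
    rw [pow_zero, one_mul] at a2 a4
    rw [mul_assoc, mul_left_comm]
    refine mul_le_mul_of_nonneg_left ?_ (Nat.cast_nonneg _)
    calc ‖z‖ ^ k * (‖iteratedFDeriv ℝ i (⇑g ∘ Prod.fst) z‖ *
          ‖iteratedFDeriv ℝ (n - i) (⇑h ∘ Prod.snd) z‖)
        ≤ (‖z.1‖ ^ k + ‖z.2‖ ^ k) *
          (‖iteratedFDeriv ℝ i g z.1‖ * ‖iteratedFDeriv ℝ (n - i) h z.2‖) := by
          gcongr
          · exact h1
          · exact h2
      _ = (‖z.1‖ ^ k * ‖iteratedFDeriv ℝ i g z.1‖) * ‖iteratedFDeriv ℝ (n - i) h z.2‖ +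
          ‖iteratedFDeriv ℝ i g z.1‖ * (‖z.2‖ ^ k * ‖iteratedFDeriv ℝ (n - i) h z.2‖) := by ring
      _ ≤ _ := by gcongr

@[simp] lemma tens_apply (g : 𝓢(V, ℂ)) (h : 𝓢(W, ℂ)) (z : V × W) :
    tens g h z = g z.1 * h z.2 := rfl

end Tensor

/-! ### Hermite functions -/

section

variable (i : Fin d) (n : Idx d)

lemma lineDerivOp_comm {V F : Type*} [NormedAddCommGroup V] [NormedSpace ℝ V]
    [NormedAddCommGroup F] [NormedSpace ℝ F] (m n : V) (f : 𝓢(V, F)) :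
    ∂_{m} (∂_{n} f) = ∂_{n} (∂_{m} f) := by
  have key : ∀ m n : V, ∀ x, ∂_{m} (∂_{n} f) x = fderiv ℝ (fderiv ℝ f) x m n := fun m n x => by
    rw [lineDerivOp_apply_eq_fderiv]
    have h : ⇑(∂_{n} f : 𝓢(V, F)) = fun y => fderiv ℝ f y n :=
      funext fun y => lineDerivOp_apply_eq_fderiv n f y
    rw [h]
    have hd : DifferentiableAt ℝ (fderiv ℝ f) x :=
      ((f.smooth ⊤).fderiv_right (m := 1) (by norm_cast)).differentiable (by norm_num) x
    rw [fderiv_clm_apply hd (differentiableAt_const n)]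
    simp
  ext x
  rw [key, key]
  exact ((f.smooth 2).contDiffAt.isSymmSndFDerivAt (by simp)) m n

/-- The `i`-th coordinate vector. -/
noncomputable abbrev eb (i : Fin d) : Vec d := EuclideanSpace.single i 1

lemma coord_temperate : Function.HasTemperateGrowth fun v : Vec d => v i :=
  (EuclideanSpace.proj (𝕜 := ℝ) i : Vec d →L[ℝ] ℝ).hasTemperateGrowth

/-- Multiplication by the `i`-th coordinate. -/
def mulV (i : Fin d) : 𝓢(Vec d, ℝ) →L[ℝ] 𝓢(Vec d, ℝ) := smulLeftCLM ℝ fun v => v i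

/-- The derivative in the `i`-th coordinate. -/
def derV (i : Fin d) : 𝓢(Vec d, ℝ) →L[ℝ] 𝓢(Vec d, ℝ) :=
  LineDeriv.lineDerivOpCLM ℝ 𝓢(Vec d, ℝ) (eb i)

lemma mulV_apply (f : 𝓢(Vec d, ℝ)) (v : Vec d) : mulV i f v = v i * f v := by
  rw [mulV, smulLeftCLM_apply_apply (coord_temperate i), smul_eq_mul]

lemma derV_apply (f : 𝓢(Vec d, ℝ)) (v : Vec d) : derV i f v = fderiv ℝ f v (eb i) :=
  lineDerivOp_apply_eq_fderiv _ _ _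

lemma derV_comm (i j : Fin d) (f : 𝓢(Vec d, ℝ)) : derV i (derV j f) = derV j (derV i f) :=
  lineDerivOp_comm _ _ _

lemma mulV_comm (i j : Fin d) (f : 𝓢(Vec d, ℝ)) : mulV i (mulV j f) = mulV j (mulV i f) := by
  ext v; simp only [mulV_apply]; ring

lemma derV_mulV (i j : Fin d) (f : 𝓢(Vec d, ℝ)) :
    derV i (mulV j f) = (if i = j then f else 0) + mulV j (derV i f) := by
  ext v
  rw [derV_apply]
  have h : ⇑(mulV j f) = fun v => v j * f v := funext fun v => mulV_apply j f v
  have h1 : HasFDerivAt (fun v : Vec d => v j) (EuclideanSpace.proj (𝕜 := ℝ) j : Vec d →L[ℝ] ℝ) v :=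
    (EuclideanSpace.proj (𝕜 := ℝ) j : Vec d →L[ℝ] ℝ).hasFDerivAt
  rw [h, (h1.fun_mul (f.hasFDerivAt v)).fderiv]
  simp only [add_apply, smul_apply, smul_eq_mul, mulV_apply, derV_apply]
  by_cases hij : i = j
  · subst hij; simp [eb]; ring
  · simp [eb, hij, Ne.symm hij]

/-- The creation operator `v_i / 2 - ∂_i`. -/
def raiseS (i : Fin d) : 𝓢(Vec d, ℝ) →L[ℝ] 𝓢(Vec d, ℝ) :=
  (1 / 2 : ℝ) • mulV i - derV i

/-- The annihilation operator `v_i / 2 + ∂_i`. -/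
def lowerS (i : Fin d) : 𝓢(Vec d, ℝ) →L[ℝ] 𝓢(Vec d, ℝ) :=
  (1 / 2 : ℝ) • mulV i + derV i

lemma raiseS_apply (f : 𝓢(Vec d, ℝ)) :
    raiseS i f = (1 / 2 : ℝ) • mulV i f - derV i f := rfl

lemma lowerS_apply (f : 𝓢(Vec d, ℝ)) :
    lowerS i f = (1 / 2 : ℝ) • mulV i f + derV i f := rfl

lemma lowerS_add_raiseS (f : 𝓢(Vec d, ℝ)) : lowerS i f + raiseS i f = mulV i f := by
  rw [lowerS_apply, raiseS_apply]; module

lemma raiseS_comm (i j : Fin d) : Function.Commute (raiseS i : 𝓢(Vec d, ℝ) → _) (raiseS j) := by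
  intro f
  simp only [raiseS_apply, map_sub, map_smul, derV_mulV, derV_comm i j, mulV_comm i j]
  by_cases h : i = j
  · subst h; rfl
  · simp only [h, Ne.symm h, if_false]; module

lemma lowerS_raiseS (i j : Fin d) (f : 𝓢(Vec d, ℝ)) :
    lowerS i (raiseS j f) = raiseS j (lowerS i f) + if i = j then f else 0 := by
  simp only [raiseS_apply, lowerS_apply, map_add, map_sub, map_smul, derV_mulV, derV_comm i j,
    mulV_comm i j]
  by_cases h : i = j
  · subst h; simp only [if_true]; module
  · simp only [h, Ne.symm h, if_false]; module

lemma derV_derV_sub (f : 𝓢(Vec d, ℝ)) :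
    derV i (derV i f) - (1 / 4 : ℝ) • mulV i (mulV i f) =
      -(raiseS i (lowerS i f)) - (1 / 2 : ℝ) • f := by
  simp only [raiseS_apply, lowerS_apply, map_add, map_smul, derV_mulV, if_true]
  module

/-- `√M` as a Schwartz function. -/
def sqrtMS : 𝓢(Vec d, ℝ) :=
  √(1 / (2 * π) ^ ((d : ℝ) / 2)) • gaussianS (c := 1 / 4) (by norm_num)

lemma sqrtMS_apply (v : Vec d) : sqrtMS v = sqrtM v := by
  change √(1 / (2 * π) ^ ((d : ℝ) / 2)) * exp (-(1 / 4 * ‖v‖ ^ 2)) = _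
  rw [sqrtM, maxwellian, sqrt_mul (by positivity)]
  congr 1
  rw [eq_comm, Real.sqrt_eq_iff_mul_self_eq_of_pos (exp_pos _), ← exp_add]
  congr 1; ring

lemma sqrtM_pos (v : Vec d) : 0 < sqrtM v := by
  unfold sqrtM maxwellian; positivity

lemma lowerS_sqrtMS : lowerS i (sqrtMS : 𝓢(Vec d, ℝ)) = 0 := by
  have h : derV i (gaussianS (c := 1 / 4) (by norm_num)) =
      -((1 / 2 : ℝ) • mulV i (gaussianS (c := 1 / 4) (by norm_num))) := by
    ext v
    rw [derV_apply]
    have h1 : HasFDerivAt (fun v : Vec d => exp (-(1 / 4 * ‖v‖ ^ 2)))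
        (exp (-(1 / 4 * ‖v‖ ^ 2)) • -((1 / 4 : ℝ) • ((2 : ℕ) • innerSL ℝ v))) v :=
      (((hasStrictFDerivAt_norm_sq v).hasFDerivAt.const_mul (1 / 4)).fun_neg).exp
    have h2 : ⇑(gaussianS (V := Vec d) (c := 1 / 4) (by norm_num)) =
      fun v => exp (-(1 / 4 * ‖v‖ ^ 2)) := rfl
    rw [h2, h1.fderiv]
    change _ = -((1 / 2 : ℝ) * (mulV i (gaussianS _) v))
    rw [mulV_apply, gaussianS_apply]
    simp [eb, EuclideanSpace.inner_single_right]
    ring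
  rw [lowerS_apply, sqrtMS, map_smul, map_smul, h]
  module

lemma integral_raiseS_mul (f g : 𝓢(Vec d, ℝ)) :
    ∫ v, raiseS i f v * g v = ∫ v, f v * lowerS i g v := by
  have h := integral_mul_lineDerivOp_right_eq_neg_left (μ := volume) f g (eb i)
  have e1 : ∀ v, raiseS i f v * g v = 1 / 2 * (mulV i f v * g v) - derV i f v * g v := fun v => by
    change ((1 / 2 : ℝ) * mulV i f v - derV i f v) * g v = _
    ring
  have e2 : ∀ v, f v * lowerS i g v = 1 / 2 * (mulV i f v * g v) + f v * derV i g v := fun v => by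
    change f v * ((1 / 2 : ℝ) * mulV i g v + derV i g v) = _
    rw [mulV_apply, mulV_apply]
    ring
  have hint : ∀ f g : 𝓢(Vec d, ℝ), Integrable fun v => f v * g v := fun f g =>
    (f.memLp 2).integrable_mul (g.memLp 2)
  simp only [e1, e2]
  rw [integral_sub ((hint _ _).const_mul _) (hint _ _),
    integral_add ((hint _ _).const_mul _) (hint _ _)]
  change ∫ v, f v * derV i g v = -∫ v, derV i f v * g v at h
  rw [h]; ring

/-- The Hermite functions `∏ (a_i†)^{n_i} √M`, not normalized. -/
def hermR (n : Idx d) : 𝓢(Vec d, ℝ) := iterProd (fun i f => raiseS i f) n sqrtMS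

lemma hermR_zero : hermR (0 : Idx d) = sqrtMS := iterProd_zero _ _

lemma raiseS_hermR : raiseS i (hermR n) = hermR (n + Pi.single i 1) :=
  (iterProd_add_single (P := fun i f => raiseS i f) (fun i j => raiseS_comm i j) n i _).symm

lemma exists_eq_add_single {n : Idx d} (hn : n ≠ 0) :
    ∃ (m : Idx d) (i : Fin d), n = m + Pi.single i 1 := by
  obtain ⟨i, hi⟩ := Function.ne_iff.1 hn
  exact ⟨n - Pi.single i 1, i, (sub_add_single hi).symm⟩

lemma induction_add_single {p : (Idx d) → Prop} (h0 : p 0)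
    (h1 : ∀ n i, p n → p (n + Pi.single i 1)) (n : Idx d) : p n := by
  induction hk : deg n generalizing n with
  | zero => rw [deg_eq_zero.1 hk]; exact h0
  | succ k ih =>
    have hn : n ≠ 0 := by rintro rfl; simp [deg] at hk
    obtain ⟨m, i, rfl⟩ := exists_eq_add_single hn
    exact h1 m i (ih m (by rw [deg_add_single] at hk; omega))

lemma lowerS_hermR :
    lowerS i (hermR n) = (n i : ℝ) • hermR (n - Pi.single i 1) := by
  induction n using induction_add_single with
  | h0 => rw [hermR_zero, lowerS_sqrtMS]; simp
  | h1 n j ih =>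
    rw [← raiseS_hermR, lowerS_raiseS, ih, map_smul, raiseS_hermR]
    by_cases hij : i = j
    · subst hij
      rw [if_pos rfl, add_tsub_cancel_right]
      by_cases h0 : n i = 0
      · simp [h0]
      · rw [sub_add_single h0]
        simp only [Pi.add_apply, Pi.single_eq_same]; push_cast; module
    · have h1 : (n + Pi.single j 1 : Idx d) i = n i := by simp [hij]
      rw [if_neg hij, add_zero, h1]
      by_cases h0 : n i = 0
      · simp [h0]
      · congr 2
        funext k
        have : k = i → n k ≠ 0 := by rintro rfl; exact h0
        simp only [Pi.add_apply, Pi.sub_apply, Pi.single_apply]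
        split_ifs <;> omega

lemma integral_sqrtMS_sq : ∫ v : Vec d, sqrtMS v * sqrtMS v = 1 := by
  have h : ∀ v : Vec d, sqrtMS v * sqrtMS v =
      1 / (2 * π) ^ ((d : ℝ) / 2) * exp (-(1 / 2) * ‖v‖ ^ 2) := fun v => by
    rw [sqrtMS_apply, sqrtM, mul_self_sqrt (by unfold maxwellian; positivity), maxwellian]
    congr 2; ring
  simp only [h]
  rw [integral_const_mul, GaussianFourier.integral_rexp_neg_mul_sq_norm (by norm_num)]
  have : π / (1 / 2) = 2 * π := by ring
  rw [this, finrank_euclideanSpace, Fintype.card_fin, one_div_mul_cancel]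
  positivity

/-- The product of factorials `n!`. -/
def factP (n : Idx d) : ℝ := ∏ i, ((n i).factorial : ℝ)

lemma factP_pos : 0 < factP n := by unfold factP; positivity

lemma factP_add_single (i : Fin d) :
    factP (n + Pi.single i 1) = (n i + 1) * factP n := by
  unfold factP
  rw [← Finset.mul_prod_erase _ _ (Finset.mem_univ i), ← Finset.mul_prod_erase Finset.univ
    (fun i => ((n i).factorial : ℝ)) (Finset.mem_univ i), ← mul_assoc]
  congr 1
  · simp [Nat.factorial_succ]
  · refine Finset.prod_congr rfl fun j hj => ?_
    simp [(Finset.mem_erase.1 hj).1]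

lemma integral_hermR_mul (n m : Idx d) :
    ∫ v, hermR n v * hermR m v = if n = m then factP n else 0 := by
  induction n using induction_add_single generalizing m with
  | h0 =>
    by_cases hm : m = 0
    · subst hm
      rw [hermR_zero, integral_sqrtMS_sq, if_pos rfl]; simp [factP]
    · rw [if_neg (Ne.symm hm)]
      obtain ⟨m', i, rfl⟩ := exists_eq_add_single hm
      rw [← raiseS_hermR]
      simp_rw [mul_comm (hermR 0 _)]
      rw [integral_raiseS_mul, hermR_zero, lowerS_sqrtMS]
      simp
  | h1 n i ih =>
    rw [← raiseS_hermR, integral_raiseS_mul, lowerS_hermR]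
    have : ∀ v, hermR n v * ((m i : ℝ) • hermR (m - Pi.single i 1)) v =
        m i * (hermR n v * hermR (m - Pi.single i 1) v) := fun v => by
      change hermR n v * (m i * hermR (m - Pi.single i 1) v) = _
      ring
    simp only [this]
    rw [integral_const_mul, ih]
    by_cases h : n + Pi.single i 1 = m
    · subst h
      rw [add_tsub_cancel_right, if_pos rfl, if_pos rfl, factP_add_single]; simp
    · rw [if_neg h]
      by_cases h0 : m i = 0
      · simp [h0]
      · rw [if_neg, mul_zero]
        rintro rfl
        exact h (sub_add_single h0)

/-- The normalized Hermite functions. -/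
def herm (n : Idx d) : 𝓢(Vec d, ℝ) := (√(factP n))⁻¹ • hermR n

lemma integral_herm_mul (n m : Idx d) :
    ∫ v, herm n v * herm m v = if n = m then 1 else 0 := by
  have : ∀ v, herm n v * herm m v =
      (√(factP n))⁻¹ * (√(factP m))⁻¹ * (hermR n v * hermR m v) := fun v => by
    change (√(factP n))⁻¹ * hermR n v * ((√(factP m))⁻¹ * hermR m v) = _
    ring
  simp only [this]
  rw [integral_const_mul, integral_hermR_mul]
  by_cases h : n = m
  · subst h
    rw [if_pos rfl, if_pos rfl, ← mul_inv, mul_self_sqrt (factP_pos n).le,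
      inv_mul_cancel₀ (factP_pos n).ne']
  · simp [h]

lemma raiseS_herm :
    raiseS i (herm n) = √(n i + 1) • herm (n + Pi.single i 1) := by
  have h1 : (0 : ℝ) < √(n i + 1) := by positivity
  rw [herm, herm, map_smul, raiseS_hermR, factP_add_single, sqrt_mul (by positivity), smul_smul]
  congr 1
  rw [mul_inv, ← mul_assoc, mul_inv_cancel₀ h1.ne', one_mul]

lemma lowerS_herm :
    lowerS i (herm n) = √(n i) • herm (n - Pi.single i 1) := by
  by_cases h0 : n i = 0
  · rw [herm, map_smul, lowerS_hermR, h0]; simp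
  · have h2 := factP_add_single (n - Pi.single i 1) i
    rw [sub_add_single h0, sub_single_add_one h0] at h2
    rw [herm, herm, map_smul, lowerS_hermR, smul_smul, smul_smul, h2, sqrt_mul (by positivity),
      mul_inv, mul_right_comm, ← div_eq_inv_mul, Real.div_sqrt]

lemma mulV_herm :
    mulV i (herm n) = √(n i) • herm (n - Pi.single i 1) +
      √(n i + 1) • herm (n + Pi.single i 1) := by
  rw [← lowerS_add_raiseS, lowerS_herm, raiseS_herm]

lemma herm_zero : herm (0 : Idx d) = sqrtMS := by
  rw [herm, hermR_zero]; simp [factP]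

lemma herm_single : herm (Pi.single i 1 : Idx d) = mulV i sqrtMS := by
  have h := raiseS_herm i (0 : Idx d)
  have h2 := lowerS_add_raiseS i (sqrtMS : 𝓢(Vec d, ℝ))
  rw [lowerS_sqrtMS, zero_add] at h2
  rw [herm_zero, h2] at h
  simpa using h.symm

/-- The Hermite functions diagonalize the harmonic oscillator. -/
lemma oscillator_herm :
    (∑ i, derV i (derV i (herm n))) - (1 / 4 : ℝ) • (∑ i, mulV i (mulV i (herm n)))
      + ((d : ℝ) / 2) • herm n = -(deg n : ℝ) • herm n := by
  have h : ∀ i : Fin d, derV i (derV i (herm n)) - (1 / 4 : ℝ) • mulV i (mulV i (herm n)) =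
      -((n i : ℝ) + 1 / 2) • herm n := fun i => by
    rw [derV_derV_sub, lowerS_herm, map_smul, raiseS_herm]
    by_cases h0 : n i = 0
    · simp [h0]
    · rw [sub_add_single h0, smul_smul, sub_single_add_one h0, mul_self_sqrt (by positivity)]
      module
  rw [Finset.smul_sum, ← Finset.sum_sub_distrib, sum_congr rfl fun i _ => h i,
    ← Finset.sum_smul]
  have : ∑ i : Fin d, -((n i : ℝ) + 1 / 2) = -(deg n : ℝ) - d / 2 := by
    rw [sum_neg_distrib, sum_add_distrib]
    simp [deg]; ring
  rw [this]; module

variable (d) in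
/-- The velocity space. -/
abbrev VE : Type := Lp ℂ 2 (volume : Measure (Vec d))

/-- The Hermite functions as elements of `L²(ℝ^d; ℂ)`. -/
def hermL (n : Idx d) : VE d := (toC (herm n)).toLp 2

lemma coeFn_hermL : hermL n =ᵐ[volume] fun v => (herm n v : ℂ) :=
  (toC (herm n)).coeFn_toLp 2

lemma inner_hermL (f : VE d) : inner ℂ (hermL n) f = ∫ v, (herm n v : ℂ) * f v := by
  rw [L2.inner_def]
  refine integral_congr_ae ?_
  filter_upwards [coeFn_hermL n] with v hv
  rw [hv, RCLike.inner_apply, conj_ofReal, mul_comm]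

lemma orthonormal_hermL : Orthonormal ℂ (hermL : (Idx d) → VE d) := by
  rw [orthonormal_iff_ite]
  intro n m
  rw [inner_hermL]
  have : ∫ v, (herm n v : ℂ) * hermL m v = ∫ v, ((herm n v * herm m v : ℝ) : ℂ) := by
    refine integral_congr_ae ?_
    filter_upwards [coeFn_hermL m] with v hv
    rw [hv]; push_cast; rfl
  rw [this, integral_complex_ofReal, integral_herm_mul]
  split_ifs <;> simp

/-- Multiplication by `⟨η, v⟩`. -/
def mulInner (η : Vec d) : 𝓢(Vec d, ℝ) →L[ℝ] 𝓢(Vec d, ℝ) := ∑ i, η i • mulV i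

lemma mulInner_apply (η : Vec d) (f : 𝓢(Vec d, ℝ)) (v : Vec d) :
    mulInner η f v = inner ℝ v η * f v := by
  have : mulInner η f v = ∑ i, η i * mulV i f v := by
    simp only [mulInner, sum_apply, smul_apply, smul_eq_mul]
  rw [this, PiLp.inner_apply, sum_mul]
  refine sum_congr rfl fun i _ => ?_
  simp [mulV_apply]; ring

lemma mulInner_pow_mem_span (η : Vec d) (j : ℕ) :
    (fun f => mulInner η f)^[j] sqrtMS ∈ Submodule.span ℝ (range (herm : (Idx d) → _)) := by
  induction j with
  | zero => exact Submodule.subset_span ⟨0, herm_zero⟩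
  | succ j ih =>
    rw [Function.iterate_succ_apply']
    have hmap : ∀ i, ∀ f ∈ Submodule.span ℝ (range (herm : (Idx d) → 𝓢(Vec d, ℝ))),
        mulV i f ∈ Submodule.span ℝ (range (herm : (Idx d) → _)) := by
      intro i f hf
      induction hf using Submodule.span_induction with
      | mem f hf =>
        obtain ⟨n, rfl⟩ := hf
        rw [mulV_herm]
        exact add_mem (Submodule.smul_mem _ _ (Submodule.subset_span ⟨_, rfl⟩))
          (Submodule.smul_mem _ _ (Submodule.subset_span ⟨_, rfl⟩))
      | zero => simp
      | add f g _ _ hf hg => rw [map_add]; exact add_mem hf hg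
      | smul c f _ hf => rw [map_smul]; exact Submodule.smul_mem _ _ hf
    rw [mulInner, sum_apply]
    exact Submodule.sum_mem _ fun i _ => Submodule.smul_mem _ _ (hmap i _ ih)

lemma iterate_mulInner_apply (η : Vec d) (j : ℕ) (v : Vec d) :
    ((fun f => mulInner η f)^[j] sqrtMS) v = inner ℝ v η ^ j * sqrtM v := by
  induction j with
  | zero => simp [sqrtMS_apply]
  | succ j ih => rw [Function.iterate_succ_apply', mulInner_apply, ih]; ring

/-- A square integrable function orthogonal to all Hermite functions vanishes: the exponential
series shows that the Fourier transform of its product with `√M` is zero. -/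
lemma eq_zero_of_inner_hermL {f : VE d} (hf : ∀ n, inner ℂ (hermL n) f = 0) : f = 0 := by
  have hL2 : MemLp f 2 volume := Lp.memLp f
  have hint : ∀ g : 𝓢(Vec d, ℝ), Integrable fun v => (g v : ℂ) * f v := fun g =>
    ((toC g).memLp 2).integrable_mul hL2
  have h0 : ∀ g ∈ Submodule.span ℝ (range (herm : (Idx d) → 𝓢(Vec d, ℝ))),
      ∫ v, (g v : ℂ) * f v = 0 := by
    intro g hg
    induction hg using Submodule.span_induction with
    | mem g hg => obtain ⟨n, rfl⟩ := hg; rw [← inner_hermL, hf]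
    | zero => simp
    | add g₁ g₂ _ _ h1 h2 =>
      simp only [add_apply, ofReal_add, add_mul]
      rw [integral_add (hint g₁) (hint g₂), h1, h2, add_zero]
    | smul c g _ h1 =>
      simp only [smul_apply, smul_eq_mul, ofReal_mul, mul_assoc]
      rw [integral_const_mul, h1, mul_zero]
  let G : Vec d → ℂ := fun v => (sqrtM v : ℂ) * f v
  have hG : Integrable G := by simpa only [sqrtMS_apply] using hint sqrtMS
  have hexp : ∀ η : Vec d, ∫ v, Complex.exp (I * (inner ℝ v η : ℝ)) * G v = 0 := by
    intro η
    have hdom : Integrable fun v => exp (‖inner ℝ v η‖) * ‖G v‖ := by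
      let g : 𝓢(Vec d, ℝ) := gaussianS (c := 1 / 8) (by norm_num)
      let K := √(1 / (2 * π) ^ ((d : ℝ) / 2))
      have hg : Integrable fun v => g v * ‖f v‖ := (g.memLp 2).integrable_mul hL2.norm
      refine (hg.const_mul (K * exp (2 * ‖η‖ ^ 2))).mono' ?_ (.of_forall fun v => ?_)
      · refine AEStronglyMeasurable.mul (Continuous.aestronglyMeasurable ?_) hG.1.norm
        fun_prop
      · have h1 : ‖G v‖ = K * exp (-(1 / 4 * ‖v‖ ^ 2)) * ‖f v‖ := by
          rw [norm_mul, norm_real, norm_of_nonneg (sqrtM_pos v).le, ← sqrtMS_apply]; rfl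
        have h2 : exp ‖(inner ℝ v η : ℝ)‖ * exp (-(1 / 4 * ‖v‖ ^ 2)) ≤
            exp (2 * ‖η‖ ^ 2) * exp (-(1 / 8 * ‖v‖ ^ 2)) := by
          rw [← exp_add, ← exp_add]
          refine exp_le_exp.2 ?_
          have := norm_inner_le_norm (𝕜 := ℝ) v η
          nlinarith [sq_nonneg (‖v‖ - 4 * ‖η‖)]
        rw [norm_of_nonneg (by positivity), h1]
        calc _ = K * (exp ‖(inner ℝ v η : ℝ)‖ * exp (-(1 / 4 * ‖v‖ ^ 2))) * ‖f v‖ := by ring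
          _ ≤ K * (exp (2 * ‖η‖ ^ 2) * exp (-(1 / 8 * ‖v‖ ^ 2))) * ‖f v‖ := by gcongr
          _ = _ := by simp only [g, gaussianS_apply]; ring
    have hs := hasSum_integral_of_dominated_convergence (μ := volume)
      (F := fun (j : ℕ) v => ((j.factorial : ℂ))⁻¹ * (I * (inner ℝ v η : ℝ)) ^ j * G v)
      (f := fun v => Complex.exp (I * (inner ℝ v η : ℝ)) * G v)
      (fun j v => ‖(inner ℝ v η : ℝ)‖ ^ j / j.factorial * ‖G v‖) ?_ ?_ ?_ ?_ ?_
    · refine hs.unique ?_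
      convert hasSum_zero using 1
      funext j
      have h1 := h0 _ (mulInner_pow_mem_span η j)
      have h2 : ∀ v, ((j.factorial : ℂ))⁻¹ * (I * (inner ℝ v η : ℝ)) ^ j * G v =
          ((j.factorial : ℂ))⁻¹ * I ^ j *
            ((((fun f => mulInner η f)^[j] sqrtMS) v : ℝ) * f v) := fun v => by
        simp only [iterate_mulInner_apply, G]; push_cast; ring
      simp only [h2]
      rw [integral_const_mul, h1, mul_zero]
    · intro j
      refine AEStronglyMeasurable.mul ?_ hG.1
      exact (by fun_prop : Continuous fun v : Vec d =>
        ((j.factorial : ℂ))⁻¹ * (I * ((inner ℝ v η : ℝ) : ℂ)) ^ j).aestronglyMeasurable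
    · refine fun j => .of_forall fun v => ?_
      simp only [norm_mul, norm_inv, norm_pow, norm_I, one_mul, Complex.norm_natCast, norm_real]
      rw [div_eq_inv_mul]
    · exact .of_forall fun v => (Real.summable_pow_div_factorial _).mul_right _
    · convert hdom using 2 with v
      rw [tsum_mul_right]
      congr 1
      rw [Real.exp_eq_exp_ℝ, NormedSpace.exp_eq_tsum_div]
    · refine .of_forall fun v => ?_
      have := NormedSpace.expSeries_div_hasSum_exp (𝔸 := ℂ) (I * (inner ℝ v η : ℝ))
      rw [← Complex.exp_eq_exp_ℂ] at this
      simpa only [div_eq_inv_mul] using this.mul_right _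
  have hF : FourierTransform.fourier G = 0 := by
    funext η
    rw [Real.fourier_eq']
    rw [Pi.zero_apply, ← hexp (-(2 * π) • η)]
    refine integral_congr_ae (.of_forall fun v => ?_)
    simp only [inner_smul_right, smul_eq_mul]
    congr 2
    push_cast; ring
  have htest : ∀ φ : 𝓢(Vec d, ℂ), ∫ v, φ v * G v = 0 := by
    intro φ
    have h1 := VectorFourier.integral_fourierIntegral_smul_eq_flip (L := innerₗ (Vec d))
      Real.continuous_fourierChar continuous_inner
      (f := ⇑(FourierTransformInv.fourierInv φ)) (g := G) (μ := volume) (ν := volume)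
      (SchwartzMap.integrable _) hG
    have h2 : VectorFourier.fourierIntegral Real.fourierChar volume (innerₗ (Vec d)).flip G = 0 := by
      rw [flip_innerₗ]; exact hF
    have h3 : VectorFourier.fourierIntegral Real.fourierChar volume (innerₗ (Vec d))
        (⇑(FourierTransformInv.fourierInv φ)) = φ := by
      have : FourierTransform.fourier (FourierTransformInv.fourierInv φ) = φ :=
        FourierTransform.fourier_fourierInv_eq φ
      exact congrArg (fun g : 𝓢(Vec d, ℂ) => (g : Vec d → ℂ)) this
    rw [h2, h3] at h1
    simpa using h1
  have hG0 : ∀ᵐ v, G v = 0 := by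
    refine ae_eq_zero_of_integral_contDiff_smul_eq_zero hG.locallyIntegrable fun g hg hgc => ?_
    simpa using htest (toC (hgc.toSchwartzMap hg))
  refine (Lp.eq_zero_iff_ae_eq_zero).2 ?_
  filter_upwards [hG0] with v hv
  have : (sqrtM v : ℂ) ≠ 0 := by exact_mod_cast (sqrtM_pos v).ne'
  simpa [G, this] using hv

/-- The Hermite basis of the velocity space. -/
def hb : HilbertBasis (Idx d) ℂ (VE d) :=
  HilbertBasis.mkOfOrthogonalEqBot orthonormal_hermL (by
    rw [Submodule.eq_bot_iff]
    intro f hf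
    refine eq_zero_of_inner_hermL fun n => ?_
    exact (Submodule.mem_orthogonal _ f).1 hf _ (Submodule.subset_span ⟨n, rfl⟩))

lemma hb_apply : (hb : HilbertBasis (Idx d) ℂ (VE d)) n = hermL n := by
  rw [hb, HilbertBasis.coe_mkOfOrthogonalEqBot]

end

/-! ### Vector-valued Fourier transform in the position variable -/

section

variable (i : Fin d) (n : Idx d)

section Pairing

variable {E : Type*} [NormedAddCommGroup E] [InnerProductSpace ℂ E] [CompleteSpace E]

/-- The Fourier transform on `L²(ℝ^d; E)`. -/
def fourX : FL2 d E ≃ₗᵢ[ℂ] FL2 d E := Lp.fourierTransformₗᵢ (Vec d) E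

lemma fourierInv_conj (γ : 𝓢(Vec d, ℂ)) (e : E) (x : Vec d) :
    𝓕⁻ (fun k => (starRingEnd ℂ) (γ k) • e) x = (starRingEnd ℂ) (𝓕 γ x) • e := by
  have h1 : (𝓕 γ) x = 𝓕 (γ : Vec d → ℂ) x := rfl
  rw [h1, Real.fourierInv_eq', Real.fourier_eq', ← integral_conj, ← integral_smul_const]
  refine integral_congr_ae (.of_forall fun k => ?_)
  simp only [smul_smul, smul_eq_mul, map_mul]
  congr 2
  rw [← Complex.exp_conj]
  congr 1
  simp [Complex.conj_ofNat]

/-- The Fourier transform can be moved to the test function in the duality between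
`L²(ℝ^d; E)` and tensor products. -/
lemma integral_fourier_mul_inner (γ : 𝓢(Vec d, ℂ)) (e : E) (F : FL2 d E) :
    ∫ x, (𝓕 γ) x * inner ℂ e (F x) = ∫ k, γ k * inner ℂ e (fourX F k) := by
  let L : ℂ →L[ℝ] E := ((ContinuousLinearMap.toSpanSingleton ℂ e).restrictScalars ℝ) ∘L
    (Complex.conjCLE : ℂ →L[ℝ] ℂ)
  let Γ : 𝓢(Vec d, E) := γ.postcompCLM L
  have hΓ : ∀ k, Γ k = (starRingEnd ℂ) (γ k) • e := fun k => rfl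
  have h1 : inner ℂ (Γ.toLp 2) (fourX F) = ∫ k, γ k * inner ℂ e (fourX F k) := by
    rw [inner_FL2]
    refine integral_congr_ae ?_
    filter_upwards [Γ.coeFn_toLp 2] with k hk
    rw [hk, hΓ, inner_smul_left, conj_conj]
  have h2 : inner ℂ ((𝓕⁻ Γ).toLp 2) F = ∫ x, (𝓕 γ) x * inner ℂ e (F x) := by
    rw [inner_FL2]
    refine integral_congr_ae ?_
    filter_upwards [(𝓕⁻ Γ).coeFn_toLp 2] with x hx
    rw [hx, fourierInv_coe]
    exact (congrArg (inner ℂ · (F x)) (fourierInv_conj γ e x)).trans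
      (by rw [inner_smul_left, conj_conj])
  have h3 : fourX ((𝓕⁻ Γ).toLp 2 : FL2 d E) = Γ.toLp 2 := by
    change 𝓕 ((𝓕⁻ Γ).toLp 2 : FL2 d E) = Γ.toLp 2
    rw [SchwartzMap.toLp_fourier_eq, FourierTransform.fourier_fourierInv_eq]
  rw [← h1, ← h2, ← h3, LinearIsometryEquiv.inner_map_map]

end Pairing

section Curry

variable {α : Type*} [MeasurableSpace α] {μ : Measure α}

open Classical in
/-- The section of a function at `a`, as an element of the velocity space (`0` if it is not
square integrable). -/
def sec (F : α × Vec d → ℂ) (a : α) : VE d :=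
  if h : MemLp (fun v => F (a, v)) 2 volume then h.toLp else 0

lemma coeFn_sec {F : α × Vec d → ℂ} {a : α} (h : MemLp (fun v => F (a, v)) 2 volume) :
    sec F a =ᵐ[volume] fun v => F (a, v) := by
  rw [sec, dif_pos h]; exact h.coeFn_toLp

lemma inner_hb_sec {F : α × Vec d → ℂ} {a : α} (h : MemLp (fun v => F (a, v)) 2 volume)
    (n : Idx d) : inner ℂ (hb n) (sec F a) = ∫ v, (herm n v : ℂ) * F (a, v) := by
  rw [hb_apply, inner_hermL]
  refine integral_congr_ae ?_
  filter_upwards [coeFn_sec h] with v hv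
  rw [hv]

lemma piOp_eq_sum (N : ℕ) (f : VE d) :
    piOp hb N f = ∑ n ∈ lev d N, inner ℂ (hb n) f • hb n := by
  simp [piOp, diagOp, sum_apply]

lemma aestronglyMeasurable_sec [SFinite μ] {F : α × Vec d → ℂ}
    (hF : AEStronglyMeasurable F (μ.prod volume))
    (hs : ∀ᵐ a ∂μ, MemLp (fun v => F (a, v)) 2 volume) : AEStronglyMeasurable (sec F) μ := by
  refine aestronglyMeasurable_of_tendsto_ae (u := atTop) (f := fun N a => piOp hb N (sec F a))
    (fun N => ?_) (.of_forall fun a => tendsto_piOp hb (sec F a))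
  simp only [piOp_eq_sum]
  refine Finset.aestronglyMeasurable_fun_sum _ fun n _ => AEStronglyMeasurable.smul_const ?_ _
  have h1 : AEStronglyMeasurable (fun a => ∫ v, (herm n v : ℂ) * F (a, v)) μ :=
    (((toC (herm n)).continuous.aestronglyMeasurable (μ := volume)).comp_snd.mul
      hF).integral_prod_right'
  refine h1.congr ?_
  filter_upwards [hs] with a ha
  rw [inner_hb_sec ha]

lemma norm_sec_sq {F : α × Vec d → ℂ} {a : α} (h : MemLp (fun v => F (a, v)) 2 volume) :
    ‖sec F a‖ ^ 2 = ∫ v, ‖F (a, v)‖ ^ 2 := by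
  rw [Lp.norm_sq_eq]
  refine integral_congr_ae ?_
  filter_upwards [coeFn_sec h] with v hv
  rw [hv]

lemma ae_memLp_section [SFinite μ] {F : α × Vec d → ℂ} (hF : MemLp F 2 (μ.prod volume)) :
    ∀ᵐ a ∂μ, MemLp (fun v => F (a, v)) 2 volume := by
  have h1 := (memLp_two_iff_integrable_sq_norm hF.1).1 hF
  filter_upwards [h1.prod_right_ae, hF.1.prodMk_left] with a ha hm
  exact (memLp_two_iff_integrable_sq_norm hm).2 ha

lemma memLp_sec [SFinite μ] {F : α × Vec d → ℂ} (hF : MemLp F 2 (μ.prod volume)) :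
    MemLp (sec F) 2 μ := by
  have hs := ae_memLp_section hF
  refine (memLp_two_iff_integrable_sq_norm (aestronglyMeasurable_sec hF.1 hs)).2 ?_
  have h1 := ((memLp_two_iff_integrable_sq_norm hF.1).1 hF).integral_prod_left
  refine h1.congr ?_
  filter_upwards [hs] with a ha
  exact (norm_sec_sq ha).symm

end Curry

variable (d) in
/-- Square integrable functions of the frequency with values in the velocity space. -/
abbrev XX : Type := FL2 d (VE d)

/-- A real function on phase space as a complex one. -/
def cx (f : Phase d → ℝ) (z : Phase d) : ℂ := f z

lemma memLp_cx {f : Phase d → ℝ} (hf : MemLp f 2 volume) :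
    MemLp (cx f) 2 ((volume : Measure (Vec d)).prod volume) := hf.ofReal

/-- An element of `L²` of phase space as a square integrable function of the position with values
in the velocity space. -/
def curry (f : L2 d) : XX d := (memLp_sec (memLp_cx (Lp.memLp f))).toLp

lemma coeFn_curry (f : L2 d) : curry f =ᵐ[volume] sec (cx f) := MemLp.coeFn_toLp _

lemma ae_sec (f : L2 d) : ∀ᵐ x : Vec d, MemLp (fun v => cx f (x, v)) 2 volume :=
  ae_memLp_section (memLp_cx (Lp.memLp f))

lemma norm_curry (f : L2 d) : ‖curry f‖ = ‖f‖ := by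
  have h : ‖curry f‖ ^ 2 = ‖f‖ ^ 2 := by
    rw [Lp.norm_sq_eq, Lp.norm_sq_eq]
    have h1 : ∫ x, ‖curry f x‖ ^ 2 = ∫ x : Vec d, ∫ v : Vec d, ‖cx f (x, v)‖ ^ 2 := by
      refine integral_congr_ae ?_
      filter_upwards [coeFn_curry f, ae_sec f] with x hx hx2
      rw [hx, norm_sec_sq hx2]
    have h2 := memLp_cx (Lp.memLp f)
    rw [h1, ← integral_prod _ ((memLp_two_iff_integrable_sq_norm h2.1).1 h2)]
    refine integral_congr_ae (.of_forall fun z => ?_)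
    simp [cx]
  exact (pow_left_inj₀ (norm_nonneg _) (norm_nonneg _) two_ne_zero).1 h

lemma ae_section_of_ae {p : Phase d → Prop} (h : ∀ᵐ z : Phase d, p z) :
    ∀ᵐ x : Vec d, ∀ᵐ v : Vec d, p (x, v) := Measure.ae_ae_of_ae_prod h

lemma curry_add (f g : L2 d) : curry (f + g) = curry f + curry g := by
  refine Lp.ext ?_
  filter_upwards [coeFn_curry f, coeFn_curry g, coeFn_curry (f + g),
    Lp.coeFn_add (curry f) (curry g), ae_sec f, ae_sec g, ae_sec (f + g),
    ae_section_of_ae (Lp.coeFn_add f g)] with x h1 h2 h3 h4 h5 h6 h7 h8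
  rw [h3, h4, Pi.add_apply, h1, h2]
  refine Lp.ext ?_
  filter_upwards [coeFn_sec h5, coeFn_sec h6, coeFn_sec h7,
    Lp.coeFn_add (sec (cx f) x) (sec (cx g) x), h8] with v e1 e2 e3 e4 e5
  rw [e3, e4, Pi.add_apply, e1, e2]
  change (((f + g : L2 d) (x, v) : ℝ) : ℂ) = (f (x, v) : ℂ) + (g (x, v) : ℂ)
  rw [e5, Pi.add_apply, ofReal_add]

lemma curry_smul (c : ℝ) (f : L2 d) : curry (c • f) = (c : ℂ) • curry f := by
  refine Lp.ext ?_
  filter_upwards [coeFn_curry f, coeFn_curry (c • f),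
    Lp.coeFn_smul (c : ℂ) (curry f), ae_sec f, ae_sec (c • f),
    ae_section_of_ae (Lp.coeFn_smul c f)] with x h1 h3 h4 h5 h7 h8
  rw [h3, h4, Pi.smul_apply, h1]
  refine Lp.ext ?_
  filter_upwards [coeFn_sec h5, coeFn_sec h7,
    Lp.coeFn_smul (c : ℂ) (sec (cx f) x), h8] with v e1 e3 e4 e5
  rw [e3, e4, Pi.smul_apply, e1]
  change (((c • f : L2 d) (x, v) : ℝ) : ℂ) = (c : ℂ) * (f (x, v) : ℂ)
  rw [e5, Pi.smul_apply, smul_eq_mul, ofReal_mul]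

/-- The isometry sending `f ∈ L²(ℝ^d × ℝ^d)` to its Fourier transform in the position variable,
a function of the frequency with values in the velocity space. -/
def J (f : L2 d) : XX d := fourX (curry f)

lemma norm_J (f : L2 d) : ‖J f‖ = ‖f‖ := by rw [J, LinearIsometryEquiv.norm_map, norm_curry]

lemma J_add (f g : L2 d) : J (f + g) = J f + J g := by simp only [J, curry_add, map_add]

lemma J_smul (c : ℝ) (f : L2 d) : J (c • f) = (c : ℂ) • J f := by
  rw [J, curry_smul]; exact map_smul fourX _ _

lemma J_sub (f g : L2 d) : J (f - g) = J f - J g := by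
  have h : f - g = f + (-1 : ℝ) • g := by module
  rw [h, J_add, J_smul]; push_cast; module

lemma J_zero : J (0 : L2 d) = 0 := by
  simpa using J_sub (0 : L2 d) 0

lemma continuous_J : Continuous (J : L2 d → XX d) :=
  (Isometry.of_dist_eq fun f g => by rw [dist_eq_norm, dist_eq_norm, ← J_sub, norm_J]).continuous

/-- The real linear functional `f ↦ ⟨x, J f⟩`. -/
def Jpair (x : XX d) : L2 d →L[ℝ] ℂ :=
  LinearMap.mkContinuous
    { toFun := fun f => inner ℂ x (J f)
      map_add' := fun f g => by rw [J_add, inner_add_right]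
      map_smul' := fun c f => by
        rw [J_smul, inner_smul_right, RingHom.id_apply, Complex.real_smul] }
    ‖x‖ fun f => by
      refine (norm_inner_le_norm (𝕜 := ℂ) x (J f)).trans_eq ?_
      rw [norm_J]

@[simp] lemma Jpair_apply (x : XX d) (f : L2 d) : Jpair x f = inner ℂ x (J f) := rfl

/-- The real adjoint of `J`. -/
def Jadj (x : XX d) : L2 d :=
  (InnerProductSpace.toDual ℝ (L2 d)).symm (reCLM ∘L Jpair x)

lemma inner_Jadj (x : XX d) (f : L2 d) : inner ℝ (Jadj x) f = (inner ℂ x (J f)).re := by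
  rw [Jadj, InnerProductSpace.toDual_symm_apply]; rfl

lemma Jadj_sub (x y : XX d) : Jadj (x - y) = Jadj x - Jadj y := by
  refine ext_inner_right ℝ fun f => ?_
  rw [inner_sub_left, inner_Jadj, inner_Jadj, inner_Jadj, inner_sub_left, sub_re]

lemma norm_Jadj_le (x : XX d) : ‖Jadj x‖ ≤ ‖x‖ := by
  have h1 : ‖Jadj x‖ ^ 2 = (inner ℂ x (J (Jadj x))).re := by
    rw [← inner_Jadj, real_inner_self_eq_norm_sq]
  have h2 : (inner ℂ x (J (Jadj x))).re ≤ ‖x‖ * ‖Jadj x‖ := by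
    refine (Complex.re_le_norm _).trans ((norm_inner_le_norm _ _).trans_eq ?_)
    rw [norm_J]
  nlinarith [norm_nonneg (Jadj x), norm_nonneg x]

lemma continuous_Jadj : Continuous (Jadj : XX d → L2 d) := by
  refine LipschitzWith.continuous (K := 1) (LipschitzWith.of_dist_le_mul fun x y => ?_)
  rw [dist_eq_norm, dist_eq_norm, ← Jadj_sub]
  simpa using norm_Jadj_le (x - y)

lemma inner_L2 (f g : L2 d) : inner ℝ f g = ∫ z, f z * g z := by
  rw [L2.inner_def]
  refine integral_congr_ae (.of_forall fun z => ?_)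
  simp [mul_comm]

lemma inner_J_re (f g : L2 d) : (inner ℂ (J f) (J g)).re = inner ℝ f g := by
  have h1 (f : L2 d) : (inner ℂ (J f) (J f)).re = inner ℝ f f := by
    rw [real_inner_self_eq_norm_sq, ← norm_J, inner_self_ofReal, ofReal_re]
  have h := h1 (f + g)
  rw [J_add, inner_add_left, inner_add_right, inner_add_right, inner_add_left, inner_add_right,
    inner_add_right] at h
  have h3 : (inner ℂ (J g) (J f)).re = (inner ℂ (J f) (J g)).re := by
    rw [← inner_conj_symm, conj_re]
  simp only [add_re, h1, h3, real_inner_comm f g] at h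
  linarith

instance : (volume : Measure (Phase d)).IsAddHaarMeasure :=
  inferInstanceAs ((volume : Measure (Vec d)).prod volume).IsAddHaarMeasure

/-- Duality between `L²` and Schwartz functions on phase space. -/
def pairS (w : L2 d) (Φ : 𝓢(Phase d, ℂ)) : ℂ := ∫ z, (w z : ℂ) * Φ z

lemma integrable_pairS (w : L2 d) (Φ : 𝓢(Phase d, ℂ)) :
    Integrable fun z => (w z : ℂ) * Φ z :=
  ((Lp.memLp w).ofReal (K := ℂ)).integrable_mul (Φ.memLp 2)

/-- Testing against a tensor product with a Hermite function reads off the Hermite coefficients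
of `J w`. -/
lemma pairS_tens (w : L2 d) (γ : 𝓢(Vec d, ℂ)) (n : Idx d) :
    pairS w (tens (𝓕 γ) (toC (herm n))) = ∫ k, γ k * inner ℂ (hb n) (J w k) := by
  rw [J, ← integral_fourier_mul_inner]
  have h := integrable_pairS w (tens (𝓕 γ) (toC (herm n)))
  have h2 : pairS w (tens (𝓕 γ) (toC (herm n))) =
      ∫ x : Vec d, ∫ v : Vec d, (w (x, v) : ℂ) * tens (𝓕 γ) (toC (herm n)) (x, v) :=
    integral_prod _ h
  rw [h2]
  refine integral_congr_ae ?_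
  filter_upwards [coeFn_curry w, ae_sec w] with x hx hx2
  rw [hx, inner_hb_sec hx2, ← integral_const_mul]
  refine integral_congr_ae (.of_forall fun v => ?_)
  simp only [tens_apply, toC_apply, cx]
  ring

end

/-! ### The operators of the equation on Schwartz functions, and Hermite coefficients -/

section

variable (α : Idx d) (i : Fin d) (n : Idx d)

lemma iterProd_induction {X : Type*} {P : Fin d → X → X} {p : X → Prop}
    (h : ∀ i x, p x → p (P i x)) (α : Idx d) {x : X} (hx : p x) : p (iterProd P α x) := by
  unfold iterProd
  induction List.finRange d with
  | nil => exact hx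
  | cons i l ih =>
    rw [List.foldr_cons]
    generalize l.foldr (fun i g => (P i)^[α i] g) x = y at ih
    induction α i with
    | zero => exact ih
    | succ m ihm => rw [Function.iterate_succ_apply']; exact h i _ ihm

lemma iterProd_mul (c : Fin d → ℂ) (α : Idx d) (x : ℂ) :
    iterProd (fun i y => c i * y) α x = (∏ i, c i ^ α i) * x := by
  have hit (a : ℂ) (m : ℕ) (y : ℂ) : (fun y => a * y)^[m] y = a ^ m * y := by
    induction m with
    | zero => simp
    | succ m ih => rw [Function.iterate_succ_apply', ih]; ring
  rw [Fin.prod_univ_def]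
  unfold iterProd
  induction List.finRange d with
  | nil => simp
  | cons i l ih => rw [List.foldr_cons, ih, List.map_cons, List.prod_cons, hit]; ring

/-- The coordinate `v_i` as a linear map on phase space. -/
def coordV (i : Fin d) : Phase d →L[ℝ] ℂ :=
  ofRealCLM ∘L EuclideanSpace.proj (𝕜 := ℝ) i ∘L ContinuousLinearMap.snd ℝ (Vec d) (Vec d)

/-- Multiplication by `v_i` on phase space. -/
def vmul (i : Fin d) : 𝓢(Phase d, ℂ) →L[ℂ] 𝓢(Phase d, ℂ) :=
  smulLeftCLM ℂ (coordV i)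

/-- The derivative in `x_i` on phase space. -/
def dx (i : Fin d) : 𝓢(Phase d, ℂ) →L[ℂ] 𝓢(Phase d, ℂ) :=
  LineDeriv.lineDerivOpCLM ℂ 𝓢(Phase d, ℂ) ((eb i, 0) : Phase d)

/-- The derivative in `v_i` on phase space. -/
def dv (i : Fin d) : 𝓢(Phase d, ℂ) →L[ℂ] 𝓢(Phase d, ℂ) :=
  LineDeriv.lineDerivOpCLM ℂ 𝓢(Phase d, ℂ) ((0, eb i) : Phase d)

lemma vmul_apply (Φ : 𝓢(Phase d, ℂ)) (z : Phase d) : vmul i Φ z = z.2 i * Φ z := by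
  rw [vmul, smulLeftCLM_apply_apply (coordV i).hasTemperateGrowth, smul_eq_mul]; rfl

lemma dx_apply (Φ : 𝓢(Phase d, ℂ)) (z : Phase d) :
    dx i Φ z = fderiv ℝ Φ z (eb i, 0) := lineDerivOp_apply_eq_fderiv _ _ _

lemma dv_apply (Φ : 𝓢(Phase d, ℂ)) (z : Phase d) :
    dv i Φ z = fderiv ℝ Φ z (0, eb i) := lineDerivOp_apply_eq_fderiv _ _ _



/-- The transport operator `v · ∇_x`. -/
def transS : 𝓢(Phase d, ℂ) →L[ℂ] 𝓢(Phase d, ℂ) := ∑ i, vmul i ∘L dx i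

/-- The operator `L`. -/
def oscS : 𝓢(Phase d, ℂ) →L[ℂ] 𝓢(Phase d, ℂ) :=
  (∑ i, dv i ∘L dv i) - (1 / 4 : ℂ) • (∑ i, vmul i ∘L vmul i) +
    ((d : ℂ) / 2) • ContinuousLinearMap.id ℂ _

/-- The derivative `∂_x^α`. -/
def dxS (α : Idx d) : 𝓢(Phase d, ℂ) →L[ℂ] 𝓢(Phase d, ℂ) :=
  iterProd (fun i T => dx i ∘L T) α (ContinuousLinearMap.id ℂ _)

lemma dxS_apply (Φ : 𝓢(Phase d, ℂ)) :
    dxS α Φ = iterProd (fun i Ψ => dx i Ψ) α Φ :=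
  iterProd_map (f := fun T : 𝓢(Phase d, ℂ) →L[ℂ] 𝓢(Phase d, ℂ) => T Φ) (fun _ _ => rfl) α _



lemma transS_apply (Φ : 𝓢(Phase d, ℂ)) (z : Phase d) : transS Φ z = fderiv ℝ Φ z (z.2, 0) := by
  have h : ((z.2, 0) : Phase d) = ∑ i, z.2 i • ((eb i, 0) : Phase d) := by
    refine Prod.ext ?_ (by simp [Prod.snd_sum])
    ext j
    simp [Prod.fst_sum, eb, Pi.single_apply]
  rw [h, map_sum]
  simp only [transS, sum_apply, comp_apply]
  refine sum_congr rfl fun i _ => ?_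
  rw [map_smul, vmul_apply, dx_apply, Complex.real_smul]

lemma oscS_apply (Φ : 𝓢(Phase d, ℂ)) :
    oscS Φ = (∑ i, dv i (dv i Φ)) - (1 / 4 : ℂ) • (∑ i, vmul i (vmul i Φ)) + ((d : ℂ) / 2) • Φ := by
  simp only [oscS, add_apply, sub_apply, smul_apply, sum_apply,
    comp_apply, id_apply]

lemma fderiv_toC {V : Type*} [NormedAddCommGroup V] [NormedSpace ℝ V] (φ : 𝓢(V, ℝ)) (z m : V) :
    fderiv ℝ (toC φ) z m = ((fderiv ℝ φ z m : ℝ) : ℂ) := by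
  have h : HasFDerivAt (fun z => (φ z : ℂ)) (ofRealCLM ∘L fderiv ℝ φ z) z :=
    ofRealCLM.hasFDerivAt.comp z (φ.hasFDerivAt z)
  have h2 : ⇑(toC φ) = fun z => (φ z : ℂ) := rfl
  rw [h2, h.fderiv]; rfl

lemma transS_toC (φ : 𝓢(Phase d, ℝ)) (z : Phase d) : transS (toC φ) z = (transport φ z : ℂ) := by
  rw [transS_apply, fderiv_toC]; rfl

lemma laplacian_slice (φ : 𝓢(Phase d, ℝ)) (z : Phase d) :
    ((Δ (fun v : Vec d => φ (z.1, v)) z.2 : ℝ) : ℂ) = ∑ i, dv i (dv i (toC φ)) z := by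
  have hg : Function.HasTemperateGrowth fun v : Vec d => ((z.1, v) : Phase d) := by
    convert (Function.HasTemperateGrowth.const ((z.1, 0) : Phase d)).add
      (ContinuousLinearMap.inr ℝ (Vec d) (Vec d)).hasTemperateGrowth using 2
    simp
  have hu : ∃ (k : ℕ) (C : ℝ), ∀ v : Vec d, ‖v‖ ≤ C * (1 + ‖((z.1, v) : Phase d)‖) ^ k := by
    refine ⟨1, 1, fun v => ?_⟩
    have : ‖v‖ ≤ ‖((z.1, v) : Phase d)‖ := norm_snd_le ((z.1, v) : Phase d)
    rw [pow_one, one_mul]; linarith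
  let S : 𝓢(Phase d, ℂ) → 𝓢(Vec d, ℂ) := fun Φ => SchwartzMap.compCLM ℂ hg hu Φ
  have hS : ∀ Φ v, S Φ v = Φ (z.1, v) := fun _ _ => rfl
  have hd : ∀ (Φ : 𝓢(Phase d, ℂ)) i, S (dv i Φ) = ∂_{eb i} (S Φ) := fun Φ i => by
    ext v
    rw [hS, dv_apply, lineDerivOp_apply_eq_fderiv]
    have h1 : HasFDerivAt (fun v : Vec d => ((z.1, v) : Phase d))
        (ContinuousLinearMap.inr ℝ (Vec d) (Vec d)) v := hasFDerivAt_prodMk_right z.1 v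
    have h2 : ⇑(S Φ) = Φ ∘ fun v => ((z.1, v) : Phase d) := rfl
    rw [h2, ((Φ.hasFDerivAt (z.1, v)).comp v h1).fderiv]
    simp
  have h1 : ∑ i, dv i (dv i (toC φ)) z = (Δ (S (toC φ)) : 𝓢(Vec d, ℂ)) z.2 := by
    rw [SchwartzMap.laplacian_eq_sum (EuclideanSpace.basisFun (Fin d) ℝ), sum_apply]
    refine sum_congr rfl fun i _ => ?_
    rw [EuclideanSpace.basisFun_apply, ← hd, ← hd, hS]
  rw [h1, SchwartzMap.laplacian_apply]
  exact (((φ.smooth 2).comp (contDiff_prodMk_right z.1)).contDiffAt.laplacian_CLM_comp_left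
    (l := ofRealCLM)).symm

lemma oscS_toC (φ : 𝓢(Phase d, ℝ)) (z : Phase d) : oscS (toC φ) z = (opL φ z : ℂ) := by
  rw [oscS_apply]
  simp only [add_apply, sub_apply, smul_apply, sum_apply]
  rw [← laplacian_slice, opL]
  have h : ‖z.2‖ ^ 2 = ∑ i, z.2 i * z.2 i := by
    rw [EuclideanSpace.real_norm_sq_eq]
    exact sum_congr rfl fun i _ => by ring
  have h2 : ∑ i, vmul i (vmul i (toC φ)) z = ((‖z.2‖ ^ 2 : ℝ) : ℂ) * φ z := by
    rw [h]; push_cast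
    rw [sum_mul]
    refine sum_congr rfl fun i _ => ?_
    rw [vmul_apply, vmul_apply, toC_apply]; ring
  rw [h2, toC_apply, smul_eq_mul, smul_eq_mul]
  push_cast; ring

/-- The derivative in `x_i` of real Schwartz functions. -/
def dxR (i : Fin d) (φ : 𝓢(Phase d, ℝ)) : 𝓢(Phase d, ℝ) := ∂_{((eb i, 0) : Phase d)} φ

lemma coe_dxR (φ : 𝓢(Phase d, ℝ)) : ⇑(dxR i φ) = xPartial i φ :=
  funext fun z => lineDerivOp_apply_eq_fderiv _ _ z

lemma coe_iterProd_dxR (φ : 𝓢(Phase d, ℝ)) :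
    ⇑(iterProd dxR α φ) = xDeriv α φ :=
  iterProd_map (f := fun φ : 𝓢(Phase d, ℝ) => (φ : Phase d → ℝ)) (fun i φ => coe_dxR i φ) α φ

lemma toC_iterProd_dxR (φ : 𝓢(Phase d, ℝ)) :
    toC (iterProd dxR α φ) = dxS α (toC φ) := by
  rw [dxS_apply]
  refine iterProd_map (f := toC) (fun i φ => ?_) α φ
  ext z
  rw [toC_apply, coe_dxR, dx_apply, fderiv_toC]; rfl

lemma dxS_toC (φ : 𝓢(Phase d, ℝ)) (z : Phase d) :
    dxS α (toC φ) z = (xDeriv α φ z : ℂ) := by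
  rw [← toC_iterProd_dxR, toC_apply, coe_iterProd_dxR]

lemma IsTest.xDeriv {ψ : Phase d → ℝ} (h : IsTest ψ) (α : Idx d) : IsTest (xDeriv α ψ) := by
  refine iterProd_induction (P := fun i => xPartial i) (p := IsTest) (fun i φ hφ => ⟨?_, ?_⟩) α h
  · exact (hφ.1.fderiv_right (m := ∞) (by simp)).clm_apply contDiff_const
  · exact hφ.2.fderiv_apply ℝ _

/-! ### Tensor products with Hermite functions -/

lemma vmul_tens (g : 𝓢(Vec d, ℂ)) (h : 𝓢(Vec d, ℝ)) :
    vmul i (tens g (toC h)) = tens g (toC (mulV i h)) := by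
  ext z
  rw [vmul_apply, tens_apply, tens_apply, toC_apply, toC_apply, mulV_apply]
  push_cast; ring

lemma hasFDerivAt_tens (g h : 𝓢(Vec d, ℂ)) (z : Phase d) :
    HasFDerivAt (tens g h) (g z.1 • (fderiv ℝ h z.2 ∘L ContinuousLinearMap.snd ℝ _ _) +
      h z.2 • (fderiv ℝ g z.1 ∘L ContinuousLinearMap.fst ℝ _ _)) z := by
  exact ((g.hasFDerivAt z.1).comp z hasFDerivAt_fst).fun_mul
    ((h.hasFDerivAt z.2).comp z hasFDerivAt_snd)

lemma dx_tens (g h : 𝓢(Vec d, ℂ)) :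
    dx i (tens g h) = tens (∂_{eb i} g) h := by
  ext z
  rw [dx_apply, (hasFDerivAt_tens g h z).fderiv, tens_apply, lineDerivOp_apply_eq_fderiv]
  simp [mul_comm]

lemma dv_tens (g : 𝓢(Vec d, ℂ)) (h : 𝓢(Vec d, ℝ)) :
    dv i (tens g (toC h)) = tens g (toC (derV i h)) := by
  ext z
  have h1 : toC (derV i h) z.2 = fderiv ℝ (toC h) z.2 (eb i) := by
    rw [toC_apply, derV_apply, fderiv_toC]
  rw [dv_apply, (hasFDerivAt_tens g _ z).fderiv, tens_apply, h1]
  simp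

lemma tens_smul_right (c : ℝ) (g : 𝓢(Vec d, ℂ)) (h : 𝓢(Vec d, ℝ)) :
    tens g (toC (c • h)) = (c : ℂ) • tens g (toC h) := by
  ext z
  change g z.1 * ((c * h z.2 : ℝ) : ℂ) = (c : ℂ) * (g z.1 * (h z.2 : ℂ))
  push_cast; ring

lemma tens_add_right (g : 𝓢(Vec d, ℂ)) (h₁ h₂ : 𝓢(Vec d, ℝ)) :
    tens g (toC (h₁ + h₂)) = tens g (toC h₁) + tens g (toC h₂) := by
  ext z
  change g z.1 * ((h₁ z.2 + h₂ z.2 : ℝ) : ℂ) = g z.1 * (h₁ z.2 : ℂ) + g z.1 * (h₂ z.2 : ℂ)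
  push_cast; ring

/-- The multiplier `-i ξ_i`, `ξ = 2πk`, dual to the derivative in `x_i`. -/
def Kmul (i : Fin d) (γ : 𝓢(Vec d, ℂ)) : 𝓢(Vec d, ℂ) :=
  -(2 * π * I) • smulLeftCLM ℂ (inner ℝ · (eb i)) γ

/-- The frequency in the units of the equation, `ξ = 2πk`. -/
def xi (k : Vec d) : Vec d := (2 * π) • k

lemma continuous_xi : Continuous (xi : Vec d → Vec d) := continuous_const_smul _

lemma Kmul_apply (γ : 𝓢(Vec d, ℂ)) (k : Vec d) :
    Kmul i γ k = -(I * xi k i) * γ k := by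
  have : (inner ℝ · (eb i) : Vec d → ℝ).HasTemperateGrowth := by fun_prop
  change -(2 * π * I) • (smulLeftCLM ℂ (inner ℝ · (eb i)) γ) k = _
  rw [smulLeftCLM_apply_apply this]
  simp [xi, eb, EuclideanSpace.inner_single_right]
  ring

lemma dx_tens_fourier (γ : 𝓢(Vec d, ℂ)) (h : 𝓢(Vec d, ℂ)) :
    dx i (tens (𝓕 γ) h) = tens (𝓕 (Kmul i γ)) h := by
  rw [dx_tens, lineDerivOp_fourier_eq]; rfl

/-- The multiplier `(-i ξ)^α` on Schwartz functions. -/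
def Kpow (α : Idx d) (γ : 𝓢(Vec d, ℂ)) : 𝓢(Vec d, ℂ) := iterProd Kmul α γ

lemma dxS_tens_fourier (γ h : 𝓢(Vec d, ℂ)) :
    dxS α (tens (𝓕 γ) h) = tens (𝓕 (Kpow α γ)) h := by
  rw [dxS_apply]
  exact (iterProd_map (f := fun γ => tens (𝓕 γ) h)
    (fun i γ => (dx_tens_fourier i γ h).symm) α γ).symm

/-- The symbol `(i ξ)^α`. -/
def symb (α : Idx d) (ξ : Vec d) : ℂ := ∏ i, (I * ξ i) ^ α i

lemma continuous_symb : Continuous (symb α : Vec d → ℂ) := by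
  unfold symb; fun_prop

lemma Kpow_apply (γ : 𝓢(Vec d, ℂ)) (k : Vec d) :
    Kpow α γ k = (-1) ^ deg α * symb α (xi k) * γ k := by
  rw [Kpow, iterProd_map (f := fun γ : 𝓢(Vec d, ℂ) => γ k) (fun i γ => Kmul_apply i γ k) α γ,
    iterProd_mul]
  congr 1
  rw [symb, deg, ← Finset.prod_pow_eq_pow_sum, ← Finset.prod_mul_distrib]
  exact Finset.prod_congr rfl fun i _ => by rw [← mul_pow]; ring

/-! ### Identities between Hermite coefficients -/

/-- The functional `Φ ↦ ∫ w Φ` on the Schwartz space. -/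
def pairSL (w : L2 d) : 𝓢(Phase d, ℂ) →L[ℂ] ℂ :=
  innerSL ℂ (((Lp.memLp w).ofReal (K := ℂ)).toLp) ∘L toLpCLM ℂ ℂ 2 volume

lemma pairSL_apply (w : L2 d) (Φ : 𝓢(Phase d, ℂ)) : pairSL w Φ = pairS w Φ := by
  change inner ℂ (((Lp.memLp w).ofReal (K := ℂ)).toLp) (Φ.toLp 2) = _
  rw [L2.inner_def, pairS]
  refine integral_congr_ae ?_
  filter_upwards [((Lp.memLp w).ofReal (K := ℂ)).coeFn_toLp, Φ.coeFn_toLp 2] with z h1 h2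
  rw [h1, h2, RCLike.inner_apply]
  simp [mul_comm]

lemma pairSL_toC (w : L2 d) (φ : 𝓢(Phase d, ℝ)) : pairSL w (toC φ) = ((∫ z, w z * φ z : ℝ) : ℂ) := by
  rw [pairSL_apply, pairS, ← integral_complex_ofReal]
  simp

/-- The `n`-th Hermite coefficient. -/
def co (n : Idx d) (x : XX d) (k : Vec d) : ℂ := inner ℂ (hb n) (x k)

/-- The `n`-th Hermite coefficient of the product with `v_i`. -/
def vco (n : Idx d) (i : Fin d) (x : XX d) (k : Vec d) : ℂ :=
  (√(n i) : ℂ) * co (n - Pi.single i 1) x k +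
    (√(n i + 1) : ℂ) * co (n + Pi.single i 1) x k

/-- The function `F` represents the functional `c` on Schwartz functions. -/
structure Rep (F : Vec d → ℂ) (c : 𝓢(Vec d, ℂ) → ℂ) : Prop where
  loc : LocallyIntegrable F
  int : ∀ γ : 𝓢(Vec d, ℂ), Integrable fun k => γ k * F k
  eq : ∀ γ : 𝓢(Vec d, ℂ), ∫ k, γ k * F k = c γ

lemma memLp_co (x : XX d) : MemLp (co n x) 2 volume := (Lp.memLp x).const_inner _

lemma rep_co (w : L2 d) :
    Rep (co n (J w)) fun γ => pairSL w (tens (𝓕 γ) (toC (herm n))) where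
  loc := (memLp_co n (J w)).locallyIntegrable one_le_two
  int γ := (γ.memLp 2).integrable_mul (memLp_co n (J w))
  eq γ := by rw [pairSL_apply, pairS_tens]; rfl

variable {F G : Vec d → ℂ} {c e : 𝓢(Vec d, ℂ) → ℂ}

lemma Rep.add (hF : Rep F c) (hG : Rep G e) :
    Rep (fun k => F k + G k) fun γ => c γ + e γ where
  loc := hF.loc.add hG.loc
  int γ := by simp only [mul_add]; exact (hF.int γ).add (hG.int γ)
  eq γ := by simp only [mul_add]; rw [integral_add (hF.int γ) (hG.int γ), hF.eq, hG.eq]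

lemma Rep.const_mul (hF : Rep F c) (a : ℂ) :
    Rep (fun k => a * F k) fun γ => a * c γ where
  loc := hF.loc.smul a
  int γ := by simpa only [mul_left_comm] using (hF.int γ).const_mul a
  eq γ := by simp only [mul_left_comm]; rw [integral_const_mul, hF.eq]

lemma Rep.sub (hF : Rep F c) (hG : Rep G e) :
    Rep (fun k => F k - G k) fun γ => c γ - e γ := by
  simpa only [sub_eq_add_neg, neg_one_mul] using hF.add (hG.const_mul (-1))

lemma Rep.sum {ι : Type*} (s : Finset ι) {F : ι → Vec d → ℂ} {c : ι → 𝓢(Vec d, ℂ) → ℂ}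
    (h : ∀ i ∈ s, Rep (F i) (c i)) : Rep (fun k => ∑ i ∈ s, F i k) fun γ => ∑ i ∈ s, c i γ where
  loc := locallyIntegrable_finsetSum _ fun i hi => (h i hi).loc
  int γ := by
    simp only [mul_sum]; exact integrable_finsetSum _ fun i hi => (h i hi).int γ
  eq γ := by
    simp only [mul_sum]
    rw [integral_finsetSum _ fun i hi => (h i hi).int γ]
    exact sum_congr rfl fun i hi => (h i hi).eq γ

lemma Rep.mul (hF : Rep F c) {p : Vec d → ℂ}
    (hp : Continuous p) {P : 𝓢(Vec d, ℂ) → 𝓢(Vec d, ℂ)} (hP : ∀ γ k, P γ k = p k * γ k) :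
    Rep (fun k => p k * F k) fun γ => c (P γ) where
  loc := by
    have h := hF.loc
    rw [← locallyIntegrableOn_univ] at h ⊢
    exact h.continuousOn_mul hp.continuousOn isOpen_univ.isLocallyClosed
  int γ := by
    refine (hF.int (P γ)).congr (.of_forall fun k => ?_)
    simp only [hP]; ring
  eq γ := by
    rw [← hF.eq]
    refine integral_congr_ae (.of_forall fun k => ?_)
    simp only [hP]; ring

lemma Rep.ae_eq (hF : Rep F c) (hG : Rep G c) :
    F =ᵐ[volume] G := by
  have h := hF.sub hG
  refine (ae_eq_zero_of_integral_contDiff_smul_eq_zero h.loc fun g hg hgc => ?_).mono fun k hk =>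
    sub_eq_zero.1 hk
  simpa using h.eq (toC (hgc.toSchwartzMap hg))

lemma rep_vco (i : Fin d) (w : L2 d) :
    Rep (vco n i (J w)) fun γ => pairSL w (vmul i (tens (𝓕 γ) (toC (herm n)))) := by
  convert ((rep_co (n - Pi.single i 1) w).const_mul (√(n i) : ℂ)).add
    ((rep_co (n + Pi.single i 1) w).const_mul (√(n i + 1) : ℂ)) using 1
  · rfl
  funext γ
  rw [vmul_tens, mulV_herm, tens_add_right, tens_smul_right, tens_smul_right, map_add, map_smul,
    map_smul, smul_eq_mul, smul_eq_mul]

lemma oscS_tens (γ : 𝓢(Vec d, ℂ)) (n : Idx d) :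
    oscS (tens γ (toC (herm n))) = -(deg n : ℂ) • tens γ (toC (herm n)) := by
  rw [oscS_apply]
  simp only [dv_tens, vmul_tens]
  ext z
  have h := congrArg (fun f : 𝓢(Vec d, ℝ) => ((f z.2 : ℝ) : ℂ)) (oscillator_herm n)
  simp only [add_apply, sub_apply, smul_apply, sum_apply, smul_eq_mul] at h ⊢
  push_cast at h
  simp only [tens_apply, toC_apply, ← mul_sum]
  linear_combination γ z.1 * h

/-- A weak equation on phase space, tested against `∂_x^α φ` for all test functions `φ`, is
equivalent to an algebraic system for the Hermite coefficients of the Fourier transforms. -/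
lemma coefficient_identity (ε : ℝ) (w₀ w₁ G₀ : L2 d) (G : Fin d → L2 d)
    (h : ∀ φ : 𝓢(Phase d, ℝ), HasCompactSupport φ →
      ∫ z, w₁ z * xDeriv α φ z =
        (∫ z, w₀ z * (ε * transport (xDeriv α φ) z + opL (xDeriv α φ) z)) +
        (∫ z, G₀ z * φ z) + ∑ i, ∫ z, G i z * (z.2 i * φ z)) (n : Idx d) :
    ∀ᵐ k, (-1) ^ deg α * symb α (xi k) * co n (J w₁) k =
      (-1) ^ deg α * symb α (xi k) *
        (-(ε * ∑ i, I * xi k i * vco n i (J w₀) k) - deg n * co n (J w₀) k) +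
      co n (J G₀) k + ∑ i, vco n i (J (G i)) k := by
  let ℓ : 𝓢(Phase d, ℂ) →L[ℂ] ℂ := pairSL w₁ ∘L dxS α -
    (pairSL w₀ ∘L ((ε : ℂ) • transS + oscS) ∘L dxS α + pairSL G₀ + ∑ i, pairSL (G i) ∘L vmul i)
  have hℓ : ∀ Φ, ℓ Φ = pairSL w₁ (dxS α Φ) -
      ((ε * pairSL w₀ (transS (dxS α Φ)) + pairSL w₀ (oscS (dxS α Φ))) + pairSL G₀ Φ +
        ∑ i, pairSL (G i) (vmul i Φ)) := fun Φ => by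
    simp only [ℓ, add_apply, sub_apply, sum_apply, comp_apply, smul_apply, map_add, map_smul,
      smul_eq_mul]
  have h0 : ℓ = 0 := by
    refine schwartz_functional_ext fun φ hφ => ?_
    have key := congrArg (fun r : ℝ => (r : ℂ)) (h φ hφ)
    simp only [ofReal_add, ofReal_sum, ← integral_complex_ofReal] at key
    have e1 : pairSL w₁ (dxS α (toC φ)) = ∫ z, ((w₁ z * xDeriv α φ z : ℝ) : ℂ) := by
      rw [pairSL_apply, pairS]; simp [dxS_toC]
    have e2 : (ε : ℂ) * pairSL w₀ (transS (dxS α (toC φ))) + pairSL w₀ (oscS (dxS α (toC φ))) =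
        ∫ z, ((w₀ z * (ε * transport (xDeriv α φ) z + opL (xDeriv α φ) z) : ℝ) : ℂ) := by
      rw [← toC_iterProd_dxR, ← smul_eq_mul, ← map_smul, ← map_add, pairSL_apply, pairS]
      refine integral_congr_ae (.of_forall fun z => ?_)
      simp only [add_apply, smul_apply, transS_toC, oscS_toC, coe_iterProd_dxR,
        smul_eq_mul]
      push_cast; ring
    have e3 : pairSL G₀ (toC φ) = ∫ z, ((G₀ z * φ z : ℝ) : ℂ) := by
      rw [pairSL_apply, pairS]; simp
    have e4 i : pairSL (G i) (vmul i (toC φ)) = ∫ z, ((G i z * (z.2 i * φ z) : ℝ) : ℂ) := by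
      rw [pairSL_apply, pairS]; simp [vmul_apply]
    simp_rw [hℓ, e1, e2, e3, e4, key, sub_self]
  have hcont : Continuous fun k : Vec d => (-1 : ℂ) ^ deg α * symb α (xi k) :=
    continuous_const.mul ((continuous_symb α).comp continuous_xi)
  have hxc i : Continuous fun k : Vec d => -(I * (xi k i : ℂ)) := by
    have := continuous_xi (d := d); fun_prop
  -- both sides represent the same functional of the Schwartz function `γ`
  have hL := (rep_co n w₁).mul hcont (Kpow_apply α)
  have hT := (Rep.sum Finset.univ fun i (_ : i ∈ Finset.univ) =>
    ((rep_vco n i w₀).mul (hxc i) (Kmul_apply i))).mul hcont (Kpow_apply α)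
  have hO := ((rep_co n w₀).const_mul (-(deg n : ℂ))).mul hcont (Kpow_apply α)
  have hR := (((hT.const_mul ε).add hO).add (rep_co n G₀)).add
    (Rep.sum Finset.univ fun i (_ : i ∈ Finset.univ) => rep_vco n i (G i))
  have heq : (fun γ => pairSL w₁ (tens (𝓕 (Kpow α γ)) (toC (herm n)))) =
      fun γ : 𝓢(Vec d, ℂ) => (ε : ℂ) * (∑ i, pairSL w₀
        (vmul i (tens (𝓕 (Kmul i (Kpow α γ))) (toC (herm n))))) +
        -(deg n : ℂ) * pairSL w₀ (tens (𝓕 (Kpow α γ)) (toC (herm n))) +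
        pairSL G₀ (tens (𝓕 γ) (toC (herm n))) +
        ∑ i, pairSL (G i) (vmul i (tens (𝓕 γ) (toC (herm n)))) := by
    funext γ
    have h1 := hℓ (tens (𝓕 γ) (toC (herm n)))
    rw [h0, zero_apply, dxS_tens_fourier, oscS_tens, map_smul, smul_eq_mul] at h1
    simp only [transS, sum_apply, comp_apply, map_sum, dx_tens_fourier] at h1
    exact sub_eq_zero.1 h1.symm
  rw [heq] at hL
  filter_upwards [hL.ae_eq hR] with k hk
  simp only [hk, neg_mul, sum_neg_distrib]
  ring

end

/-! ### The momentum term -/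

section

variable (i : Fin d) (n : Idx d)

lemma memLp_mul_prod {b h : Vec d → ℝ} (hb : MemLp b 2 volume) (hh : MemLp h 2 volume) :
    MemLp (fun z : Phase d => b z.1 * h z.2) 2 volume := by
  have hm : AEStronglyMeasurable (fun z : Phase d => b z.1 * h z.2) volume :=
    (hb.1.comp_fst (ν := volume)).mul (hh.1.comp_snd (μ := volume))
  refine (memLp_two_iff_integrable_sq hm).2 ?_
  have h := ((memLp_two_iff_integrable_sq hb.1).1 hb).mul_prod
    ((memLp_two_iff_integrable_sq hh.1).1 hh)
  refine h.congr (.of_forall fun z => ?_)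
  simp only [mul_pow]

lemma ae_memLp_section_real (w : L2 d) : ∀ᵐ x : Vec d, MemLp (fun v => w (x, v)) 2 volume := by
  filter_upwards [ae_sec w] with x hx
  simpa [cx] using hx.re

/-- The `i`-th component of the momentum of `w`. -/
def bco (w : L2 d) (i : Fin d) (x : Vec d) : ℝ :=
  ∫ v, herm (Pi.single i 1 : Idx d) v * w (x, v)

lemma herm_single_apply (v : Vec d) :
    herm (Pi.single i 1 : Idx d) v = v i * sqrtM v := by
  rw [herm_single, mulV_apply, sqrtMS_apply]

lemma bco_eq (w : L2 d) (i : Fin d) :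
    ∀ᵐ x : Vec d, (bco w i x : ℂ) = inner ℂ (hb (Pi.single i 1)) (curry w x) := by
  filter_upwards [ae_sec w, coeFn_curry w] with x hx hc
  rw [hc, inner_hb_sec hx, bco, ← integral_complex_ofReal]
  simp [cx]

lemma memLp_bco (w : L2 d) (i : Fin d) : MemLp (bco w i) 2 volume := by
  have h : MemLp (fun x => inner ℂ (hb (Pi.single i 1)) (curry w x)) 2 volume :=
    (Lp.memLp (curry w)).const_inner _
  refine h.re.ae_eq ?_
  filter_upwards [bco_eq w i] with x hx
  rw [← hx]; simp

lemma momentumTerm_eq (w : L2 d) : ∀ᵐ x : Vec d, ∀ v : Vec d,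
    momentumTerm w (x, v) = ∑ i, bco w i x * herm (Pi.single i 1 : Idx d) v := by
  filter_upwards [ae_memLp_section_real w] with x hx v
  have hi : ∀ i, Integrable fun v => herm (Pi.single i 1 : Idx d) v * w (x, v) := fun i =>
    ((herm _).memLp 2).integrable_mul hx
  have hint : Integrable fun v : Vec d => (sqrtM v * w (x, v)) • v := by
    rw [← (EuclideanSpace.equiv (Fin d) ℝ).integrable_comp_iff]
    refine Integrable.of_eval fun i => (hi i).congr (.of_forall fun v => ?_)
    simp only [herm_single_apply]
    simp; ring
  have hco i : momentum w x i = bco w i x := by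
    have := (EuclideanSpace.proj (𝕜 := ℝ) i : Vec d →L[ℝ] ℝ).integral_comp_comm hint
    rw [momentum, bco]
    refine Eq.trans this.symm (integral_congr_ae (.of_forall fun v => ?_))
    simp only [herm_single_apply]
    simp; ring
  rw [momentumTerm, PiLp.inner_apply, sum_mul]
  refine sum_congr rfl fun i _ => ?_
  rw [hco, herm_single_apply]
  simp; ring

lemma memLp_momentum (w : L2 d) : MemLp (fun z : Phase d =>
    ∑ i, bco w i z.1 * herm (Pi.single i 1 : Idx d) z.2) 2 volume :=
  memLp_finsetSum _ fun i _ => memLp_mul_prod (memLp_bco w i) ((herm _).memLp 2)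

/-- The momentum term `b · v √M` as an element of `L²`. -/
def P1 (w : L2 d) : L2 d := (memLp_momentum w).toLp

lemma coeFn_P1 (w : L2 d) : P1 w =ᵐ[volume] momentumTerm w := by
  filter_upwards [(memLp_momentum w).coeFn_toLp,
    Measure.quasiMeasurePreserving_fst.ae (momentumTerm_eq w)] with z h1 h2
  rw [P1, h1, ← h2 z.2]

lemma deg_single : deg (Pi.single i 1 : Idx d) = 1 := by
  simp [deg]

lemma eq_single_of_deg_one {n : Idx d} (h : deg n = 1) : ∃ i, n = Pi.single i 1 := by
  have h0 : n ≠ 0 := by rintro rfl; simp [deg] at h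
  obtain ⟨m, i, rfl⟩ := exists_eq_add_single h0
  rw [deg_add_single] at h
  have : m = 0 := deg_eq_zero.1 (by omega)
  exact ⟨i, by rw [this, zero_add]⟩

lemma pairS_P1 (w : L2 d) (γ : 𝓢(Vec d, ℂ)) (n : Idx d) :
    pairS (P1 w) (tens (𝓕 γ) (toC (herm n))) =
      if deg n = 1 then pairS w (tens (𝓕 γ) (toC (herm n))) else 0 := by
  have h2 : ∀ w : L2 d, pairS w (tens (𝓕 γ) (toC (herm n))) =
      ∫ x : Vec d, ∫ v : Vec d, (w (x, v) : ℂ) * tens (𝓕 γ) (toC (herm n)) (x, v) := fun w =>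
    integral_prod _ (integrable_pairS w (tens (𝓕 γ) (toC (herm n))))
  have h3 : ∀ᵐ x : Vec d, ∀ᵐ v : Vec d, P1 w (x, v) =
      ∑ i, bco w i x * herm (Pi.single i 1 : Idx d) v :=
    ae_section_of_ae (memLp_momentum w).coeFn_toLp
  have h4 : ∀ᵐ x : Vec d, ∫ v : Vec d, (P1 w (x, v) : ℂ) * tens (𝓕 γ) (toC (herm n)) (x, v) =
      ((∑ i, if Pi.single i 1 = n then bco w i x else 0 : ℝ) : ℂ) * 𝓕 γ x := by
    filter_upwards [h3] with x hx
    have e1 : ∫ v : Vec d, (P1 w (x, v) : ℂ) * tens (𝓕 γ) (toC (herm n)) (x, v) =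
        ∫ v : Vec d, ∑ i, (𝓕 γ x * bco w i x) *
          ((herm (Pi.single i 1 : Idx d) v * herm n v : ℝ) : ℂ) := by
      refine integral_congr_ae ?_
      filter_upwards [hx] with v hv
      rw [hv, tens_apply, toC_apply]
      push_cast
      rw [sum_mul]
      exact sum_congr rfl fun i _ => by ring
    rw [e1, integral_finsetSum]
    · rw [ofReal_sum, sum_mul]
      refine sum_congr rfl fun i _ => ?_
      rw [integral_const_mul, integral_complex_ofReal, integral_herm_mul]
      split_ifs <;> simp [mul_comm]
    · exact fun i _ =>
        (((herm _).memLp 2).integrable_mul ((herm n).memLp 2)).ofReal (𝕜 := ℂ) |>.const_mul _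
  rw [h2, integral_congr_ae h4]
  by_cases hn : deg n = 1
  · obtain ⟨i, rfl⟩ := eq_single_of_deg_one hn
    rw [if_pos hn, h2]
    refine integral_congr_ae (.of_forall fun x => ?_)
    have hinj (j : Fin d) : (Pi.single j 1 : Idx d) = Pi.single i 1 ↔ j = i := by
      refine ⟨fun h => ?_, fun h => h ▸ rfl⟩
      simpa [Pi.single_apply] using congrFun h j
    simp only [hinj, Finset.sum_ite_eq', Finset.mem_univ, if_true]
    rw [bco, ← integral_complex_ofReal, ← integral_mul_const]
    refine integral_congr_ae (.of_forall fun v => ?_)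
    simp only [tens_apply, toC_apply]
    push_cast; ring
  · rw [if_neg hn]
    have (i : Fin d) : (Pi.single i 1 : Idx d) ≠ n := by rintro rfl; exact hn (deg_single i)
    simp [this]

/-- In Hermite coefficients, the momentum term is the projection to degree one. -/
lemma co_P1 (w : L2 d) :
    co n (J (P1 w)) =ᵐ[volume] fun k => if deg n = 1 then co n (J w) k else 0 := by
  have h1 := rep_co n (P1 w)
  simp only [pairSL_apply, pairS_P1] at h1
  by_cases hn : deg n = 1
  · simp only [hn, if_true] at h1 ⊢
    have h2 := rep_co n w
    simp only [pairSL_apply] at h2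
    exact h1.ae_eq h2
  · simp only [hn, if_false] at h1 ⊢
    exact h1.ae_eq ⟨locallyIntegrable_zero, fun γ => by simp, fun γ => by simp⟩

lemma ae_all_co {p : (Idx d) → Vec d → Prop} (h : ∀ n, ∀ᵐ k, p n k) : ∀ᵐ k, ∀ n, p n k :=
  ae_all_iff.2 h

lemma ext_inner_hb {x y : VE d} (h : ∀ n, inner ℂ (hb n) x = inner ℂ (hb n) y) : x = y := by
  refine hb.repr.injective ?_
  ext n
  rw [hb.repr_apply_apply, hb.repr_apply_apply, h]

lemma J_P1_apply (w : L2 d) : ∀ᵐ k, J (P1 w) k = pOp hb 1 (J w k) := by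
  filter_upwards [ae_all_co fun n => co_P1 n w] with k hk
  refine ext_inner_hb fun n => ?_
  rw [pOp, inner_basis_diagOp]
  refine (hk n).trans ?_
  simp only [mem_sph]
  split_ifs <;> simp [co]

lemma inner_P1 (w f : L2 d) : inner ℝ (P1 w) f = inner ℝ w (P1 f) := by
  rw [← inner_J_re, ← inner_J_re, inner_FL2, inner_FL2]
  congr 1
  refine integral_congr_ae ?_
  filter_upwards [J_P1_apply w, J_P1_apply f] with k h1 h2
  rw [h1, h2, ← adjoint_inner_right, adjoint_pOp]

end

/-! ### The equation on the Fourier–Hermite side -/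

section

variable (α : Idx d) (i : Fin d)

lemma integrable_mulS (Φ Ψ : 𝓢(Phase d, ℂ)) : Integrable fun z => Φ z * Ψ z :=
  (Φ.memLp 2).integrable_mul (Ψ.memLp 2)

lemma dx_vmul (i j : Fin d) (Φ : 𝓢(Phase d, ℂ)) : dx i (vmul j Φ) = vmul j (dx i Φ) := by
  ext z
  have h : ⇑(vmul j Φ) = fun z => coordV j z * Φ z := funext fun z => vmul_apply j Φ z
  rw [dx_apply, vmul_apply, dx_apply, h, ((coordV j).hasFDerivAt.fun_mul (Φ.hasFDerivAt z)).fderiv]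
  simp [coordV]

/-- The bilinear pairing `∫ Φ Ψ` of Schwartz functions on phase space. -/
def pairSS : 𝓢(Phase d, ℂ) →ₗ[ℂ] 𝓢(Phase d, ℂ) →ₗ[ℂ] ℂ :=
  LinearMap.mk₂ ℂ (fun Φ Ψ => ∫ z, Φ z * Ψ z)
    (fun Φ Φ' Ψ => by
      simp only [add_apply, add_mul]
      exact integral_add (integrable_mulS _ _) (integrable_mulS _ _))
    (fun c Φ Ψ => by
      simp only [smul_apply, smul_eq_mul, mul_assoc]; exact integral_const_mul _ _)
    (fun Φ Ψ Ψ' => by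
      simp only [add_apply, mul_add]
      exact integral_add (integrable_mulS _ _) (integrable_mulS _ _))
    (fun c Φ Ψ => by
      simp only [smul_apply, smul_eq_mul, mul_left_comm _ c]; exact integral_const_mul _ _)

lemma pairSS_dx (Φ Ψ : 𝓢(Phase d, ℂ)) : pairSS Φ (dx i Ψ) = -pairSS (dx i Φ) Ψ :=
  integral_mul_lineDerivOp_right_eq_neg_left (μ := volume) Φ Ψ ((eb i, 0) : Phase d)

lemma pairSS_dv (Φ Ψ : 𝓢(Phase d, ℂ)) : pairSS Φ (dv i Ψ) = -pairSS (dv i Φ) Ψ :=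
  integral_mul_lineDerivOp_right_eq_neg_left (μ := volume) Φ Ψ ((0, eb i) : Phase d)

lemma pairSS_vmul (Φ Ψ : 𝓢(Phase d, ℂ)) : pairSS Φ (vmul i Ψ) = pairSS (vmul i Φ) Ψ :=
  integral_congr_ae (.of_forall fun z => by simp only [vmul_apply]; ring)

lemma pairSS_transS (Φ Ψ : 𝓢(Phase d, ℂ)) : pairSS Φ (transS Ψ) = -pairSS (transS Φ) Ψ := by
  simp only [transS, sum_apply, comp_apply, map_sum, LinearMap.sum_apply, pairSS_vmul, pairSS_dx,
    dx_vmul, sum_neg_distrib]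

lemma pairSS_oscS (Φ Ψ : 𝓢(Phase d, ℂ)) : pairSS Φ (oscS Ψ) = pairSS (oscS Φ) Ψ := by
  simp only [oscS_apply, map_add, map_sub, map_smul, map_sum, LinearMap.add_apply,
    LinearMap.sub_apply, LinearMap.smul_apply, LinearMap.sum_apply, pairSS_dv, pairSS_vmul, neg_neg]

/-- A real Schwartz function on phase space as an element of `L²`. -/
def tL (φ : 𝓢(Phase d, ℝ)) : L2 d := φ.toLp 2

lemma coeFn_tL (φ : 𝓢(Phase d, ℝ)) : tL φ =ᵐ[volume] φ := φ.coeFn_toLp 2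

lemma inner_tL (w : L2 d) (φ : 𝓢(Phase d, ℝ)) : inner ℝ w (tL φ) = ∫ z, w z * φ z := by
  rw [inner_L2]
  refine integral_congr_ae ?_
  filter_upwards [coeFn_tL φ] with z hz
  rw [hz]

/-- The operator `ε v · ∇_x + L`. -/
def opS (ε : ℝ) : 𝓢(Phase d, ℂ) →L[ℂ] 𝓢(Phase d, ℂ) := (ε : ℂ) • transS + oscS

lemma opS_toC (φ : 𝓢(Phase d, ℝ)) (ε : ℝ) (z : Phase d) :
    opS ε (toC φ) z = ((ε * transport φ z + opL φ z : ℝ) : ℂ) := by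
  simp only [opS, add_apply, smul_apply, transS_toC, oscS_toC, smul_eq_mul]
  push_cast; ring

lemma memLp_transport_add_opL (φ : 𝓢(Phase d, ℝ)) (ε : ℝ) :
    MemLp (fun z => ε * transport φ z + opL φ z) 2 volume := by
  simpa only [opS_toC, RCLike.re_to_complex, ofReal_re] using ((opS ε (toC φ)).memLp 2 volume).re

/-- `v · ∇_x φ + L φ`, the formal adjoint of the generator without the momentum term. -/
def genMain (φ : 𝓢(Phase d, ℝ)) : L2 d := (memLp_transport_add_opL φ 1).toLp

lemma coeFn_genMain (φ : 𝓢(Phase d, ℝ)) :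
    genMain φ =ᵐ[volume] fun z => transport φ z + opL φ z := by
  filter_upwards [(memLp_transport_add_opL φ 1).coeFn_toLp] with z hz
  rw [genMain, hz, one_mul]

/-- The formal adjoint of the generator, on test functions. -/
def genT (φ : 𝓢(Phase d, ℝ)) : L2 d := genMain φ + P1 (tL φ)

lemma inner_genMain (w : L2 d) (φ : 𝓢(Phase d, ℝ)) :
    inner ℝ w (genMain φ) = ∫ z, w z * (transport φ z + opL φ z) := by
  rw [inner_L2]
  refine integral_congr_ae ?_
  filter_upwards [coeFn_genMain φ] with z hz
  rw [hz]

lemma inner_P1_tL (w : L2 d) (φ : 𝓢(Phase d, ℝ)) :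
    inner ℝ w (P1 (tL φ)) = ∫ z, momentumTerm w z * φ z := by
  rw [← inner_P1, inner_tL]
  refine integral_congr_ae ?_
  filter_upwards [coeFn_P1 w] with z hz
  rw [hz]

lemma integral_genMain_mul (φ η : 𝓢(Phase d, ℝ)) :
    ∫ z, φ z * (-1 * transport η z + opL η z) = ∫ z, (transport φ z + opL φ z) * η z := by
  have h : pairSS (toC φ) (opS (-1) (toC η)) = pairSS (opS 1 (toC φ)) (toC η) := by
    simp only [opS, add_apply, smul_apply, map_add, map_smul, LinearMap.add_apply, LinearMap.smul_apply,
      pairSS_transS, pairSS_oscS]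
    simp
  simp only [pairSS, LinearMap.mk₂_apply, opS_toC, toC_apply, ← ofReal_mul,
    integral_complex_ofReal, one_mul] at h
  exact_mod_cast h

lemma inner_tL_genMain (φ η : 𝓢(Phase d, ℝ)) :
    ∫ z, tL φ z * (-1 * transport η z + opL η z) = ∫ z, genMain φ z * η z := by
  refine Eq.trans ?_ ((integral_genMain_mul φ η).trans ?_)
  · refine integral_congr_ae ?_
    filter_upwards [coeFn_tL φ] with z hz
    rw [hz]
  · refine integral_congr_ae ?_
    filter_upwards [coeFn_genMain φ] with z hz
    rw [hz]

lemma xDeriv_zero (ψ : Phase d → ℝ) : xDeriv 0 ψ = ψ := iterProd_zero (fun i => xPartial i) ψ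

lemma J_neg (f : L2 d) : J (-f) = -J f := by
  have := J_sub 0 f
  rwa [J_zero, zero_sub, zero_sub] at this

lemma co_neg (n : Idx d) (x : XX d) : co n (-x) =ᵐ[volume] fun k => -co n x k := by
  filter_upwards [Lp.coeFn_neg x] with k hk
  rw [co, hk, Pi.neg_apply, inner_neg_right]; rfl

lemma co_add (n : Idx d) (x y : XX d) :
    co n (x + y) =ᵐ[volume] fun k => co n x k + co n y k := by
  filter_upwards [Lp.coeFn_add x y] with k hk
  rw [co, hk, Pi.add_apply, inner_add_right]; rfl

lemma co_smul (n : Idx d) (c : ℂ) (x : XX d) :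
    co n (c • x) =ᵐ[volume] fun k => c * co n x k := by
  filter_upwards [Lp.coeFn_smul c x] with k hk
  rw [co, hk, Pi.smul_apply, inner_smul_right]; rfl

lemma co_zero (n : Idx d) : co n (0 : XX d) =ᵐ[volume] fun _ => 0 := by
  filter_upwards [Lp.coeFn_zero (VE d) 2 (volume : Measure (Vec d))] with k hk
  rw [co, hk, Pi.zero_apply, inner_zero_right]

lemma ae_co_J_zero : ∀ᵐ k, ∀ m, co m (J (0 : L2 d)) k = 0 :=
  ae_all_co fun m => by rw [J_zero]; exact co_zero m

lemma integral_zero_mul (f : Phase d → ℝ) : ∫ z, (0 : L2 d) z * f z = 0 := by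
  rw [integral_congr_ae (g := fun _ => 0), integral_zero]
  filter_upwards [Lp.coeFn_zero ℝ 2 (volume : Measure (Phase d))] with z hz
  rw [hz]; simp

lemma inner_fullGen (ξ : Vec d) (n : Idx d) (x : XX d) (k : Vec d) :
    inner ℂ (fullGen hb ξ n) (x k) =
      (∑ i, I * ξ i * vco n i x k) - lam n * co n x k := by
  simp only [fullGen, inner_sub_left, inner_smul_left, sum_inner, inner_add_left, co, vco,
    map_neg, conj_I, conj_ofReal, neg_neg, mul_sum]
  congr 1
  exact sum_congr rfl fun i _ => by ring

lemma deg_sub_lam (n : Idx d) (z : ℂ) :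
    (if deg n = 1 then z else 0) - deg n * z = -((lam n : ℝ) : ℂ) * z := by
  unfold lam
  split_ifs with h
  · rw [h]; simp
  · push_cast; ring

/-- The adjoint generator acts on the fibers through `fullGen`. -/
lemma inner_genT (φ : 𝓢(Phase d, ℝ)) : ∀ᵐ k, ∀ n,
    inner ℂ (J (genT φ) k) (hb n) = inner ℂ (J (tL φ) k) (fullGen hb (xi k) n) := by
  refine ae_all_co fun n => ?_
  have h := coefficient_identity 0 (-1) (tL φ) 0 (-genMain φ) 0 (fun η _ => by
    have h3 : ∫ z, (-genMain φ : L2 d) z * η z = -∫ z, genMain φ z * η z := by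
      rw [← integral_neg]
      refine integral_congr_ae ?_
      filter_upwards [Lp.coeFn_neg (genMain φ)] with z hz
      rw [hz, Pi.neg_apply, neg_mul]
    rw [integral_zero_mul, h3, xDeriv_zero, inner_tL_genMain]
    simp [integral_zero_mul]) n
  have hn : co n (J (-genMain φ)) =ᵐ[volume] fun k => -co n (J (genMain φ)) k := by
    rw [J_neg]; exact co_neg n _
  have hs : co n (J (genT φ)) =ᵐ[volume]
      fun k => co n (J (genMain φ)) k + co n (J (P1 (tL φ))) k := by
    rw [genT, J_add]; exact co_add n _ _
  filter_upwards [h, ae_co_J_zero, hn, hs, co_P1 n (tL φ)] with k h hv hn hs hp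
  have hd : (deg (0 : Idx d)) = 0 := deg_eq_zero.2 rfl
  rw [hv, hn, hd] at h
  simp only [Pi.zero_apply, vco, hv, symb, pow_zero, Finset.prod_const_one, mul_zero, add_zero,
    sum_const_zero, one_mul] at h
  rw [hp] at hs
  rw [← inner_conj_symm, ← inner_conj_symm (J (tL φ) k)]
  congr 1
  rw [inner_fullGen]
  change co n (J (genT φ)) k = _
  rw [hs]
  have hl := deg_sub_lam n (co n (J (tL φ)) k)
  simp only [vco] at h ⊢
  push_cast at h
  linear_combination hl + h

/-! ### Weak derivatives -/

/-- A weak derivative acts on the Fourier side as multiplication by its symbol. -/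
lemma J_weak_deriv (w g : L2 d)
    (h : ∀ φ : 𝓢(Phase d, ℝ), HasCompactSupport φ →
      ∫ z, w z * xDeriv α φ z = (-1) ^ deg α * ∫ z, g z * φ z) :
    ∀ᵐ k, J g k = symb α (xi k) • J w k := by
  have hc : ∀ n, ∀ᵐ k, co n (J g) k = symb α (xi k) * co n (J w) k := by
    intro n
    have h := coefficient_identity α 1 0 w (((-1) ^ deg α : ℝ) • g) 0 (fun φ hφ => by
      have h3 : ∫ z, (((-1) ^ deg α : ℝ) • g : L2 d) z * φ z =
          (-1) ^ deg α * ∫ z, g z * φ z := by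
        rw [← integral_const_mul]
        refine integral_congr_ae ?_
        filter_upwards [Lp.coeFn_smul ((-1) ^ deg α : ℝ) g] with z hz
        rw [hz, Pi.smul_apply, smul_eq_mul, mul_assoc]
      simp [h φ hφ, h3, integral_zero_mul]) n
    have hn : co n (J (((-1) ^ deg α : ℝ) • g)) =ᵐ[volume]
        fun k => (-1) ^ deg α * co n (J g) k := by
      rw [J_smul]
      filter_upwards [co_smul n (((-1) ^ deg α : ℝ) : ℂ) (J g)] with k hk
      rw [hk]; push_cast; ring
    filter_upwards [h, ae_co_J_zero, hn] with k h hv hn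
    rw [hn] at h
    simp only [Pi.zero_apply, vco, hv, mul_zero, add_zero, sum_const_zero, sub_zero, neg_zero,
      zero_add, mul_assoc] at h
    exact (mul_left_cancel₀ (pow_ne_zero _ (by norm_num)) h).symm
  filter_upwards [ae_all_co hc] with k hk
  refine ext_inner_hb fun n => ?_
  rw [inner_smul_right]
  exact hk n

lemma conj_symb (ξ : Vec d) :
    (starRingEnd ℂ) (symb α ξ) = (-1) ^ deg α * symb α ξ := by
  rw [symb, map_prod, deg, ← Finset.prod_pow_eq_pow_sum, ← Finset.prod_mul_distrib]
  refine Finset.prod_congr rfl fun i _ => ?_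
  rw [map_pow, map_mul, conj_I, conj_ofReal, ← mul_pow]
  ring

lemma integral_mul_xDeriv_xDeriv (φ η : 𝓢(Phase d, ℝ)) :
    ∫ z, φ z * xDeriv α η z = (-1) ^ deg α * ∫ z, xDeriv α φ z * η z := by
  have hstep : ∀ i (φ η : 𝓢(Phase d, ℝ)), ∫ z, φ z * dxR i η z = -∫ z, dxR i φ z * η z :=
    fun i φ η => integral_mul_lineDerivOp_right_eq_neg_left φ η _
  rw [← coe_iterProd_dxR, ← coe_iterProd_dxR]
  have hcomm : ∀ i j : Fin d, Function.Commute (dxR i : 𝓢(Phase d, ℝ) → _) (dxR j) :=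
    fun i j f => lineDerivOp_comm _ _ f
  induction α using induction_add_single generalizing φ with
  | h0 => simp [iterProd_zero, deg]
  | h1 n i ih =>
    rw [iterProd_add_single hcomm, hstep, ih, iterProd_add_single hcomm, deg_add_single]
    have e : iterProd dxR n (dxR i φ) = dxR i (iterProd dxR n φ) :=
      (iterProd_comm (P := dxR) (Q := dxR i) (fun j => hcomm i j) n φ).symm
    rw [e, pow_succ]; ring

lemma xDeriv_apply_tL (φ : 𝓢(Phase d, ℝ)) :
    ∀ᵐ k, J (tL (iterProd dxR α φ)) k = symb α (xi k) • J (tL φ) k := by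
  refine J_weak_deriv α _ _ fun η _ => ?_
  have h1 : ∫ z, tL φ z * xDeriv α η z = ∫ z, φ z * xDeriv α η z := by
    refine integral_congr_ae ?_
    filter_upwards [coeFn_tL φ] with z hz
    rw [hz]
  rw [h1, integral_mul_xDeriv_xDeriv]
  congr 1
  refine integral_congr_ae ?_
  filter_upwards [coeFn_tL (iterProd dxR α φ)] with z hz
  rw [hz, coe_iterProd_dxR]

lemma Jadj_J (f : L2 d) : Jadj (J f) = f := by
  refine ext_inner_right ℝ fun g => ?_
  rw [inner_Jadj, inner_J_re]

/-- The test function `ψ` as a Schwartz function. -/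
def IsTest.toS {ψ : Phase d → ℝ} (h : IsTest ψ) : 𝓢(Phase d, ℝ) :=
  h.2.toSchwartzMap h.1

lemma IsTest.coe_toS {ψ : Phase d → ℝ} (h : IsTest ψ) : ⇑h.toS = ψ := rfl

lemma isTest_of_schwartz (φ : 𝓢(Phase d, ℝ)) (h : HasCompactSupport φ) : IsTest φ :=
  ⟨φ.smooth', h⟩

lemma locallyIntegrable_L2 (w : L2 d) : LocallyIntegrable w :=
  (Lp.memLp w).locallyIntegrable one_le_two

/-- Multiplication by the symbol on the Fourier side produces a weak derivative. -/
lemma isWeakXDeriv_Jadj (y z : XX d)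
    (h : ∀ᵐ k, z k = symb α (xi k) • y k) : IsWeakXDeriv α (Jadj y) (Jadj z) := by
  refine ⟨locallyIntegrable_L2 _, locallyIntegrable_L2 _, fun ψ hψ => ?_⟩
  have e1 : ∫ x, Jadj y x * xDeriv α ψ x = inner ℝ (Jadj y) (tL (iterProd dxR α hψ.toS)) := by
    rw [inner_tL, coe_iterProd_dxR, hψ.coe_toS]
  have e2 : ∫ x, Jadj z x * ψ x = inner ℝ (Jadj z) (tL hψ.toS) := by
    rw [inner_tL, hψ.coe_toS]
  rw [e1, e2, inner_Jadj, inner_Jadj, inner_FL2, inner_FL2]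
  have e3 : (((-1 : ℝ) ^ (∑ i, α i) : ℝ) : ℂ) = (-1) ^ (∑ i, α i) := by push_cast; rfl
  rw [← Complex.re_ofReal_mul, e3, ← integral_const_mul]
  congr 1
  refine integral_congr_ae ?_
  filter_upwards [h, xDeriv_apply_tL α hψ.toS] with k h1 h2
  rw [h1, h2, inner_smul_right, inner_smul_left, conj_symb, ← mul_assoc, ← mul_assoc]
  change _ = (-1 : ℂ) ^ deg α * (-1) ^ deg α * _ * _
  rw [← mul_pow]; simp

end

/-! ### Uniqueness for linear equations with a bounded generator -/

section BoundedGenerator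

variable {H : Type*} [NormedAddCommGroup H] [InnerProductSpace ℂ H] [CompleteSpace H]

lemma eq_zero_of_weak_linear {A : H →L[ℂ] H} {y : ℝ → H} {T : ℝ} (hT : 0 ≤ T)
    (hy : ContinuousOn y (Icc 0 T))
    (h : ∀ ψ, ∀ t ∈ Icc 0 T, inner ℂ ψ (y t) = ∫ s in 0..t, inner ℂ ψ (A (y s))) :
    ∀ t ∈ Icc 0 T, y t = 0 := by
  let δ : ℝ → H := IccExtend hT ((Icc 0 T).domRestrict y)
  have hδ : Continuous δ := (continuousOn_iff_continuous_domRestrict.1 hy).Icc_extend'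
  have hδy : ∀ t ∈ Icc 0 T, δ t = y t := fun t ht => by
    simp only [δ]; rw [IccExtend_of_mem hT _ ht]; rfl
  have hAδ : Continuous fun s => A (δ s) := A.continuous.comp hδ
  let F : ℝ → H := fun t => ∫ s in 0..t, A (δ s)
  have hF : ∀ t, HasDerivAt F (A (δ t)) t := fun t =>
    integral_hasDerivAt_right (hAδ.intervalIntegrable _ _)
      hAδ.aestronglyMeasurable.stronglyMeasurableAtFilter hAδ.continuousAt
  have hFy : ∀ t ∈ Icc 0 T, F t = y t := by
    intro t ht
    refine ext_inner_left ℂ fun ψ => ?_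
    rw [h ψ t ht]
    have h1 : inner ℂ ψ (F t) = ∫ s in 0..t, inner ℂ ψ (A (δ s)) :=
      ((innerSL ℂ ψ).intervalIntegral_comp_comm (hAδ.intervalIntegrable 0 t)).symm
    rw [h1]
    refine intervalIntegral.integral_congr fun s hs => ?_
    rw [uIcc_of_le ht.1] at hs
    simp only [hδy s ⟨hs.1, hs.2.trans ht.2⟩]
  intro t ht
  have hg := norm_le_gronwallBound_of_norm_deriv_right_le (f := F) (f' := fun s => A (δ s))
    (δ := 0) (K := ‖A‖) (ε := 0) (a := 0) (b := T)
    (fun s _ => (hF s).continuousAt.continuousWithinAt) (fun s _ => (hF s).hasDerivWithinAt)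
    (by simp [F]) (fun s hs => by
      rw [hFy s ⟨hs.1, hs.2.le⟩, ← hδy s ⟨hs.1, hs.2.le⟩, add_zero]
      exact A.le_opNorm _) t ht
  rw [hFy t ht, gronwallBound_ε0_δ0] at hg
  exact norm_le_zero_iff.1 hg

/-- A weak solution of a linear equation with bounded generator is given by Duhamel's formula. -/
lemma eq_duhamel {A : H →L[ℂ] H} {S : ℝ → H →L[ℂ] H} (hS : IsContraction S)
    (hSA : ∀ ψ f t, 0 ≤ t → inner ℂ ψ (S t f) =
      inner ℂ ψ f + ∫ s in 0..t, inner ℂ (adjoint A ψ) (S s f))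
    {y r : ℝ → H} {T : ℝ} (hT : 0 ≤ T) (hy : ContinuousOn y (Icc 0 T))
    (hr : IntegrableOn r (Ioc 0 T))
    (h : ∀ ψ, ∀ t ∈ Icc 0 T, inner ℂ ψ (y t) =
      (∫ s in 0..t, inner ℂ (adjoint A ψ) (y s)) + ∫ s in 0..t, inner ℂ ψ (r s))
    (ψ : H) : inner ℂ ψ (y T) = ∫ s in 0..T, inner ℂ ψ (S (T - s) (r s)) := by
  let r' : ℝ → H := (Ioc 0 T).indicator r
  have hr' : Integrable r' := hr.integrable_indicator measurableSet_Ioc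
  have hr'' : ∀ T : ℝ, IntegrableOn r' (Ioc 0 T) := fun _ => hr'.integrableOn
  have hrr : ∀ t ∈ Icc 0 T, ∀ s ∈ Ioc 0 t, r' s = r s := fun t ht s hs =>
    indicator_of_mem (s := Ioc 0 T) ⟨hs.1, hs.2.trans ht.2⟩ _
  have hzc : ContinuousOn (duhamel S r') (Icc 0 T) :=
    (continuousOn_duhamel hS hr'').mono Icc_subset_Ici_self
  have key := eq_zero_of_weak_linear (A := A) hT (hy.sub hzc) (fun ψ t ht => by
    rw [Pi.sub_apply, inner_sub_right, h ψ t ht, inner_duhamel hS hr'' (fun f t ht => hSA ψ f t ht) ht.1]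
    have e : ∫ s in 0..t, inner ℂ ψ (r' s) = ∫ s in 0..t, inner ℂ ψ (r s) := by
      rw [integral_of_le ht.1, integral_of_le ht.1]
      exact setIntegral_congr_fun measurableSet_Ioc fun s hs => by simp only [hrr t ht s hs]
    have hi : ∀ {x : ℝ → H}, ContinuousOn x (Icc 0 T) →
        IntervalIntegrable (fun s => inner ℂ (adjoint A ψ) (x s)) volume 0 t := fun hx => by
      refine ContinuousOn.intervalIntegrable ?_
      rw [uIcc_of_le ht.1]
      exact ContinuousOn.inner (𝕜 := ℂ) continuousOn_const (hx.mono (Icc_subset_Icc_right ht.2))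
    have e2 : ∀ s, inner ℂ ψ (A ((y - duhamel S r') s)) =
        inner ℂ (adjoint A ψ) (y s) - inner ℂ (adjoint A ψ) (duhamel S r' s) := fun s => by
      rw [← adjoint_inner_left, Pi.sub_apply, inner_sub_right]
    simp only [e2]
    rw [e, intervalIntegral.integral_sub (hi hy) (hi hzc)]
    ring)
  rw [sub_eq_zero.1 (key T ⟨hT, le_rfl⟩)]
  have h2 : ∫ s in 0..T, inner ℂ ψ (S (T - s) (r s)) =
      ∫ s in 0..T, inner ℂ ψ (S (T - s) (r' s)) := by
    rw [integral_of_le hT, integral_of_le hT]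
    exact setIntegral_congr_fun measurableSet_Ioc fun s hs => by
      simp only [hrr T ⟨hT, le_rfl⟩ s hs]
  rw [h2, duhamel]
  refine ((innerSL ℂ ψ).intervalIntegral_comp_comm ?_).symm
  rw [intervalIntegrable_iff_integrableOn_Ioc_of_le hT]
  exact hS.integrable (by fun_prop) (hr'' T)

end BoundedGenerator

/-! ### The weak formulation -/

lemma vcoord_temperate (i : Fin d) : Function.HasTemperateGrowth fun z : Phase d => z.2 i :=
  ((EuclideanSpace.proj (𝕜 := ℝ) i : Vec d →L[ℝ] ℝ) ∘L
      ContinuousLinearMap.snd ℝ (Vec d) (Vec d)).hasTemperateGrowth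

/-- Multiplication by `v_i` of real Schwartz functions on phase space. -/
def vmulR (i : Fin d) : 𝓢(Phase d, ℝ) →L[ℝ] 𝓢(Phase d, ℝ) :=
  smulLeftCLM ℝ fun z : Phase d => z.2 i

lemma vmulR_apply (i : Fin d) (φ : 𝓢(Phase d, ℝ)) (z : Phase d) : vmulR i φ z = z.2 i * φ z := by
  rw [vmulR, smulLeftCLM_apply_apply (vcoord_temperate i), smul_eq_mul]

lemma restrict_Ioc_prod (T : ℝ) : (volume : Measure (ℝ × Phase d)).restrict (Ioc 0 T ×ˢ univ) =
    (volume.restrict (Ioc 0 T)).prod volume := by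
  rw [Measure.volume_eq_prod, ← Measure.prod_restrict, Measure.restrict_univ]

lemma continuous_sqrtM : Continuous (sqrtM : Vec d → ℝ) := sqrtMS.continuous.congr sqrtMS_apply

lemma SourceIntegrable.integrable_mul {h : ℝ → Phase d → ℝ} (hh : SourceIntegrable h)
    {φ : Phase d → ℝ} (hφ : Continuous φ) (hc : HasCompactSupport φ) (T : ℝ) :
    Integrable (fun p : ℝ × Phase d => h p.1 p.2 * φ p.2) ((volume.restrict (Ioc 0 T)).prod volume) := by
  rw [← restrict_Ioc_prod]
  let K : Set (Vec d) := Prod.fst '' tsupport φ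
  have hK : IsCompact K := hc.isCompact.image continuous_fst
  let g : Phase d → ℝ := fun z => φ z * ((1 + ‖z.2‖) * sqrtM z.2)⁻¹
  have hpos : ∀ z : Phase d, 0 < (1 + ‖z.2‖) * sqrtM z.2 := fun z =>
    mul_pos (by positivity) (sqrtM_pos _)
  have hg : Continuous g := hφ.mul (Continuous.inv₀
    ((by fun_prop : Continuous fun z : Phase d => 1 + ‖z.2‖).mul
      (continuous_sqrtM.comp continuous_snd)) fun z => (hpos z).ne')
  obtain ⟨C, hC⟩ := hg.bounded_above_of_compact_support hc.mul_right
  have h1 : IntegrableOn (fun p : ℝ × Phase d => h p.1 p.2 * φ p.2) (Ioc 0 T ×ˢ (K ×ˢ univ)) := by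
    have h2 := (hh T K hK).bdd_mul (c := C) (f := fun p : ℝ × Phase d => g p.2)
      (hg.comp continuous_snd).aestronglyMeasurable (.of_forall fun p => hC p.2)
    refine h2.congr (.of_forall fun p => ?_)
    simp only [g]
    have h3 := inv_mul_cancel₀ (hpos p.2).ne'
    linear_combination (φ p.2 * h p.1 p.2) * h3
  refine h1.of_forall_sdiff_eq_zero (measurableSet_Ioc.prod MeasurableSet.univ) fun p hp => ?_
  have : φ p.2 = 0 := by
    by_contra hne
    exact hp.2 ⟨hp.1.1, ⟨p.2, subset_tsupport _ hne, rfl⟩, mem_univ _⟩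
  rw [this, mul_zero]

lemma weak_integrand (w : L2 d) (g : Phase d → ℝ) (φ : 𝓢(Phase d, ℝ))
    (hg : Integrable fun z => g z * φ z) :
    ∫ z, (w z * (transport φ z + opL φ z) + momentumTerm w z * φ z + g z * φ z) =
      inner ℝ w (genT φ) + ∫ z, g z * φ z := by
  have i1 : Integrable fun z => w z * (transport φ z + opL φ z) :=
    ((Lp.memLp w).integrable_mul (Lp.memLp (genMain φ))).congr (by
      filter_upwards [coeFn_genMain φ] with z hz
      rw [Pi.mul_apply, hz])
  have i2 : Integrable fun z => momentumTerm w z * φ z :=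
    ((Lp.memLp (P1 w)).integrable_mul (φ.memLp 2)).congr (by
      filter_upwards [coeFn_P1 w] with z hz
      rw [Pi.mul_apply, hz])
  have h1 : ∫ z, (w z * (transport φ z + opL φ z) + momentumTerm w z * φ z + g z * φ z) =
      (∫ z, (w z * (transport φ z + opL φ z) + momentumTerm w z * φ z)) + ∫ z, g z * φ z :=
    integral_add (i1.add i2) hg
  rw [h1, integral_add i1 i2, genT, inner_add_right, inner_genMain, inner_P1_tL]

lemma integrableOn_inner {u : ℝ → L2 d} (hu : ContinuousOn u (Ici 0)) (x : L2 d) {t : ℝ}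
    (ht : 0 ≤ t) : IntervalIntegrable (fun s => inner ℝ (u s) x) volume 0 t := by
  refine ContinuousOn.intervalIntegrable ?_
  rw [uIcc_of_le ht]
  exact ContinuousOn.inner (𝕜 := ℝ) (hu.mono Icc_subset_Ici_self) continuousOn_const

lemma SourceIntegrable.integral_weak {h : ℝ → Phase d → ℝ} (hh : SourceIntegrable h)
    {u : ℝ → L2 d} (hu : ContinuousOn u (Ici 0)) (φ : 𝓢(Phase d, ℝ)) (hφ : HasCompactSupport φ)
    {t : ℝ} (ht : 0 ≤ t) :
    ∫ s in 0..t, ∫ z, (u s z * (transport φ z + opL φ z) + momentumTerm (u s) z * φ z +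
      h s z * φ z) =
    (∫ s in 0..t, inner ℝ (u s) (genT φ)) + ∫ s in 0..t, ∫ z, h s z * φ z := by
  have hi := hh.integrable_mul φ.continuous hφ t
  rw [← intervalIntegral.integral_add (integrableOn_inner hu _ ht)
    ((intervalIntegrable_iff_integrableOn_Ioc_of_le ht).2 hi.integral_prod_left)]
  rw [integral_of_le ht, integral_of_le ht]
  refine integral_congr_ae ?_
  filter_upwards [hi.prod_right_ae] with s hs
  exact weak_integrand (u s) (h s) φ hs

lemma IsWeakSolution.eq {f₀ : L2 d} {h : ℝ → Phase d → ℝ} {u : ℝ → L2 d}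
    (hu : IsWeakSolution f₀ h u) (φ : 𝓢(Phase d, ℝ)) (hφ : HasCompactSupport φ) {t : ℝ}
    (ht : 0 ≤ t) : inner ℝ (u t) (tL φ) = inner ℝ f₀ (tL φ) +
      (∫ s in 0..t, inner ℝ (u s) (genT φ)) + ∫ s in 0..t, ∫ z, h s z * φ z := by
  rw [inner_tL, inner_tL, hu.weak_eq φ (isTest_of_schwartz φ hφ) t ht,
    hu.source.integral_weak hu.continuousOn φ hφ ht, add_assoc]

lemma IsWeakSolution.mk' {f₀ : L2 d} {h : ℝ → Phase d → ℝ} {u : ℝ → L2 d}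
    (hh : SourceIntegrable h) (hu : ContinuousOn u (Ici 0))
    (heq : ∀ φ : 𝓢(Phase d, ℝ), HasCompactSupport φ → ∀ t : ℝ, 0 ≤ t →
      inner ℝ (u t) (tL φ) = inner ℝ f₀ (tL φ) +
      (∫ s in 0..t, inner ℝ (u s) (genT φ)) + ∫ s in 0..t, ∫ z, h s z * φ z) :
    IsWeakSolution f₀ h u where
  source := hh
  continuousOn := hu
  weak_eq ψ hψ t ht := by
    have := heq hψ.toS hψ.2 t ht
    rw [inner_tL, inner_tL, add_assoc, ← hh.integral_weak hu hψ.toS hψ.2 ht] at this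
    exact this

/-- `(-1)^|α| ∂^α u` solves the equation on `[0, T]` with vanishing datum and with the source
`G₀ + ∑ᵢ vᵢ Gᵢ`, all derivatives being carried by the test function. -/
structure IsDerivSol (α : Idx d) (T : ℝ) (u G₀ : ℝ → L2 d) (G : Fin d → ℝ → L2 d) : Prop where
  cont : ContinuousOn u (Ici 0)
  int₀ : IntegrableOn G₀ (Ioc 0 T)
  int₁ i : IntegrableOn (G i) (Ioc 0 T)
  eq (φ : 𝓢(Phase d, ℝ)) : HasCompactSupport φ → ∀ t ∈ Icc 0 T,
    inner ℝ (u t) (tL (iterProd dxR α φ)) =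
      (∫ s in 0..t, inner ℝ (u s) (genT (iterProd dxR α φ))) +
      ∫ s in 0..t, (inner ℝ (G₀ s) (tL φ) + ∑ i, inner ℝ (G i s) (tL (vmulR i φ)))

variable {α : Idx d} {u G₀ : ℝ → L2 d} {G : Fin d → ℝ → L2 d} {T : ℝ}

lemma IsDerivSol.intervalIntegrable (h : IsDerivSol α T u G₀ G) {t : ℝ} (ht : t ∈ Icc 0 T) :
    IntervalIntegrable u volume 0 t ∧ IntervalIntegrable G₀ volume 0 t ∧
      ∀ i, IntervalIntegrable (G i) volume 0 t := by
  have hint : ∀ {g : ℝ → L2 d}, IntegrableOn g (Ioc 0 T) → IntervalIntegrable g volume 0 t :=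
    fun hg => (intervalIntegrable_iff_integrableOn_Ioc_of_le ht.1).2
      (hg.mono_set (Ioc_subset_Ioc_right ht.2))
  refine ⟨ContinuousOn.intervalIntegrable ?_, hint h.int₀, fun i => hint (h.int₁ i)⟩
  rw [uIcc_of_le ht.1]; exact h.cont.mono Icc_subset_Ici_self

/-- The equation integrated in time, in terms of Hermite coefficients. -/
lemma coefficient_weak (h : IsDerivSol α T u G₀ G) {t : ℝ} (ht : t ∈ Icc 0 T) : ∀ᵐ k, ∀ n,
      (-1) ^ deg α * symb α (xi k) * co n (J (u t)) k =
        (-1) ^ deg α * symb α (xi k) *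
          inner ℂ (fullGen hb (-xi k) n) (J (∫ s in 0..t, u s) k) +
        co n (J (∫ s in 0..t, G₀ s)) k +
        ∑ i, vco n i (J (∫ s in 0..t, G i s)) k := by
  set W := ∫ s in 0..t, u s with hW
  obtain ⟨huI, h0, h1⟩ := h.intervalIntegrable ht
  have hcomm : ∀ {g : ℝ → L2 d}, IntervalIntegrable g volume 0 t → ∀ x : L2 d,
      inner ℝ (∫ s in 0..t, g s) x = ∫ s in 0..t, inner ℝ (g s) x := by
    intro g hg x
    have := (innerSL ℝ x).intervalIntegral_comp_comm hg
    simp only [innerSL_apply_apply] at this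
    rw [real_inner_comm, ← this]
    exact intervalIntegral.integral_congr fun s _ => real_inner_comm _ _
  have hintc : ∀ {g : ℝ → L2 d}, IntervalIntegrable g volume 0 t → ∀ x : L2 d,
      IntervalIntegrable (fun s => inner ℝ (g s) x) volume 0 t := by
    intro g hg x
    simp only [← fun s => real_inner_comm (g s) x]
    exact ⟨(innerSL ℝ x).integrable_comp hg.1, (innerSL ℝ x).integrable_comp hg.2⟩
  have key := fun n => coefficient_identity α 1 W (u t - P1 W) (∫ s in 0..t, G₀ s)
    (fun i => ∫ s in 0..t, G i s) (fun φ hφ => by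
      have e1 : ∫ z, (u t - P1 W : L2 d) z * xDeriv α φ z =
          inner ℝ (u t - P1 W) (tL (iterProd dxR α φ)) := by
        rw [inner_tL, coe_iterProd_dxR]
      have e2 : ∫ z, W z * (1 * transport (xDeriv α φ) z + opL (xDeriv α φ) z) =
          inner ℝ W (genMain (iterProd dxR α φ)) := by
        rw [inner_genMain, coe_iterProd_dxR]; simp only [one_mul]
      have e3 : ∀ i, ∫ z, (∫ s in 0..t, G i s : L2 d) z * (z.2 i * φ z) =
          inner ℝ (∫ s in 0..t, G i s) (tL (vmulR i φ)) := fun i => by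
        simp only [inner_tL, vmulR_apply]
      rw [e1, e2, ← inner_tL, sum_congr rfl fun i _ => e3 i, inner_sub_left, h.eq φ hφ t ht,
        inner_P1, ← hcomm huI, genT, inner_add_right, intervalIntegral.integral_add
          (hintc h0 _), intervalIntegral.integral_finsetSum, hcomm h0,
        sum_congr rfl fun i _ => hcomm (h1 i) _]
      · ring
      · exact fun i _ => hintc (h1 i) _
      · have := IntervalIntegrable.sum (f := fun i s => inner ℝ (G i s) (tL (vmulR i φ)))
          Finset.univ fun i _ => hintc (h1 i) (tL (vmulR i φ))
        simpa only [Finset.sum_fn] using this) n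
  have hs : ∀ n, co n (J (u t - P1 W)) =ᵐ[volume]
      fun k => co n (J (u t)) k - co n (J (P1 W)) k := fun n => by
    rw [J_sub, sub_eq_add_neg]
    filter_upwards [co_add n (J (u t)) (-J (P1 W)), co_neg n (J (P1 W))] with k h1 h2
    rw [h1, h2, sub_eq_add_neg]
  filter_upwards [ae_all_co key, ae_all_co hs, ae_all_co fun n => co_P1 n W] with k h1 h2 h3 n
  have h1 := h1 n
  rw [h2, h3] at h1
  rw [inner_fullGen]
  have hl := deg_sub_lam n (co n (J W) k)
  have hsum : ∑ i, I * ((-xi k) i : ℂ) * vco n i (J W) k =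
      -∑ i, I * (xi k i : ℂ) * vco n i (J W) k := by simp
  rw [hsum]
  push_cast at h1
  linear_combination h1 + (-1) ^ deg α * symb α (xi k) * hl

/-! ### Sources on one fiber -/

section FiberSource

variable {E : Type*} [NormedAddCommGroup E] [InnerProductSpace ℂ E] [CompleteSpace E]
variable (b : HilbertBasis (Idx d) ℂ E)
variable (N : ℕ) (ξ : Vec d)

lemma inner_basis_piOp_genOp (x : E) (n : Idx d) :
    inner ℂ (b n) (piOp b N (genOp b (N + 1) ξ x)) =
      if deg n ≤ N then inner ℂ (fullGen b (-ξ) n) x else 0 := by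
  rw [← adjoint_inner_left, adjoint_piOp, piOp_basis]
  split_ifs with h
  · rw [← adjoint_inner_left, adjoint_genOp, genOp_basis b (by omega)]
  · rw [inner_zero_left]

/-- Truncating the generator leaks mass across the top degree. -/
lemma inner_piOp_genOp (φ x : E) :
    inner ℂ φ (piOp b N (genOp b (N + 1) ξ x)) =
      inner ℂ φ (genOp b N ξ (piOp b N x)) + inner ℂ (leakOp b N (-ξ) φ) x := by
  have h := congrArg (fun T : E →L[ℂ] E => inner ℂ (T φ) x) (genOp_comp_piOp b (le_refl (N + 1)) (-ξ))
  simp only [comp_apply, add_apply, inner_add_left] at h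
  rw [← adjoint_inner_left, adjoint_piOp, ← adjoint_inner_left, adjoint_genOp, h]
  congr 1
  rw [← adjoint_genOp, adjoint_inner_left]
  nth_rw 1 [← adjoint_piOp]
  rw [adjoint_inner_left]
  congr 1
  exact DFunLike.congr_fun (piOp_genOp b N ξ) x

/-- The product with `v_i`, truncated to degrees at most `N`. -/
def srcOp (N : ℕ) (i : Fin d) : E →L[ℂ] E :=
  piOp b N ∘L (lowOp b (N + 1) i + adjoint (lowOp b (N + 1) i))

lemma inner_basis_srcOp (i : Fin d) (x : E) (n : Idx d) :
    inner ℂ (b n) (srcOp b N i x) = if deg n ≤ N then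
      (√(n i) : ℂ) * inner ℂ (b (n - Pi.single i 1)) x +
        (√(n i + 1) : ℂ) * inner ℂ (b (n + Pi.single i 1)) x else 0 := by
  rw [srcOp, comp_apply, ← adjoint_inner_left, adjoint_piOp, piOp_basis]
  split_ifs with h
  · rw [add_apply, inner_add_right, ← adjoint_inner_left, adjoint_inner_right, raiseOp_basis,
      lowOp_basis, if_pos (by omega), if_pos (by omega), inner_smul_left, inner_smul_left,
      conj_ofReal, conj_ofReal, add_comm]
  · rw [inner_zero_left]

lemma inner_eq_sum_lev {N : ℕ} (φ x : E) (hx : ∀ n, ¬ deg n ≤ N → inner ℂ (b n) x = 0) :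
    inner ℂ φ x = ∑ n ∈ lev d N, inner ℂ φ (b n) * inner ℂ (b n) x := by
  rw [← b.tsum_inner_mul_inner φ x]
  refine tsum_eq_sum fun n hn => ?_
  rw [hx n (fun h => hn (mem_lev.2 h)), mul_zero]

lemma sum_shift_add_le (s : Finset (Idx d)) (i : Fin d) (f : E) :
    ∑ n ∈ s, ‖inner ℂ (b (n + Pi.single i 1)) f‖ ^ 2 ≤ ‖f‖ ^ 2 := by
  rw [← Finset.sum_image (s := s) (g := fun n => n + Pi.single i 1)
    (f := fun n => ‖inner ℂ (b n) f‖ ^ 2) (fun x _ y _ h => add_right_cancel h)]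
  exact sum_norm_sq_le b _ f

lemma sum_shift_sub_le (s : Finset (Idx d)) (i : Fin d) (f : E) :
    ∑ n ∈ s, (if n i = 0 then 0 else ‖inner ℂ (b (n - Pi.single i 1)) f‖ ^ 2) ≤ ‖f‖ ^ 2 := by
  have h0 : ∑ n ∈ s, (if n i = 0 then 0 else ‖inner ℂ (b (n - Pi.single i 1)) f‖ ^ 2) =
      ∑ n ∈ s.filter fun n => ¬ n i = 0, ‖inner ℂ (b (n - Pi.single i 1)) f‖ ^ 2 := by
    rw [Finset.sum_filter]
    exact sum_congr rfl fun n _ => by split_ifs <;> simp_all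
  rw [h0]
  have hinj : Set.InjOn (fun n : Idx d => n - Pi.single i 1)
      (s.filter fun n => ¬ n i = 0 : Finset (Idx d)) := by
    intro x hx y hy h
    have hx' := sub_add_single (mem_filter.1 hx).2
    have hy' := sub_add_single (mem_filter.1 hy).2
    rw [← hx', ← hy']
    exact congrArg (· + Pi.single i 1) h
  have h1 := Finset.sum_image (f := fun n => ‖inner ℂ (b n) f‖ ^ 2) hinj
  exact h1.symm.le.trans (sum_norm_sq_le b _ f)

/-- The `n`-th coefficient of the source `g₀ + Σ v_i g_i`. -/
def srcCo (g₀ : E) (g : Fin d → E) (n : Idx d) : ℂ :=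
  inner ℂ (b n) g₀ + ∑ i, ((√(n i) : ℂ) * inner ℂ (b (n - Pi.single i 1)) (g i) +
        (√(n i + 1) : ℂ) * inner ℂ (b (n + Pi.single i 1)) (g i))

lemma norm_srcCo_sq_le (g₀ : E) (g : Fin d → E) (n : Idx d) :
    ‖srcCo b g₀ g n‖ ^ 2 ≤ (2 * d + 1) * (deg n + 1) * (‖inner ℂ (b n) g₀‖ ^ 2 +
      ∑ i, ((if n i = 0 then 0 else ‖inner ℂ (b (n - Pi.single i 1)) (g i)‖ ^ 2) +
        ‖inner ℂ (b (n + Pi.single i 1)) (g i)‖ ^ 2)) := by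
  set D : ℝ := deg n + 1 with hD
  have hD1 : 1 ≤ D := by simp [hD]
  let A : Fin d → ℝ := fun i => if n i = 0 then 0 else ‖inner ℂ (b (n - Pi.single i 1)) (g i)‖
  let B : Fin d → ℝ := fun i => ‖inner ℂ (b (n + Pi.single i 1)) (g i)‖
  let c₀ : ℝ := ‖inner ℂ (b n) g₀‖
  have h1 : ‖srcCo b g₀ g n‖ ≤ √D * (c₀ + ∑ i, (A i + B i)) := by
    rw [srcCo, mul_add, mul_sum]
    refine (norm_add_le _ _).trans (add_le_add ?_ ((norm_sum_le _ _).trans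
      (sum_le_sum fun i _ => ?_)))
    · exact le_mul_of_one_le_left (norm_nonneg _) (Real.one_le_sqrt.2 hD1)
    · have hni : (n i : ℝ) ≤ deg n := by exact_mod_cast le_deg n i
      rw [mul_add]
      refine (norm_add_le _ _).trans (add_le_add ?_ ?_)
      · rw [norm_mul, norm_real, norm_of_nonneg (sqrt_nonneg _)]
        by_cases h0 : n i = 0
        · simp [A, h0]
        · simp only [A, h0, if_false]
          exact mul_le_mul_of_nonneg_right (Real.sqrt_le_sqrt (by linarith)) (norm_nonneg _)
      · rw [norm_mul, norm_real, norm_of_nonneg (sqrt_nonneg _)]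
        exact mul_le_mul_of_nonneg_right (Real.sqrt_le_sqrt (by linarith)) (norm_nonneg _)
  have hA0 : ∀ i, 0 ≤ A i := fun i => by simp only [A]; split_ifs <;> positivity
  have h2 : ‖srcCo b g₀ g n‖ ^ 2 ≤ D * (c₀ + ∑ i, (A i + B i)) ^ 2 := by
    have := pow_le_pow_left₀ (norm_nonneg _) h1 2
    rwa [mul_pow, sq_sqrt (by linarith)] at this
  have h3 : (c₀ + ∑ i, (A i + B i)) ^ 2 ≤ (2 * d + 1) * (c₀ ^ 2 + ∑ i, (A i ^ 2 + B i ^ 2)) := by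
    let F : Option (Fin d ⊕ Fin d) → ℝ := fun o => o.elim c₀ (Sum.elim A B)
    have h := sq_sum_le_card_mul_sum_sq (s := Finset.univ) (f := F)
    simp only [Finset.card_univ, Fintype.card_option, Fintype.card_sum, Fintype.card_fin,
      Fintype.sum_option, Fintype.sum_sum_type, F, Option.elim, Sum.elim_inl, Sum.elim_inr] at h
    rw [sum_add_distrib, sum_add_distrib]
    refine h.trans_eq ?_
    push_cast; ring
  have h4 : ∀ i, A i ^ 2 = if n i = 0 then 0 else ‖inner ℂ (b (n - Pi.single i 1)) (g i)‖ ^ 2 := by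
    intro i; simp only [A]; split_ifs <;> simp
  simp only [h4] at h3
  calc _ ≤ _ := h2
    _ ≤ _ := mul_le_mul_of_nonneg_left h3 (by linarith)
    _ = _ := by simp only [B, c₀]; ring

/-- The pairing with the source `g₀ + Σ v_i g_i` is controlled by the dissipation, for sources
without components of degree at most one, and by the dissipation and the norm in general. -/
lemma norm_inner_src_le {N : ℕ} {g₀ : E} {g : Fin d → E} {φ : E} {c : ℝ} (hc0 : 0 ≤ c)
    (hc : 1 ≤ c ∨ ∀ n, deg n ≤ 1 → srcCo b g₀ g n = 0) {w : ℝ} (hw : 0 < w) :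
    ‖inner ℂ φ (piOp b N g₀ + ∑ i, srcOp b N i (g i))‖ ≤
      w * (dissip b N φ + c * ‖φ‖ ^ 2) +
        (2 * d + 1) / w * (‖g₀‖ ^ 2 + ∑ i, ‖g i‖ ^ 2) := by
  have hco : ∀ n, inner ℂ (b n) (piOp b N g₀ + ∑ i, srcOp b N i (g i)) =
      if deg n ≤ N then srcCo b g₀ g n else 0 := by
    intro n
    rw [inner_add_right, inner_sum]
    simp only [inner_basis_srcOp]
    rw [piOp, inner_basis_diagOp]
    simp only [mem_lev]
    split_ifs with h
    · simp [srcCo]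
    · simp
  rw [inner_eq_sum_lev b (N := N) φ _ fun n hn => by rw [hco, if_neg hn]]
  set K : (Idx d) → ℝ := fun n => ‖inner ℂ (b n) g₀‖ ^ 2 +
      ∑ i, ((if n i = 0 then 0 else ‖inner ℂ (b (n - Pi.single i 1)) (g i)‖ ^ 2) +
        ‖inner ℂ (b (n + Pi.single i 1)) (g i)‖ ^ 2) with hK
  have hKs : ∑ n ∈ lev d N, K n ≤ 2 * (‖g₀‖ ^ 2 + ∑ i, ‖g i‖ ^ 2) := by
    simp only [hK]
    rw [sum_add_distrib, sum_comm]
    have h1 := sum_norm_sq_le b (lev d N) g₀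
    have h2 : ∑ i, ∑ n ∈ lev d N,
        ((if n i = 0 then 0 else ‖inner ℂ (b (n - Pi.single i 1)) (g i)‖ ^ 2) +
        ‖inner ℂ (b (n + Pi.single i 1)) (g i)‖ ^ 2) ≤ ∑ i, 2 * ‖g i‖ ^ 2 := by
      refine sum_le_sum fun i _ => ?_
      rw [sum_add_distrib]
      have := sum_shift_add_le b (lev d N) i (g i)
      have := sum_shift_sub_le b (lev d N) i (g i)
      linarith
    rw [← mul_sum] at h2
    nlinarith [sq_nonneg ‖g₀‖]
  have hn : ∀ n ∈ lev d N, ‖inner ℂ φ (b n) *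
        inner ℂ (b n) (piOp b N g₀ + ∑ i, srcOp b N i (g i))‖ ≤
      w * ((lam n + c) * ‖inner ℂ (b n) φ‖ ^ 2) + (2 * d + 1) / (2 * w) * K n := by
    intro n hn
    rw [hco, if_pos (mem_lev.1 hn), norm_mul, norm_inner_symm]
    have hl := lam_nonneg n
    have hK0 : 0 ≤ K n := by
      refine add_nonneg (sq_nonneg _) (sum_nonneg fun i _ => add_nonneg ?_ (sq_nonneg _))
      split_ifs <;> positivity
    set x := ‖inner ℂ (b n) φ‖
    set y := ‖srcCo b g₀ g n‖ with hy
    have hdeg : y = 0 ∨ (deg n + 1 : ℝ) ≤ 2 * (lam n + c) := by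
      by_cases h1 : deg n ≤ 1
      · rcases hc with hc | hc
        · right
          have : 0 ≤ lam n := hl
          have h2 : (deg n : ℝ) ≤ 1 := by exact_mod_cast h1
          linarith
        · left; rw [hy, hc n h1, norm_zero]
      · right
        have h2 : (2 : ℝ) ≤ deg n := by exact_mod_cast (by omega : 2 ≤ deg n)
        rw [lam, if_neg (by omega)]
        linarith
    rcases hdeg with h0 | hdeg
    · rw [h0, mul_zero]; positivity
    · have hy2 := norm_srcCo_sq_le b g₀ g n
      change y ^ 2 ≤ (2 * d + 1) * (deg n + 1) * K n at hy2
      have hD : (0 : ℝ) < deg n + 1 := by positivity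
      have h3 : x * y ≤ w * (deg n + 1) / 2 * x ^ 2 + y ^ 2 / (2 * w * (deg n + 1)) := by
        have e : w * (deg n + 1) / 2 * x ^ 2 + y ^ 2 / (2 * w * (deg n + 1)) - x * y =
            (w * (deg n + 1) * x - y) ^ 2 / (2 * w * (deg n + 1)) := by
          field_simp; ring
        have : 0 ≤ (w * (deg n + 1) * x - y) ^ 2 / (2 * w * (deg n + 1)) := by positivity
        linarith
      have h4 : y ^ 2 / (2 * w * (deg n + 1)) ≤ (2 * d + 1) / (2 * w) * K n := by
        rw [div_le_iff₀ (by positivity)]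
        refine hy2.trans_eq ?_
        field_simp
      have h5 : w * (deg n + 1) / 2 * x ^ 2 ≤ w * ((lam n + c) * x ^ 2) := by
        have := mul_le_mul_of_nonneg_left hdeg (by positivity : 0 ≤ w * x ^ 2 / 2)
        linarith
      linarith
  refine (norm_sum_le _ _).trans ((sum_le_sum hn).trans ?_)
  rw [sum_add_distrib, ← mul_sum, ← mul_sum]
  refine add_le_add (mul_le_mul_of_nonneg_left ?_ hw.le) ?_
  · simp only [add_mul, sum_add_distrib, ← mul_sum]
    exact add_le_add le_rfl (mul_le_mul_of_nonneg_left (sum_norm_sq_le b _ φ) hc0)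
  · refine (mul_le_mul_of_nonneg_left hKs (by positivity)).trans_eq ?_
    field_simp

/-- The pairing with the leak is controlled by the dissipation and the top degree. -/
lemma norm_inner_leakOp_le {N : ℕ} (hN : 2 ≤ N) (ξ : Vec d) (φ x : E) {K : ℝ} (hK : 0 < K)
    (hξ : ‖ξ‖ ≤ K) {w : ℝ} (hw : 0 < w) :
    ‖inner ℂ (leakOp b N ξ φ) x‖ ≤ w * dissip b N φ + K ^ 2 / (2 * w) * ‖pOp b (N + 1) x‖ ^ 2 := by
  have h1 : inner ℂ (leakOp b N ξ φ) x = inner ℂ (leakOp b N ξ φ) (pOp b (N + 1) x) := by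
    rw [← inner_conj_symm, inner_leakOp, inner_conj_symm]
  rw [h1]
  refine (norm_inner_le_norm _ _).trans ?_
  set y := ‖pOp b (N + 1) x‖
  set l := ‖leakOp b N ξ φ‖
  have h2 : l ^ 2 ≤ (N + 1) * (‖ξ‖ ^ 2 * ‖pOp b N φ‖ ^ 2) := norm_leakOp_sq_le b N ξ φ
  have h3 : N * ‖pOp b N φ‖ ^ 2 ≤ dissip b N φ := pOp_le_dissip b le_rfl hN φ
  have hN' : (2 : ℝ) ≤ N := by exact_mod_cast hN
  have h4 : l ^ 2 ≤ 2 * K ^ 2 * dissip b N φ := by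
    have h5 : ‖ξ‖ ^ 2 ≤ K ^ 2 := pow_le_pow_left₀ (norm_nonneg _) hξ 2
    calc l ^ 2 ≤ (N + 1) * (‖ξ‖ ^ 2 * ‖pOp b N φ‖ ^ 2) := h2
      _ = ‖ξ‖ ^ 2 * ((N + 1) * ‖pOp b N φ‖ ^ 2) := by ring
      _ ≤ K ^ 2 * (2 * dissip b N φ) := by
        refine mul_le_mul h5 ?_ (by positivity) (by positivity)
        nlinarith [sq_nonneg ‖pOp b N φ‖]
      _ = _ := by ring
  have h6 : l * y ≤ w / (2 * K ^ 2) * l ^ 2 + K ^ 2 / (2 * w) * y ^ 2 := by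
    have e : w / (2 * K ^ 2) * l ^ 2 + K ^ 2 / (2 * w) * y ^ 2 - l * y =
        (w * l - K ^ 2 * y) ^ 2 / (2 * K ^ 2 * w) := by
      field_simp; ring
    have : 0 ≤ (w * l - K ^ 2 * y) ^ 2 / (2 * K ^ 2 * w) := by positivity
    linarith
  have h7 : w / (2 * K ^ 2) * l ^ 2 ≤ w * dissip b N φ := by
    refine (mul_le_mul_of_nonneg_left h4 (by positivity)).trans_eq ?_
    field_simp
  linarith

end FiberSource

/-! ### The truncated equation in frequency space -/

lemma inner_semi_eq {d : ℕ} {E : Type*} [NormedAddCommGroup E] [InnerProductSpace ℂ E]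
    [CompleteSpace E] (b : HilbertBasis (Idx d) ℂ E) (N : ℕ) (ξ : Vec d) (ψ f : E) (t : ℝ) :
    inner ℂ ψ (semi b N ξ t f) =
      inner ℂ ψ f + ∫ s in 0..t, inner ℂ (genOp b N (-ξ) ψ) (semi b N ξ s f) := by
  have h1 : ∀ s, HasDerivAt (fun s => inner ℂ ψ (semi b N ξ s f))
      (inner ℂ (genOp b N (-ξ) ψ) (semi b N ξ s f)) s := by
    intro s
    rw [← adjoint_genOp, adjoint_inner_left]
    have h := (hasDerivAt_const s ψ).inner ℂ (hasDerivAt_semi b N ξ f s)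
    simpa using h
  rw [integral_eq_sub_of_hasDerivAt (fun s _ => h1 s)
    ((Continuous.inner (𝕜 := ℂ) continuous_const
      (continuous_semi_apply b N ξ f)).intervalIntegrable _ _), semi_zero]
  ring

/-- The radial retraction onto the ball of radius `K`; it keeps the generators bounded. -/
def clamp {d : ℕ} (K : ℝ) (ξ : Vec d) : Vec d := (max 1 (‖ξ‖ / K))⁻¹ • ξ

lemma clamp_of_le {d : ℕ} {K : ℝ} (hK : 0 < K) {ξ : Vec d} (h : ‖ξ‖ ≤ K) : clamp K ξ = ξ := by
  rw [clamp, max_eq_left ((div_le_one hK).2 h), inv_one, one_smul]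

lemma norm_clamp_le {d : ℕ} {K : ℝ} (hK : 0 < K) (ξ : Vec d) : ‖clamp K ξ‖ ≤ K := by
  have h1 : 0 < max 1 (‖ξ‖ / K) := lt_max_of_lt_left one_pos
  rw [clamp, norm_smul, norm_inv, norm_of_nonneg h1.le, inv_mul_le_iff₀ h1]
  have := (div_le_iff₀ hK).1 (le_max_right 1 (‖ξ‖ / K))
  linarith

lemma continuous_clamp {d : ℕ} (K : ℝ) : Continuous (clamp K : Vec d → Vec d) := by
  refine Continuous.smul (Continuous.inv₀ (continuous_const.max (continuous_norm.div_const K))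
    fun ξ => ?_) continuous_id
  exact (lt_max_of_lt_left one_pos).ne'

lemma isFiberFlow_semi {d : ℕ} {E : Type*} [NormedAddCommGroup E] [InnerProductSpace ℂ E]
    [CompleteSpace E] (b : HilbertBasis (Idx d) ℂ E) (N : ℕ) (K : ℝ) :
    IsFiberFlow fun (k : Vec d) t => semi b N (clamp K (xi k)) (max t 0) where
  cont := by
    have hc : Continuous fun p : (Vec d × ℝ) × E => (clamp K (xi p.1.1), max p.1.2 0) :=
      ((continuous_clamp K).comp (continuous_xi.comp
        (continuous_fst.comp continuous_fst))).prodMk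
        ((continuous_snd.comp continuous_fst).max continuous_const)
    exact ((continuous_semi b N).comp hc).clm_apply continuous_snd
  bound k t x := norm_semi_le b N _ (le_max_right t 0) x

section Truncated

lemma isField_of_bound {L : Vec d → VE d →L[ℂ] VE d} (hL : Continuous L) {s : Set (Vec d)}
    (hs : MeasurableSet s) {C : ℝ} (hC : ∀ k ∈ s, ‖L k‖ ≤ C) (hC0 : 0 ≤ C) :
    IsField (s.indicator L) where
  meas x hx := isBoundedBilinearMap_apply.continuous.comp_aestronglyMeasurable
    ((hL.aestronglyMeasurable.indicator hs).prodMk hx)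
  bound := by
    refine ⟨C, fun k x => ?_⟩
    by_cases h : k ∈ s
    · rw [indicator_of_mem h]
      exact (L k).le_of_opNorm_le (hC k h) x
    · rw [indicator_of_notMem h]; simp; positivity

/-- The frequencies of size at most `K`. -/
def freqBall (d : ℕ) (K : ℝ) : Set (Vec d) := {k | ‖xi k‖ ≤ K}

lemma isCompact_freqBall (K : ℝ) : IsCompact (freqBall d K) := by
  have : freqBall d K = (fun k : Vec d => (2 * Real.pi)⁻¹ • k) '' Metric.closedBall 0 K := by
    ext k
    simp only [freqBall, xi, mem_ofPred_eq, mem_image, mem_closedBall_zero_iff]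
    constructor
    · intro h
      exact ⟨_, h, by rw [smul_smul, inv_mul_cancel₀ (by positivity), one_smul]⟩
    · rintro ⟨x, hx, rfl⟩
      rwa [smul_smul, mul_inv_cancel₀ (by positivity), one_smul]
  rw [this]
  exact (isCompact_closedBall _ _).image (by fun_prop)

lemma measurableSet_freqBall (K : ℝ) : MeasurableSet (freqBall d K) :=
  (isCompact_freqBall K).measurableSet

lemma isField_cut (K : ℝ) {L : Vec d → VE d →L[ℂ] VE d} (hL : Continuous L) :
    IsField ((freqBall d K).indicator L) := by
  obtain ⟨C, hC⟩ := (isCompact_freqBall K).exists_bound_of_continuousOn hL.continuousOn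
  exact isField_of_bound hL (measurableSet_freqBall K)
    (fun k hk => (hC k hk).trans (le_max_left C 0)) (le_max_right C 0)

/-- The operator acting by `L k` on the frequencies of size at most `K`. -/
def cutOp (K : ℝ) (L : Vec d → VE d →L[ℂ] VE d) (hL : Continuous L) :
    XX d →L[ℂ] XX d := fiberOp _ (isField_cut K hL)

lemma coeFn_cutOp (K : ℝ) {L : Vec d → VE d →L[ℂ] VE d} (hL : Continuous L) (x : XX d) :
    cutOp K L hL x =ᵐ[volume] fun k => (freqBall d K).indicator L k (x k) := coeFn_fiberOp _ x

lemma isField_comp_clamp {K : ℝ} (hK : 0 < K) {L : Vec d → VE d →L[ℂ] VE d} (hL : Continuous L) :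
    IsField fun k : Vec d => L (clamp K (xi k)) := by
  obtain ⟨C, hC⟩ := (isCompact_closedBall (0 : Vec d) K).exists_bound_of_continuousOn
    hL.continuousOn
  have h := isField_of_bound (hL.comp ((continuous_clamp K).comp continuous_xi))
    MeasurableSet.univ (C := max C 0) (fun k _ => (hC _
      (mem_closedBall_zero_iff.2 (norm_clamp_le hK _))).trans (le_max_left C 0)) (le_max_right C 0)
  rwa [indicator_univ] at h

lemma isField_gen (N : ℕ) {K : ℝ} (hK : 0 < K) :
    IsField fun k : Vec d => genOp hb N (clamp K (xi k)) :=
  isField_comp_clamp hK (continuous_genOp hb N)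

/-- The truncated generator in frequency space. -/
def genF (N : ℕ) {K : ℝ} (hK : 0 < K) : XX d →L[ℂ] XX d :=
  fiberOp _ (isField_gen N hK)

lemma adjoint_genF (N : ℕ) {K : ℝ} (hK : 0 < K) (ψ : XX d) :
    adjoint (genF N hK) ψ =ᵐ[volume] fun k => genOp hb N (-clamp K (xi k)) (ψ k) := by
  have hf : IsField fun k : Vec d => genOp hb N (-clamp K (xi k)) :=
    isField_comp_clamp hK ((continuous_genOp hb N).comp continuous_neg)
  have h : adjoint (genF N hK) ψ = fiberOp _ hf ψ := by
    refine ext_inner_right ℂ fun x => ?_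
    rw [adjoint_inner_left, inner_FL2, inner_FL2]
    refine integral_congr_ae ?_
    filter_upwards [coeFn_fiberOp hf ψ, coeFn_fiberOp (isField_gen N hK) x] with k h1 h2
    rw [h1, genF, h2, ← adjoint_genOp, adjoint_inner_left]
  rw [h]
  exact coeFn_fiberOp hf ψ

/-- The truncated semigroup in frequency space. -/
def semiF (N : ℕ) (K : ℝ) : ℝ → XX d →L[ℂ] XX d := fiberFlow (isFiberFlow_semi hb N K)

lemma inner_semiF (N : ℕ) {K : ℝ} (hK : 0 < K) (ψ f : XX d) (t : ℝ) (ht : 0 ≤ t) :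
    inner ℂ ψ (semiF N K t f) =
      inner ℂ ψ f + ∫ s in 0..t, inner ℂ (adjoint (genF N hK) ψ) (semiF N K s f) := by
  refine inner_fiberFlow _ ht ?_
  filter_upwards [adjoint_genF N hK ψ] with k hk
  rw [hk, max_eq_left ht]
  rw [inner_semi_eq]
  congr 1
  refine intervalIntegral.integral_congr fun s hs => ?_
  rw [uIcc_of_le ht] at hs
  simp only [max_eq_left hs.1]

lemma integrable_clm_J {ι : Type*} [MeasurableSpace ι] {μ : Measure ι} (F : XX d →L[ℂ] XX d)
    {g : ι → L2 d} (hg : Integrable g μ) : Integrable (fun s => F (J (g s))) μ := by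
  refine (hg.norm.const_mul ‖F‖).mono'
    ((F.continuous.comp continuous_J).comp_aestronglyMeasurable hg.1)
    (.of_forall fun s => ?_)
  simpa only [norm_J] using F.le_opNorm (J (g s))

lemma inner_clm_J_integral (F : XX d →L[ℂ] XX d) (ψ : XX d) {g : ℝ → L2 d} {t : ℝ}
    (hg : IntervalIntegrable g volume 0 t) :
    inner ℂ ψ (F (J (∫ s in 0..t, g s))) = ∫ s in 0..t, inner ℂ ψ (F (J (g s))) := by
  have h := (Jpair (adjoint F ψ)).intervalIntegral_comp_comm hg
  simp only [Jpair_apply, adjoint_inner_left] at h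
  exact h.symm

lemma intervalIntegrable_inner_clm_J (F : XX d →L[ℂ] XX d) (ψ : XX d) {g : ℝ → L2 d} {t : ℝ}
    (hg : IntervalIntegrable g volume 0 t) :
    IntervalIntegrable (fun s => inner ℂ ψ (F (J (g s)))) volume 0 t := by
  simp only [← adjoint_inner_left, ← Jpair_apply]
  exact ⟨(Jpair _).integrable_comp hg.1, (Jpair _).integrable_comp hg.2⟩

lemma continuous_symb_xi (α : Idx d) : Continuous fun k : Vec d => symb α (xi k) :=
  (continuous_symb α).comp continuous_xi

/-- The derivative of order `α`, restricted to low frequencies, composed with `T`. -/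
def symbOp (α : Idx d) (K : ℝ) (T : VE d →L[ℂ] VE d) : XX d →L[ℂ] XX d :=
  cutOp K (fun k => symb α (xi k) • T) ((continuous_symb_xi α).smul continuous_const)

/-- The derivative of order `α` of the truncated generator, restricted to low frequencies. -/
def symbGen (α : Idx d) (K : ℝ) (N : ℕ) : XX d →L[ℂ] XX d :=
  cutOp K (fun k => symb α (xi k) • (piOp hb N ∘L genOp hb (N + 1) (xi k)))
    ((continuous_symb_xi α).smul (continuous_const.clm_comp
      ((continuous_genOp hb (N + 1)).comp continuous_xi)))

lemma coeFn_symbOp (α : Idx d) (K : ℝ) (T : VE d →L[ℂ] VE d) (x : XX d) :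
    ∀ᵐ k, symbOp α K T x k = (freqBall d K).indicator (fun k => symb α (xi k) • T (x k)) k := by
  filter_upwards [coeFn_cutOp K (L := fun k => symb α (xi k) • T)
    ((continuous_symb_xi α).smul continuous_const) x] with k hk
  rw [symbOp, hk]
  by_cases h : k ∈ freqBall d K <;> simp [h]

lemma coeFn_symbGen (α : Idx d) (K : ℝ) (N : ℕ) (x : XX d) :
    ∀ᵐ k, symbGen α K N x k = (freqBall d K).indicator
      (fun k => symb α (xi k) • piOp hb N (genOp hb (N + 1) (xi k) (x k))) k := by
  filter_upwards [coeFn_cutOp K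
    (L := fun k => symb α (xi k) • (piOp hb N ∘L genOp hb (N + 1) (xi k)))
    ((continuous_symb_xi α).smul (continuous_const.clm_comp
      ((continuous_genOp hb (N + 1)).comp continuous_xi))) x] with k hk
  rw [symbGen, hk]
  by_cases h : k ∈ freqBall d K <;> simp [h]

/-- An operator on the velocity space acting on the low frequencies. -/
def lowF (K : ℝ) (T : VE d →L[ℂ] VE d) : XX d →L[ℂ] XX d :=
  cutOp K (fun _ => T) continuous_const

/-- The source of the truncated equation. -/
def srcF (α : Idx d) (K : ℝ) (N : ℕ) (g₀ : L2 d) (g : Fin d → L2 d) : XX d :=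
  ((-1) ^ deg α : ℂ) • (lowF K (piOp hb N) (J g₀) + ∑ i, lowF K (srcOp hb N i) (J (g i)))

lemma coeFn_sum {ι : Type*} (s : Finset ι) (x : ι → XX d) :
    ∀ᵐ k, (∑ i ∈ s, x i : XX d) k = ∑ i ∈ s, x i k := by
  classical
  induction s using Finset.induction_on with
  | empty =>
    simp only [Finset.sum_empty]
    exact Lp.coeFn_zero _ _ _
  | insert i s hi ih =>
    rw [sum_insert hi]
    filter_upwards [ih, Lp.coeFn_add (x i) (∑ i ∈ s, x i)] with k h1 h2
    rw [h2, Pi.add_apply, h1, sum_insert hi]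

lemma coeFn_srcF (α : Idx d) (K : ℝ) (N : ℕ) (g₀ : L2 d) (g : Fin d → L2 d) :
    ∀ᵐ k, srcF α K N g₀ g k = (freqBall d K).indicator (fun k => ((-1) ^ deg α : ℂ) •
      (piOp hb N (J g₀ k) + ∑ i, srcOp hb N i (J (g i) k))) k := by
  have h2 : ∀ᵐ k, ∀ i, lowF K (srcOp hb N i) (J (g i)) k =
      (freqBall d K).indicator (fun _ => srcOp hb N i) k (J (g i) k) :=
    ae_all_iff.2 fun i => coeFn_cutOp K continuous_const _
  filter_upwards [Lp.coeFn_smul ((-1) ^ deg α : ℂ) (lowF K (piOp hb N) (J g₀) + _), Lp.coeFn_add (lowF K (piOp hb N) (J g₀)) _,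
    coeFn_sum Finset.univ fun i => lowF K (srcOp hb N i) (J (g i)), h2,
    coeFn_cutOp K (L := fun _ => piOp hb N) continuous_const (J g₀)] with k h1 h3 h4 h2 h5
  rw [srcF, h1, Pi.smul_apply, h3, Pi.add_apply, h4, lowF, h5]
  simp only [h2]
  by_cases hk : k ∈ freqBall d K <;> simp [hk]

lemma integrable_srcF (α : Idx d) (K : ℝ) (N : ℕ) {μ : Measure ℝ} {G₀ : ℝ → L2 d}
    {G : Fin d → ℝ → L2 d} (h₀ : Integrable G₀ μ) (h₁ : ∀ i, Integrable (G i) μ) :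
    Integrable (fun s => srcF α K N (G₀ s) fun i => G i s) μ :=
  ((integrable_clm_J _ h₀).add (integrable_finsetSum _ fun i _ =>
    integrable_clm_J _ (h₁ i))).smul ((-1) ^ deg α : ℂ)

variable (α : Idx d)

/-- The source of the truncated equation including the leak from higher degrees. -/
def leakSrc (K : ℝ) (hK : 0 < K) (N : ℕ) (w g₀ : L2 d) (g : Fin d → L2 d) : XX d :=
  symbGen α K N (J w) - genF N hK (symbOp α K (piOp hb N) (J w)) + srcF α K N g₀ g

/-- The truncated equation. -/
lemma truncated_weak {K : ℝ} (hK : 0 < K) (N : ℕ) {u G₀ : ℝ → L2 d} {G : Fin d → ℝ → L2 d}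
    {T : ℝ} (h : IsDerivSol α T u G₀ G) (ψ : XX d) {t : ℝ} (ht : t ∈ Icc 0 T) :
    inner ℂ ψ (symbOp α K (piOp hb N) (J (u t))) =
      (∫ s in 0..t, inner ℂ (adjoint (genF N hK) ψ) (symbOp α K (piOp hb N) (J (u s)))) +
      ∫ s in 0..t, inner ℂ ψ (leakSrc α K hK N (u s) (G₀ s) fun i => G i s) := by
  obtain ⟨huI, h₀, h₁⟩ := h.intervalIntegrable ht
  have key : symbOp α K (piOp hb N) (J (u t)) =
      symbGen α K N (J (∫ s in 0..t, u s)) +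
        srcF α K N (∫ s in 0..t, G₀ s) (fun i => ∫ s in 0..t, G i s) := by
    refine Lp.ext ?_
    filter_upwards [coefficient_weak h ht, Lp.coeFn_add (symbGen α K N (J (∫ s in 0..t, u s))) _,
      coeFn_srcF α K N (∫ s in 0..t, G₀ s) _, coeFn_symbOp α K (piOp hb N) (J (u t)),
      coeFn_symbGen α K N (J (∫ s in 0..t, u s))] with k h1 h2 h3 h4 h5
    rw [h2, Pi.add_apply, h3, h4, h5]
    by_cases hk : k ∈ freqBall d K
    · simp only [indicator_of_mem hk]
      refine ext_inner_hb fun n => ?_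
      rw [inner_add_right, inner_smul_right, inner_smul_right, inner_smul_right,
        inner_basis_piOp_genOp, inner_add_right, inner_sum]
      simp only [inner_basis_srcOp]
      rw [piOp, inner_basis_diagOp, inner_basis_diagOp]
      simp only [mem_lev]
      have hs : ((-1 : ℂ) ^ deg α) * (-1) ^ deg α = 1 := by rw [← mul_pow]; simp
      by_cases hn : deg n ≤ N
      · simp only [hn, if_true]
        have h1 := h1 n
        simp only [co, vco] at h1
        push_cast
        linear_combination (-1) ^ deg α * h1 + (symb α (xi k) *
          (inner ℂ (fullGen hb (-xi k) n) (J (∫ s in 0..t, u s) k) -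
            inner ℂ (hb n) (J (u t) k))) * hs
      · simp [hn]
    · simp only [indicator_of_notMem hk]; simp
  have hA : ∀ s, inner ℂ ψ (leakSrc α K hK N (u s) (G₀ s) fun i => G i s) =
      (inner ℂ ψ (symbGen α K N (J (u s))) -
        inner ℂ ψ ((genF N hK ∘L symbOp α K (piOp hb N)) (J (u s)))) +
      inner ℂ ψ (srcF α K N (G₀ s) fun i => G i s) := fun s => by
    rw [leakSrc, inner_add_right, inner_sub_right]; rfl
  have hB : ∀ s, inner ℂ (adjoint (genF N hK) ψ) (symbOp α K (piOp hb N) (J (u s))) =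
      inner ℂ ψ ((genF N hK ∘L symbOp α K (piOp hb N)) (J (u s))) := fun s => by
    rw [adjoint_inner_left]; rfl
  have hsrc : ∀ g₀ (g : Fin d → L2 d), inner ℂ ψ (srcF α K N g₀ g) = (-1) ^ deg α *
      (inner ℂ ψ (lowF K (piOp hb N) (J g₀)) +
        ∑ i, inner ℂ ψ (lowF K (srcOp hb N i) (J (g i)))) := fun g₀ g => by
    rw [srcF, inner_smul_right, inner_add_right, inner_sum]
  have hi0 := intervalIntegrable_inner_clm_J (lowF K (piOp hb N)) ψ h₀
  have hi1 := fun i => intervalIntegrable_inner_clm_J (lowF K (srcOp hb N i)) ψ (h₁ i)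
  have hi2 : IntervalIntegrable (fun s => ∑ i, inner ℂ ψ (lowF K (srcOp hb N i) (J (G i s))))
      volume 0 t := by
    have := IntervalIntegrable.sum (f := fun i s => inner ℂ ψ (lowF K (srcOp hb N i) (J (G i s))))
      Finset.univ fun i _ => hi1 i
    simpa only [Finset.sum_fn] using this
  have hi3 := intervalIntegrable_inner_clm_J (symbGen α K N) ψ huI
  have hi4 := intervalIntegrable_inner_clm_J (genF N hK ∘L symbOp α K (piOp hb N)) ψ huI
  rw [key]
  simp only [hA, hB, hsrc]
  rw [inner_add_right, inner_clm_J_integral _ _ huI, hsrc, inner_clm_J_integral _ _ h₀,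
    sum_congr rfl fun i _ => inner_clm_J_integral _ _ (h₁ i),
    intervalIntegral.integral_add (hi3.sub hi4) ((hi0.add hi2).const_mul _),
    intervalIntegral.integral_sub hi3 hi4, intervalIntegral.integral_const_mul,
    intervalIntegral.integral_add hi0 hi2, intervalIntegral.integral_finsetSum fun i _ => hi1 i]
  ring

end Truncated

/-! ### The a priori estimate -/

section FiberEnergy

variable {E : Type*} [NormedAddCommGroup E] [InnerProductSpace ℂ E] [CompleteSpace E]
variable (b : HilbertBasis (Idx d) ℂ E)

/-- The exponentially weighted dissipation of the backward semigroup. -/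
def enF (N : ℕ) (c : ℝ) (ξ : Vec d) (τ : ℝ) (f : E) : ℝ :=
  exp (rate ξ / 12 * τ) *
    (dissip b N (semi b N (-ξ) τ f) + c * ‖semi b N (-ξ) τ f‖ ^ 2)

lemma rate_neg (ξ : Vec d) : rate (-ξ) = rate ξ := by simp [rate]

lemma continuous_rate : Continuous (rate : Vec d → ℝ) := by
  unfold rate
  exact Continuous.div (by fun_prop) (by fun_prop) fun ξ => by positivity

lemma enF_nonneg (N : ℕ) {c : ℝ} (hc : 0 ≤ c) (ξ : Vec d) (τ : ℝ) (f : E) : 0 ≤ enF b N c ξ τ f :=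
  mul_nonneg (exp_nonneg _) (add_nonneg (dissip_nonneg b _ _) (by positivity))

lemma continuous_enF (N : ℕ) (c : ℝ) :
    Continuous fun p : (Vec d × ℝ) × E => enF b N c p.1.1 p.1.2 p.2 := by
  have h : Continuous fun p : (Vec d × ℝ) × E => semi b N (-p.1.1) p.1.2 p.2 := by
    have hc : Continuous fun p : (Vec d × ℝ) × E => (-p.1.1, p.1.2) := by fun_prop
    exact ((continuous_semi b N).comp hc).clm_apply continuous_snd
  have hr : Continuous fun p : (Vec d × ℝ) × E => rate p.1.1 :=
    continuous_rate.comp (continuous_fst.comp continuous_fst)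
  unfold enF
  exact (continuous_exp.comp ((hr.div_const 12).mul (by fun_prop))).mul
    (((continuous_dissip b N).comp h).add (continuous_const.mul (h.norm.pow 2)))

lemma dissip_le (N : ℕ) (f : E) : dissip b N f ≤ N * ‖f‖ ^ 2 := by
  refine le_trans (sum_le_sum fun n hn => ?_) ((mul_sum _ _ _).symm.le.trans
    (mul_le_mul_of_nonneg_left (sum_norm_sq_le b (lev d N) f) (Nat.cast_nonneg N)))
  refine mul_le_mul_of_nonneg_right ?_ (sq_nonneg _)
  have : (deg n : ℝ) ≤ N := by exact_mod_cast mem_lev.1 hn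
  unfold lam
  split_ifs
  · positivity
  · exact this

lemma enF_le (N : ℕ) {c : ℝ} (hc : 0 ≤ c) (ξ : Vec d) {τ T : ℝ} (hτ : 0 ≤ τ) (hT : τ ≤ T) (f : E) :
    enF b N c ξ τ f ≤ exp (T / 12) * (N + c) * ‖f‖ ^ 2 := by
  have h1 : rate ξ / 12 * τ ≤ T / 12 := by
    have := mul_le_mul (rate_le_one ξ) hT hτ zero_le_one
    linarith
  have h2 : ‖semi b N (-ξ) τ f‖ ^ 2 ≤ ‖f‖ ^ 2 :=
    pow_le_pow_left₀ (norm_nonneg _) (norm_semi_le b N (-ξ) hτ f) 2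
  have h3 := dissip_le b N (semi b N (-ξ) τ f)
  rw [mul_assoc]
  refine mul_le_mul (exp_le_exp.2 h1) ?_ (add_nonneg (dissip_nonneg b _ _) (by positivity))
    (exp_nonneg _)
  have h4 := mul_le_mul_of_nonneg_left h2 (add_nonneg (Nat.cast_nonneg N : (0 : ℝ) ≤ N) hc)
  linarith

lemma integral_enF_le {N : ℕ} (hN : 3 ≤ N) {c : ℝ} (hc : 0 ≤ c) (ξ : Vec d) {T : ℝ} (hT : 0 ≤ T)
    {f : E} (hf : piOp b N f = f) :
    ∫ s in 0..T, enF b N c ξ s f ≤ (12 / 5 + 3 / 2 * c * T) * ‖f‖ ^ 2 := by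
  have hs := continuous_semi_apply b N (-ξ) f
  have he : Continuous fun s : ℝ => exp (rate ξ / 12 * s) := by fun_prop
  have h1 : Continuous fun s => exp (rate ξ / 12 * s) * dissip b N (semi b N (-ξ) s f) :=
    he.mul ((continuous_dissip b N).comp hs)
  have h2 : Continuous fun s => exp (rate ξ / 12 * s) * (c * ‖semi b N (-ξ) s f‖ ^ 2) :=
    he.mul (continuous_const.mul (hs.norm.pow 2))
  simp only [enF, mul_add]
  rw [intervalIntegral.integral_add (h1.intervalIntegrable _ _) (h2.intervalIntegrable _ _)]
  have h3 := integral_exp_dissip_semi_le b hN (-ξ) hT hf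
  rw [rate_neg] at h3
  have h4 : ∫ s in 0..T, exp (rate ξ / 12 * s) * (c * ‖semi b N (-ξ) s f‖ ^ 2) ≤
      ∫ _s in 0..T, 3 / 2 * c * ‖f‖ ^ 2 := by
    refine intervalIntegral.integral_mono_on hT (h2.intervalIntegrable _ _)
      (continuous_const.intervalIntegrable _ _) fun s hs => ?_
    have h5 := norm_semi_sq_le b hN (-ξ) hs.1 hf
    rw [rate_neg] at h5
    have h6 : exp (rate ξ / 12 * s) * exp (-(rate ξ / 12 * s)) = 1 := by
      rw [← exp_add]; simp
    calc _ ≤ exp (rate ξ / 12 * s) *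
          (c * (3 / 2 * exp (-(rate ξ / 12 * s)) * ‖f‖ ^ 2)) := by gcongr
      _ = 3 / 2 * c * ‖f‖ ^ 2 * (exp (rate ξ / 12 * s) * exp (-(rate ξ / 12 * s))) := by
        ring
      _ = _ := by rw [h6, mul_one]
  rw [intervalIntegral.integral_const, smul_eq_mul, sub_zero] at h4
  nlinarith

/-- The source and the leak on one fiber, paired with the backward semigroup. -/
lemma norm_inner_semi_src_le {N : ℕ} (hN : 2 ≤ N) {ξ : Vec d} {K : ℝ} (hK : 0 < K) (hξ : ‖ξ‖ ≤ K)
    {c a : ℝ} (hc0 : 0 ≤ c) (ha : 0 < a) {τ : ℝ} (hτ : 0 ≤ τ) (ψ x g₀ : E) (g : Fin d → E)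
    (hc : 1 ≤ c ∨ ∀ n, deg n ≤ 1 → srcCo b g₀ g n = 0) {ε : ℂ} (hε : ‖ε‖ = 1) :
    ‖inner ℂ ψ (semi b N ξ τ (piOp b N (genOp b (N + 1) ξ x) - genOp b N ξ (piOp b N x) +
        ε • (piOp b N g₀ + ∑ i, srcOp b N i (g i))))‖ ≤
      2 * a * enF b N c ξ τ ψ + K ^ 2 / (2 * a) * ‖pOp b (N + 1) x‖ ^ 2 +
        (2 * d + 1) / a * (exp (-(rate ξ / 12 * τ)) * (‖g₀‖ ^ 2 + ∑ i, ‖g i‖ ^ 2)) := by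
  set e := exp (rate ξ / 12 * τ) with he
  have he1 : 1 ≤ e := Real.one_le_exp (mul_nonneg (div_nonneg (rate_nonneg ξ) (by norm_num)) hτ)
  have he0 : 0 < e := exp_pos _
  rw [← adjoint_inner_left, adjoint_semi]
  set φ := semi b N (-ξ) τ ψ with hφ
  rw [inner_add_right, inner_sub_right, inner_piOp_genOp, add_sub_cancel_left, inner_smul_right]
  have hae : 0 < a * e := mul_pos ha he0
  have h1 := norm_inner_leakOp_le b hN (-ξ) φ x hK (by rwa [norm_neg]) hae
  have h2 := norm_inner_src_le b (N := N) (φ := φ) hc0 hc hae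
  have h3 : K ^ 2 / (2 * (a * e)) ≤ K ^ 2 / (2 * a) :=
    div_le_div_of_nonneg_left (by positivity) (by positivity)
      (by nlinarith)
  have h4 : (2 * d + 1) / (a * e) = (2 * d + 1) / a * exp (-(rate ξ / 12 * τ)) := by
    rw [Real.exp_neg, ← he]; field_simp
  refine (norm_add_le _ _).trans ?_
  rw [norm_mul, hε, one_mul]
  have h5 := mul_le_mul_of_nonneg_right h3 (sq_nonneg ‖pOp b (N + 1) x‖)
  rw [h4] at h2
  have h6 : 2 * a * enF b N c ξ τ ψ = a * e * dissip b N φ +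
      a * e * (dissip b N φ + c * ‖φ‖ ^ 2) + a * e * (c * ‖φ‖ ^ 2) := by
    rw [enF]; ring
  have h7 : 0 ≤ a * e * (c * ‖φ‖ ^ 2) := by positivity
  rw [h6]
  linarith



lemma aestronglyMeasurable_enF {ι : Type*} [TopologicalSpace ι] [MeasurableSpace ι]
    [OpensMeasurableSpace ι] [SecondCountableTopology ι] {μ : Measure ι}
    (N : ℕ) (c K : ℝ) {τ : ι → ℝ} (hτ : Continuous τ) {κ : ι → Vec d} (hκ : Continuous κ)
    {f : ι → E} (hf : AEStronglyMeasurable f μ) :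
    AEStronglyMeasurable (fun i => enF b N c (clamp K (xi (κ i))) (τ i) (f i)) μ := by
  have h := (continuous_enF b N c).comp_aestronglyMeasurable
    ((((continuous_clamp K).comp (continuous_xi.comp hκ)).prodMk hτ).aestronglyMeasurable.prodMk hf)
  exact h

end FiberEnergy

lemma symbOp_apply_id (α : Idx d) (K : ℝ) (P : VE d →L[ℂ] VE d) (x : XX d) :
    ∀ᵐ k, symbOp α K P x k = P (symbOp α K 1 x k) := by
  filter_upwards [coeFn_symbOp α K P x, coeFn_symbOp α K 1 x]
    with k h1 h2
  rw [h1, h2]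
  by_cases h : k ∈ freqBall d K <;> simp [h]

lemma tendsto_norm_symbOp (α : Idx d) (K : ℝ) {P : ℕ → VE d →L[ℂ] VE d} {Q : VE d →L[ℂ] VE d}
    (hP : ∀ N f, ‖P N f‖ ≤ ‖f‖) (h : ∀ f, Tendsto (fun N => ‖P N f‖) atTop (𝓝 ‖Q f‖)) (x : XX d) :
    Tendsto (fun N => ‖symbOp α K (P N) x‖ ^ 2) atTop (𝓝 (‖symbOp α K Q x‖ ^ 2)) := by
  set z := symbOp α K 1 x with hz
  have hn : ∀ R : VE d →L[ℂ] VE d, ‖symbOp α K R x‖ ^ 2 = ∫ k, ‖R (z k)‖ ^ 2 := fun R => by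
    rw [Lp.norm_sq_eq]
    exact integral_congr_ae ((symbOp_apply_id α K R x).mono fun k hk => by dsimp only; rw [hk])
  simp only [hn]
  refine tendsto_integral_of_dominated_convergence (fun k => ‖z k‖ ^ 2) (fun N => ?_)
    (Lp.integrable_norm_sq z) (fun N => .of_forall fun k => ?_)
    (.of_forall fun k => (h (z k)).pow 2)
  · exact (((P N).continuous.comp_aestronglyMeasurable (Lp.aestronglyMeasurable z)).norm).pow 2
  · rw [norm_of_nonneg (by positivity)]
    exact pow_le_pow_left₀ (norm_nonneg _) (hP N _) 2



lemma norm_symbOp_le (α : Idx d) (K : ℝ) {P : VE d →L[ℂ] VE d} (hP : ∀ f, ‖P f‖ ≤ ‖f‖)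
    (x : XX d) : ‖symbOp α K P x‖ ≤ ‖symbOp α K 1 x‖ := by
  refine Lp.norm_le_norm_of_ae_le ?_
  filter_upwards [symbOp_apply_id α K P x] with k hk
  rw [hk]; exact hP _

lemma integrable_enF (N : ℕ) {c : ℝ} (hc : 0 ≤ c) (K : ℝ) {τ : ℝ} (hτ : 0 ≤ τ) (ψ : XX d) :
    Integrable fun k => enF hb N c (clamp K (xi k)) τ (ψ k) := by
  refine ((Lp.integrable_norm_sq ψ).const_mul (exp (τ / 12) * (N + c))).mono'
    (aestronglyMeasurable_enF hb N c K (by fun_prop) (by fun_prop) (Lp.aestronglyMeasurable ψ))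
    (.of_forall fun k => ?_)
  rw [norm_of_nonneg (enF_nonneg hb N hc _ _ _)]
  exact enF_le hb N hc _ hτ le_rfl _

lemma integrable_enF_prod (N : ℕ) {c : ℝ} (hc : 0 ≤ c) (K : ℝ) {T : ℝ} (ψ : XX d) :
    Integrable (fun p : ℝ × Vec d => enF hb N c (clamp K (xi p.2)) (T - p.1) (ψ p.2))
      ((volume.restrict (Ioc 0 T)).prod volume) := by
  have h1 : Integrable (fun p : ℝ × Vec d => ‖ψ p.2‖ ^ 2)
      ((volume.restrict (Ioc 0 T)).prod volume) := (Lp.integrable_norm_sq ψ).comp_snd _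
  have h2 : ∀ᵐ p : ℝ × Vec d ∂((volume.restrict (Ioc 0 T)).prod volume), p.1 ∈ Ioc 0 T :=
    Measure.quasiMeasurePreserving_fst.ae (ae_restrict_mem measurableSet_Ioc)
  refine (h1.const_mul (exp (T / 12) * (N + c))).mono'
    (aestronglyMeasurable_enF hb N c K (by fun_prop) continuous_snd
      (Lp.aestronglyMeasurable ψ).comp_snd) ?_
  filter_upwards [h2] with p hp
  rw [norm_of_nonneg (enF_nonneg hb N hc _ _ _)]
  exact enF_le hb N hc _ (by linarith [hp.2]) (by linarith [hp.1]) _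

lemma integral_integral_enF_le {N : ℕ} (hN : 3 ≤ N) {c : ℝ} (hc : 0 ≤ c) (K : ℝ) {T : ℝ}
    (hT : 0 ≤ T) {ψ : XX d} (hψ : ∀ᵐ k, piOp hb N (ψ k) = ψ k) :
    ∫ s in Ioc 0 T, ∫ k, enF hb N c (clamp K (xi k)) (T - s) (ψ k) ≤
      (12 / 5 + 3 / 2 * c * T) * ‖ψ‖ ^ 2 := by
  rw [integral_integral_swap (integrable_enF_prod N hc K ψ), Lp.norm_sq_eq, ← integral_const_mul]
  refine integral_mono_ae (integrable_enF_prod N hc K ψ).integral_prod_right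
    ((Lp.integrable_norm_sq ψ).const_mul _) ?_
  filter_upwards [hψ] with k hk
  have h := integral_enF_le hb hN hc (clamp K (xi k)) hT hk
  rw [← integral_of_le hT,
    intervalIntegral.integral_comp_sub_left (fun s => enF hb N c (clamp K (xi k)) s (ψ k)) T]
  simpa using h

/-- The squared size of the source at time `s`, as seen at time `s + τ`. -/
def srcSize (τ : ℝ) (g₀ : L2 d) (g : Fin d → L2 d) : ℝ :=
  ∫ k, exp (-(rate (xi k) / 12 * τ)) * (‖J g₀ k‖ ^ 2 + ∑ i, ‖J (g i) k‖ ^ 2)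

lemma exp_rate_le_one {τ : ℝ} (hτ : 0 ≤ τ) (ξ : Vec d) : exp (-(rate ξ / 12 * τ)) ≤ 1 := by
  have := rate_nonneg ξ
  exact exp_le_one_iff.2 (neg_nonpos.2 (by positivity))

lemma integrable_exp_rate {τ : ℝ} (hτ : 0 ≤ τ) (x : XX d) :
    Integrable fun k => exp (-(rate (xi k) / 12 * τ)) * ‖x k‖ ^ 2 := by
  refine (Lp.integrable_norm_sq x).bdd_mul (c := 1) ?_ (.of_forall fun k => ?_)
  · exact (continuous_exp.comp (((continuous_rate.comp continuous_xi).div_const 12).mul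
      continuous_const).neg).aestronglyMeasurable
  · rw [norm_of_nonneg (exp_nonneg _)]
    exact exp_rate_le_one hτ _

lemma integrable_srcSize {τ : ℝ} (hτ : 0 ≤ τ) (g₀ : L2 d) (g : Fin d → L2 d) :
    Integrable fun k => exp (-(rate (xi k) / 12 * τ)) * (‖J g₀ k‖ ^ 2 + ∑ i, ‖J (g i) k‖ ^ 2) := by
  simp only [mul_add, mul_sum]
  exact (integrable_exp_rate hτ _).add (integrable_finsetSum _ fun i _ => integrable_exp_rate hτ _)

lemma srcSize_eq {τ : ℝ} (hτ : 0 ≤ τ) (g₀ : L2 d) (g : Fin d → L2 d) :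
    srcSize τ g₀ g = (∫ k, exp (-(rate (xi k) / 12 * τ)) * ‖J g₀ k‖ ^ 2) +
      ∑ i, ∫ k, exp (-(rate (xi k) / 12 * τ)) * ‖J (g i) k‖ ^ 2 := by
  rw [← integral_finsetSum _ fun i _ => integrable_exp_rate hτ _,
    ← integral_add (integrable_exp_rate hτ _)
      (integrable_finsetSum _ fun i _ => integrable_exp_rate hτ _), srcSize]
  simp only [mul_add, mul_sum]

lemma norm_inner_leakSrc_le (α : Idx d) {N : ℕ} (hN : 2 ≤ N) {K : ℝ} (hK : 0 < K)
    {c a : ℝ} (hc0 : 0 ≤ c) (ha : 0 < a) {τ : ℝ} (hτ : 0 ≤ τ) (ψ : XX d) (w g₀ : L2 d)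
    (g : Fin d → L2 d) (hc : ∀ᵐ k, 1 ≤ c ∨ ∀ n, deg n ≤ 1 →
      srcCo hb (J g₀ k) (fun i => J (g i) k) n = 0) :
    ‖inner ℂ ψ (semiF N K τ (leakSrc α K hK N w g₀ g))‖ ≤
      2 * a * (∫ k, enF hb N c (clamp K (xi k)) τ (ψ k)) +
        K ^ 2 / (2 * a) * ‖symbOp α K (pOp hb (N + 1)) (J w)‖ ^ 2 +
        (2 * d + 1) / a * srcSize τ g₀ g := by
  have i1 := (integrable_enF N hc0 K hτ ψ).const_mul (2 * a)
  have i2 := (Lp.integrable_norm_sq (symbOp α K (pOp hb (N + 1)) (J w))).const_mul (K ^ 2 / (2 * a))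
  have i3 := (integrable_srcSize hτ g₀ g).const_mul ((2 * d + 1) / a)
  rw [srcSize, Lp.norm_sq_eq, ← integral_const_mul, ← integral_const_mul, ← integral_const_mul,
    ← integral_add i1 i2]
  have i12 := i1.add i2
  simp only [Pi.add_def] at i12
  rw [← integral_add i12 i3, inner_FL2]
  refine norm_integral_le_of_norm_le (i12.add i3) ?_
  filter_upwards [hc, coeFn_fiberFlow (isFiberFlow_semi hb N K) τ (leakSrc α K hK N w g₀ g),
    Lp.coeFn_add (symbGen α K N (J w) - genF N hK (symbOp α K (piOp hb N) (J w))) (srcF α K N g₀ g),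
    Lp.coeFn_sub (symbGen α K N (J w)) _,
    coeFn_symbGen α K N (J w), coeFn_fiberOp (isField_gen N hK) (symbOp α K (piOp hb N) (J w)),
    coeFn_symbOp α K (piOp hb N) (J w), coeFn_symbOp α K (pOp hb (N + 1)) (J w),
    coeFn_srcF α K N g₀ g] with k hc h1 h2 h3 h4 h5 h6 h7 h8
  have hnn1 := enF_nonneg hb N hc0 (clamp K (xi k)) τ (ψ k)
  rw [semiF, h1, max_eq_left hτ, leakSrc, h2, Pi.add_apply, h3, Pi.sub_apply, h4, genF, h5, h6, h7, h8]
  by_cases hk : k ∈ freqBall d K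
  · have := norm_inner_semi_src_le hb hN hK hk hc0 ha hτ (ψ k) (symb α (xi k) • J w k) (J g₀ k)
      (fun i => J (g i) k) hc (ε := (-1) ^ deg α) (by simp)
    simpa only [indicator_of_mem hk, clamp_of_le hK hk, map_smul] using this
  · simp only [indicator_of_notMem hk, map_zero, sub_zero, add_zero, inner_zero_right, norm_zero]
    positivity

lemma integrableOn_norm_symbOp {u : ℝ → L2 d} (hu : ContinuousOn u (Ici 0)) (α : Idx d) (K : ℝ)
    (P : VE d →L[ℂ] VE d) (T : ℝ) :
    IntegrableOn (fun s => ‖symbOp α K P (J (u s))‖ ^ 2) (Ioc 0 T) :=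
  ((((symbOp α K P).continuous.comp continuous_J).comp_continuousOn
    (hu.mono Icc_subset_Ici_self)).norm.pow 2).integrableOn_Icc.mono_set Ioc_subset_Icc_self

section Source

variable {α : Idx d} {u G₀ : ℝ → L2 d} {G : Fin d → ℝ → L2 d} {T : ℝ}

/-- Duhamel's formula for the truncated equation. -/
lemma inner_symbOp_eq (hT : 0 ≤ T) (h : IsDerivSol α T u G₀ G) {K : ℝ} (hK : 0 < K) (N : ℕ)
    (ψ : XX d) :
    inner ℂ ψ (symbOp α K (piOp hb N) (J (u T))) = ∫ s in 0..T,
      inner ℂ ψ (semiF N K (T - s) (leakSrc α K hK N (u s) (G₀ s) fun i => G i s)) := by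
  have hu : ContinuousOn u (Icc 0 T) := h.cont.mono Icc_subset_Ici_self
  have huI : IntegrableOn u (Ioc 0 T) := hu.integrableOn_Icc.mono_set Ioc_subset_Icc_self
  exact eq_duhamel (A := genF N hK) (S := semiF N K)
    (isContraction_fiberFlow (isFiberFlow_semi hb N K)) (inner_semiF N hK) hT
    (((symbOp α K (piOp hb N)).continuous.comp continuous_J).comp_continuousOn hu)
    (((integrable_clm_J (symbGen α K N) huI).sub
      (integrable_clm_J (genF N hK ∘L symbOp α K (piOp hb N)) huI)).add
      (integrable_srcF α K N h.int₀ h.int₁))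
    (fun ψ' t ht => truncated_weak α hK N h ψ' ht) ψ

/-- `q` bounds the squared size of the source at time `T`; the parameter `c` is at least one unless
the source has no components of degree at most one. -/
structure SrcBound (T c : ℝ) (G₀ : ℝ → L2 d) (G : Fin d → ℝ → L2 d) (q : ℝ → ℝ) : Prop where
  nonneg : 0 ≤ c
  alt : ∀ᵐ s ∂volume.restrict (Ioc 0 T), ∀ᵐ k, 1 ≤ c ∨ ∀ n, deg n ≤ 1 →
    srcCo hb (J (G₀ s) k) (fun i => J (G i s) k) n = 0
  int : IntegrableOn q (Ioc 0 T)
  le : ∀ᵐ s ∂volume.restrict (Ioc 0 T), srcSize (T - s) (G₀ s) (fun i => G i s) ≤ q s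

variable {c : ℝ} {q : ℝ → ℝ}

/-- The energy estimate for the truncated equation, by pairing with the backward semigroup started
from the solution at time `T`. The first term on the right is absorbed for small `a`, the leak term
vanishes as `N → ∞`. -/
lemma norm_symbOp_piOp_sq_le (hT : 0 ≤ T) (h : IsDerivSol α T u G₀ G) (hq : SrcBound T c G₀ G q)
    {K : ℝ} (hK : 0 < K) {a : ℝ} (ha0 : 0 < a) {N : ℕ} (hN : 3 ≤ N) :
    ‖symbOp α K (piOp hb N) (J (u T))‖ ^ 2 ≤
      2 * a * ((12 / 5 + 3 / 2 * c * T) * ‖symbOp α K (piOp hb N) (J (u T))‖ ^ 2) +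
      K ^ 2 / (2 * a) * (∫ s in Ioc 0 T, ‖symbOp α K (pOp hb (N + 1)) (J (u s))‖ ^ 2) +
      (2 * d + 1) / a * ∫ s in Ioc 0 T, q s := by
  set e : ℝ → ℝ := fun s => ‖symbOp α K (pOp hb (N + 1)) (J (u s))‖ ^ 2
  have hei : IntegrableOn e (Ioc 0 T) := integrableOn_norm_symbOp h.cont α K _ T
  set ψ := symbOp α K (piOp hb N) (J (u T)) with hψ
  have hψN : ∀ᵐ k, piOp hb N (ψ k) = ψ k := by
    filter_upwards [symbOp_apply_id α K (piOp hb N) (J (u T))] with k hk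
    rw [hψ, hk, piOp_piOp]
  have hAn : ‖ψ‖ ^ 2 = ‖inner ℂ ψ (symbOp α K (piOp hb N) (J (u T)))‖ := by
    rw [← hψ, inner_self_ofReal, norm_real, norm_of_nonneg (by positivity)]
  have hiE := (integrable_enF_prod (T := T) N hq.nonneg K ψ).integral_prod_left
  have hbound : ‖ψ‖ ^ 2 ≤ ∫ s in Ioc 0 T,
      (2 * a * (∫ k, enF hb N c (clamp K (xi k)) (T - s) (ψ k)) +
        K ^ 2 / (2 * a) * e s + (2 * d + 1) / a * q s) := by
    rw [hAn, inner_symbOp_eq hT h hK N ψ, integral_of_le hT]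
    refine norm_integral_le_of_norm_le
      (((hiE.const_mul _).add (hei.const_mul _)).add (hq.int.const_mul _)) ?_
    filter_upwards [hq.alt, hq.le, ae_restrict_mem measurableSet_Ioc] with s hcs hqs hs
    refine (norm_inner_leakSrc_le α (by omega) hK hq.nonneg ha0 (sub_nonneg.2 hs.2) ψ (u s) (G₀ s)
      (fun i => G i s) hcs).trans ?_
    exact add_le_add le_rfl (mul_le_mul_of_nonneg_left hqs (by positivity))
  have j12 := (hiE.const_mul (2 * a)).add (hei.const_mul (K ^ 2 / (2 * a)))
  simp only [Pi.add_def] at j12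
  rw [integral_add j12 (hq.int.const_mul _), integral_add (hiE.const_mul _) (hei.const_mul _),
    integral_const_mul, integral_const_mul, integral_const_mul] at hbound
  refine hbound.trans ?_
  have hE := integral_integral_enF_le hN hq.nonneg K hT hψN
  gcongr

/-- The a priori estimate at low frequencies. -/
lemma norm_symbOp_sq_le (hT : 0 ≤ T) (h : IsDerivSol α T u G₀ G) (hq : SrcBound T c G₀ G q)
    {K : ℝ} (hK : 0 < K) :
    ‖symbOp α K 1 (J (u T))‖ ^ 2 ≤
      20 * (2 * d + 1) * (1 + c * T) * ∫ s in Ioc 0 T, q s := by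
  set B : ℝ := 12 / 5 + 3 / 2 * c * T with hB
  have hcT : 0 ≤ c * T := mul_nonneg hq.nonneg hT
  have hB0 : 0 < B := by rw [hB]; linarith
  -- this choice of `a` absorbs half of the left side
  set a : ℝ := 1 / (4 * B) with ha
  have ha0 : 0 < a := by positivity
  let A : ℕ → ℝ := fun N => ‖symbOp α K (piOp hb N) (J (u T))‖ ^ 2
  let e : ℕ → ℝ → ℝ := fun N s => ‖symbOp α K (pOp hb (N + 1)) (J (u s))‖ ^ 2

  have hmain : ∀ N, 3 ≤ N → A N ≤ 2 * (K ^ 2 / (2 * a) * (∫ s in Ioc 0 T, e N s) +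
      (2 * d + 1) / a * ∫ s in Ioc 0 T, q s) := fun N hN => by
    have h := norm_symbOp_piOp_sq_le hT h hq hK ha0 hN
    change A N ≤ 2 * a * (B * A N) + K ^ 2 / (2 * a) * (∫ s in Ioc 0 T, e N s) + _ at h
    have hE2 : 2 * a * (B * A N) = 1 / 2 * A N := by
      rw [ha]; field_simp; norm_num
    linarith
  -- the leak disappears in the limit
  have he0 : Tendsto (fun N => ∫ s in Ioc 0 T, e N s) atTop (𝓝 0) := by
    have h := tendsto_integral_of_dominated_convergence (μ := volume.restrict (Ioc 0 T))
      (F := e) (f := fun _ => 0)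
      (fun s => ‖symbOp α K 1 (J (u s))‖ ^ 2)
      (fun N => (integrableOn_norm_symbOp h.cont α K _ T).1) (integrableOn_norm_symbOp h.cont α K _ T)
      (fun N => .of_forall fun s => by
        rw [norm_of_nonneg (by positivity)]
        exact pow_le_pow_left₀ (norm_nonneg _) (norm_symbOp_le α K (norm_diagOp_one_le hb _) _) 2)
      (.of_forall fun s => by
        have := tendsto_norm_symbOp α K (P := fun N => pOp hb (N + 1)) (Q := 0)
          (fun N f => norm_diagOp_one_le hb _ f) (fun f => by simpa using tendsto_pOp hb f) (J (u s))
        have h0 : symbOp α K 0 (J (u s)) = 0 := by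
          refine Lp.ext ?_
          filter_upwards [symbOp_apply_id α K 0 (J (u s)),
            Lp.coeFn_zero (VE d) 2 (volume : Measure (Vec d))] with k h1 h2
          rw [h1, h2]; rfl
        simpa [h0] using this)
    simpa using h
  have hA : Tendsto A atTop (𝓝 (‖symbOp α K 1 (J (u T))‖ ^ 2)) :=
    tendsto_norm_symbOp α K (P := fun N => piOp hb N) (Q := 1) (fun N f => norm_diagOp_one_le hb _ f)
      (fun f => (tendsto_piOp hb f).norm) (J (u T))
  have hlim : Tendsto (fun N => 2 * (K ^ 2 / (2 * a) * (∫ s in Ioc 0 T, e N s) +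
      (2 * d + 1) / a * ∫ s in Ioc 0 T, q s)) atTop
      (𝓝 (2 * (K ^ 2 / (2 * a) * 0 + (2 * d + 1) / a * ∫ s in Ioc 0 T, q s))) :=
    (((he0.const_mul _).add_const _).const_mul _)
  have hfin := le_of_tendsto_of_tendsto hA hlim
    (by filter_upwards [eventually_ge_atTop 3] with N hN using hmain N hN)
  have hq0 : 0 ≤ ∫ s in Ioc 0 T, q s := by
    refine integral_nonneg_of_ae (hq.le.mono fun s hs => le_trans (integral_nonneg fun k => ?_) hs)
    positivity
  refine hfin.trans ?_
  have hda : (2 * d + 1) / a = (2 * d + 1) * (4 * B) := by rw [ha]; field_simp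
  rw [hda, mul_zero, zero_add]
  have hB10 : 4 * B ≤ 10 * (1 + c * T) := by rw [hB]; linarith
  have := mul_le_mul_of_nonneg_right hB10 (mul_nonneg (by positivity : (0 : ℝ) ≤ 2 * d + 1) hq0)
  linarith

/-- The a priori estimate: a solution with vanishing initial datum is controlled by its source. -/
theorem a_priori (hT : 0 ≤ T) (h : IsDerivSol α T u G₀ G) (hq : SrcBound T c G₀ G q) :
    ∃ z : XX d, (∀ᵐ k, z k = symb α (xi k) • J (u T) k) ∧
      ‖z‖ ^ 2 ≤ 20 * (2 * d + 1) * (1 + c * T) * ∫ s in Ioc 0 T, q s := by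
  set C := 20 * (2 * d + 1) * (1 + c * T) * ∫ s in Ioc 0 T, q s with hC
  let y : Vec d → VE d := fun k => symb α (xi k) • J (u T) k
  have hym : AEStronglyMeasurable y volume :=
    (continuous_symb_xi α).aestronglyMeasurable.smul (Lp.aestronglyMeasurable _)
  have hcut : ∀ K : ℕ, ∫⁻ k in freqBall d (K + 1), ‖y k‖ₑ ^ 2 ≤ ofReal C := fun K => by
    refine le_trans (le_of_eq ?_) (ENNReal.ofReal_le_ofReal
      (norm_symbOp_sq_le hT h hq (K := K + 1) (by positivity)))
    rw [ENNReal.ofReal_pow (norm_nonneg _), ofReal_norm, Lp.enorm_sq_eq,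
      ← lintegral_indicator (measurableSet_freqBall _)]
    refine lintegral_congr_ae ?_
    filter_upwards [coeFn_symbOp α (K + 1) 1 (J (u T))] with k hk
    rw [hk]
    by_cases h : k ∈ freqBall d (K + 1) <;> simp [h, y]
  have hall : ∫⁻ k, ‖y k‖ₑ ^ 2 ≤ ofReal C := by
    have hmono : Monotone fun K : ℕ => freqBall d ((K : ℝ) + 1) := by
      intro K L hKL k hk
      have : (K : ℝ) ≤ L := by exact_mod_cast hKL
      exact le_trans (show ‖xi k‖ ≤ K + 1 from hk) (by linarith)
    have hU : ⋃ K : ℕ, freqBall d ((K : ℝ) + 1) = univ := by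
      refine eq_univ_of_forall fun k => mem_iUnion.2 ?_
      obtain ⟨n, hn⟩ := exists_nat_ge ‖xi k‖
      exact ⟨n, (by linarith : ‖xi k‖ ≤ n + 1)⟩
    have h := setLIntegral_iUnion_of_directed (μ := (volume : Measure (Vec d)))
      (fun k => ‖y k‖ₑ ^ 2) (s := fun K : ℕ => freqBall d ((K : ℝ) + 1)) hmono.directed_le
    rw [hU, setLIntegral_univ] at h
    exact h.trans_le (iSup_le hcut)
  have hLp : eLpNorm y 2 volume ^ 2 ≤ ofReal C := eLpNorm_two_sq y ▸ hall
  have hC0 : 0 ≤ C := le_trans (sq_nonneg _) (norm_symbOp_sq_le hT h hq one_pos)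
  have hmem : MemLp y 2 volume := ⟨hym, by
    by_contra h
    rw [not_lt, top_le_iff] at h
    rw [h] at hLp
    simp at hLp⟩
  refine ⟨hmem.toLp, hmem.coeFn_toLp, ?_⟩
  rw [Lp.norm_toLp, ← ENNReal.toReal_pow]
  exact ENNReal.toReal_le_of_le_ofReal hC0 hLp

end Source

/-! ### Sources as families of square integrable functions -/

/-- A weakly measurable family in a separable real Hilbert space is strongly measurable. -/
lemma aestronglyMeasurable_of_inner {H ι : Type*} [NormedAddCommGroup H] [InnerProductSpace ℝ H]
    [CompleteSpace H] [SecondCountableTopology H] [MeasurableSpace ι] {μ : Measure ι} {f : ι → H}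
    (hf : ∀ e : H, AEStronglyMeasurable (fun s => inner ℝ e (f s)) μ) :
    AEStronglyMeasurable f μ := by
  obtain ⟨w, b, hb⟩ := exists_hilbertBasis ℝ H
  -- an orthonormal family in a separable space is countable: the balls of radius `1/2` are disjoint
  have hd : (univ : Set w).PairwiseDisjoint fun i => Metric.ball (b i) (1 / 2) := by
    intro i _ j _ hij
    refine Metric.ball_disjoint_ball ?_
    have h1 : ‖b i - b j‖ ^ 2 = 2 := by
      rw [norm_sub_sq_real, b.orthonormal.norm_eq_one, b.orthonormal.norm_eq_one,
        b.orthonormal.inner_eq_zero hij]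
      norm_num
    rw [dist_eq_norm]
    nlinarith [norm_nonneg (b i - b j)]
  have hc : (univ : Set w).Countable := hd.countable_of_isOpen (fun _ _ => Metric.isOpen_ball)
    (fun i _ => ⟨b i, Metric.mem_ball_self (by norm_num)⟩)
  have : Countable w := countable_univ_iff.1 hc
  refine aestronglyMeasurable_of_tendsto_ae (u := atTop)
    (f := fun (F : Finset w) s => ∑ i ∈ F, b.repr (f s) i • b i) (fun F => ?_)
    (.of_forall fun s => b.hasSum_repr (f s))
  refine Finset.aestronglyMeasurable_fun_sum _ fun i _ => ?_
  simp only [b.repr_apply_apply]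
  exact (hf (b i)).smul_const _

instance : Fact ((2 : ℝ≥0∞) ≠ ⊤) := ⟨by simp⟩

instance : MeasureTheory.IsSeparable (volume : Measure (Phase d)) := by
  have : MeasurableSpace.CountablyGenerated (Phase d) := inferInstance
  have : SigmaFinite (volume : Measure (Phase d)) := inferInstance
  exact isSeparable_of_sigmaFinite _

open Classical in
/-- The value at time `s` of a family of functions on phase space, as an element of `L²`
(`0` if it is not square integrable). -/
def slice (F : ℝ → Phase d → ℝ) (s : ℝ) : L2 d :=
  if h : MemLp (F s) 2 volume then h.toLp else 0

lemma coeFn_slice {F : ℝ → Phase d → ℝ} {s : ℝ} (h : MemLp (F s) 2 volume) :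
    slice F s =ᵐ[volume] F s := by
  rw [slice, dif_pos h]; exact h.coeFn_toLp

lemma enorm_slice {F : ℝ → Phase d → ℝ} {s : ℝ} (h : MemLp (F s) 2 volume) :
    ‖slice F s‖ₑ = eLpNorm (F s) 2 volume := by
  rw [Lp.enorm_def, eLpNorm_congr_ae (coeFn_slice h)]

lemma aestronglyMeasurable_slice {μ : Measure ℝ} [SFinite μ] {F : ℝ → Phase d → ℝ}
    (hF : AEStronglyMeasurable (fun p : ℝ × Phase d => F p.1 p.2) (μ.prod volume))
    (hs : ∀ᵐ s ∂μ, MemLp (F s) 2 volume) : AEStronglyMeasurable (slice F) μ := by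
  refine aestronglyMeasurable_of_inner fun e => ?_
  have h1 : AEStronglyMeasurable (fun s => ∫ z, e z * F s z) μ := by
    refine AEStronglyMeasurable.integral_prod_right' (f := fun p => e p.2 * F p.1 p.2) ?_
    exact ((Lp.aestronglyMeasurable e).comp_snd).mul hF
  refine h1.congr ?_
  filter_upwards [hs] with s h
  rw [inner_L2]
  refine integral_congr_ae ?_
  filter_upwards [coeFn_slice h] with z hz
  rw [hz]

lemma memLp_mul_vel {w : Vec d → ℝ} (hw : Continuous w) {C : ℝ} (hC : ∀ v, |w v| ≤ C) (f : L2 d) :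
    MemLp (fun z => w z.2 * f z) 2 volume :=
  (Lp.memLp f).of_le_mul (c := C)
    ((hw.comp continuous_snd).aestronglyMeasurable.mul (Lp.aestronglyMeasurable f))
    (.of_forall fun z => by
      rw [norm_mul]; exact mul_le_mul_of_nonneg_right (hC _) (norm_nonneg _))

/-- Multiplication by a bounded function of the velocity. -/
def velMul (w : Vec d → ℝ) (hw : Continuous w) {C : ℝ} (hC : ∀ v, |w v| ≤ C) : L2 d →L[ℝ] L2 d :=
  have hm := memLp_mul_vel hw hC
  LinearMap.mkContinuous
    { toFun := fun f => (hm f).toLp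
      map_add' := fun f g => by
        refine Lp.ext ?_
        filter_upwards [(hm (f + g)).coeFn_toLp, Lp.coeFn_add ((hm f).toLp) ((hm g).toLp),
          (hm f).coeFn_toLp, (hm g).coeFn_toLp, Lp.coeFn_add f g] with z h1 h2 h3 h4 h5
        rw [h1, h2, Pi.add_apply, h3, h4, h5, Pi.add_apply, mul_add]
      map_smul' := fun c f => by
        refine Lp.ext ?_
        filter_upwards [(hm (c • f)).coeFn_toLp, Lp.coeFn_smul c ((hm f).toLp),
          (hm f).coeFn_toLp, Lp.coeFn_smul c f] with z h1 h2 h3 h4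
        rw [h1, RingHom.id_apply, h2, Pi.smul_apply, h3, h4, Pi.smul_apply, smul_eq_mul,
          smul_eq_mul]
        ring }
    C (fun f => by
      refine Lp.norm_le_mul_norm_of_ae_le_mul ?_
      filter_upwards [(hm f).coeFn_toLp] with z hz
      change ‖((hm f).toLp : L2 d) z‖ ≤ _
      rw [hz, norm_mul]
      exact mul_le_mul_of_nonneg_right (hC _) (norm_nonneg _))

section

variable {w : Vec d → ℝ} (hw : Continuous w) {C : ℝ} (hC : ∀ v, |w v| ≤ C) (f : L2 d)

lemma coeFn_velMul : velMul w hw hC f =ᵐ[volume] fun z => w z.2 * f z :=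
  (memLp_mul_vel hw hC f).coeFn_toLp

lemma norm_velMul_le : ‖velMul w hw hC f‖ ≤ C * ‖f‖ := by
  refine Lp.norm_le_mul_norm_of_ae_le_mul ((coeFn_velMul hw hC f).mono fun z hz => ?_)
  rw [hz, norm_mul]
  exact mul_le_mul_of_nonneg_right (hC _) (norm_nonneg _)

end

lemma mu_pos (v : Vec d) : 0 < mu v := by unfold mu; positivity

lemma one_le_mu (v : Vec d) : 1 ≤ mu v := by unfold mu; linarith [sq_nonneg ‖v‖]

/-- The weight `μ^{-1/2}`. -/
def wt (v : Vec d) : ℝ := (mu v) ^ (-(1 / 2 : ℝ))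

lemma wt_pos (v : Vec d) : 0 < wt v := Real.rpow_pos_of_pos (mu_pos v) _

lemma wt_sq_mul_mu (v : Vec d) : wt v ^ 2 * mu v = 1 := by
  rw [wt, ← rpow_natCast, ← rpow_mul (mu_pos v).le]
  norm_num
  rw [Real.rpow_neg_one, inv_mul_cancel₀ (mu_pos v).ne']

lemma wt_le_one (v : Vec d) : wt v ≤ 1 := by
  have h1 := wt_sq_mul_mu v
  have h2 := one_le_mu v
  have h3 := wt_pos v
  nlinarith [sq_nonneg (wt v)]

lemma continuous_mu : Continuous (mu : Vec d → ℝ) := by unfold mu; fun_prop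

lemma continuous_wt : Continuous (wt : Vec d → ℝ) :=
  continuous_mu.rpow_const fun v => Or.inl (mu_pos v).ne'

lemma wt_sq_add (v : Vec d) : wt v ^ 2 + ∑ i, (wt v * v i) ^ 2 = 1 := by
  rw [← wt_sq_mul_mu v, mu, EuclideanSpace.norm_sq_eq]
  simp only [mul_pow, ← mul_sum, norm_eq_abs, sq_abs]
  ring

lemma abs_wt_le (v : Vec d) : |wt v| ≤ 1 := by
  rw [abs_of_pos (wt_pos v)]; exact wt_le_one v

lemma abs_wt_coord_le (i : Fin d) (v : Vec d) : |wt v * v i| ≤ 1 := by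
  have h := wt_sq_add v
  have h2 := Finset.single_le_sum (f := fun i => (wt v * v i) ^ 2) (fun i _ => sq_nonneg _)
    (Finset.mem_univ i)
  rw [← sq_le_one_iff_abs_le_one]
  dsimp only at h2
  nlinarith [sq_nonneg (wt v)]

lemma continuous_wt_coord (i : Fin d) : Continuous fun v : Vec d => wt v * v i :=
  continuous_wt.mul (by fun_prop)

/-- `μ^{1/2} g` is the sum of `W₀ g` and of the `v_i W_i g`, where `W₀` is multiplication by
`μ^{-1/2}` and `W_i` multiplication by `v_i μ^{-1/2}`. -/
def W₀ : L2 d →L[ℝ] L2 d := velMul wt continuous_wt abs_wt_le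

/-- Multiplication by `v_i μ^{-1/2}`. -/
def W (i : Fin d) : L2 d →L[ℝ] L2 d :=
  velMul (fun v => wt v * v i) (continuous_wt_coord i) (abs_wt_coord_le i)

lemma coeFn_W (g : L2 d) : ∀ᵐ z, W₀ g z = wt z.2 * g z ∧ ∀ i, W i g z = wt z.2 * z.2 i * g z :=
  (coeFn_velMul continuous_wt abs_wt_le g).and
    (ae_all_iff.2 fun i => coeFn_velMul (continuous_wt_coord i) (abs_wt_coord_le i) g)

lemma norm_W_sq_add (g : L2 d) : ‖W₀ g‖ ^ 2 + ∑ i, ‖W i g‖ ^ 2 = ‖g‖ ^ 2 := by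
  simp only [Lp.norm_sq_eq]
  rw [← integral_finsetSum _ fun i _ => Lp.integrable_norm_sq _,
    ← integral_add (Lp.integrable_norm_sq _)
      (integrable_finsetSum _ fun i _ => Lp.integrable_norm_sq _)]
  refine integral_congr_ae ?_
  filter_upwards [coeFn_W g] with z ⟨h1, h2⟩
  rw [h1]
  simp only [h2, norm_eq_abs, sq_abs, mul_pow (_ * _) (g z), ← sum_mul]
  rw [mul_pow, ← add_mul, wt_sq_add, one_mul]

/-- Testing a function `f` such that `μ^{-1/2} f` is square integrable. -/
lemma mul_of_weight {f : Phase d → ℝ} {g : L2 d} (hg : g =ᵐ[volume] invSqrtMuMul f)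
    (φ : 𝓢(Phase d, ℝ)) : Integrable (fun z => f z * φ z) ∧
    ∫ z, f z * φ z = inner ℝ (W₀ g) (tL φ) + ∑ i, inner ℝ (W i g) (tL (vmulR i φ)) := by
  have hint : ∀ (w : L2 d) (η : 𝓢(Phase d, ℝ)), Integrable fun z => w z * η z := fun w η =>
    (Lp.memLp w).integrable_mul (η.memLp 2 volume)
  have hi : Integrable fun z => ∑ i, W i g z * vmulR i φ z :=
    integrable_finsetSum _ fun i _ => hint _ _
  have key : (fun z => W₀ g z * φ z + ∑ i, W i g z * vmulR i φ z) =ᵐ[volume]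
      fun z => f z * φ z := by
    filter_upwards [coeFn_W g, hg] with z ⟨h1, h2⟩ h3
    simp only [h1, h2, vmulR_apply, h3, invSqrtMuMul]
    rw [show (mu z.2) ^ (-(1 / 2 : ℝ)) = wt z.2 from rfl]
    have h4 : ∀ i, wt z.2 * z.2 i * (wt z.2 * f z) * (z.2 i * φ z) =
        (wt z.2 * z.2 i) ^ 2 * (f z * φ z) := fun i => by ring
    simp only [h4, ← sum_mul]
    linear_combination (f z * φ z) * wt_sq_add z.2
  refine ⟨((hint _ φ).add hi).congr key, ?_⟩
  simp only [inner_tL]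
  rw [← integral_finsetSum _ fun i _ => hint _ _, ← integral_add (hint _ _) hi]
  exact (integral_congr_ae key).symm

lemma srcSize_le {τ : ℝ} (hτ : 0 ≤ τ) (g : L2 d) :
    srcSize τ (W₀ g) (fun i => W i g) ≤ ‖g‖ ^ 2 := by
  have h : ∀ f : L2 d, ∫ k, exp (-(rate (xi k) / 12 * τ)) * ‖J f k‖ ^ 2 ≤ ‖f‖ ^ 2 := fun f => by
    rw [← norm_J, Lp.norm_sq_eq]
    exact integral_mono (integrable_exp_rate hτ _) (Lp.integrable_norm_sq _) fun k =>
      mul_le_of_le_one_left (sq_nonneg _) (exp_rate_le_one hτ _)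
  rw [← norm_W_sq_add, srcSize_eq hτ]
  exact add_le_add (h _) (sum_le_sum fun i _ => h _)

/-! ### The solution operator -/

lemma isFiberFlow_flow {d : ℕ} {E : Type*} [NormedAddCommGroup E] [InnerProductSpace ℂ E]
    [CompleteSpace E] (b : HilbertBasis (Idx d) ℂ E) :
    IsFiberFlow fun (k : Vec d) t => flow b (xi k) t where
  cont := by
    have hc : Continuous fun p : (Vec d × ℝ) × E => ((xi p.1.1, p.1.2), p.2) :=
      ((continuous_xi.comp (continuous_fst.comp continuous_fst)).prodMk
        (continuous_snd.comp continuous_fst)).prodMk continuous_snd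
    have h := (continuous_flow b).comp hc
    exact h
  bound k t x := norm_flow_le b _ t x

lemma re_intervalIntegral {f : ℝ → ℂ} {t : ℝ} (ht : 0 ≤ t) (hf : IntegrableOn f (Ioc 0 t)) :
    (∫ s in 0..t, f s).re = ∫ s in 0..t, (f s).re := by
  rw [integral_of_le ht, integral_of_le ht]
  have h := reCLM.integral_comp_comm (μ := volume.restrict (Ioc 0 t)) hf
  simp only [reCLM_apply] at h
  exact h.symm

section Mild

variable {H : Type*} [NormedAddCommGroup H] [InnerProductSpace ℂ H] [CompleteSpace H]
variable {S : ℝ → H →L[ℂ] H} (hS : IsContraction S) {r : ℝ → H}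
include hS

lemma IsContraction.continuousOn_mild (f : H) (hr : ∀ T : ℝ, IntegrableOn r (Ioc 0 T)) :
    ContinuousOn (fun t => S t f + duhamel S r t) (Ici 0) := by
  have h1 : Continuous fun t => S t f := hS.cont.comp (continuous_id.prodMk continuous_const)
  exact h1.continuousOn.add (continuousOn_duhamel hS hr)

lemma IsContraction.re_inner_mild {ψ χ : H} (f : H) (hr : ∀ T : ℝ, IntegrableOn r (Ioc 0 T))
    (hw : ∀ f t, 0 ≤ t →
      inner ℂ ψ (S t f) = inner ℂ ψ f + ∫ s in 0..t, inner ℂ χ (S s f))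
    {t : ℝ} (ht : 0 ≤ t) :
    (inner ℂ ψ (S t f + duhamel S r t)).re = (inner ℂ ψ f).re +
      (∫ s in 0..t, (inner ℂ χ (S s f + duhamel S r s)).re) +
      ∫ s in 0..t, (inner ℂ ψ (r s)).re := by
  have h1 : Continuous fun t => S t f := hS.cont.comp (continuous_id.prodMk continuous_const)
  have hi1 : IntegrableOn (fun s => inner ℂ χ (S s f)) (Ioc 0 t) :=
    ((continuous_const.inner h1).continuousOn.integrableOn_Icc).mono_set Ioc_subset_Icc_self
  have hi2 : IntegrableOn (fun s => inner ℂ χ (duhamel S r s)) (Ioc 0 t) :=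
    (continuousOn_const.inner ((continuousOn_duhamel hS hr).mono
      Icc_subset_Ici_self)).integrableOn_Icc.mono_set Ioc_subset_Icc_self
  have hi3 : IntegrableOn (fun s => inner ℂ ψ (r s)) (Ioc 0 t) := (hr t).const_inner _
  rw [← re_intervalIntegral ht hi3, ← re_intervalIntegral (f := fun s =>
    inner ℂ χ (S s f + duhamel S r s)) ht
    ((hi1.add hi2).congr_fun (fun s _ => (inner_add_right _ _ _).symm) measurableSet_Ioc)]
  simp only [inner_add_right]
  rw [intervalIntegral.integral_add
    ((intervalIntegrable_iff_integrableOn_Ioc_of_le ht).2 hi1)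
    ((intervalIntegrable_iff_integrableOn_Ioc_of_le ht).2 hi2), hw f t ht,
    inner_duhamel hS hr hw ht]
  simp only [add_re]
  ring

lemma IsContraction.re_inner_duhamel (ψ : H) {t : ℝ} (ht : 0 ≤ t) (hr : IntegrableOn r (Ioc 0 t)) :
    (inner ℂ ψ (duhamel S r t)).re = ∫ s in Ioc 0 t, (inner ℂ ψ (S (t - s) (r s))).re := by
  have hi : IntegrableOn (fun s => S (t - s) (r s)) (Ioc 0 t) :=
    hS.integrable (by fun_prop) hr
  rw [duhamel, integral_of_le ht, ← integral_inner (𝕜 := ℂ) hi]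
  have h3 := reCLM.integral_comp_comm (μ := volume.restrict (Ioc 0 t))
    (hi.const_inner (𝕜 := ℂ) ψ)
  simp only [reCLM_apply] at h3
  exact h3.symm

end Mild

variable (d) in
/-- The dynamics of the homogeneous equation on the Fourier side. -/
def flowF : ℝ → XX d →L[ℂ] XX d := fiberFlow (isFiberFlow_flow hb)

lemma coeFn_flowF (t : ℝ) (x : XX d) : ∀ᵐ k, flowF d t x k = flow hb (xi k) t (x k) :=
  coeFn_fiberFlow _ t x

lemma isContraction_flowF : IsContraction (flowF d) := isContraction_fiberFlow _

lemma inner_flowF (φ : 𝓢(Phase d, ℝ)) (f : XX d) (t : ℝ) (ht : 0 ≤ t) :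
    inner ℂ (J (tL φ)) (flowF d t f) =
      inner ℂ (J (tL φ)) f + ∫ s in 0..t, inner ℂ (J (genT φ)) (flowF d s f) := by
  refine inner_fiberFlow (isFiberFlow_flow hb) ht ?_
  filter_upwards [inner_genT φ] with k hk
  exact inner_flow hb (xi k) hk ht (f k)

/-- The mild solution with datum `f₀` and square integrable source `H`. -/
def mild (f₀ : L2 d) (H : ℝ → L2 d) (t : ℝ) : L2 d :=
  Jadj (flowF d t (J f₀) + duhamel (flowF d) (fun s => J (H s)) t)

lemma integrable_J {ι : Type*} [MeasurableSpace ι] {μ : Measure ι} {g : ι → L2 d}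
    (hg : Integrable g μ) : Integrable (fun s => J (g s)) μ :=
  integrable_clm_J (ContinuousLinearMap.id ℂ _) hg

lemma continuousOn_mild (f₀ : L2 d) {H : ℝ → L2 d} (hH : ∀ T : ℝ, IntegrableOn H (Ioc 0 T)) :
    ContinuousOn (mild f₀ H) (Ici 0) := by
  have h := isContraction_flowF.continuousOn_mild (J f₀) (r := fun s => J (H s))
    fun T => integrable_J (hH T)
  exact continuous_Jadj.comp_continuousOn h

lemma inner_Jadj' (x : XX d) (f : L2 d) : inner ℝ (Jadj x) f = (inner ℂ (J f) x).re := by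
  rw [inner_Jadj, ← inner_conj_symm, conj_re]

lemma inner_mild (f₀ : L2 d) {H : ℝ → L2 d} (hH : ∀ T : ℝ, IntegrableOn H (Ioc 0 T))
    (φ : 𝓢(Phase d, ℝ)) {t : ℝ} (ht : 0 ≤ t) :
    inner ℝ (mild f₀ H t) (tL φ) = inner ℝ f₀ (tL φ) +
      (∫ s in 0..t, inner ℝ (mild f₀ H s) (genT φ)) +
      ∫ s in 0..t, inner ℝ (H s) (tL φ) := by
  have h := isContraction_flowF.re_inner_mild (J f₀) (r := fun s => J (H s))
    (fun T => integrable_J (hH T)) (inner_flowF φ) ht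
  simp only [inner_J_re, real_inner_comm _ (tL φ)] at h
  simp only [mild, inner_Jadj']
  exact h

/-- The energy estimate for the equation with zero datum and source `μ^{1/2} G`. -/
lemma norm_sq_le_of_weak {u G : ℝ → L2 d} {T : ℝ} (hT : 0 ≤ T) (hu : ContinuousOn u (Ici 0))
    (hG : IntegrableOn G (Ioc 0 T)) (hG2 : IntegrableOn (fun s => ‖G s‖ ^ 2) (Ioc 0 T))
    (hw : ∀ φ : 𝓢(Phase d, ℝ), HasCompactSupport φ → ∀ t ∈ Icc 0 T, inner ℝ (u t) (tL φ) =
      (∫ s in 0..t, inner ℝ (u s) (genT φ)) + ∫ s in 0..t,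
        (inner ℝ (W₀ (G s)) (tL φ) + ∑ i, inner ℝ (W i (G s)) (tL (vmulR i φ)))) :
    ‖u T‖ ^ 2 ≤ 20 * (2 * d + 1) * (1 + T) * ∫ s in Ioc 0 T, ‖G s‖ ^ 2 := by
  obtain ⟨z, hz, hle⟩ := a_priori (α := 0) hT ⟨hu, W₀.integrable_comp hG,
    fun i => (W i).integrable_comp hG, fun φ hφ t ht => by
      rw [iterProd_zero]; exact hw φ hφ t ht⟩
    ⟨zero_le_one, .of_forall fun _ => .of_forall fun _ => .inl le_rfl, hG2,
      (ae_restrict_mem measurableSet_Ioc).mono fun s hs => srcSize_le (by linarith [hs.2]) (G s)⟩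
  have hzJ : z = J (u T) := Lp.ext (hz.mono fun k hk => by rw [hk]; simp [symb])
  rwa [hzJ, norm_J, one_mul] at hle

lemma IsWeakSolution.unique {f₀ : L2 d} {h : ℝ → Phase d → ℝ} {u u' : ℝ → L2 d}
    (hu : IsWeakSolution f₀ h u) (hu' : IsWeakSolution f₀ h u') : EqOn u' u (Ici 0) := by
  intro T hT
  have hc := hu'.continuousOn.sub hu.continuousOn
  have h := norm_sq_le_of_weak (u := fun t => u' t - u t) (G := fun _ => 0) hT hc
    integrableOn_zero (by simpa using integrableOn_zero) (fun φ hφ t ht => by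
      rw [inner_sub_left, hu'.eq φ hφ ht.1, hu.eq φ hφ ht.1]
      simp only [inner_sub_left, map_zero, inner_zero_left, sum_const_zero, add_zero,
        intervalIntegral.integral_zero]
      rw [intervalIntegral.integral_sub (integrableOn_inner hu'.continuousOn _ ht.1)
        (integrableOn_inner hu.continuousOn _ ht.1)]
      ring)
  simp only [norm_zero, ne_eq, OfNat.ofNat_ne_zero, not_false_eq_true, zero_pow,
    integral_zero, mul_zero] at h
  have h0 : ‖u' T - u T‖ = 0 := by
    have := le_antisymm h (sq_nonneg _)
    exact pow_eq_zero_iff two_ne_zero |>.1 this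
  exact sub_eq_zero.1 (norm_eq_zero.1 h0)

lemma IsWeakSolution.congr {f₀ : L2 d} {h : ℝ → Phase d → ℝ} {u u' : ℝ → L2 d}
    (hu : IsWeakSolution f₀ h u) (he : EqOn u' u (Ici 0)) : IsWeakSolution f₀ h u' where
  source := hu.source
  continuousOn := hu.continuousOn.congr he
  weak_eq ψ hψ t ht := by
    rw [he ht, hu.weak_eq ψ hψ t ht]
    congr 1
    refine intervalIntegral.integral_congr fun s hs => ?_
    rw [uIcc_of_le ht] at hs
    rw [he hs.1]

lemma mul_integral_of_ae {f : Phase d → ℝ} {g : L2 d} (h : g =ᵐ[volume] f) (φ : 𝓢(Phase d, ℝ)) :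
    ∫ z, f z * φ z = inner ℝ g (tL φ) := by
  rw [inner_tL]
  exact integral_congr_ae (h.mono fun z hz => by dsimp only; rw [hz])

/-- The mild solution is a weak solution. -/
lemma isWeakSolution_mild (f₀ : L2 d) {h : ℝ → Phase d → ℝ} {H : ℝ → L2 d}
    (hs : SourceIntegrable h) (hH : ∀ T : ℝ, IntegrableOn H (Ioc 0 T))
    (hh : ∀ᵐ s ∂volume.restrict (Ioi (0 : ℝ)), H s =ᵐ[volume] h s) :
    IsWeakSolution f₀ h (mild f₀ H) := by
  refine IsWeakSolution.mk' hs (continuousOn_mild f₀ hH) fun φ hφ t ht => ?_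
  rw [inner_mild f₀ hH φ ht]
  congr 1
  rw [integral_of_le ht, integral_of_le ht]
  refine integral_congr_ae ?_
  filter_upwards [ae_restrict_of_ae_restrict_of_subset Ioc_subset_Ioi_self hh] with s h1
  exact (mul_integral_of_ae h1 φ).symm

lemma sourceIntegrable_zero : SourceIntegrable (0 : ℝ → Phase d → ℝ) := fun T K _ => by
  simpa using integrableOn_zero

lemma isWeakSolution_homogeneous (f₀ : L2 d) : IsWeakSolution f₀ 0 (mild f₀ 0) :=
  isWeakSolution_mild f₀ sourceIntegrable_zero (fun _ => integrableOn_zero)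
    (.of_forall fun _ => Lp.coeFn_zero ℝ 2 (volume : Measure (Phase d)))

/-- The solution operator on the Fourier side. -/
lemma solutionOperator_eq (f₀ : L2 d) {t : ℝ} (ht : 0 ≤ t) :
    solutionOperator t f₀ = Jadj (flowF d t (J f₀)) := by
  have hex : ∃ u : ℝ → L2 d, IsWeakSolution f₀ 0 u := ⟨_, isWeakSolution_homogeneous f₀⟩
  rw [solutionOperator, dif_pos hex, (isWeakSolution_homogeneous f₀).unique hex.choose_spec ht,
    mild, duhamel]
  simp [J_zero]

/-- The Duhamel integral of the solution operator is the mild solution. -/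
lemma integral_solutionOperator {H : ℝ → L2 d} (hH : ∀ T : ℝ, IntegrableOn H (Ioc 0 T)) {t : ℝ}
    (ht : 0 ≤ t) : ∫ s in 0..t, solutionOperator (t - s) (H s) = mild 0 H t := by
  have hi : IntegrableOn (fun s => flowF d (t - s) (J (H s))) (Ioc 0 t) :=
    isContraction_flowF.integrable (by fun_prop) (integrable_J (hH t))
  have hi2 : IntegrableOn (fun s => Jadj (flowF d (t - s) (J (H s)))) (Ioc 0 t) :=
    hi.norm.mono' (continuous_Jadj.comp_aestronglyMeasurable hi.1)
      (.of_forall fun s => norm_Jadj_le _)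
  have h1 : ∫ s in 0..t, solutionOperator (t - s) (H s) =
      ∫ s in Ioc 0 t, Jadj (flowF d (t - s) (J (H s))) := by
    rw [integral_of_le ht]
    refine setIntegral_congr_fun measurableSet_Ioc fun s hs => ?_
    exact solutionOperator_eq _ (by linarith [hs.2])
  rw [h1, mild, J_zero, map_zero, zero_add]
  refine ext_inner_left ℝ fun f => ?_
  rw [← integral_inner (𝕜 := ℝ) hi2 f, real_inner_comm, inner_Jadj',
    isContraction_flowF.re_inner_duhamel (J f) ht (integrable_J (hH t))]
  refine integral_congr_ae (.of_forall fun s => ?_)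
  dsimp only
  rw [real_inner_comm, inner_Jadj']

/-- The function `(1 + |v|) √M` times the weight `μ^{1/2}` is square integrable in `v`. -/
lemma memLp_momentWeight :
    MemLp (fun v : Vec d => (1 + ‖v‖) * sqrtM v * (wt v)⁻¹) 2 volume := by
  have hS := (sqrtMS + ∑ i, mulV i (mulV i sqrtMS) : 𝓢(Vec d, ℝ)).memLp 2 volume
  refine hS.of_le_mul (c := 2) ?_ (.of_forall fun v => ?_)
  · exact (((by fun_prop : Continuous fun v : Vec d => 1 + ‖v‖).mul continuous_sqrtM).mul
      (continuous_wt.inv₀ fun v => (wt_pos v).ne')).aestronglyMeasurable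
  · have h1 : (sqrtMS + ∑ i, mulV i (mulV i sqrtMS) : 𝓢(Vec d, ℝ)) v = mu v * sqrtM v := by
      rw [add_apply, sum_apply, mu, EuclideanSpace.norm_sq_eq]
      simp only [mulV_apply, sqrtMS_apply, norm_eq_abs, sq_abs]
      rw [add_mul, one_mul, sum_mul]
      congr 1
      exact sum_congr rfl fun i _ => by ring
    rw [h1]
    have h2 := wt_pos v
    have h3 := sqrtM_pos v
    have h4 := mu_pos v
    rw [norm_of_nonneg (by positivity), norm_of_nonneg (by positivity)]
    have h5 : (wt v)⁻¹ = wt v * mu v := by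
      refine (eq_inv_of_mul_eq_one_right ?_).symm
      linarith [wt_sq_mul_mu v]
    rw [h5]
    have h6 : (1 + ‖v‖) * wt v ≤ 2 := by
      have : ((1 + ‖v‖) * wt v) ^ 2 ≤ 2 := by
        have e : (1 + ‖v‖) ^ 2 ≤ 2 * mu v := by unfold mu; nlinarith [sq_nonneg (1 - ‖v‖)]
        calc ((1 + ‖v‖) * wt v) ^ 2 = (1 + ‖v‖) ^ 2 * wt v ^ 2 := by ring
          _ ≤ 2 * mu v * wt v ^ 2 := by gcongr
          _ = 2 := by linarith [wt_sq_mul_mu v]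
      nlinarith
    calc (1 + ‖v‖) * sqrtM v * (wt v * mu v) = ((1 + ‖v‖) * wt v) * (mu v * sqrtM v) := by ring
      _ ≤ 2 * (mu v * sqrtM v) := by gcongr

/-! ### Well-posedness -/

lemma memLp_momentWeight_phase {K : Set (Vec d)} (hK : IsCompact K) :
    MemLp (fun z : Phase d => (1 + ‖z.2‖) * sqrtM z.2 * (wt z.2)⁻¹) 2
      (volume.restrict (K ×ˢ univ)) := by
  have : IsFiniteMeasure (volume.restrict K) := ⟨by simpa using hK.measure_lt_top⟩
  have h := (memLp_momentWeight (d := d)).comp_snd (volume.restrict K)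
  have h2 : (volume : Measure (Phase d)).restrict (K ×ˢ univ) =
      (volume.restrict K).prod volume := by
    have := Measure.prod_restrict (μ := (volume : Measure (Vec d)))
      (ν := (volume : Measure (Vec d))) K univ
    rw [Measure.restrict_univ] at this
    exact this.symm
  rw [h2]
  exact h

lemma restrict_Ioc_prod' (T : ℝ) (S : Set (Phase d)) :
    (volume : Measure (ℝ × Phase d)).restrict (Ioc 0 T ×ˢ S) =
      (volume.restrict (Ioc 0 T)).prod (volume.restrict S) :=
  (Measure.prod_restrict _ _).symm

lemma sourceIntegrable_of_weight {h : ℝ → Phase d → ℝ}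
    (hh : ∀ T : ℝ, MemLp (fun p : ℝ × Phase d => invSqrtMuMul (h p.1) p.2) 2
      (volume.restrict (Ioc 0 T ×ˢ univ))) : SourceIntegrable h := by
  intro T K hK
  have h1 := (memLp_momentWeight_phase hK).comp_snd (volume.restrict (Ioc 0 T))
  rw [← restrict_Ioc_prod'] at h1
  have h2 := (hh T).mono_measure (Measure.restrict_mono
    (prod_mono_right (subset_univ (K ×ˢ (univ : Set (Vec d))))) le_rfl)
  have h3 := h1.integrable_mul h2
  refine h3.congr (.of_forall fun p => ?_)
  have : (wt p.2.2)⁻¹ * (mu p.2.2) ^ (-(1 / 2 : ℝ)) = 1 := inv_mul_cancel₀ (wt_pos _).ne'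
  simp only [invSqrtMuMul, Pi.mul_apply, Function.comp_apply]
  linear_combination ((1 + ‖p.2.2‖) * sqrtM p.2.2 * h p.1 p.2) * this

lemma sourceIntegrable_of_L1 {h : ℝ → Phase d → ℝ} {H : ℝ → L2 d}
    (hm : AEStronglyMeasurable (fun p : ℝ × Phase d => h p.1 p.2)
      (volume.restrict (Ioi 0 ×ˢ univ)))
    (he : ∀ᵐ s ∂volume.restrict (Ioi (0 : ℝ)), H s =ᵐ[volume] h s)
    (hH : ∀ T : ℝ, IntegrableOn H (Ioc 0 T)) : SourceIntegrable h := by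
  intro T K hK
  have hm1 : AEStronglyMeasurable (fun p : ℝ × Phase d => h p.1 p.2)
      (volume.restrict (Ioc 0 T ×ˢ (K ×ˢ univ))) :=
    hm.mono_measure (Measure.restrict_mono (Set.prod_mono Ioc_subset_Ioi_self (subset_univ _)) le_rfl)
  have hw : Continuous fun z : Phase d => (1 + ‖z.2‖) * sqrtM z.2 :=
    (by fun_prop : Continuous fun z : Phase d => 1 + ‖z.2‖).mul
      (continuous_sqrtM.comp continuous_snd)
  have hwL : MemLp (fun z : Phase d => (1 + ‖z.2‖) * sqrtM z.2) 2
      (volume.restrict (K ×ˢ univ)) := by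
    refine (memLp_momentWeight_phase hK).mono hw.aestronglyMeasurable
      (.of_forall fun z => ?_)
    rw [norm_mul _ (wt z.2)⁻¹]
    refine le_mul_of_one_le_right (norm_nonneg _) ?_
    rw [norm_of_nonneg (inv_nonneg.2 (wt_pos _).le)]
    exact (one_le_inv₀ (wt_pos _)).2 (wt_le_one _)
  have hKm : MeasurableSet (K ×ˢ (univ : Set (Vec d))) := hK.measurableSet.prod MeasurableSet.univ
  have hwI : MemLp ((K ×ˢ (univ : Set (Vec d))).indicator
      fun z : Phase d => (1 + ‖z.2‖) * sqrtM z.2) 2 volume :=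
    (memLp_indicator_iff_restrict hKm).2 hwL
  rw [IntegrableOn, restrict_Ioc_prod'] at *
  have hm2 : AEStronglyMeasurable (fun p : ℝ × Phase d =>
      (1 + ‖p.2.2‖) * sqrtM p.2.2 * h p.1 p.2)
      ((volume.restrict (Ioc 0 T)).prod (volume.restrict (K ×ˢ univ))) :=
    (hw.comp continuous_snd).aestronglyMeasurable.mul hm1
  have he' := ae_restrict_of_ae_restrict_of_subset
    (Ioc_subset_Ioi_self : Ioc 0 T ⊆ Ioi 0) he
  rw [integrable_prod_iff hm2]
  constructor
  · filter_upwards [he'] with s hs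
    have := hwL.integrable_mul ((Lp.memLp (H s)).restrict (K ×ˢ univ))
    refine this.congr ?_
    filter_upwards [ae_restrict_of_ae hs] with z hz
    rw [Pi.mul_apply, hz]
  · have hb : IntegrableOn (fun s => ‖(hwI.toLp : L2 d)‖ * ‖H s‖) (Ioc 0 T) :=
      (hH T).norm.const_mul _
    refine hb.mono' (hm2.norm.integral_prod_right') ?_
    filter_upwards [he'] with s hs
    rw [norm_of_nonneg (by positivity)]
    have h1 : ∫ z in K ×ˢ univ, ‖(1 + ‖z.2‖) * sqrtM z.2 * h s z‖ =
        inner ℝ (hwI.toLp : L2 d) |H s| := by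
      rw [inner_L2, ← integral_indicator hKm]
      refine integral_congr_ae ?_
      filter_upwards [hwI.coeFn_toLp, Lp.coeFn_abs (H s), hs] with z h1 h2 h3
      rw [h1, h2, h3]
      by_cases hz : z ∈ K ×ˢ (univ : Set (Vec d))
      · simp only [indicator_of_mem hz]
        have := sqrtM_pos z.2
        rw [norm_mul, norm_of_nonneg (by positivity), norm_eq_abs]
      · simp only [indicator_of_notMem hz, zero_mul]
    rw [h1]
    refine (real_inner_le_norm _ _).trans_eq ?_
    rw [norm_abs_eq_norm]

/-- Families that are square integrable jointly in time, position and velocity. -/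
lemma integrableOn_slice {F : ℝ → Phase d → ℝ} {T : ℝ}
    (hF : MemLp (fun p : ℝ × Phase d => F p.1 p.2) 2 (volume.restrict (Ioc 0 T ×ˢ univ))) :
    (∀ᵐ s ∂volume.restrict (Ioc 0 T), MemLp (F s) 2 volume) ∧
      IntegrableOn (slice F) (Ioc 0 T) ∧ IntegrableOn (fun s => ‖slice F s‖ ^ 2) (Ioc 0 T) := by
  rw [restrict_Ioc_prod] at hF
  have h1 := (memLp_two_iff_integrable_sq_norm hF.1).1 hF
  have hs : ∀ᵐ s ∂volume.restrict (Ioc 0 T), MemLp (F s) 2 volume := by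
    filter_upwards [h1.prod_right_ae, hF.1.prodMk_left] with a ha hm
    exact (memLp_two_iff_integrable_sq_norm hm).2 ha
  have hm := aestronglyMeasurable_slice hF.1 hs
  have h2 : IntegrableOn (fun s => ‖slice F s‖ ^ 2) (Ioc 0 T) := by
    refine h1.integral_prod_left.congr ?_
    filter_upwards [hs] with s h
    rw [Lp.norm_sq_eq]
    refine integral_congr_ae ?_
    filter_upwards [coeFn_slice h] with z hz
    rw [hz]
  exact ⟨hs, ((memLp_two_iff_integrable_sq_norm hm).2 h2).integrable one_le_two, h2⟩

/-- The test vector through which a source `μ^{1/2} g` acts: the pairing of `μ^{1/2} g` with `φ`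
is `⟨g, srcTest φ⟩`. -/
def srcTest (φ : 𝓢(Phase d, ℝ)) : L2 d :=
  adjoint W₀ (tL φ) + ∑ i, adjoint (W i) (tL (vmulR i φ))

lemma inner_srcTest (g : L2 d) (φ : 𝓢(Phase d, ℝ)) : inner ℝ g (srcTest φ) =
    inner ℝ (W₀ g) (tL φ) + ∑ i, inner ℝ (W i g) (tL (vmulR i φ)) := by
  simp only [srcTest, inner_add_right, inner_sum, adjoint_inner_right]

/-- The cut-off `min(1, j μ^{-1/2})` of the weighted source. -/
lemma abs_cut_le (j : ℕ) (v : Vec d) : |min 1 (j * wt v)| ≤ 1 := by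
  have := (wt_pos v).le
  rw [abs_of_nonneg (by positivity)]
  exact min_le_left _ _

lemma continuous_cut (j : ℕ) : Continuous fun v : Vec d => min 1 (j * wt v) :=
  continuous_const.min (continuous_const.mul continuous_wt)

lemma abs_cut_div_le (j : ℕ) (v : Vec d) : |min 1 (j * wt v) * (wt v)⁻¹| ≤ j := by
  have h := wt_pos v
  rw [abs_of_nonneg (by positivity), ← div_eq_mul_inv, div_le_iff₀ h]
  exact min_le_right _ _

lemma continuous_cut_div (j : ℕ) : Continuous fun v : Vec d => min 1 (j * wt v) * (wt v)⁻¹ :=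
  (continuous_cut j).mul (continuous_wt.inv₀ fun v => (wt_pos v).ne')

/-- Multiplication by `min(1, j μ^{-1/2})`. -/
def cutR (j : ℕ) : L2 d →L[ℝ] L2 d := velMul _ (continuous_cut j) (abs_cut_le j)

/-- Multiplication by `μ^{1/2} min(1, j μ^{-1/2})`, a bounded function. -/
def cutH (j : ℕ) : L2 d →L[ℝ] L2 d :=
  velMul _ (continuous_cut_div j) (abs_cut_div_le j)

lemma inner_cutH (j : ℕ) (g : L2 d) (φ : 𝓢(Phase d, ℝ)) :
    inner ℝ (cutH j g) (tL φ) = inner ℝ (cutR j g) (srcTest φ) := by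
  rw [inner_srcTest, ← (mul_of_weight (f := cutH j g) ?_ _).2, inner_tL]
  filter_upwards [coeFn_velMul (continuous_cut j) (abs_cut_le j) g,
    coeFn_velMul (continuous_cut_div j) (abs_cut_div_le j) g] with z h1 h2
  have : (mu z.2) ^ (-(1 / 2 : ℝ)) * (wt z.2)⁻¹ = 1 := mul_inv_cancel₀ (wt_pos _).ne'
  rw [cutR, cutH, invSqrtMuMul, h1, h2]
  linear_combination -(min 1 (j * wt z.2) * g z) * this

lemma norm_cutR_sub_le (j : ℕ) (g : L2 d) : ‖cutR j g - g‖ ≤ 2 * ‖g‖ := by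
  have h : ‖cutR j g‖ ≤ 1 * ‖g‖ := norm_velMul_le (continuous_cut j) (abs_cut_le j) g
  linarith [norm_sub_le (cutR j g) g]

lemma tendsto_cutR (g : L2 d) : Tendsto (fun j => cutR j g) atTop (𝓝 g) := by
  rw [tendsto_iff_norm_sub_tendsto_zero]
  have hsq : Tendsto (fun j => ‖cutR j g - g‖ ^ 2) atTop (𝓝 0) := by
    have he : ∀ j, ‖cutR j g - g‖ ^ 2 = ∫ z, ((min 1 (j * wt z.2) - 1) * g z) ^ 2 := fun j => by
      rw [Lp.norm_sq_eq]
      refine integral_congr_ae ?_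
      filter_upwards [Lp.coeFn_sub (cutR j g) g,
        coeFn_velMul (continuous_cut j) (abs_cut_le j) g] with z h1 h2
      rw [h1, Pi.sub_apply, cutR, h2, norm_eq_abs, sq_abs]
      ring
    simp only [he]
    rw [show (0 : ℝ) = ∫ z : Phase d, (0 : ℝ) by simp]
    refine tendsto_integral_of_dominated_convergence (fun z => 4 * ‖g z‖ ^ 2) (fun j => ?_)
      ((Lp.integrable_norm_sq g).const_mul 4) (fun j => .of_forall fun z => ?_)
      (.of_forall fun z => ?_)
    · exact (((((continuous_cut j).comp continuous_snd).sub
        continuous_const).aestronglyMeasurable).mul (Lp.aestronglyMeasurable g)).pow 2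
    · rw [norm_of_nonneg (sq_nonneg _), mul_pow, norm_eq_abs, sq_abs]
      refine mul_le_mul_of_nonneg_right ?_ (sq_nonneg _)
      have := abs_le.1 (abs_cut_le j z.2)
      nlinarith
    · refine tendsto_const_nhds.congr' ?_
      obtain ⟨N, hN⟩ := exists_nat_ge (wt z.2)⁻¹
      filter_upwards [eventually_ge_atTop N] with j hj
      have h1 : (1 : ℝ) ≤ j * wt z.2 := by
        rw [← div_le_iff₀ (wt_pos _), one_div]
        exact hN.trans (by exact_mod_cast hj)
      rw [min_eq_left h1]; ring
  have h := hsq.sqrt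
  simpa [Real.sqrt_sq (norm_nonneg _)] using h

/-- Existence for sources `μ^{1/2} G`: the sources are truncated, the mild solutions converge
locally uniformly in time by the energy estimate. -/
lemma exists_weak (f₀ : L2 d) {G : ℝ → L2 d} (hG : ∀ T : ℝ, IntegrableOn G (Ioc 0 T))
    (hG2 : ∀ T : ℝ, IntegrableOn (fun s => ‖G s‖ ^ 2) (Ioc 0 T)) :
    ∃ u : ℝ → L2 d, ContinuousOn u (Ici 0) ∧ ∀ (φ : 𝓢(Phase d, ℝ)) (t : ℝ), 0 ≤ t →
      inner ℝ (u t) (tL φ) = inner ℝ f₀ (tL φ) + (∫ s in 0..t, inner ℝ (u s) (genT φ)) +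
        ∫ s in 0..t, inner ℝ (G s) (srcTest φ) := by
  set v : ℕ → ℝ → L2 d := fun j => mild f₀ fun s => cutH j (G s) with hv
  have hH : ∀ (j : ℕ) (T : ℝ), IntegrableOn (fun s => cutH j (G s)) (Ioc 0 T) :=
    fun j T => (cutH j).integrable_comp (hG T)
  have hR : ∀ (j : ℕ) (T : ℝ), IntegrableOn (fun s => cutR j (G s)) (Ioc 0 T) :=
    fun j T => (cutR j).integrable_comp (hG T)
  have hvc : ∀ j, ContinuousOn (v j) (Ici 0) := fun j => continuousOn_mild f₀ (hH j)
  have hvw : ∀ j (φ : 𝓢(Phase d, ℝ)) (t : ℝ), 0 ≤ t → inner ℝ (v j t) (tL φ) =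
      inner ℝ f₀ (tL φ) + (∫ s in 0..t, inner ℝ (v j s) (genT φ)) +
        ∫ s in 0..t, inner ℝ (cutR j (G s)) (srcTest φ) := fun j φ t ht => by
    rw [hv, inner_mild f₀ (hH j) φ ht]
    simp only [inner_cutH]
  set a : ℕ → ℝ → ℝ := fun j T => ∫ s in Ioc 0 T, ‖cutR j (G s) - G s‖ ^ 2 with ha
  have hdi : ∀ j T, IntegrableOn (fun s => ‖cutR j (G s) - G s‖ ^ 2) (Ioc 0 T) := fun j T => by
    refine ((hG2 T).const_mul 4).mono' (((hR j T).sub (hG T)).1.norm.pow 2)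
      (.of_forall fun s => ?_)
    rw [norm_of_nonneg (by positivity)]
    nlinarith [norm_cutR_sub_le j (G s), norm_nonneg (cutR j (G s) - G s), norm_nonneg (G s)]
  have ha0 : ∀ T, Tendsto (fun j => a j T) atTop (𝓝 0) := fun T => by
    have h := tendsto_integral_of_dominated_convergence (μ := volume.restrict (Ioc 0 T))
      (F := fun j s => ‖cutR j (G s) - G s‖ ^ 2) (f := fun _ => 0)
      (fun s => 4 * ‖G s‖ ^ 2) (fun j => (hdi j T).1) ((hG2 T).const_mul 4)
      (fun j => .of_forall fun s => by
        rw [norm_of_nonneg (by positivity)]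
        nlinarith [norm_cutR_sub_le j (G s), norm_nonneg (cutR j (G s) - G s), norm_nonneg (G s)])
      (.of_forall fun s => by
        have := (tendsto_iff_norm_sub_tendsto_zero.1 (tendsto_cutR (G s))).pow 2
        simpa using this)
    simpa using h
  set κ : ℝ → ℝ := fun T => 20 * (2 * d + 1) * (1 + T) * 2 with hκ
  have hamono : ∀ j {t T : ℝ}, t ≤ T → a j t ≤ a j T := fun j t T htT =>
    setIntegral_mono_set (hdi j T) (.of_forall fun s => by positivity)
      (Ioc_subset_Ioc_right htT).eventuallyLE
  have hanon : ∀ j T, 0 ≤ a j T := fun j T => integral_nonneg fun s => by positivity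
  -- the energy estimate for differences
  have hdiff : ∀ (T : ℝ), ∀ t ∈ Icc 0 T, ∀ j k,
      ‖v j t - v k t‖ ^ 2 ≤ κ T * (a j T + a k T) := by
    intro T t ht j k
    have hint : IntegrableOn (fun s => cutR j (G s) - cutR k (G s)) (Ioc 0 t) :=
      (hR j t).sub (hR k t)
    have hb : ∀ s, ‖cutR j (G s) - cutR k (G s)‖ ^ 2 ≤
        2 * (‖cutR j (G s) - G s‖ ^ 2 + ‖cutR k (G s) - G s‖ ^ 2) := fun s => by
      have h1 : ‖cutR j (G s) - cutR k (G s)‖ ≤ ‖cutR j (G s) - G s‖ + ‖cutR k (G s) - G s‖ := by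
        rw [← norm_sub_rev (G s) (cutR k (G s))]
        exact norm_sub_le_norm_sub_add_norm_sub _ _ _
      nlinarith [norm_nonneg (cutR j (G s) - cutR k (G s)),
        sq_nonneg (‖cutR j (G s) - G s‖ - ‖cutR k (G s) - G s‖)]
    have hbi := ((hdi j t).add (hdi k t)).const_mul 2
    have h2 : IntegrableOn (fun s => ‖cutR j (G s) - cutR k (G s)‖ ^ 2) (Ioc 0 t) :=
      hbi.mono' (hint.1.norm.pow 2) (.of_forall fun s => by
        rw [norm_of_nonneg (by positivity)]; exact hb s)
    have hRI : ∀ (l : ℕ) (φ : 𝓢(Phase d, ℝ)) (r : ℝ), 0 ≤ r → IntervalIntegrable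
        (fun s => inner ℝ (cutR l (G s)) (srcTest φ)) volume 0 r := fun l φ r hr =>
      (intervalIntegrable_iff_integrableOn_Ioc_of_le hr).2
        (Integrable.inner_const (𝕜 := ℝ) (hR l r) _)
    have h := norm_sq_le_of_weak (u := fun s => v j s - v k s) ht.1 ((hvc j).sub (hvc k)) hint h2
      (fun φ _ r hr => by
        simp only [← inner_srcTest]
        simp only [inner_sub_left]
        rw [hvw j φ r hr.1, hvw k φ r hr.1,
          intervalIntegral.integral_sub (integrableOn_inner (hvc j) _ hr.1)
            (integrableOn_inner (hvc k) _ hr.1),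
          intervalIntegral.integral_sub (hRI j φ r hr.1) (hRI k φ r hr.1)]
        ring)
    have h3 : ∫ s in Ioc 0 t, ‖cutR j (G s) - cutR k (G s)‖ ^ 2 ≤ 2 * (a j T + a k T) := by
      have h4 := integral_mono h2 hbi hb
      simp only [Pi.add_apply] at h4
      rw [integral_const_mul, integral_add (hdi j t) (hdi k t)] at h4
      exact h4.trans (mul_le_mul_of_nonneg_left
        (add_le_add (hamono j ht.2) (hamono k ht.2)) zero_le_two)
    have hT : 0 ≤ t := ht.1
    calc _ ≤ 20 * (2 * d + 1) * (1 + t) * (2 * (a j T + a k T)) :=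
          h.trans (mul_le_mul_of_nonneg_left h3 (by positivity))
      _ ≤ 20 * (2 * d + 1) * (1 + T) * (2 * (a j T + a k T)) := by
          have := hanon j T
          have := hanon k T
          have := ht.2
          gcongr
      _ = _ := by rw [hκ]; ring
  have hcau : ∀ t, 0 ≤ t → CauchySeq fun j => v j t := fun t ht => by
    refine Metric.cauchySeq_iff.2 fun ε hε => ?_
    have h0 : Tendsto (fun j => κ t * a j t) atTop (𝓝 0) := by simpa using (ha0 t).const_mul (κ t)
    obtain ⟨N, hN⟩ := eventually_atTop.1 (h0.eventually_lt_const (u := ε ^ 2 / 2) (by positivity))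
    refine ⟨N, fun j hj k hk => ?_⟩
    rw [dist_eq_norm]
    refine lt_of_pow_lt_pow_left₀ 2 hε.le ((hdiff t t ⟨ht, le_rfl⟩ j k).trans_lt ?_)
    linarith [hN j hj, hN k hk]
  choose! u hu using fun t (ht : 0 ≤ t) => cauchySeq_tendsto_of_complete (hcau t ht)
  have hclose : ∀ T, ∀ t ∈ Icc 0 T, ∀ j, ‖v j t - u t‖ ^ 2 ≤ κ T * a j T := fun T t ht j => by
    refine le_of_tendsto_of_tendsto' ((tendsto_const_nhds.sub (hu t ht.1)).norm.pow 2) ?_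
      (hdiff T t ht j)
    simpa using ((tendsto_const_nhds (x := a j T)).add (ha0 T)).const_mul (κ T)
  have hunif : ∀ T, TendstoUniformlyOn v u atTop (Icc 0 T) := fun T => by
    refine Metric.tendstoUniformlyOn_iff.2 fun ε hε => ?_
    have h0 : Tendsto (fun j => κ T * a j T) atTop (𝓝 0) := by simpa using (ha0 T).const_mul (κ T)
    filter_upwards [h0.eventually_lt_const (u := ε ^ 2) (by positivity)] with j hj t ht
    rw [dist_comm, dist_eq_norm]
    exact lt_of_pow_lt_pow_left₀ 2 hε.le ((hclose T t ht j).trans_lt hj)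
  have huc : ContinuousOn u (Ici 0) := fun t ht => by
    have h1 : ContinuousOn u (Icc 0 (t + 1)) := (hunif (t + 1)).continuousOn
      (Frequently.of_forall fun j => (hvc j).mono Icc_subset_Ici_self)
    refine (h1 t ⟨ht, by linarith⟩).mono_of_mem_nhdsWithin ?_
    rw [← Ici_inter_Iic]
    exact inter_mem_nhdsWithin _ (Iic_mem_nhds (by linarith))
  refine ⟨u, huc, fun φ t ht => ?_⟩
  have hlim2 : Tendsto (fun j => ∫ s in 0..t, inner ℝ (v j s) (genT φ)) atTop
      (𝓝 (∫ s in 0..t, inner ℝ (u s) (genT φ))) := by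
    refine tendsto_integral_filter_of_dominated_convergence
      (fun s => (‖u s‖ + 1) * ‖genT φ‖) (.of_forall fun j => ?_) ?_ ?_ ?_
    · exact (intervalIntegrable_iff.1 (integrableOn_inner (hvc j) (genT φ) ht)).1
    · filter_upwards [Metric.tendstoUniformlyOn_iff.1 (hunif t) 1 one_pos] with j hj
      refine .of_forall fun s hs => ?_
      rw [uIoc_of_le ht] at hs
      refine (norm_inner_le_norm _ _).trans (mul_le_mul_of_nonneg_right ?_ (norm_nonneg _))
      have h1 := hj s ⟨hs.1.le, hs.2⟩
      rw [dist_comm, dist_eq_norm] at h1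
      have h2 := norm_add_le (u s) (v j s - u s)
      rw [add_sub_cancel] at h2
      linarith
    · refine ContinuousOn.intervalIntegrable ?_
      rw [uIcc_of_le ht]
      exact ((huc.mono Icc_subset_Ici_self).norm.add continuousOn_const).mul continuousOn_const
    · refine .of_forall fun s hs => ?_
      rw [uIoc_of_le ht] at hs
      exact (hu s hs.1.le).inner tendsto_const_nhds
  have hlim3 : Tendsto (fun j => ∫ s in 0..t, inner ℝ (cutR j (G s)) (srcTest φ)) atTop
      (𝓝 (∫ s in 0..t, inner ℝ (G s) (srcTest φ))) := by
    refine tendsto_integral_filter_of_dominated_convergence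
      (fun s => 3 * ‖G s‖ * ‖srcTest φ‖) (.of_forall fun j => ?_) ?_ ?_ ?_
    · rw [uIoc_of_le ht]
      exact (Integrable.inner_const (𝕜 := ℝ) (hR j t) (srcTest φ)).1
    · refine .of_forall fun j => .of_forall fun s _ => ?_
      refine (norm_inner_le_norm _ _).trans (mul_le_mul_of_nonneg_right ?_ (norm_nonneg _))
      have h2 := norm_add_le (cutR j (G s) - G s) (G s)
      rw [sub_add_cancel] at h2
      linarith [norm_cutR_sub_le j (G s)]
    · exact (intervalIntegrable_iff_integrableOn_Ioc_of_le ht).2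
        (((hG t).norm.const_mul 3).mul_const _)
    · exact .of_forall fun s _ => (tendsto_cutR (G s)).inner tendsto_const_nhds
  refine tendsto_nhds_unique ((hu t ht).inner tendsto_const_nhds) ?_
  simp only [hvw _ φ t ht]
  exact (tendsto_const_nhds.add hlim2).add hlim3

/-- Existence and uniqueness for weighted square integrable sources. -/
lemma exists_unique_solution (f₀ : L2 d) (h : ℝ → Phase d → ℝ)
    (hh : ∀ T : ℝ, MemLp (fun p : ℝ × Phase d => invSqrtMuMul (h p.1) p.2) 2
      (volume.restrict (Ioc 0 T ×ˢ univ))) :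
    ∃ u : ℝ → L2 d, IsWeakSolution f₀ h u ∧
      ∀ u' : ℝ → L2 d, IsWeakSolution f₀ h u' → EqOn u' u (Ici 0) := by
  have hF := fun T => integrableOn_slice (F := fun s => invSqrtMuMul (h s)) (hh T)
  obtain ⟨u, huc, huw⟩ := exists_weak f₀ (fun T => (hF T).2.1) (fun T => (hF T).2.2)
  have hu : IsWeakSolution f₀ h u := by
    refine IsWeakSolution.mk' (sourceIntegrable_of_weight hh) huc fun φ _ t ht => ?_
    rw [huw φ t ht]
    congr 1
    rw [integral_of_le ht, integral_of_le ht]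
    refine integral_congr_ae ?_
    filter_upwards [(hF t).1] with s hs
    rw [inner_srcTest]
    exact (mul_of_weight (coeFn_slice (F := fun s => invSqrtMuMul (h s)) hs) φ).2.symm
  exact ⟨u, hu, fun u' hu' => hu.unique hu'⟩

/-- For sources in `L¹_loc(L²)` the solution is the Duhamel integral. -/
lemma isWeakSolution_duhamel (h : ℝ → Phase d → ℝ) (H : ℝ → L2 d)
    (hm : AEStronglyMeasurable (fun p : ℝ × Phase d => h p.1 p.2)
      (volume.restrict (Ioi 0 ×ˢ univ)))
    (he : ∀ᵐ s ∂volume.restrict (Ioi (0 : ℝ)), H s =ᵐ[volume] h s)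
    (hH : ∀ T : ℝ, IntegrableOn H (Ioc 0 T)) :
    IsWeakSolution 0 h (fun t => ∫ s in 0..t, solutionOperator (t - s) (H s)) :=
  (isWeakSolution_mild 0 (sourceIntegrable_of_L1 hm he hH) hH he).congr
    fun _ ht => integral_solutionOperator hH ht

/-! ### Smoothing of mixed norms in the position variable -/

/-- Hölder's inequality with `L^{q'}` interpolated between `L²` and `L^∞`. -/
lemma lintegral_mul_le_of_sup_of_sq {q : ℝ} (hq1 : 1 ≤ q) (hq2 : q ≤ 2) {g : Vec d → ℝ}
    {f : Vec d → ℂ} (hg : AEStronglyMeasurable g volume) (hf : AEStronglyMeasurable f volume)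
    {M s : ℝ} (hM : 0 ≤ M) (hs : 0 ≤ s) (hsup : ∀ x, ‖f x‖ ≤ M * s)
    (hsq : ∫⁻ x, ‖f x‖ₑ ^ 2 ≤ ofReal (M ^ 2)) :
    ∫⁻ x, ‖g x‖ₑ * ‖f x‖ₑ ≤
      ofReal (M * s ^ (2 / q - 1)) * eLpNorm g (ofReal q) volume := by
  have hsup' : ∀ x, ‖f x‖ₑ ≤ ofReal (M * s) := fun x => by
    rw [← ofReal_norm]; exact ENNReal.ofReal_le_ofReal (hsup x)
  have hq0 : 0 < q := by linarith
  rcases hq1.eq_or_lt with rfl | hq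
  · rw [ENNReal.ofReal_one, eLpNorm_one_eq_lintegral_enorm, mul_comm,
      ← lintegral_mul_const'' _ hg.enorm]
    norm_num
    exact lintegral_mono fun x => mul_le_mul_right (hsup' x) _
  · have hpq := Real.HolderConjugate.conjExponent hq
    set p := Real.conjExponent q with hp
    have hp0 : 0 < p := hpq.symm.pos
    have hpe : 1 / p = 1 - 1 / q := by
      have := hpq.inv_add_inv_eq_one
      rw [one_div, one_div]; linarith
    have hp2 : 2 ≤ p := by
      have h1 : 1 / 2 ≤ 1 / q := one_div_le_one_div_of_le hq0 hq2
      have h2 : 1 / p ≤ 1 / 2 := by rw [hpe]; linarith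
      exact (one_div_le_one_div hp0 two_pos).1 h2
    refine (ENNReal.lintegral_mul_le_Lp_mul_Lq volume hpq hg.enorm hf.enorm).trans ?_
    rw [mul_comm, eLpNorm_eq_lintegral_rpow_enorm_toReal (by simpa using hq0) (by simp),
      ENNReal.toReal_ofReal hq0.le]
    refine mul_le_mul_left ?_ _
    have h1 : ∫⁻ x, ‖f x‖ₑ ^ p ≤ ofReal ((M * s) ^ (p - 2) * M ^ 2) := by
      rw [ENNReal.ofReal_mul (by positivity)]
      calc ∫⁻ x, ‖f x‖ₑ ^ p ≤ ∫⁻ x, ofReal ((M * s) ^ (p - 2)) * ‖f x‖ₑ ^ 2 := by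
            refine lintegral_mono fun x => ?_
            rw [← ENNReal.ofReal_rpow_of_nonneg (by positivity) (by linarith)]
            have : ‖f x‖ₑ ^ p = ‖f x‖ₑ ^ (p - 2) * ‖f x‖ₑ ^ (2 : ℕ) := by
              rw [← ENNReal.rpow_natCast, ← ENNReal.rpow_add_of_nonneg _ _ (by linarith)
                (by norm_num)]
              norm_num
            rw [this]
            gcongr
            exact hsup' x
        _ = ofReal ((M * s) ^ (p - 2)) * ∫⁻ x, ‖f x‖ₑ ^ 2 :=
            lintegral_const_mul'' _ (hf.enorm.pow_const 2)
        _ ≤ _ := by gcongr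
    refine (ENNReal.rpow_le_rpow h1 (by positivity)).trans_eq ?_
    rw [ENNReal.ofReal_rpow_of_nonneg (by positivity) (by positivity)]
    congr 1
    have h2 : (M * s) ^ (p - 2) * M ^ 2 = M ^ p * s ^ (p - 2) := by
      have : M ^ p = M ^ (p - 2) * M ^ (2 : ℕ) := by
        rw [← rpow_natCast, ← Real.rpow_add_of_nonneg hM (by linarith) (by norm_num)]
        norm_num
      rw [this, mul_rpow hM hs]; ring
    rw [h2, mul_rpow (by positivity) (by positivity), ← rpow_mul hM,
      ← rpow_mul hs, mul_one_div_cancel hp0.ne', Real.rpow_one]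
    congr 2
    rw [sub_mul, mul_one_div_cancel hp0.ne', hpe]; ring

/-- The Gaussian multiplier `e^{-τ|ξ|²}`. -/
def damp (τ : ℝ) (k : Vec d) : ℝ := exp (-(τ * ‖xi k‖ ^ 2))

lemma damp_pos (τ : ℝ) (k : Vec d) : 0 < damp τ k := exp_pos _

lemma damp_eq (τ : ℝ) (k : Vec d) :
    damp τ k = exp (-(τ * (2 * π) ^ 2 * ‖k‖ ^ 2)) := by
  rw [damp, xi, norm_smul, norm_of_nonneg (by positivity)]
  congr 1; ring

lemma continuous_damp (τ : ℝ) : Continuous (damp τ : Vec d → ℝ) := by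
  unfold damp
  have := continuous_xi (d := d)
  fun_prop

lemma damp_le_one {τ : ℝ} (hτ : 0 ≤ τ) (k : Vec d) : damp τ k ≤ 1 :=
  exp_le_one_iff.2 (neg_nonpos.2 (by positivity))

variable (d) in
/-- The value of `∫ e^{-|ξ|²} dk`. -/
def gaussConst : ℝ := (π / (2 * π) ^ 2) ^ ((d : ℝ) / 2)

lemma gaussConst_pos : 0 < gaussConst d := by unfold gaussConst; positivity

lemma integral_damp {τ : ℝ} (hτ : 0 < τ) :
    ∫ k : Vec d, damp τ k = gaussConst d * τ ^ (-((d : ℝ) / 2)) := by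
  have h := GaussianFourier.integral_rexp_neg_mul_sq_norm (V := Vec d)
    (b := τ * (2 * π) ^ 2) (by positivity)
  simp only [neg_mul] at h
  simp only [damp_eq, h, gaussConst, finrank_euclideanSpace, Fintype.card_fin]
  rw [rpow_neg hτ.le, ← div_eq_mul_inv, ← Real.div_rpow (by positivity) hτ.le]
  congr 1
  field_simp

lemma integrable_damp {τ : ℝ} (hτ : 0 < τ) : Integrable (damp τ : Vec d → ℝ) := by
  have h := (gaussianS (V := Vec d) (c := τ * (2 * π) ^ 2) (by positivity)).integrable
    (μ := volume)
  refine h.congr (.of_forall fun k => ?_)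
  rw [gaussianS_apply, damp_eq]

/-- Multiplication of a Schwartz function by the Gaussian multiplier. -/
def dampS {τ : ℝ} (hτ : 0 < τ) (γ : 𝓢(Vec d, ℂ)) : 𝓢(Vec d, ℂ) :=
  smulLeftCLM ℂ (toC (gaussianS (V := Vec d) (c := τ * (2 * π) ^ 2) (by positivity))) γ

lemma dampS_apply {τ : ℝ} (hτ : 0 < τ) (γ : 𝓢(Vec d, ℂ)) (k : Vec d) :
    dampS hτ γ k = damp τ k * γ k := by
  rw [dampS, smulLeftCLM_apply_apply (SchwartzMap.hasTemperateGrowth _), toC_apply,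
    gaussianS_apply, ← damp_eq, smul_eq_mul]

lemma norm_symb_le (α : Idx d) (ξ : Vec d) : ‖symb α ξ‖ ≤ ‖ξ‖ ^ deg α := by
  rw [symb, norm_prod, deg, ← Finset.prod_pow_eq_pow_sum]
  refine Finset.prod_le_prod (fun i _ => norm_nonneg _) fun i _ => ?_
  rw [norm_pow, norm_mul, norm_I, one_mul, norm_real]
  exact pow_le_pow_left₀ (norm_nonneg _) (PiLp.norm_apply_le ξ i) _

/-- The heat multiplier absorbs the derivatives: `|ξ^α e^{-τ|ξ|²}|² ≤ m! τ^{-m} e^{-τ|ξ|²}`. -/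
lemma norm_symb_mul_damp_sq_le (α : Idx d) {τ : ℝ} (hτ : 0 < τ) (k : Vec d) :
    (‖symb α (xi k)‖ * damp τ k) ^ 2 ≤
      (deg α).factorial * (τ ^ deg α)⁻¹ * damp τ k := by
  have h1 := Real.pow_div_factorial_le_exp (x := τ * ‖xi k‖ ^ 2) (by positivity) (deg α)
  have h2 : damp τ k * exp (τ * ‖xi k‖ ^ 2) = 1 := by
    rw [damp, ← exp_add]; simp
  have h3 := damp_pos τ k
  have h4 : ‖symb α (xi k)‖ ^ 2 ≤ (‖xi k‖ ^ 2) ^ deg α := by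
    rw [← pow_mul, mul_comm, pow_mul]
    exact pow_le_pow_left₀ (norm_nonneg _) (norm_symb_le α _) 2
  have h5 : (‖xi k‖ ^ 2) ^ deg α * damp τ k ≤ (deg α).factorial * (τ ^ deg α)⁻¹ := by
    rw [div_le_iff₀ (by positivity), mul_pow] at h1
    rw [← div_eq_mul_inv, le_div_iff₀ (by positivity)]
    calc (‖xi k‖ ^ 2) ^ deg α * damp τ k * τ ^ deg α =
        damp τ k * (τ ^ deg α * (‖xi k‖ ^ 2) ^ deg α) := by ring
      _ ≤ damp τ k * (exp (τ * ‖xi k‖ ^ 2) * (deg α).factorial) := by gcongr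
      _ = (deg α).factorial := by rw [← mul_assoc, h2, one_mul]
  calc (‖symb α (xi k)‖ * damp τ k) ^ 2 = ‖symb α (xi k)‖ ^ 2 * damp τ k * damp τ k := by ring
    _ ≤ (‖xi k‖ ^ 2) ^ deg α * damp τ k * damp τ k := by gcongr
    _ ≤ _ := by gcongr

/-- The constant of the smoothing estimate. -/
def mixConst (d : ℕ) (q : ℝ) (m : ℕ) : ℝ :=
  √m.factorial * √(gaussConst d) ^ (2 / q - 1)

lemma mixConst_pos (q : ℝ) (m : ℕ) : 0 < mixConst d q m := by
  have := gaussConst_pos (d := d)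
  unfold mixConst; positivity

/-- The smoothing estimate for the Fourier transform of `ξ^α e^{-τ|ξ|²} Γ` paired with `g ∈ L^q`. -/
lemma lintegral_mul_fourier_le {q : ℝ} (hq1 : 1 ≤ q) (hq2 : q ≤ 2) (α : Idx d) {τ : ℝ}
    (hτ : 0 < τ) {g : Vec d → ℝ} (hg : AEStronglyMeasurable g volume) (Ξ Γ : 𝓢(Vec d, ℂ))
    (h : ∀ k, ‖Ξ k‖ = ‖symb α (xi k)‖ * damp τ k * ‖Γ k‖) :
    ∫⁻ x, ‖g x‖ₑ * ‖𝓕 Ξ x‖ₑ ≤ ofReal (mixConst d q (deg α) * τ ^ (-sigma d q (deg α))) *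
      (∫⁻ k, ‖Γ k‖ₑ ^ 2) ^ (1 / 2 : ℝ) * eLpNorm g (ofReal q) volume := by
  set N : ℝ := ∫ k, ‖Γ k‖ ^ 2 with hN
  have hΓi : Integrable fun k => ‖Γ k‖ ^ 2 :=
    (memLp_two_iff_integrable_sq_norm Γ.continuous.aestronglyMeasurable).1 (Γ.memLp 2 volume)
  have hN0 : 0 ≤ N := integral_nonneg fun k => by positivity
  have hNl : ∫⁻ k, ‖Γ k‖ₑ ^ 2 = ofReal N := by
    rw [hN, ofReal_integral_eq_lintegral_ofReal hΓi (.of_forall fun k => by positivity)]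
    refine lintegral_congr fun k => ?_
    rw [ENNReal.ofReal_pow (norm_nonneg _), ofReal_norm]
  set B : ℝ := (deg α).factorial * (τ ^ deg α)⁻¹ with hB
  have hB0 : 0 < B := by positivity
  set D : ℝ := gaussConst d * τ ^ (-((d : ℝ) / 2)) with hD
  have hD0 : 0 < D := by have := gaussConst_pos (d := d); positivity
  have hp : ∀ k, (‖symb α (xi k)‖ * damp τ k) ^ 2 ≤ B * damp τ k :=
    norm_symb_mul_damp_sq_le α hτ
  -- the sup bound, by Cauchy–Schwarz on the frequency side
  have hsup : ∀ x, ‖𝓕 Ξ x‖ ≤ (√B * √N) * √D := fun x => by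
    have h1 : ‖𝓕 Ξ x‖ ≤ ∫ k, ‖Ξ k‖ := VectorFourier.norm_fourierIntegral_le_integral_norm _ _ _ _ _
    refine h1.trans ?_
    simp only [h]
    have hpi : MemLp (fun k => ‖symb α (xi k)‖ * damp τ k) 2 (volume : Measure (Vec d)) := by
      have hc : Continuous fun k : Vec d => ‖symb α (xi k)‖ * damp τ k :=
        (continuous_symb_xi α).norm.mul (continuous_damp τ)
      refine (memLp_two_iff_integrable_sq hc.aestronglyMeasurable).2
        (((integrable_damp hτ).const_mul B).mono' (hc.pow 2).aestronglyMeasurable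
          (.of_forall fun k => ?_))
      rw [norm_of_nonneg (by positivity)]
      exact hp k
    have h2 := integral_mul_le_Lp_mul_Lq_of_nonneg (μ := (volume : Measure (Vec d)))
      Real.HolderConjugate.two_two (f := fun k => ‖symb α (xi k)‖ * damp τ k) (g := fun k => ‖Γ k‖)
      (.of_forall fun k => mul_nonneg (norm_nonneg _) (damp_pos τ k).le)
      (.of_forall fun k => norm_nonneg _) (by simpa using hpi)
      (by simpa using (Γ.memLp 2 volume).norm)
    refine h2.trans ?_
    simp only [Real.rpow_two, ← sqrt_eq_rpow]
    rw [mul_right_comm, ← hN, ← sqrt_mul hB0.le]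
    refine mul_le_mul_of_nonneg_right (Real.sqrt_le_sqrt ?_) (sqrt_nonneg _)
    rw [hD, ← integral_damp hτ, ← integral_const_mul]
    exact integral_mono ((memLp_two_iff_integrable_sq hpi.1).1 hpi)
      ((integrable_damp hτ).const_mul B) hp
  have hsq : ∫⁻ x, ‖𝓕 Ξ x‖ₑ ^ 2 ≤ ofReal ((√B * √N) ^ 2) := by
    have hi : Integrable fun x => ‖𝓕 Ξ x‖ ^ 2 :=
      (memLp_two_iff_integrable_sq_norm (𝓕 Ξ).continuous.aestronglyMeasurable).1
        ((𝓕 Ξ).memLp 2 volume)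
    have hi2 : Integrable fun x => ‖Ξ x‖ ^ 2 :=
      (memLp_two_iff_integrable_sq_norm Ξ.continuous.aestronglyMeasurable).1 (Ξ.memLp 2 volume)
    have e : ∫⁻ x, ‖𝓕 Ξ x‖ₑ ^ 2 = ofReal (∫ x, ‖𝓕 Ξ x‖ ^ 2) := by
      rw [ofReal_integral_eq_lintegral_ofReal hi (.of_forall fun k => by positivity)]
      refine lintegral_congr fun k => ?_
      rw [ENNReal.ofReal_pow (norm_nonneg _), ofReal_norm]
    rw [e, integral_norm_sq_fourier, mul_pow, sq_sqrt hB0.le, sq_sqrt hN0, hN,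
      ← integral_const_mul]
    refine ENNReal.ofReal_le_ofReal (integral_mono hi2 (hΓi.const_mul B) fun k => ?_)
    dsimp only
    rw [h, mul_pow]
    refine mul_le_mul_of_nonneg_right ((hp k).trans ?_) (by positivity)
    exact mul_le_of_le_one_right hB0.le (damp_le_one hτ.le k)
  refine (lintegral_mul_le_of_sup_of_sq hq1 hq2 hg (𝓕 Ξ).continuous.aestronglyMeasurable
    (by positivity) (sqrt_nonneg D) hsup hsq).trans_eq ?_
  rw [hNl, ENNReal.ofReal_rpow_of_nonneg hN0 (by norm_num), ← ENNReal.ofReal_mul (by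
    have := mixConst_pos (d := d) q (deg α); positivity)]
  congr 2
  rw [← sqrt_eq_rpow, mul_right_comm]
  congr 1
  have hg0 := gaussConst_pos (d := d)
  have e1 : √B = √(deg α).factorial * τ ^ (-((deg α : ℝ) / 2)) := by
    rw [hB, sqrt_mul (by positivity), ← rpow_natCast, ← rpow_neg hτ.le,
      sqrt_eq_rpow (τ ^ _), ← rpow_mul hτ.le]
    congr 2; ring
  have e2 : √D ^ (2 / q - 1) = √(gaussConst d) ^ (2 / q - 1) *
      τ ^ (-((d : ℝ) / 2 * (1 / q - 1 / 2))) := by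
    rw [hD, sqrt_mul hg0.le, mul_rpow (sqrt_nonneg _) (sqrt_nonneg _),
      sqrt_eq_rpow (τ ^ _), ← rpow_mul hτ.le, ← rpow_mul hτ.le]
    congr 2; ring
  rw [e1, e2, mixConst, sigma, neg_add, Real.rpow_add hτ]
  ring

/-! ### The smoothing estimate for mixed norms, by duality -/

lemma aestronglyMeasurable_swap {G : Phase d → ℝ} (hG : AEStronglyMeasurable G volume) :
    ∀ᵐ v : Vec d, AEStronglyMeasurable (fun x : Vec d => G (x, v)) volume :=
  (hG.prod_swap (μ := (volume : Measure (Vec d))) (ν := (volume : Measure (Vec d)))).prodMk_left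

lemma aemeasurable_mixed {G : Phase d → ℝ} (hG : AEStronglyMeasurable G volume) {q : ℝ}
    (hq : 0 < q) :
    AEMeasurable (fun v : Vec d => eLpNorm (fun x : Vec d => G (x, v)) (ofReal q) volume)
      volume := by
  have h := (hG.prod_swap (μ := (volume : Measure (Vec d))) (ν := (volume : Measure (Vec d))))
  simp only [eLpNorm_eq_lintegral_rpow_enorm_toReal (p := ofReal q) (by simpa using hq)
    (by simp)]
  exact ((h.enorm.pow_const _).lintegral_prod_right').pow_const _

/-- Integration in `v` of bounds in terms of the `L^q` norms of the slices. -/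
lemma lintegral_le_mixedNorm {q : ℝ} (hq : 0 < q) {G : Phase d → ℝ} {F : Phase d → ℂ}
    (hG : AEStronglyMeasurable G volume) (hF : AEStronglyMeasurable F volume) {B : ℝ≥0∞}
    {N : Vec d → ℝ≥0∞} (hN : AEMeasurable N volume)
    (h : ∀ᵐ v : Vec d, ∫⁻ x, ‖G (x, v)‖ₑ * ‖F (x, v)‖ₑ ≤
      B * N v ^ (1 / 2 : ℝ) * eLpNorm (fun x : Vec d => G (x, v)) (ofReal q) volume) :
    ∫⁻ z, ‖G z‖ₑ * ‖F z‖ₑ ≤ B * (∫⁻ v, N v) ^ (1 / 2 : ℝ) * mixedNorm q G := by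
  have h1 : ∫⁻ z, ‖G z‖ₑ * ‖F z‖ₑ = ∫⁻ v : Vec d, ∫⁻ x : Vec d, ‖G (x, v)‖ₑ * ‖F (x, v)‖ₑ :=
    lintegral_prod_symm _ (hG.enorm.mul hF.enorm)
  rw [h1]
  refine (lintegral_mono_ae h).trans ?_
  simp only [mul_assoc]
  have hm := aemeasurable_mixed hG hq
  have hNm : AEMeasurable (fun v => N v ^ (1 / 2 : ℝ) *
      eLpNorm (fun x : Vec d => G (x, v)) (ofReal q) volume) volume :=
    (hN.pow_const _).mul hm
  rw [lintegral_const_mul'' _ hNm]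
  gcongr
  refine (ENNReal.lintegral_mul_le_Lp_mul_Lq volume Real.HolderConjugate.two_two
    (hN.pow_const _) hm).trans_eq ?_
  rw [mixedNorm]
  congr 2
  · refine lintegral_congr fun v => ?_
    rw [← ENNReal.rpow_mul]; norm_num
  · refine lintegral_congr fun v => ?_
    rw [← ENNReal.rpow_natCast]; norm_num

/-- A function with finite mixed norm is a tempered distribution. -/
lemma exists_functional {q : ℝ} (hq1 : 1 ≤ q) (hq2 : q ≤ 2) {G : Phase d → ℝ}
    (hG : AEStronglyMeasurable G volume) (hfin : mixedNorm q G < ⊤) :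
    ∃ ℓ : 𝓢(Phase d, ℂ) →L[ℂ] ℂ, ∀ Φ, ℓ Φ = ∫ z, (G z : ℂ) * Φ z := by
  set w : Vec d → ℝ := fun x => (1 + ‖x‖) ^ (-((d : ℝ) + 1)) with hw
  have hwi : Integrable w := integrable_one_add_norm (by simp)
  have hw0 : ∀ x, 0 ≤ w x := fun x => by positivity
  have hw1 : ∀ x, w x ≤ 1 := fun x => Real.rpow_le_one_of_one_le_of_nonpos
    (by linarith [norm_nonneg x]) (by linarith [(Nat.cast_nonneg d : (0 : ℝ) ≤ d)])
  have hwc : Continuous w := by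
    have : Continuous fun x : Vec d => 1 + ‖x‖ := by fun_prop
    exact this.rpow_const fun x => Or.inl (by positivity)
  have hwl : ∫⁻ x, ‖(w x : ℂ)‖ₑ ^ 2 ≤ ofReal (∫ x, w x) := by
    rw [ofReal_integral_eq_lintegral_ofReal hwi (.of_forall hw0)]
    refine lintegral_mono fun x => ?_
    rw [← ofReal_norm, norm_real, norm_of_nonneg (hw0 x),
      ← ENNReal.ofReal_pow (hw0 x)]
    exact ENNReal.ofReal_le_ofReal (by nlinarith [hw0 x, hw1 x])
  set A : ℝ := ∫ x, w x with hA
  have hA0 : 0 ≤ A := integral_nonneg hw0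
  set M : ℝ := 1 + √A with hM
  have hM1 : 1 ≤ M := by rw [hM]; linarith [sqrt_nonneg A]
  have hAM : A ≤ M ^ 2 := by
    rw [hM]; nlinarith [sq_sqrt hA0, sqrt_nonneg A]
  have hbound : ∫⁻ z : Phase d, ‖G z‖ₑ * ‖((w z.1 * w z.2 : ℝ) : ℂ)‖ₑ < ⊤ := by
    refine (lintegral_le_mixedNorm (by linarith : 0 < q) hG
      (F := fun z => ((w z.1 * w z.2 : ℝ) : ℂ)) (B := ofReal (M * 1 ^ (2 / q - 1)))
      (N := fun v => ‖(w v : ℂ)‖ₑ ^ 2) ?_ ?_ ?_).trans_lt ?_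
    · exact (continuous_ofReal.comp ((hwc.comp continuous_fst).mul
        (hwc.comp continuous_snd))).aestronglyMeasurable
    · exact (continuous_ofReal.comp hwc).enorm.measurable.aemeasurable.pow_const 2
    · filter_upwards [aestronglyMeasurable_swap hG] with v hv
      have h := lintegral_mul_le_of_sup_of_sq hq1 hq2 hv (f := fun x => (w x : ℂ))
        (continuous_ofReal.comp hwc).aestronglyMeasurable (by linarith : 0 ≤ M) zero_le_one
        (fun x => by
          rw [norm_real, norm_of_nonneg (hw0 x), mul_one]
          exact (hw1 x).trans hM1) (hwl.trans (ENNReal.ofReal_le_ofReal hAM))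
      have e : ((‖(w v : ℂ)‖ₑ ^ 2) ^ (1 / 2 : ℝ)) = ‖(w v : ℂ)‖ₑ := by
        rw [← ENNReal.rpow_natCast, ← ENNReal.rpow_mul]; norm_num
      simp only [ofReal_mul, enorm_mul, ← mul_assoc, e]
      rw [lintegral_mul_const' _ _ enorm_ne_top, mul_right_comm]
      gcongr
    · refine ENNReal.mul_lt_top (ENNReal.mul_lt_top ENNReal.ofReal_lt_top ?_) hfin
      exact ENNReal.rpow_lt_top_of_nonneg (by norm_num)
        (hwl.trans_lt ENNReal.ofReal_lt_top).ne
  have hGw : Integrable fun z : Phase d => |G z| * (w z.1 * w z.2) := by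
    refine ⟨(hG.norm.mul ((hwc.comp continuous_fst).mul
      (hwc.comp continuous_snd)).aestronglyMeasurable), ?_⟩
    refine lt_of_eq_of_lt (lintegral_congr fun z => ?_) hbound
    rw [enorm_mul]
    congr 1
    · rw [← ofReal_norm, ← ofReal_norm, norm_eq_abs, abs_abs, norm_eq_abs]
    · rw [← ofReal_norm, ← ofReal_norm, norm_real]
  set n : ℕ := 2 * (d + 1) with hn
  -- pointwise domination of a Schwartz function by the weight
  have hdom : ∀ (Φ : 𝓢(Phase d, ℂ)) z, ‖Φ z‖ ≤ (2 ^ n * (Finset.Iic (n, 0)).sup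
      (fun m => SchwartzMap.seminorm ℂ m.1 m.2) Φ) * (w z.1 * w z.2) := fun Φ z => by
    have h1 := one_add_le_sup_seminorm_apply (𝕜 := ℂ) (m := (n, 0)) (k := n) (n := 0) le_rfl le_rfl
      Φ z
    rw [norm_iteratedFDeriv_zero] at h1
    have hz : w z.1 * w z.2 * (1 + ‖z‖) ^ n ≥ 1 := by
      have hx : ∀ x : Vec d, ‖x‖ ≤ ‖z‖ → 1 ≤ w x * (1 + ‖z‖) ^ (d + 1) := fun x hx => by
        rw [hw]
        dsimp only
        rw [rpow_neg (by positivity), show (d : ℝ) + 1 = ((d + 1 : ℕ) : ℝ) by push_cast; ring,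
          rpow_natCast, ← div_eq_inv_mul, le_div_iff₀ (by positivity), one_mul]
        gcongr
      have h2 := hx z.1 (norm_fst_le z)
      have h3 := hx z.2 (norm_snd_le z)
      rw [hn, two_mul, pow_add]
      nlinarith
    have hS := (norm_nonneg (Φ z))
    have hP : 0 ≤ w z.1 * w z.2 := mul_nonneg (hw0 _) (hw0 _)
    calc ‖Φ z‖ ≤ (w z.1 * w z.2 * (1 + ‖z‖) ^ n) * ‖Φ z‖ := le_mul_of_one_le_left hS hz
      _ = ((1 + ‖z‖) ^ n * ‖Φ z‖) * (w z.1 * w z.2) := by ring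
      _ ≤ _ := mul_le_mul_of_nonneg_right h1 hP
  have hle : ∀ (Φ : 𝓢(Phase d, ℂ)) z, ‖(G z : ℂ) * Φ z‖ ≤ (2 ^ n * (Finset.Iic (n, 0)).sup
      (fun m => SchwartzMap.seminorm ℂ m.1 m.2) Φ) * (|G z| * (w z.1 * w z.2)) := fun Φ z => by
    rw [norm_mul, norm_real, norm_eq_abs]
    calc _ ≤ |G z| * ((2 ^ n * (Finset.Iic (n, 0)).sup
      (fun m => SchwartzMap.seminorm ℂ m.1 m.2) Φ) * (w z.1 * w z.2)) := by gcongr; exact hdom Φ z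
      _ = _ := by ring
  have hint : ∀ Φ : 𝓢(Phase d, ℂ), Integrable fun z => (G z : ℂ) * Φ z := fun Φ =>
    (hGw.const_mul _).mono' ((continuous_ofReal.comp_aestronglyMeasurable hG).mul
      Φ.continuous.aestronglyMeasurable) (.of_forall (hle Φ))
  refine ⟨mkCLMtoNormedSpace (fun Φ => ∫ z, (G z : ℂ) * Φ z) (fun Φ Ψ => ?_) (fun c Φ => ?_)
    ⟨Finset.Iic (n, 0), 2 ^ n * ∫ z : Phase d, |G z| * (w z.1 * w z.2), ?_, fun Φ => ?_⟩,
    fun Φ => rfl⟩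
  · simp only [add_apply, mul_add]
    exact integral_add (hint Φ) (hint Ψ)
  · simp only [smul_apply, smul_eq_mul, mul_left_comm _ c]
    exact integral_const_mul c _
  · exact mul_nonneg (by positivity) (integral_nonneg fun z =>
      mul_nonneg (abs_nonneg _) (mul_nonneg (hw0 _) (hw0 _)))
  · refine (norm_integral_le_of_norm_le (hGw.const_mul _)
      (.of_forall (hle Φ))).trans_eq ?_
    rw [integral_const_mul, mul_right_comm]
    rfl

/-- A weak derivative between a square integrable function and a function with finite mixed norm
may be tested with Schwartz functions. -/
lemma weak_deriv_schwartz {q : ℝ} (hq1 : 1 ≤ q) (hq2 : q ≤ 2) (γ : Idx d) {G₁ : L2 d}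
    {G₂ : Phase d → ℝ} (hG : AEStronglyMeasurable G₂ volume) (hfin : mixedNorm q G₂ < ⊤)
    (hw : ∀ φ : 𝓢(Phase d, ℝ), HasCompactSupport φ →
      ∫ z, G₂ z * xDeriv γ φ z = (-1) ^ deg γ * ∫ z, G₁ z * φ z) (Φ : 𝓢(Phase d, ℂ)) :
    ∫ z, (G₂ z : ℂ) * dxS γ Φ z = (-1) ^ deg γ * pairS G₁ Φ := by
  obtain ⟨ℓ, hℓ⟩ := exists_functional hq1 hq2 hG hfin
  have h0 : ℓ ∘L dxS γ - ((-1) ^ deg γ : ℂ) • pairSL G₁ = 0 := by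
    refine schwartz_functional_ext fun φ hφ => ?_
    rw [sub_apply, smul_apply, ContinuousLinearMap.comp_apply, hℓ, pairSL_toC]
    simp only [dxS_toC, ← ofReal_mul]
    rw [integral_complex_ofReal, hw φ hφ, smul_eq_mul]
    simp
  have h1 := congrArg (fun f => f Φ) h0
  simp only [sub_apply, smul_apply, ContinuousLinearMap.comp_apply, hℓ, pairSL_apply,
    zero_apply, smul_eq_mul] at h1
  exact sub_eq_zero.1 h1

/-- Complex conjugation of a Schwartz function. -/
def conjS (γ : 𝓢(Vec d, ℂ)) : 𝓢(Vec d, ℂ) :=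
  γ.postcompCLM (Complex.conjCLE : ℂ →L[ℝ] ℂ)

lemma conjS_apply (γ : 𝓢(Vec d, ℂ)) (k : Vec d) : conjS γ k = (starRingEnd ℂ) (γ k) := rfl

/-- The field `k ↦ γ(k) hb n`. -/
def elemF (n : Idx d) : 𝓢(Vec d, ℂ) →L[ℂ] XX d :=
  (ContinuousLinearMap.toSpanSingleton ℂ (hb n : VE d)).compLpL 2 volume ∘L toLpCLM ℂ ℂ 2 volume

lemma coeFn_elemF (n : Idx d) (γ : 𝓢(Vec d, ℂ)) :
    ∀ᵐ k, elemF n γ k = γ k • (hb n : VE d) := by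
  have h1 := (ContinuousLinearMap.toSpanSingleton ℂ (hb n : VE d)).coeFn_compLpL
    (p := 2) (μ := (volume : Measure (Vec d))) (toLpCLM ℂ ℂ 2 volume γ)
  filter_upwards [h1, γ.coeFn_toLp 2] with k h1 h2
  change ((ContinuousLinearMap.toSpanSingleton ℂ (hb n : VE d)).compLpL 2 volume
    (toLpCLM ℂ ℂ 2 volume γ) : XX d) k = _
  rw [h1]
  change ContinuousLinearMap.toSpanSingleton ℂ (hb n : VE d) (γ.toLp 2 volume k) = _
  rw [h2, ContinuousLinearMap.toSpanSingleton_apply]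

lemma coeFn_sum_hb (s : Finset (Idx d)) (c : (Idx d) → ℂ) :
    ∀ᵐ v : Vec d, (∑ n ∈ s, c n • (hb n : VE d) : VE d) v = ∑ n ∈ s, c n * (herm n v : ℂ) := by
  classical
  induction s using Finset.induction_on with
  | empty =>
    filter_upwards [Lp.coeFn_zero ℂ 2 (volume : Measure (Vec d))] with v hv
    simpa using hv
  | insert n s hn ih =>
    rw [sum_insert hn]
    filter_upwards [ih, Lp.coeFn_add (c n • (hb n : VE d)) (∑ n ∈ s, c n • (hb n : VE d)),
      Lp.coeFn_smul (c n) (hb n : VE d), coeFn_hermL n] with v h1 h2 h3 h4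
    rw [h2, Pi.add_apply, h3, Pi.smul_apply, h1, sum_insert hn, hb_apply, h4, smul_eq_mul]

/-- The size of `∑ g_n hb n`, computed in the variables `(k, v)`. -/
lemma lintegral_sum_tens (s : Finset (Idx d)) (g : (Idx d) → 𝓢(Vec d, ℂ)) :
    ∫⁻ v : Vec d, ∫⁻ k : Vec d, ‖∑ n ∈ s, (herm n v : ℂ) * g n k‖ₑ ^ 2 =
      ‖∑ n ∈ s, elemF n (g n)‖ₑ ^ 2 := by
  have hc : Continuous fun p : Vec d × Vec d => ∑ n ∈ s, (herm n p.1 : ℂ) * g n p.2 := by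
    refine continuous_finsetSum _ fun n _ => ?_
    exact (continuous_ofReal.comp ((herm n).continuous.comp continuous_fst)).mul
      ((g n).continuous.comp continuous_snd)
  rw [lintegral_lintegral_swap (hc.enorm.measurable.pow_const 2).aemeasurable, Lp.enorm_sq_eq]
  have h : ∀ᵐ k, ∀ n, elemF n (g n) k = g n k • (hb n : VE d) :=
    ae_all_co fun n => coeFn_elemF n (g n)
  refine lintegral_congr_ae ?_
  filter_upwards [h, coeFn_sum s fun n => elemF n (g n)] with k h1 h2
  rw [h2, sum_congr rfl fun n _ => h1 n, Lp.enorm_sq_eq]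
  refine lintegral_congr_ae ?_
  filter_upwards [coeFn_sum_hb s fun n => g n k] with v hv
  rw [hv]
  simp only [mul_comm]

/-- The fields `∑ g_n hb n` with Schwartz coefficients are dense. -/
lemma dense_elemF : (LinearMap.range (Finsupp.lsum ℂ fun n : Idx d =>
    (elemF n).toLinearMap)).topologicalClosure = ⊤ := by
  rw [Submodule.topologicalClosure_eq_top_iff, Submodule.eq_bot_iff]
  intro w hw
  have h0 : ∀ n, ∀ᵐ k, co n w k = 0 := by
    intro n
    have hr : Rep (co n w) fun _ => 0 :=
      { loc := (memLp_co n w).locallyIntegrable one_le_two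
        int := fun γ => (γ.memLp 2).integrable_mul (memLp_co n w)
        eq := fun γ => by
          have h1 := (Submodule.mem_orthogonal _ _).1 hw (elemF n (conjS γ))
            ⟨Finsupp.single n (conjS γ), by simp⟩
          rw [inner_FL2] at h1
          rw [← h1]
          refine integral_congr_ae ?_
          filter_upwards [coeFn_elemF n (conjS γ)] with k hk
          rw [hk, inner_smul_left, conjS_apply, conj_conj]; rfl }
    have hz : Rep (fun _ : Vec d => (0 : ℂ)) fun _ => 0 :=
      { loc := locallyIntegrable_zero
        int := fun γ => by simp
        eq := fun γ => by simp }
    exact hr.ae_eq hz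
  refine Lp.ext ?_
  filter_upwards [ae_all_co h0, Lp.coeFn_zero (VE d) 2 (volume : Measure (Vec d))] with k h1 h2
  rw [h2]
  exact ext_inner_hb fun n => by rw [Pi.zero_apply, inner_zero_right]; exact h1 n

/-- The duality estimate behind the smoothing of mixed norms. -/
lemma enorm_inner_elemF_le {q : ℝ} (hq1 : 1 ≤ q) (hq2 : q ≤ 2) (γ : Idx d) {G₁ : L2 d}
    {G₂ : Phase d → ℝ} (hG : AEStronglyMeasurable G₂ volume) (hfin : mixedNorm q G₂ < ⊤)
    (hw : ∀ φ : 𝓢(Phase d, ℝ), HasCompactSupport φ →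
      ∫ z, G₂ z * xDeriv γ φ z = (-1) ^ deg γ * ∫ z, G₁ z * φ z) {τ : ℝ} (hτ : 0 < τ)
    {z : XX d} (hz : ∀ᵐ k, z k = (damp τ k : ℂ) • J G₁ k)
    (s : Finset (Idx d)) (g : (Idx d) → 𝓢(Vec d, ℂ)) :
    ‖inner ℂ (∑ n ∈ s, elemF n (g n)) z‖ₑ ≤
      ofReal (mixConst d q (deg γ) * τ ^ (-sigma d q (deg γ))) *
        ‖∑ n ∈ s, elemF n (g n)‖ₑ * mixedNorm q G₂ := by
  set η : (Idx d) → 𝓢(Vec d, ℂ) := fun n => dampS hτ (conjS (g n)) with hη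
  set Φ : 𝓢(Phase d, ℂ) := ∑ n ∈ s, tens (𝓕 (η n)) (toC (herm n)) with hΦ
  have h1 : inner ℂ (∑ n ∈ s, elemF n (g n)) z = pairS G₁ Φ := by
    rw [← pairSL_apply, hΦ, map_sum, sum_inner]
    refine sum_congr rfl fun n _ => ?_
    rw [pairSL_apply, pairS_tens, inner_FL2]
    refine integral_congr_ae ?_
    filter_upwards [coeFn_elemF n (g n), hz] with k h1 h2
    rw [h1, h2, inner_smul_left, inner_smul_right, hη, dampS_apply, conjS_apply]
    ring
  have h2 : ‖pairS G₁ Φ‖ₑ = ‖∫ z, (G₂ z : ℂ) * dxS γ Φ z‖ₑ := by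
    rw [weak_deriv_schwartz hq1 hq2 γ hG hfin hw, enorm_mul, enorm_pow]
    simp
  rw [h1, h2]
  refine (enorm_integral_le_lintegral_enorm _).trans ?_
  have hdx : ∀ x v, dxS γ Φ (x, v) = ∑ n ∈ s, (herm n v : ℂ) * 𝓕 (Kpow γ (η n)) x := by
    intro x v
    rw [hΦ, map_sum, sum_apply]
    refine sum_congr rfl fun n _ => ?_
    rw [dxS_tens_fourier, tens_apply, toC_apply, mul_comm]
  have hc : Continuous fun p : Vec d × Vec d => ∑ n ∈ s, (herm n p.1 : ℂ) * g n p.2 := by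
    refine continuous_finsetSum _ fun n _ => ?_
    exact (continuous_ofReal.comp ((herm n).continuous.comp continuous_fst)).mul
      ((g n).continuous.comp continuous_snd)
  have hmain := lintegral_le_mixedNorm (by linarith : 0 < q) hG (F := fun z => dxS γ Φ z)
    (B := ofReal (mixConst d q (deg γ) * τ ^ (-sigma d q (deg γ))))
    (N := fun v => ∫⁻ k : Vec d, ‖∑ n ∈ s, (herm n v : ℂ) * g n k‖ₑ ^ 2)
    (dxS γ Φ).continuous.aestronglyMeasurable
    (hc.enorm.measurable.pow_const 2).lintegral_prod_right'.aemeasurable (by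
      filter_upwards [aestronglyMeasurable_swap hG] with v hv
      have h := lintegral_mul_fourier_le hq1 hq2 γ hτ hv
        (∑ n ∈ s, (herm n v : ℂ) • Kpow γ (η n)) (∑ n ∈ s, (herm n v : ℂ) • g n) (fun k => by
          simp only [sum_apply, smul_apply, smul_eq_mul, hη, Kpow_apply, dampS_apply,
            conjS_apply]
          have e : ∀ n, (herm n v : ℂ) * ((-1) ^ deg γ * symb γ (xi k) *
              ((damp τ k : ℂ) * (starRingEnd ℂ) (g n k))) =
              ((-1) ^ deg γ * symb γ (xi k) * (damp τ k : ℂ)) *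
                (starRingEnd ℂ) ((herm n v : ℂ) * g n k) := fun n => by
            rw [map_mul, conj_ofReal]; ring
          simp only [e, ← mul_sum, ← map_sum]
          rw [norm_mul, norm_mul, norm_mul, RCLike.norm_conj, norm_pow, norm_neg, norm_one,
            one_pow, one_mul, norm_real, norm_of_nonneg (damp_pos τ k).le])
      simp only [sum_apply, smul_apply, smul_eq_mul] at h
      refine le_of_eq_of_le (lintegral_congr fun x => ?_) h
      rw [hdx]
      congr 2
      rw [FourierTransform.fourier_sum, sum_apply]
      refine sum_congr rfl fun n _ => ?_
      rw [FourierTransform.fourier_smul, smul_apply, smul_eq_mul])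
  rw [lintegral_sum_tens] at hmain
  have e2 : ((‖∑ n ∈ s, elemF n (g n)‖ₑ ^ 2) ^ (1 / 2 : ℝ)) = ‖∑ n ∈ s, elemF n (g n)‖ₑ := by
    rw [← ENNReal.rpow_natCast, ← ENNReal.rpow_mul]; norm_num
  rw [e2] at hmain
  refine le_of_eq_of_le (lintegral_congr fun x => ?_) hmain
  rw [enorm_mul]
  congr 1
  rw [← ofReal_norm, ← ofReal_norm, norm_real]

/-- The smoothing estimate: if `G₁ = ∂^γ G₂`, the heat flow of `G₁` in the position variable is
controlled by the mixed norm of `G₂`. -/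
lemma integral_damp_sq_le {q : ℝ} (hq1 : 1 ≤ q) (hq2 : q ≤ 2) (γ : Idx d) {G₁ : L2 d}
    {G₂ : Phase d → ℝ} (hG : AEStronglyMeasurable G₂ volume) (hfin : mixedNorm q G₂ < ⊤)
    (hw : ∀ φ : 𝓢(Phase d, ℝ), HasCompactSupport φ →
      ∫ z, G₂ z * xDeriv γ φ z = (-1) ^ deg γ * ∫ z, G₁ z * φ z) {τ : ℝ} (hτ : 0 < τ) :
    ∫ k, damp τ k ^ 2 * ‖J G₁ k‖ ^ 2 ≤
      (mixConst d q (deg γ) * τ ^ (-sigma d q (deg γ)) * (mixedNorm q G₂).toReal) ^ 2 := by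
  set K : ℝ := mixConst d q (deg γ) * τ ^ (-sigma d q (deg γ)) * (mixedNorm q G₂).toReal with hK
  have hC := mixConst_pos (d := d) q (deg γ)
  have hmem : MemLp (fun k => (damp τ k : ℂ) • J G₁ k) 2 volume := by
    refine (Lp.memLp (J G₁)).of_le_mul (c := 1) ?_ (.of_forall fun k => ?_)
    · exact (continuous_ofReal.comp (continuous_damp τ)).aestronglyMeasurable.smul
        (Lp.aestronglyMeasurable _)
    · rw [norm_smul, norm_real, norm_of_nonneg (damp_pos τ k).le]
      exact mul_le_mul_of_nonneg_right (damp_le_one hτ.le k) (norm_nonneg _)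
  set z : XX d := hmem.toLp with hz
  have hzk : ∀ᵐ k, z k = (damp τ k : ℂ) • J G₁ k := hmem.coeFn_toLp
  have hK0 : 0 ≤ K := by positivity
  have hd : ∀ χ : XX d, ‖inner ℂ χ z‖ ≤ K * ‖χ‖ := by
    intro χ
    have hcl : IsClosed {χ : XX d | ‖inner ℂ χ z‖ ≤ K * ‖χ‖} :=
      isClosed_le (continuous_id.inner continuous_const).norm (continuous_const.mul continuous_norm)
    have hsub : ((LinearMap.range (Finsupp.lsum ℂ fun n : Idx d =>
        (elemF n).toLinearMap) : Submodule ℂ (XX d)) : Set (XX d)) ⊆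
        {χ : XX d | ‖inner ℂ χ z‖ ≤ K * ‖χ‖} := by
      rintro _ ⟨g, rfl⟩
      have h := enorm_inner_elemF_le hq1 hq2 γ hG hfin hw hτ hzk g.support g
      have e : Finsupp.lsum ℂ (fun n : Idx d => (elemF n).toLinearMap) g =
          ∑ n ∈ g.support, elemF n (g n) := rfl
      rw [e]
      have h2 := ENNReal.toReal_mono (by
        exact (ENNReal.mul_lt_top (ENNReal.mul_lt_top ENNReal.ofReal_lt_top enorm_lt_top) hfin).ne) h
      rw [ENNReal.toReal_mul, ENNReal.toReal_mul, ENNReal.toReal_ofReal (by positivity),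
        toReal_enorm, toReal_enorm] at h2
      refine h2.trans_eq ?_
      rw [hK]; ring
    have hall := hcl.closure_subset_iff.2 hsub
    have := dense_elemF (d := d)
    rw [← Submodule.topologicalClosure_coe, this] at hall
    exact hall (mem_univ χ)
  have hzz := hd z
  rw [inner_self_eq_norm_sq_to_K, norm_pow, RCLike.norm_ofReal, abs_norm] at hzz
  have hle : ‖z‖ ≤ K := by
    rcases eq_or_lt_of_le (norm_nonneg z) with h | h
    · rw [← h]; exact hK0
    · have h3 : ‖z‖ * ‖z‖ ≤ K * ‖z‖ := by linarith
      exact le_of_mul_le_mul_right h3 h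
  calc ∫ k, damp τ k ^ 2 * ‖J G₁ k‖ ^ 2 = ‖z‖ ^ 2 := by
        rw [Lp.norm_sq_eq]
        refine integral_congr_ae ?_
        filter_upwards [hzk] with k hk
        rw [hk, norm_smul, norm_real, norm_of_nonneg (damp_pos τ k).le, mul_pow]
    _ ≤ K ^ 2 := pow_le_pow_left₀ (norm_nonneg _) hle 2

/-! ### Decay of weak derivatives along the flow -/

lemma dxR_comm (i j : Fin d) : Function.Commute (dxR i : 𝓢(Phase d, ℝ) → _) (dxR j) :=
  fun φ => lineDerivOp_comm _ _ φ

/-- The quotient of two weak derivatives of the same function. -/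
lemma IsWeakXDeriv.quotient {α β γ : Idx d} (hαβ : α = β + γ) {f fα fβ : Phase d → ℝ}
    (hα : IsWeakXDeriv α f fα) (hβ : IsWeakXDeriv β f fβ) {ψ : Phase d → ℝ} (hψ : IsTest ψ) :
    ∫ z, fβ z * xDeriv γ ψ z = (-1) ^ deg γ * ∫ z, fα z * ψ z := by
  have h1 := hα.2.2 ψ hψ
  have h2 := hβ.2.2 _ (hψ.xDeriv γ)
  have e : xDeriv α ψ = xDeriv β (xDeriv γ ψ) := by
    have h := iterProd_add dxR_comm β γ hψ.toS
    rw [← hαβ] at h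
    have h3 := congrArg (fun φ : 𝓢(Phase d, ℝ) => (φ : Phase d → ℝ)) h
    rw [coe_iterProd_dxR, coe_iterProd_dxR, coe_iterProd_dxR, hψ.coe_toS] at h3
    exact h3
  have hd : ∑ i, α i = deg β + deg γ := by
    rw [hαβ, deg, deg, ← sum_add_distrib]; rfl
  rw [e, h2, hd, pow_add, mul_assoc] at h1
  exact mul_left_cancel₀ (pow_ne_zero _ (by norm_num)) h1

/-- Derivatives in the position commute with multiplication by functions of the velocity. -/
lemma xDeriv_mul_vel (γ : Idx d) {w : Vec d → ℝ} (hw : ContDiff ℝ ∞ w) {ψ : Phase d → ℝ}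
    (hψ : ContDiff ℝ ∞ ψ) :
    xDeriv γ (fun z => w z.2 * ψ z) = fun z => w z.2 * xDeriv γ ψ z := by
  let P : Fin d → (Phase d → ℝ) × (Phase d → ℝ) → (Phase d → ℝ) × (Phase d → ℝ) :=
    fun i p => (xPartial i p.1, xPartial i p.2)
  have h := iterProd_induction (P := P)
    (p := fun p => ContDiff ℝ ∞ p.2 ∧ p.1 = fun z => w z.2 * p.2 z) (fun i p hp => by
      obtain ⟨a, b⟩ := p
      obtain ⟨hb, hab⟩ := hp
      change a = fun z => w z.2 * b z at hab
      subst hab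
      refine ⟨(hb.fderiv_right (m := ∞) (by simp)).clm_apply contDiff_const, ?_⟩
      funext z
      have h1 : DifferentiableAt ℝ b z := (hb.differentiable (by simp)) z
      have h2 : HasFDerivAt (fun z : Phase d => w z.2)
          (fderiv ℝ w z.2 ∘L ContinuousLinearMap.snd ℝ _ _) z :=
        ((hw.differentiable (by simp)) z.2).hasFDerivAt.comp z hasFDerivAt_snd
      have h3 := (h2.fun_mul h1.hasFDerivAt).fderiv
      change fderiv ℝ (fun z => w z.2 * b z) z _ = w z.2 * fderiv ℝ b z _
      rw [h3]
      simp) γ (x := ((fun z => w z.2 * ψ z), ψ)) ⟨hψ, rfl⟩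
  have h1 := iterProd_map (P := P) (Q := fun i => xPartial i) (f := Prod.fst)
    (fun i x => rfl) γ ((fun z => w z.2 * ψ z), ψ)
  have h2 := iterProd_map (P := P) (Q := fun i => xPartial i) (f := Prod.snd)
    (fun i x => rfl) γ ((fun z => w z.2 * ψ z), ψ)
  have h3 := h.2
  rw [h1, h2] at h3
  exact h3

lemma mixedNorm_mono {q : ℝ} {f g : Phase d → ℝ} (h : ∀ z, |f z| ≤ |g z|) :
    mixedNorm q f ≤ mixedNorm q g := by
  refine ENNReal.rpow_le_rpow (lintegral_mono fun v => ?_) (by norm_num)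
  exact pow_le_pow_left' (eLpNorm_mono fun x => h (x, v)) 2

/-- The fiber decay is split into the heat flow at low and exponential decay at high frequencies. -/
lemma exp_rate_le {t : ℝ} (ht : 0 ≤ t) (k : Vec d) : exp (-(rate (xi k) / 12 * t)) ≤
    2 * (damp ((1 + t) / 48) k ^ 2 + exp (-((1 + t) / 24))) := by
  have h0 := rate_nonneg (xi k)
  have h1 := rate_le_one (xi k)
  have he : exp (-(rate (xi k) / 12 * t)) ≤ 2 * exp (-(rate (xi k) / 12 * (1 + t))) := by
    have e : -(rate (xi k) / 12 * t) = rate (xi k) / 12 + -(rate (xi k) / 12 * (1 + t)) := by ring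
    rw [e, exp_add]
    refine mul_le_mul_of_nonneg_right ?_ (exp_nonneg _)
    have h2 := Real.exp_bound_div_one_sub_of_interval (x := rate (xi k) / 12) (by positivity)
      (by linarith)
    refine h2.trans ?_
    rw [div_le_iff₀ (by linarith)]; linarith
  refine he.trans (mul_le_mul_of_nonneg_left ?_ zero_le_two)
  have hd : damp ((1 + t) / 48) k ^ 2 = exp (-(‖xi k‖ ^ 2 / 24 * (1 + t))) := by
    rw [damp, ← Real.exp_nat_mul]; congr 1; push_cast; ring
  rcases le_or_gt ‖xi k‖ 1 with h | h
  · have hr : ‖xi k‖ ^ 2 / 2 ≤ rate (xi k) := by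
      rw [rate, div_le_div_iff₀ two_pos (by positivity)]
      have h5 : ‖xi k‖ ^ 2 ≤ 1 := pow_le_one₀ (norm_nonneg _) h
      exact mul_le_mul_of_nonneg_left (by linarith) (sq_nonneg _)
    refine le_add_of_le_of_nonneg ?_ (exp_nonneg _)
    rw [hd]
    exact exp_le_exp.2 (by nlinarith)
  · have hr : 1 / 2 ≤ rate (xi k) := by
      rw [rate, div_le_div_iff₀ two_pos (by positivity)]
      nlinarith
    refine le_add_of_nonneg_of_le (by positivity) ?_
    exact exp_le_exp.2 (by nlinarith)

lemma exp_le_rpow {a : ℝ} (ha : 0 ≤ a) : ∃ C : ℝ, 0 < C ∧ ∀ t : ℝ, 0 ≤ t →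
    exp (-((1 + t) / 24)) ≤ C * (1 + t) ^ (-a) := by
  obtain ⟨n, hn⟩ := exists_nat_ge a
  refine ⟨n.factorial * 24 ^ n, by positivity, fun t ht => ?_⟩
  have h1 := Real.pow_div_factorial_le_exp (x := (1 + t) / 24) (by positivity) n
  have h2 : (1 + t) ^ a ≤ (1 + t) ^ n := by
    rw [← rpow_natCast]
    exact Real.rpow_le_rpow_of_exponent_le (by linarith) hn
  rw [Real.exp_neg, rpow_neg (by positivity), ← div_eq_mul_inv, inv_eq_one_div,
    div_le_div_iff₀ (exp_pos _) (by positivity), one_mul]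
  rw [div_pow, div_div, div_le_iff₀ (by positivity)] at h1
  linarith

lemma sigma_nonneg {q : ℝ} (hq1 : 1 ≤ q) (hq2 : q ≤ 2) (m : ℕ) : 0 ≤ sigma d q m := by
  have : 1 / 2 ≤ 1 / q := one_div_le_one_div_of_le (by linarith) hq2
  have h : 0 ≤ 1 / q - 1 / 2 := by linarith
  unfold sigma; positivity

/-- The decay of `e^{-rate(ξ) t/12}` against a derivative of order `m` of a function with finite
mixed norm. -/
lemma exists_decay {q : ℝ} (hq1 : 1 ≤ q) (hq2 : q ≤ 2) (m : ℕ) : ∃ C : ℝ, 0 < C ∧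
    ∀ (γ : Idx d), deg γ = m → ∀ (G₁ : L2 d) (G₂ : Phase d → ℝ),
      AEStronglyMeasurable G₂ volume → mixedNorm q G₂ < ⊤ →
      (∀ φ : 𝓢(Phase d, ℝ), HasCompactSupport φ →
        ∫ z, G₂ z * xDeriv γ φ z = (-1) ^ deg γ * ∫ z, G₁ z * φ z) → ∀ t : ℝ, 0 ≤ t →
      ∫ k, exp (-(rate (xi k) / 12 * t)) * ‖J G₁ k‖ ^ 2 ≤
        C * (1 + t) ^ (-2 * sigma d q m) * ((mixedNorm q G₂).toReal ^ 2 + ‖G₁‖ ^ 2) := by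
  have hσ := sigma_nonneg (d := d) hq1 hq2 m
  obtain ⟨C, hC0, hC⟩ := exp_le_rpow (mul_nonneg zero_le_two hσ)
  set D : ℝ := (mixConst d q m * (48 : ℝ)⁻¹ ^ (-sigma d q m)) ^ 2 with hD
  have hm := mixConst_pos (d := d) q m
  have hD0 : 0 < D := by positivity
  refine ⟨2 * (D + C), by positivity, fun γ hγ G₁ G₂ hG hfin hw t ht => ?_⟩
  -- `1 + t` instead of `t` avoids the singularity at `t = 0`; as `|ξ|² / 2 ≤ rate ξ` for `|ξ| ≤ 1`,
  -- the squared heat multiplier at time `(1 + t) / 48` bounds the decay factor up to a constant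
  have h1 := integral_damp_sq_le hq1 hq2 γ hG hfin hw (τ := (1 + t) / 48) (by positivity)
  rw [hγ] at h1
  have e1 : (mixConst d q m * ((1 + t) / 48) ^ (-sigma d q m) * (mixedNorm q G₂).toReal) ^ 2 =
      D * (1 + t) ^ (-2 * sigma d q m) * (mixedNorm q G₂).toReal ^ 2 := by
    rw [div_eq_mul_inv, mul_rpow (by positivity) (by positivity), hD,
      show -2 * sigma d q m = -sigma d q m * (2 : ℕ) by push_cast; ring,
      Real.rpow_mul_natCast (by positivity)]
    ring
  rw [e1] at h1
  have h2 := hC t ht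
  have hi1 : Integrable fun k => damp ((1 + t) / 48) k ^ 2 * ‖J G₁ k‖ ^ 2 := by
    refine (Lp.integrable_norm_sq (J G₁)).bdd_mul (c := 1)
      ((continuous_damp _).pow 2).aestronglyMeasurable (.of_forall fun k => ?_)
    rw [norm_of_nonneg (by positivity)]
    exact pow_le_one₀ (damp_pos _ _).le (damp_le_one (by positivity) k)
  have hi2 := (Lp.integrable_norm_sq (J G₁)).const_mul (exp (-((1 + t) / 24)))
  have h3 : ∫ k, exp (-(rate (xi k) / 12 * t)) * ‖J G₁ k‖ ^ 2 ≤
      ∫ k, 2 * (damp ((1 + t) / 48) k ^ 2 * ‖J G₁ k‖ ^ 2 +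
        exp (-((1 + t) / 24)) * ‖J G₁ k‖ ^ 2) := by
    refine integral_mono_of_nonneg (.of_forall fun k => by positivity)
      ((hi1.add hi2).const_mul 2) (.of_forall fun k => ?_)
    dsimp only
    rw [← add_mul, ← mul_assoc]
    exact mul_le_mul_of_nonneg_right (exp_rate_le ht k) (by positivity)
  rw [integral_const_mul, integral_add hi1 hi2, integral_const_mul, ← Lp.norm_sq_eq, norm_J] at h3
  have hp : 0 < (1 + t) ^ (-2 * sigma d q m) := by positivity
  rw [show -(2 * sigma d q m) = -2 * sigma d q m by ring] at h2
  have hN : 0 ≤ (mixedNorm q G₂).toReal ^ 2 := by positivity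
  have hG0 : 0 ≤ ‖G₁‖ ^ 2 := by positivity
  have h4 := mul_le_mul_of_nonneg_right h2 hG0
  have h5 : 0 ≤ C * (1 + t) ^ (-2 * sigma d q m) * (mixedNorm q G₂).toReal ^ 2 := by positivity
  have h6 : 0 ≤ D * (1 + t) ^ (-2 * sigma d q m) * ‖G₁‖ ^ 2 := by positivity
  nlinarith

lemma eLpNorm_eq_ofReal (f : L2 d) : eLpNorm f 2 volume = ofReal ‖f‖ := by
  rw [← Lp.enorm_def, ofReal_norm]

lemma exists_eq_add {α β : Idx d} {m : ℕ} (hβ : β ≤ α) (hm : ∑ i, α i = ∑ i, β i + m) :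
    ∃ γ, α = β + γ ∧ deg γ = m := by
  refine ⟨α - β, (add_tsub_cancel_of_le hβ).symm, ?_⟩
  have : ∑ i, α i = ∑ i, β i + deg (α - β) := by
    rw [deg, ← sum_add_distrib]
    exact sum_congr rfl fun i _ => (Nat.add_sub_cancel' (hβ i)).symm
  omega

/-- Decay of the homogeneous solution. -/
lemma exists_decay_homogeneous {q : ℝ} (hq1 : 1 ≤ q) (hq2 : q ≤ 2) (m : ℕ) :
    ∃ C : ℝ, 0 < C ∧ ∀ α β : Idx d, β ≤ α → ∑ i, α i = ∑ i, β i + m →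
      ∀ (f₀ : L2 d) (fα fβ : Phase d → ℝ),
        IsWeakXDeriv α f₀ fα → MemLp fα 2 volume → IsWeakXDeriv β f₀ fβ → mixedNorm q fβ < ⊤ →
        ∀ t : ℝ, 0 < t → ∃ g : Phase d → ℝ, IsWeakXDeriv α (solutionOperator t f₀) g ∧
          MemLp g 2 volume ∧ eLpNorm g 2 volume ≤
            ofReal (C * (1 + t) ^ (-sigma d q m)) *
              (mixedNorm q fβ + eLpNorm fα 2 volume) := by
  obtain ⟨C, hC0, hC⟩ := exists_decay (d := d) hq1 hq2 m
  refine ⟨1 + 3 / 2 * C, by positivity, ?_⟩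
  intro α β hβα hm f₀ fα fβ hα hα2 hβ hfin t ht
  obtain ⟨γ, hγ, hγm⟩ := exists_eq_add hβα hm
  set F : L2 d := hα2.toLp with hF
  have hFe : F =ᵐ[volume] fα := hα2.coeFn_toLp
  have hFφ : ∀ φ : Phase d → ℝ, ∫ z, F z * φ z = ∫ z, fα z * φ z := fun φ =>
    integral_congr_ae (hFe.mono fun z hz => by dsimp only; rw [hz])
  have hJ := J_weak_deriv α f₀ F fun φ hφ => by
    rw [hFφ, hα.2.2 φ (isTest_of_schwartz φ hφ)]; rfl
  have hdec := hC γ hγm F fβ hβ.2.1.aestronglyMeasurable hfin (fun φ hφ => by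
    rw [hFφ]; exact hα.quotient hγ hβ (isTest_of_schwartz φ hφ)) t ht.le
  set z : XX d := flowF d t (J F) with hz
  refine ⟨Jadj z, ?_, Lp.memLp _, ?_⟩
  · rw [solutionOperator_eq f₀ ht.le]
    refine isWeakXDeriv_Jadj α _ _ ?_
    filter_upwards [coeFn_flowF t (J F), coeFn_flowF t (J f₀), hJ] with k h1 h2 h3
    rw [hz, h1, h2, h3, map_smul]
  · have hzn : ‖z‖ ^ 2 ≤ 3 / 2 * (C * (1 + t) ^ (-2 * sigma d q m) *
        ((mixedNorm q fβ).toReal ^ 2 + ‖F‖ ^ 2)) := by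
      refine le_trans ?_ (mul_le_mul_of_nonneg_left hdec (by norm_num))
      rw [Lp.norm_sq_eq, ← integral_const_mul]
      refine integral_mono_of_nonneg (.of_forall fun k => by positivity)
        ((integrable_exp_rate ht.le (J F)).const_mul _) ?_
      filter_upwards [coeFn_flowF t (J F)] with k hk
      rw [hz, hk, ← mul_assoc]
      exact norm_flow_sq_le hb (xi k) ht.le _
    set N : ℝ := (mixedNorm q fβ).toReal with hN
    have hN0 : 0 ≤ N := ENNReal.toReal_nonneg
    set p : ℝ := (1 + t) ^ (-sigma d q m) with hp
    have hp0 : 0 < p := by positivity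
    have hp2 : (1 + t) ^ (-2 * sigma d q m) = p ^ 2 := by
      rw [hp, ← Real.rpow_mul_natCast (by positivity)]; congr 1; push_cast; ring
    have hle : ‖z‖ ≤ (1 + 3 / 2 * C) * p * (N + ‖F‖) := by
      refine le_of_sq_le_sq (hzn.trans ?_) (by positivity)
      have h1 : N ^ 2 + ‖F‖ ^ 2 ≤ (N + ‖F‖) ^ 2 := by nlinarith [norm_nonneg F]
      calc _ = 3 / 2 * C * (p ^ 2 * (N ^ 2 + ‖F‖ ^ 2)) := by rw [hp2]; ring
        _ ≤ (1 + 3 / 2 * C) ^ 2 * (p ^ 2 * (N + ‖F‖) ^ 2) := by gcongr; nlinarith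
        _ = _ := by ring
    have e : mixedNorm q fβ + eLpNorm fα 2 volume = ofReal (N + ‖F‖) := by
      rw [ENNReal.ofReal_add hN0 (norm_nonneg _), hN, ENNReal.ofReal_toReal hfin.ne,
        ← eLpNorm_eq_ofReal, eLpNorm_congr_ae hFe]
    rw [e, ← ENNReal.ofReal_mul (by positivity), eLpNorm_eq_ofReal]
    exact ENNReal.ofReal_le_ofReal ((norm_Jadj_le z).trans hle)

/-! ### Sources without moments -/

/-- The product `g(x) w(v)` of two real Schwartz functions. -/
def tensR (g w : 𝓢(Vec d, ℝ)) : 𝓢(Phase d, ℝ) :=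
  (tens (toC g) (toC w)).postcompCLM reCLM

lemma tensR_apply (g w : 𝓢(Vec d, ℝ)) (z : Phase d) : tensR g w z = g z.1 * w z.2 := by
  change (tens (toC g) (toC w) z).re = _
  rw [tens_apply, toC_apply, toC_apply, ← ofReal_mul, ofReal_re]

lemma toC_tensR (g w : 𝓢(Vec d, ℝ)) : toC (tensR g w) = tens (toC g) (toC w) := by
  ext z
  rw [toC_apply, tensR_apply, tens_apply, toC_apply, toC_apply, ofReal_mul]

lemma abs_herm_le {n : Idx d} (hn : deg n ≤ 1) (v : Vec d) :
    |herm n v| ≤ (1 + ‖v‖) * sqrtM v := by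
  have h0 := sqrtM_pos v
  have hv := norm_nonneg v
  rcases Nat.le_one_iff_eq_zero_or_eq_one.1 hn with h | h
  · rw [deg_eq_zero.1 h, herm_zero, sqrtMS_apply, abs_of_pos h0]
    nlinarith
  · obtain ⟨i, rfl⟩ := eq_single_of_deg_one h
    rw [herm_single_apply, abs_mul, abs_of_pos h0]
    have : |v i| ≤ ‖v‖ := PiLp.norm_apply_le v i
    nlinarith

lemma integral_herm_eq_zero {h : Phase d → ℝ} {x : Vec d}
    (hint : Integrable fun v => (1 + ‖v‖) * sqrtM v * h (x, v))
    (h0 : density h x = 0) (h1 : momentum h x = 0) {n : Idx d} (hn : deg n ≤ 1) :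
    ∫ v, h (x, v) * herm n v = 0 := by
  rcases Nat.le_one_iff_eq_zero_or_eq_one.1 hn with hn | hn
  · rw [deg_eq_zero.1 hn, herm_zero, ← h0]
    simp only [sqrtMS_apply, density, mul_comm]
  · obtain ⟨i, rfl⟩ := eq_single_of_deg_one hn
    have hm : Integrable fun v => (sqrtM v * h (x, v)) • v := by
      have e : (fun v => (sqrtM v * h (x, v)) • v) = fun v : Vec d =>
          ((1 + ‖v‖) * sqrtM v * h (x, v)) • ((1 + ‖v‖)⁻¹ • v) := by
        funext v
        rw [smul_smul]
        congr 1
        field_simp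
      rw [e]
      have hc : Continuous fun v : Vec d => (1 + ‖v‖)⁻¹ • v :=
        ((by fun_prop : Continuous fun v : Vec d => 1 + ‖v‖).inv₀ fun v => by positivity).smul
          continuous_id
      refine hint.mono (hint.1.smul hc.aestronglyMeasurable) (.of_forall fun v => ?_)
      rw [norm_smul, norm_smul (1 + ‖v‖)⁻¹, norm_inv]
      refine mul_le_of_le_one_right (norm_nonneg _) ?_
      rw [norm_of_nonneg (by positivity), inv_mul_le_iff₀ (by positivity)]
      linarith
    have e := (EuclideanSpace.proj i : Vec d →L[ℝ] ℝ).integral_comp_comm hm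
    rw [show ∫ v, (sqrtM v * h (x, v)) • v = 0 from h1, map_zero] at e
    rw [← e]
    refine integral_congr_ae (.of_forall fun v => ?_)
    change h (x, v) * herm (Pi.single i 1) v = (sqrtM v * h (x, v)) * v i
    rw [herm_single_apply]
    ring

lemma xDeriv_comp_fst (α : Idx d) {g : Vec d → ℝ} (hg : ContDiff ℝ ∞ g)
    (hgc : HasCompactSupport g) : ∃ g₁ : Vec d → ℝ, Continuous g₁ ∧ HasCompactSupport g₁ ∧
      xDeriv α (fun z : Phase d => g z.1) = fun z => g₁ z.1 := by
  have h := iterProd_induction (P := fun i => xPartial i)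
    (p := fun ψ : Phase d → ℝ => ∃ g₁ : Vec d → ℝ, (ContDiff ℝ ∞ g₁ ∧ HasCompactSupport g₁) ∧
      ψ = fun z => g₁ z.1) (fun i ψ hψ => by
        obtain ⟨g₁, ⟨h1, h2⟩, rfl⟩ := hψ
        refine ⟨fun x => fderiv ℝ g₁ x (eb i), ⟨(h1.fderiv_right (m := ∞) (by simp)).clm_apply
          contDiff_const, h2.fderiv_apply ℝ (eb i)⟩, ?_⟩
        funext z
        have h3 : HasFDerivAt (fun z : Phase d => g₁ z.1)
            (fderiv ℝ g₁ z.1 ∘L ContinuousLinearMap.fst ℝ _ _) z :=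
          ((h1.differentiable (by simp)) z.1).hasFDerivAt.comp z hasFDerivAt_fst
        rw [xPartial, h3.fderiv]
        rfl) α ⟨g, ⟨hg, hgc⟩, rfl⟩
  obtain ⟨g₁, ⟨h1, h2⟩, h3⟩ := h
  exact ⟨g₁, h1.continuous, h2, h3⟩

/-- If the moments of a source vanish, then so do those of its derivative. -/
lemma integral_mul_tensR_eq_zero (α : Idx d) {h k : Phase d → ℝ} {G : L2 d}
    (hG : G =ᵐ[volume] invSqrtMuMul k)
    (hw : ∀ ψ, IsTest ψ → ∫ z, h z * xDeriv α ψ z = ∫ z, k z * ψ z)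
    (hint : ∀ R : ℕ, IntegrableOn (fun z : Phase d => (1 + ‖z.2‖) * sqrtM z.2 * h z)
      (Metric.closedBall 0 R ×ˢ univ))
    (hmom : ∀ᵐ x, density h x = 0 ∧ momentum h x = 0) {n : Idx d} (hn : deg n ≤ 1)
    (g : 𝓢(Vec d, ℝ)) (hg : HasCompactSupport g) : ∫ z, k z * tensR g (herm n) z = 0 := by
  obtain ⟨χ, hχs, hχc, hχ1, hχ, -⟩ := exists_cutoff (V := Vec d)
  obtain ⟨g₁, hg₁, hg₁c, hx⟩ := xDeriv_comp_fst α (g := g) g.smooth' hg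
  obtain ⟨R, hR⟩ : ∃ R : ℕ, tsupport g₁ ⊆ Metric.closedBall 0 R := by
    obtain ⟨r, hr⟩ := hg₁c.isCompact.isBounded.subset_closedBall 0
    obtain ⟨R, hR⟩ := exists_nat_ge r
    exact ⟨R, hr.trans (Metric.closedBall_subset_closedBall hR)⟩
  obtain ⟨C, hC⟩ := hg₁c.exists_bound_of_continuous hg₁
  -- the derivative acts on the first factor only
  have hF : Integrable fun z : Phase d => (1 + ‖z.2‖) * sqrtM z.2 * h z * g₁ z.1 := by
    have h1 : IntegrableOn (fun z : Phase d => (1 + ‖z.2‖) * sqrtM z.2 * h z * g₁ z.1)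
        (Metric.closedBall 0 R ×ˢ univ) :=
      (hint R).mul_bdd (c := C) (hg₁.comp continuous_fst).aestronglyMeasurable
        (.of_forall fun z => hC z.1)
    refine (integrableOn_iff_integrable_of_support_subset fun z hz => ?_).1 h1
    refine ⟨hR (subset_tsupport _ fun h0 => hz ?_), mem_univ _⟩
    dsimp only
    rw [h0, mul_zero]
  have hle : ∀ (S : ℕ) (z : Phase d), ‖h z * (χ S z.2 * herm n z.2 * g₁ z.1)‖ ≤
      ‖(1 + ‖z.2‖) * sqrtM z.2 * h z * g₁ z.1‖ := fun S z => by
    have h1 := abs_herm_le hn z.2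
    have h2 := hχ1 S z.2
    have h3 : 0 ≤ (1 + ‖z.2‖) * sqrtM z.2 := (abs_nonneg _).trans h1
    rw [norm_mul, norm_mul, norm_mul (χ S z.2), norm_mul, norm_mul _ (h z), norm_of_nonneg h3]
    calc ‖h z‖ * (‖χ S z.2‖ * ‖herm n z.2‖ * ‖g₁ z.1‖) ≤
        ‖h z‖ * (1 * ((1 + ‖z.2‖) * sqrtM z.2) * ‖g₁ z.1‖) := by
          gcongr
          exact h1
      _ = _ := by ring
  have hwt : Continuous fun z : Phase d => ((1 + ‖z.2‖) * sqrtM z.2)⁻¹ :=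
    ((by fun_prop : Continuous fun z : Phase d => 1 + ‖z.2‖).mul
      (continuous_sqrtM.comp continuous_snd)).inv₀ fun z => by
        exact (mul_pos (by positivity) (sqrtM_pos z.2)).ne'
  have hm : AEStronglyMeasurable (fun z : Phase d => h z * g₁ z.1) volume := by
    refine (hF.1.mul hwt.aestronglyMeasurable).congr (.of_forall fun z => ?_)
    have := sqrtM_pos z.2
    have h2 : 0 < 1 + ‖z.2‖ := by positivity
    simp only [Pi.mul_apply]
    field_simp
  have hms : ∀ w : Vec d → ℝ, Continuous w →
      AEStronglyMeasurable (fun z : Phase d => h z * (w z.2 * g₁ z.1)) volume := fun w hw => by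
    refine (hm.mul (hw.comp continuous_snd).aestronglyMeasurable).congr
      (.of_forall fun z => ?_)
    simp only [Pi.mul_apply, Function.comp_apply]; ring
  have hcs : ∀ S, Continuous fun v : Vec d => χ S v * herm n v := fun S =>
    (hχs S).continuous.mul (herm n).continuous
  have hlim1 : Tendsto (fun S => ∫ z : Phase d, h z * (χ S z.2 * herm n z.2 * g₁ z.1)) atTop
      (𝓝 (∫ z : Phase d, h z * (herm n z.2 * g₁ z.1))) := by
    refine tendsto_integral_of_dominated_convergence _ (fun S => hms _ (hcs S)) hF.norm
      (fun S => .of_forall fun z => hle S z) (.of_forall fun z => ?_)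
    have := ((hχ z.2).mul_const (herm n z.2)).mul_const (g₁ z.1) |>.const_mul (h z)
    rwa [one_mul] at this
  have hk := (mul_of_weight hG (tensR g (herm n))).1
  have hlim2 : Tendsto (fun S => ∫ z : Phase d, k z * (χ S z.2 * herm n z.2 * g z.1)) atTop
      (𝓝 (∫ z, k z * tensR g (herm n) z)) := by
    have e : ∀ (S : ℕ) (z : Phase d), k z * (χ S z.2 * herm n z.2 * g z.1) =
        χ S z.2 * (k z * tensR g (herm n) z) := fun S z => by rw [tensR_apply]; ring
    simp only [e]
    refine tendsto_integral_of_dominated_convergence _ (fun S =>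
      ((hχs S).continuous.comp continuous_snd).aestronglyMeasurable.mul hk.1) hk.norm
      (fun S => .of_forall fun z => ?_) (.of_forall fun z => ?_)
    · rw [norm_mul]
      exact mul_le_of_le_one_left (norm_nonneg _) (hχ1 S z.2)
    · have := (hχ z.2).mul_const (k z * tensR g (herm n) z)
      rwa [one_mul] at this
  have heq : ∀ S, ∫ z : Phase d, h z * (χ S z.2 * herm n z.2 * g₁ z.1) =
      ∫ z : Phase d, k z * (χ S z.2 * herm n z.2 * g z.1) := fun S => by
    have hs : ContDiff ℝ ∞ fun v : Vec d => χ S v * herm n v := (hχs S).mul (herm n).smooth'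
    have hgs : ContDiff ℝ ∞ fun z : Phase d => g z.1 := g.smooth'.comp contDiff_fst
    have h1 := hw (fun z => χ S z.2 * herm n z.2 * g z.1) ⟨(hs.comp contDiff_snd).mul hgs, by
      refine HasCompactSupport.of_support_subset_isCompact
        (hg.isCompact.prod (hχc S).isCompact) fun z hz => ⟨subset_tsupport _ fun h0 => hz ?_,
          subset_tsupport _ fun h0 => hz ?_⟩ <;> dsimp only <;> rw [h0] <;> ring⟩
    rw [xDeriv_mul_vel α hs hgs, hx] at h1
    exact h1
  refine (tendsto_nhds_unique (hlim1.congr heq) hlim2).symm.trans ?_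
  have hI : Integrable (fun z : Phase d => h z * (herm n z.2 * g₁ z.1)) :=
    hF.mono (hms _ (herm n).continuous) (.of_forall fun z => by
      have h1 := abs_herm_le hn z.2
      have h3 : 0 ≤ (1 + ‖z.2‖) * sqrtM z.2 := (abs_nonneg _).trans h1
      rw [norm_mul, norm_mul, norm_mul, norm_mul _ (h z), norm_of_nonneg h3]
      calc ‖h z‖ * (‖herm n z.2‖ * ‖g₁ z.1‖) ≤ ‖h z‖ * ((1 + ‖z.2‖) * sqrtM z.2 * ‖g₁ z.1‖) := by
            gcongr
            exact h1
        _ = _ := by ring)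
  have hF2 := hF
  rw [Measure.volume_eq_prod] at hI hF2
  rw [Measure.volume_eq_prod, integral_prod _ hI]
  refine integral_eq_zero_of_ae ?_
  filter_upwards [hmom, hF2.prod_right_ae] with x hx hxi
  by_cases h0 : g₁ x = 0
  · simp [h0]
  · have h1 : Integrable fun v => (1 + ‖v‖) * sqrtM v * h (x, v) := by
      refine (hxi.mul_const (g₁ x)⁻¹).congr (.of_forall fun v => ?_)
      dsimp only
      rw [mul_assoc, mul_inv_cancel₀ h0, mul_one]
    simp only [← mul_assoc, integral_mul_const, integral_herm_eq_zero h1 hx.1 hx.2 hn, zero_mul,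
      Pi.zero_apply]

lemma memLp_vco (n : Idx d) (i : Fin d) (x : XX d) : MemLp (vco n i x) 2 volume :=
  ((memLp_co _ x).const_mul _).add ((memLp_co _ x).const_mul _)

/-- If the density and the momentum of a source vanish, then so do the Hermite coefficients of
order `0` and `1` of the Fourier transform of its derivative. -/
lemma srcCo_eq_zero (α : Idx d) {h k : Phase d → ℝ} {G : L2 d}
    (hG : G =ᵐ[volume] invSqrtMuMul k)
    (hw : ∀ ψ, IsTest ψ → ∫ z, h z * xDeriv α ψ z = ∫ z, k z * ψ z)
    (hint : ∀ R : ℕ, IntegrableOn (fun z : Phase d => (1 + ‖z.2‖) * sqrtM z.2 * h z)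
      (Metric.closedBall 0 R ×ˢ univ))
    (hmom : ∀ᵐ x, density h x = 0 ∧ momentum h x = 0) {n : Idx d} (hn : deg n ≤ 1) :
    ∀ᵐ ξ, srcCo hb (J (W₀ G) ξ) (fun i => J (W i G) ξ) n = 0 := by
  set F : Vec d → ℂ := fun ξ => co n (J (W₀ G)) ξ + ∑ i, vco n i (J (W i G)) ξ with hF
  have hF2 : MemLp F 2 volume :=
    (memLp_co n _).add (memLp_finsetSum _ fun i _ => memLp_vco n i _)
  have hrep := (rep_co n (W₀ G)).add
    (Rep.sum Finset.univ fun i (_ : i ∈ Finset.univ) => rep_vco n i (W i G))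
  -- the functional `g ↦ ∫ F 𝓕⁻¹ g` vanishes
  let ℓ : 𝓢(Vec d, ℂ) →L[ℂ] ℂ := innerSL ℂ (hF2.star.toLp) ∘L toLpCLM ℂ ℂ 2 volume ∘L
    (FourierTransform.fourierInvCLM ℂ 𝓢(Vec d, ℂ))
  have hℓ : ∀ γ, ℓ γ = ∫ ξ, (𝓕⁻ γ) ξ * F ξ := fun γ => by
    change inner ℂ (hF2.star.toLp) ((𝓕⁻ γ).toLp 2) = _
    rw [L2.inner_def]
    refine integral_congr_ae ?_
    filter_upwards [hF2.star.coeFn_toLp, (𝓕⁻ γ).coeFn_toLp 2] with z h1 h2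
    rw [h1, h2, RCLike.inner_apply]
    simp
  have h0 : ℓ = 0 := by
    refine schwartz_functional_ext fun g hg => ?_
    rw [hℓ, hrep.eq, FourierTransform.fourier_fourierInv_eq, ← toC_tensR, pairSL_toC]
    have e : ∀ i, vmul i (toC (tensR g (herm n))) = toC (vmulR i (tensR g (herm n))) := fun i => by
      ext z
      rw [vmul_apply, toC_apply, toC_apply, vmulR_apply, ofReal_mul]
    simp only [e, pairSL_toC]
    have h1 := (mul_of_weight hG (tensR g (herm n))).2
    rw [integral_mul_tensR_eq_zero α hG hw hint hmom hn g hg] at h1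
    simp only [inner_tL] at h1
    exact_mod_cast h1.symm
  have hz : Rep F fun _ => 0 := ⟨hrep.loc, hrep.int, fun γ => by
    have h1 := hℓ (𝓕 γ)
    rw [h0, FourierTransform.fourierInv_fourier_eq] at h1
    exact h1.symm⟩
  have hz0 : Rep (fun _ : Vec d => (0 : ℂ)) fun _ => 0 :=
    ⟨locallyIntegrable_const 0, fun γ => by simp, fun γ => by simp⟩
  exact hz.ae_eq hz0

/-! ### Decay of the Duhamel term -/

/-- The multiplier `e^{-rate(ξ) t/24}` on the fibers. -/
def rateOp (k : Vec d) (t : ℝ) : VE d →L[ℂ] VE d :=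
  ((exp (-(rate (xi k) / 24 * max t 0)) : ℝ) : ℂ) • ContinuousLinearMap.id ℂ (VE d)

lemma norm_rateOp (k : Vec d) (t : ℝ) (x : VE d) :
    ‖rateOp k t x‖ = exp (-(rate (xi k) / 24 * max t 0)) * ‖x‖ := by
  rw [rateOp, smul_apply, norm_smul, norm_real,
    norm_of_nonneg (exp_nonneg _), id_apply]

lemma isFiberFlow_rateOp : IsFiberFlow (rateOp (d := d)) where
  cont := by
    have h : Continuous fun p : (Vec d × ℝ) × VE d =>
        ((exp (-(rate (xi p.1.1) / 24 * max p.1.2 0)) : ℝ) : ℂ) := by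
      have := continuous_rate.comp (continuous_xi.comp
        (continuous_fst.comp (continuous_fst : Continuous fun p : (Vec d × ℝ) × VE d => p.1)))
      have h2 : Continuous fun p : (Vec d × ℝ) × VE d => max p.1.2 0 := by fun_prop
      exact continuous_ofReal.comp (continuous_exp.comp ((this.div_const 24).mul h2).neg)
    exact h.smul continuous_snd
  bound k t x := by
    rw [norm_rateOp]
    refine mul_le_of_le_one_left (norm_nonneg _) (exp_le_one_iff.2 (neg_nonpos.2 ?_))
    exact mul_nonneg (div_nonneg (rate_nonneg _) (by norm_num)) (le_max_right _ _)

lemma norm_fiberFlow_rateOp_sq {t : ℝ} (ht : 0 ≤ t) (x : XX d) :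
    ‖fiberFlow isFiberFlow_rateOp t x‖ ^ 2 =
      ∫ k, exp (-(rate (xi k) / 12 * t)) * ‖x k‖ ^ 2 := by
  rw [Lp.norm_sq_eq]
  refine integral_congr_ae ?_
  filter_upwards [coeFn_fiberFlow isFiberFlow_rateOp t x] with k hk
  rw [hk, norm_rateOp, mul_pow, ← Real.exp_nat_mul, max_eq_left ht]
  congr 2
  push_cast; ring

lemma aestronglyMeasurable_srcSize {G : ℝ → L2 d} {T : ℝ}
    (hG : AEStronglyMeasurable G (volume.restrict (Ioc 0 T))) :
    AEStronglyMeasurable (fun s => srcSize (T - s) (W₀ (G s)) fun i => W i (G s))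
      (volume.restrict (Ioc 0 T)) := by
  have hm : ∀ A : L2 d →L[ℝ] L2 d, AEStronglyMeasurable
      (fun s => ‖fiberFlow isFiberFlow_rateOp (T - s) (J (A (G s)))‖ ^ 2)
      (volume.restrict (Ioc 0 T)) := fun A =>
    ((isContraction_fiberFlow isFiberFlow_rateOp).aestronglyMeasurable
      (continuous_const.sub continuous_id)
      ((continuous_J.comp A.continuous).comp_aestronglyMeasurable hG)).norm.pow 2
  refine ((hm W₀).add (Finset.aestronglyMeasurable_fun_sum Finset.univ fun i _ => hm (W i))).congr ?_
  filter_upwards [ae_restrict_mem measurableSet_Ioc] with s hs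
  have hs0 : 0 ≤ T - s := sub_nonneg.2 hs.2
  rw [Pi.add_apply, srcSize_eq hs0, norm_fiberFlow_rateOp_sq hs0]
  simp only [norm_fiberFlow_rateOp_sq hs0]

lemma IsTest.mul_vel {ψ : Phase d → ℝ} (hψ : IsTest ψ) {w : Vec d → ℝ} (hw : ContDiff ℝ ∞ w) :
    IsTest fun z => w z.2 * ψ z :=
  ⟨(hw.comp contDiff_snd).mul hψ.1, hψ.2.mul_left⟩

/-- The decay of a weighted source. -/
lemma exists_decay_source {q : ℝ} (hq1 : 1 ≤ q) (hq2 : q ≤ 2) (m : ℕ) : ∃ C : ℝ, 0 < C ∧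
    ∀ γ : Idx d, deg γ = m → ∀ (kα kβ : Phase d → ℝ) (G : L2 d),
      AEStronglyMeasurable kβ volume → mixedNorm q (invSqrtMuMul kβ) < ⊤ →
      G =ᵐ[volume] invSqrtMuMul kα →
      (∀ ψ, IsTest ψ → ∫ z, kβ z * xDeriv γ ψ z = (-1) ^ deg γ * ∫ z, kα z * ψ z) →
      ∀ t : ℝ, 0 ≤ t → srcSize t (W₀ G) (fun i => W i G) ≤
        C * (1 + t) ^ (-2 * sigma d q m) *
          ((mixedNorm q (invSqrtMuMul kβ)).toReal ^ 2 + ‖G‖ ^ 2) := by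
  obtain ⟨C, hC0, hC⟩ := exists_decay (d := d) hq1 hq2 m
  refine ⟨C * (d + 1), by positivity, fun γ hγ kα kβ G hm hfin hG hw t ht => ?_⟩
  set B := C * (1 + t) ^ (-2 * sigma d q m) *
    ((mixedNorm q (invSqrtMuMul kβ)).toReal ^ 2 + ‖G‖ ^ 2) with hB
  have key : ∀ (w : Vec d → ℝ) (hwc : Continuous w) (hw1 : ∀ v, |w v| ≤ 1),
      ContDiff ℝ ∞ (fun v => w v * wt v) →
      ∫ k, exp (-(rate (xi k) / 12 * t)) * ‖J (velMul w hwc hw1 G) k‖ ^ 2 ≤ B := by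
    intro w hwc hw1 hws
    have hle : mixedNorm q (fun z : Phase d => w z.2 * wt z.2 * kβ z) ≤
        mixedNorm q (invSqrtMuMul kβ) := mixedNorm_mono fun z => by
      rw [mul_assoc, abs_mul]
      exact mul_le_of_le_one_left (abs_nonneg _) (hw1 _)
    have h := hC γ hγ (velMul w hwc hw1 G) (fun z => w z.2 * wt z.2 * kβ z)
      (((hwc.mul continuous_wt).comp continuous_snd).aestronglyMeasurable.mul hm)
      (hle.trans_lt hfin) (fun φ hφ => ?_) t ht
    · refine h.trans (mul_le_mul_of_nonneg_left ?_ (by positivity))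
      gcongr
      · exact hfin.ne
      · exact (norm_velMul_le hwc hw1 G).trans_eq (one_mul _)
    · have hT := isTest_of_schwartz φ hφ
      have h1 := hw _ (hT.mul_vel hws)
      rw [xDeriv_mul_vel γ hws hT.1] at h1
      refine (integral_congr_ae (.of_forall fun z => ?_)).trans (h1.trans ?_)
      · dsimp only; ring
      · congr 1
        refine integral_congr_ae ?_
        filter_upwards [coeFn_velMul hwc hw1 G, hG] with z h2 h3
        rw [h2, h3, invSqrtMuMul]
        change _ = w z.2 * (wt z.2 * kα z) * φ z
        ring
  have hmu : ContDiff ℝ ∞ fun v : Vec d => wt v * wt v := by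
    have e : (fun v : Vec d => wt v * wt v) = fun v => (mu v)⁻¹ := by
      funext v
      exact eq_inv_of_mul_eq_one_left (by rw [← sq]; exact wt_sq_mul_mu v)
    rw [e]
    exact (contDiff_const.add (contDiff_norm_sq ℝ)).inv fun v => (mu_pos v).ne'
  have h0 := key wt continuous_wt abs_wt_le hmu
  have h1 : ∀ i, ∫ k, exp (-(rate (xi k) / 12 * t)) * ‖J (W i G) k‖ ^ 2 ≤ B := fun i => by
    refine key _ (continuous_wt_coord i) (abs_wt_coord_le i) ?_
    have e : (fun v : Vec d => wt v * v i * wt v) = fun v => wt v * wt v * v i := by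
      funext v; ring
    rw [e]
    exact hmu.mul (EuclideanSpace.proj i : Vec d →L[ℝ] ℝ).contDiff
  rw [srcSize_eq ht]
  refine (add_le_add h0 (sum_le_sum fun i _ => h1 i)).trans_eq ?_
  rw [Finset.sum_const, Finset.card_univ, Fintype.card_fin, nsmul_eq_mul, hB]
  ring

lemma SourceIntegrable.ae_integrableOn {h : ℝ → Phase d → ℝ} (hh : SourceIntegrable h) (T : ℝ) :
    ∀ᵐ s ∂volume.restrict (Ioc 0 T), ∀ R : ℕ,
      IntegrableOn (fun z : Phase d => (1 + ‖z.2‖) * sqrtM z.2 * h s z)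
        (Metric.closedBall 0 R ×ˢ univ) := by
  refine ae_all_iff.2 fun R => ?_
  have h1 := hh T (Metric.closedBall 0 R) (isCompact_closedBall 0 _)
  rw [IntegrableOn, restrict_Ioc_prod'] at h1
  exact h1.prod_right_ae

/-- Decay of the solution with zero datum and a source without moments. -/
lemma exists_decay_duhamel {q : ℝ} (hq1 : 1 ≤ q) (hq2 : q ≤ 2) (m : ℕ) : ∃ C : ℝ, 0 < C ∧
    ∀ α β : Idx d, β ≤ α → ∑ i, α i = ∑ i, β i + m → ∀ (h hα hβ : ℝ → Phase d → ℝ),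
      AEStronglyMeasurable (fun p : ℝ × Phase d => hα p.1 p.2) (volume.restrict (Ioi 0 ×ˢ univ)) →
      (∀ᵐ s ∂volume.restrict (Ioi (0 : ℝ)), IsWeakXDeriv α (h s) (hα s) ∧
        MemLp (invSqrtMuMul (hα s)) 2 volume ∧ IsWeakXDeriv β (h s) (hβ s) ∧
        mixedNorm q (invSqrtMuMul (hβ s)) < ⊤) →
      (∀ᵐ s ∂volume.restrict (Ioi (0 : ℝ)), ∀ᵐ x : Vec d,
        density (h s) x = 0 ∧ momentum (h s) x = 0) →
      ∀ u : ℝ → L2 d, IsWeakSolution 0 h u → ∀ t : ℝ, 0 ≤ t → ∀ R : ℝ≥0∞,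
        R = ∫⁻ s in Ioc 0 t, ofReal ((1 + t - s) ^ (-2 * sigma d q m)) *
          (mixedNorm q (invSqrtMuMul (hβ s)) ^ 2 + eLpNorm (invSqrtMuMul (hα s)) 2 volume ^ 2) →
        R < ⊤ → ∃ g : Phase d → ℝ, IsWeakXDeriv α (u t) g ∧ MemLp g 2 volume ∧
          eLpNorm g 2 volume ^ 2 ≤ ofReal C * R := by
  obtain ⟨C, hC0, hC⟩ := exists_decay_source (d := d) hq1 hq2 m
  refine ⟨20 * (2 * d + 1) * C, by positivity, ?_⟩
  intro α β hβα hm h hα hβ hmα hae hmom u hu t ht R hR hRfin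
  obtain ⟨γ, hγ, hγm⟩ := exists_eq_add hβα hm
  have hsub : (Ioc 0 t : Set ℝ) ⊆ Ioi 0 := Ioc_subset_Ioi_self
  have hae' := ae_restrict_of_ae_restrict_of_subset hsub hae
  have hmom' := ae_restrict_of_ae_restrict_of_subset hsub hmom
  have hσ := sigma_nonneg (d := d) hq1 hq2 m
  -- the sign of the integrations by parts is moved into the source
  set ε : ℝ := (-1) ^ deg α with hε
  have hε1 : |ε| = 1 := by rw [hε, abs_pow, abs_neg, abs_one, one_pow]
  let F : ℝ → Phase d → ℝ := fun s => invSqrtMuMul fun z => ε * hα s z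
  have hFα : ∀ s z, ‖F s z‖ₑ = ‖invSqrtMuMul (hα s) z‖ₑ := fun s z => by
    rw [enorm_eq_iff_norm_eq, show F s z = ε * invSqrtMuMul (hα s) z by
      simp only [F, invSqrtMuMul]; ring, norm_mul, norm_eq_abs ε, hε1, one_mul]
  have hFm : AEStronglyMeasurable (fun p : ℝ × Phase d => F p.1 p.2)
      ((volume.restrict (Ioc 0 t)).prod volume) := by
    rw [← restrict_Ioc_prod]
    have h1 := hmα.mono_measure (Measure.restrict_mono
      (Set.prod_mono hsub (subset_refl (univ : Set (Phase d)))) le_rfl)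
    exact ((continuous_wt.comp (continuous_snd.comp continuous_snd)).aestronglyMeasurable).mul
      (h1.const_mul ε)
  have hFe : ∀ s, eLpNorm (F s) 2 volume = eLpNorm (invSqrtMuMul (hα s)) 2 volume := fun s =>
    eLpNorm_congr_enorm_ae (.of_forall fun z => hFα s z)
  have hFs : ∀ᵐ s ∂volume.restrict (Ioc 0 t), MemLp (F s) 2 volume := by
    filter_upwards [hae'] with s hs
    refine hs.2.1.congr_enorm ?_ (.of_forall fun z => (hFα s z).symm)
    have h1 := hs.2.1.1.const_mul ε
    refine h1.congr (.of_forall fun z => ?_)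
    simp only [F, invSqrtMuMul]; ring
  set G : ℝ → L2 d := slice F with hG
  have hGm : AEStronglyMeasurable G (volume.restrict (Ioc 0 t)) := aestronglyMeasurable_slice hFm hFs
  have hGF : ∀ᵐ s ∂volume.restrict (Ioc 0 t), G s =ᵐ[volume] F s :=
    hFs.mono fun s hs => coeFn_slice hs
  have hGn : ∀ᵐ s ∂volume.restrict (Ioc 0 t),
      ‖G s‖ₑ = eLpNorm (invSqrtMuMul (hα s)) 2 volume :=
    hFs.mono fun s hs => by rw [hG, enorm_slice hs, hFe]
  -- the time weight is bounded from below, so that the source is square integrable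
  have hp : ∀ s ∈ Ioc 0 t, (1 + t) ^ (-2 * sigma d q m) ≤ (1 + t - s) ^ (-2 * sigma d q m) :=
    fun s hs => Real.rpow_le_rpow_of_nonpos (by linarith [hs.2]) (by linarith [hs.1]) (by linarith)
  have hG2 : IntegrableOn (fun s => ‖G s‖ ^ 2) (Ioc 0 t) := by
    refine ⟨hGm.norm.pow 2, ?_⟩
    have h1 : ofReal ((1 + t) ^ (-2 * sigma d q m)) *
        ∫⁻ s in Ioc 0 t, ‖(‖G s‖ ^ 2)‖ₑ ≤ R := by
      rw [hR, ← lintegral_const_mul' _ _ ENNReal.ofReal_ne_top]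
      refine lintegral_mono_ae ?_
      filter_upwards [hGn, ae_restrict_mem measurableSet_Ioc] with s hs hsm
      rw [enorm_pow, enorm_norm, hs]
      exact mul_le_mul' (ENNReal.ofReal_le_ofReal (hp s hsm)) le_add_self
    refine lt_top_iff_ne_top.2 fun h2 => ?_
    rw [h2, ENNReal.mul_top (by simpa using by positivity)] at h1
    exact absurd h1 (not_le.2 hRfin)
  have hGi : IntegrableOn G (Ioc 0 t) :=
    ((memLp_two_iff_integrable_sq_norm hGm).2 hG2).integrable one_le_two
  have hwk : ∀ᵐ s ∂volume.restrict (Ioc 0 t), ∀ ψ, IsTest ψ →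
      ∫ z, h s z * xDeriv α ψ z = ∫ z, ε * hα s z * ψ z := by
    filter_upwards [hae'] with s hs ψ hψ
    rw [hs.1.2.2 ψ hψ, ← integral_const_mul]
    refine integral_congr_ae (.of_forall fun z => ?_)
    simp only [hε, deg]; ring
  have hq : IntegrableOn (fun s => srcSize (t - s) (W₀ (G s)) fun i => W i (G s)) (Ioc 0 t) := by
    refine Integrable.mono hG2 (aestronglyMeasurable_srcSize hGm) ?_
    filter_upwards [ae_restrict_mem measurableSet_Ioc] with s hs
    rw [norm_of_nonneg (by unfold srcSize; positivity), norm_of_nonneg (by positivity)]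
    exact srcSize_le (sub_nonneg.2 hs.2) _
  obtain ⟨z, hz, hzn⟩ := a_priori (α := α) (c := 0) ht ⟨hu.continuousOn, W₀.integrable_comp hGi,
    fun i => (W i).integrable_comp hGi, fun φ hφ s hs => by
      have hT := (isTest_of_schwartz φ hφ).xDeriv α
      rw [← coe_iterProd_dxR] at hT
      have h1 := hu.eq (iterProd dxR α φ) hT.2 hs.1
      rw [h1, inner_zero_left (𝕜 := ℝ), zero_add]
      congr 1
      rw [integral_of_le hs.1, integral_of_le hs.1]
      have hle : (Ioc 0 s : Set ℝ) ⊆ Ioc 0 t := Ioc_subset_Ioc_right hs.2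
      refine integral_congr_ae (ae_restrict_of_ae_restrict_of_subset hle ?_)
      filter_upwards [hwk, hGF] with r h2 h3
      rw [coe_iterProd_dxR, h2 φ (isTest_of_schwartz φ hφ)]
      exact (mul_of_weight h3 φ).2⟩
    ⟨le_rfl, by
      filter_upwards [hwk, hGF, hmom', hu.source.ae_integrableOn t] with s h1 h2 h3 h4
      refine (ae_all_iff.2 fun n => ?_).mono fun ξ hξ => Or.inr hξ
      by_cases hn : deg n ≤ 1
      · exact (srcCo_eq_zero α h2 h1 h4 h3 hn).mono fun ξ hξ _ => hξ
      · exact .of_forall fun ξ hξ => absurd hξ hn, hq, .of_forall fun s => le_rfl⟩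
  refine ⟨Jadj z, ?_, Lp.memLp _, ?_⟩
  · have h1 := isWeakXDeriv_Jadj α (J (u t)) z hz
    rwa [Jadj_J] at h1
  have hint : ofReal (∫ s in Ioc 0 t, srcSize (t - s) (W₀ (G s)) fun i => W i (G s)) ≤
      ofReal C * R := by
    rw [ofReal_integral_eq_lintegral_ofReal hq
      (.of_forall fun s => by unfold srcSize; positivity), hR,
      ← lintegral_const_mul' _ _ ENNReal.ofReal_ne_top]
    refine lintegral_mono_ae ?_
    filter_upwards [hae', hGF, hGn, ae_restrict_mem measurableSet_Ioc] with s hs h2 h3 hsm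
    have hle : mixedNorm q (invSqrtMuMul fun z => ε * hβ s z) ≤
        mixedNorm q (invSqrtMuMul (hβ s)) := mixedNorm_mono fun z => by
      simp only [invSqrtMuMul, abs_mul, hε1, one_mul, le_refl]
    have h4 := hC γ hγm (fun z => ε * hα s z) (fun z => ε * hβ s z) (G s)
      (hs.2.2.1.2.1.aestronglyMeasurable.const_mul ε) (hle.trans_lt hs.2.2.2) h2
      (fun ψ hψ => by
        simp only [mul_assoc, integral_const_mul]
        rw [hs.1.quotient hγ hs.2.2.1 hψ]
        ring) (t - s) (sub_nonneg.2 hsm.2)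
    have h5 := add_le_add_left (pow_le_pow_left₀ ENNReal.toReal_nonneg
      (ENNReal.toReal_mono hs.2.2.2.ne hle) 2) (‖G s‖ ^ 2)
    have hpos : 0 ≤ (1 + (t - s)) ^ (-2 * sigma d q m) :=
      Real.rpow_nonneg (by linarith [hsm.2]) _
    refine (ENNReal.ofReal_le_ofReal (h4.trans
      (mul_le_mul_of_nonneg_left h5 (mul_nonneg hC0.le hpos)))).trans_eq ?_
    rw [mul_assoc, ENNReal.ofReal_mul hC0.le, ENNReal.ofReal_mul hpos, add_sub_assoc,
      ENNReal.ofReal_add (by positivity) (by positivity), ENNReal.ofReal_pow ENNReal.toReal_nonneg,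
      ENNReal.ofReal_pow (norm_nonneg _), ENNReal.ofReal_toReal hs.2.2.2.ne, ofReal_norm, h3]
  rw [eLpNorm_eq_ofReal, ← ENNReal.ofReal_pow (norm_nonneg _)]
  rw [zero_mul, add_zero, mul_one] at hzn
  have hJz : ‖Jadj z‖ ^ 2 ≤ ‖z‖ ^ 2 := pow_le_pow_left₀ (norm_nonneg _) (norm_Jadj_le z) 2
  refine (ENNReal.ofReal_le_ofReal (hJz.trans hzn)).trans ?_
  rw [ENNReal.ofReal_mul (by positivity),
    ENNReal.ofReal_mul (p := 20 * (2 * (d : ℝ) + 1)) (by positivity), mul_assoc]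
  exact mul_le_mul_right hint _

end

end FokkerPlanck

theorem proposition2p2 (d : ℕ) (hd : 1 ≤ d) :
    -- The Cauchy problem is well posed, so that `e^{𝐁t}` and the Duhamel term are meaningful.
    (∀ (f₀ : FokkerPlanck.L2 d) (h : ℝ → FokkerPlanck.Phase d → ℝ),
      (∀ T : ℝ, MemLp (fun p : ℝ × FokkerPlanck.Phase d => FokkerPlanck.invSqrtMuMul (h p.1) p.2) 2
        (volume.restrict (Ioc 0 T ×ˢ univ))) →
      ∃ u : ℝ → FokkerPlanck.L2 d, FokkerPlanck.IsWeakSolution f₀ h u ∧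
        ∀ u' : ℝ → FokkerPlanck.L2 d, FokkerPlanck.IsWeakSolution f₀ h u' → EqOn u' u (Ici 0)) ∧
    -- For sources in `L¹_loc([0, ∞); L²)` the solution with zero datum is the Duhamel integral.
    (∀ (h : ℝ → FokkerPlanck.Phase d → ℝ) (H : ℝ → FokkerPlanck.L2 d),
      AEStronglyMeasurable (fun p : ℝ × FokkerPlanck.Phase d => h p.1 p.2)
        (volume.restrict (Ioi 0 ×ˢ univ)) →
      (∀ᵐ s ∂(volume.restrict (Ioi (0 : ℝ))), H s =ᵐ[volume] h s) →
      (∀ T : ℝ, IntegrableOn H (Ioc 0 T)) →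
      FokkerPlanck.IsWeakSolution 0 h
        (fun t => ∫ s in (0 : ℝ)..t, FokkerPlanck.solutionOperator (t - s) (H s))) ∧
    ∀ (q : ℝ), 1 ≤ q → q ≤ 2 → ∀ (m : ℕ), ∃ C : ℝ, 0 < C ∧
      -- (i)
      (∀ α β : Fin d → ℕ, β ≤ α → ∑ i, α i = ∑ i, β i + m →
        ∀ (f₀ : FokkerPlanck.L2 d) (fα fβ : FokkerPlanck.Phase d → ℝ),
          FokkerPlanck.IsWeakXDeriv α f₀ fα → MemLp fα 2 volume →
          FokkerPlanck.IsWeakXDeriv β f₀ fβ → FokkerPlanck.mixedNorm q fβ < ⊤ →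
          ∀ t : ℝ, 0 < t →
            ∃ g : FokkerPlanck.Phase d → ℝ,
              FokkerPlanck.IsWeakXDeriv α (FokkerPlanck.solutionOperator t f₀) g ∧
              MemLp g 2 volume ∧
              eLpNorm g 2 volume ≤
                ENNReal.ofReal (C * (1 + t) ^ (-FokkerPlanck.sigma d q m)) *
                  (FokkerPlanck.mixedNorm q fβ + eLpNorm fα 2 volume)) ∧
      -- (ii)
      (∀ α β : Fin d → ℕ, β ≤ α → ∑ i, α i = ∑ i, β i + m →
        ∀ (h hα hβ : ℝ → FokkerPlanck.Phase d → ℝ),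
          AEStronglyMeasurable (fun p : ℝ × FokkerPlanck.Phase d => hα p.1 p.2)
            (volume.restrict (Ioi 0 ×ˢ univ)) →
          AEStronglyMeasurable (fun p : ℝ × FokkerPlanck.Phase d => hβ p.1 p.2)
            (volume.restrict (Ioi 0 ×ˢ univ)) →
          (∀ᵐ s ∂(volume.restrict (Ioi (0 : ℝ))),
            FokkerPlanck.IsWeakXDeriv α (h s) (hα s) ∧
            MemLp (FokkerPlanck.invSqrtMuMul (hα s)) 2 volume ∧
            FokkerPlanck.IsWeakXDeriv β (h s) (hβ s) ∧
            FokkerPlanck.mixedNorm q (FokkerPlanck.invSqrtMuMul (hβ s)) < ⊤) →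
          (∀ᵐ s ∂(volume.restrict (Ioi (0 : ℝ))), ∀ᵐ x : FokkerPlanck.Vec d,
            FokkerPlanck.density (h s) x = 0 ∧ FokkerPlanck.momentum (h s) x = 0) →
          ∀ u : ℝ → FokkerPlanck.L2 d, FokkerPlanck.IsWeakSolution 0 h u →
            ∀ t : ℝ, 0 ≤ t → ∀ R : ℝ≥0∞,
              R = ∫⁻ s in Ioc 0 t, ENNReal.ofReal ((1 + t - s) ^ (-2 * FokkerPlanck.sigma d q m)) *
                  (FokkerPlanck.mixedNorm q (FokkerPlanck.invSqrtMuMul (hβ s)) ^ 2 +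
                    eLpNorm (FokkerPlanck.invSqrtMuMul (hα s)) 2 volume ^ 2) →
              R < ⊤ →
              ∃ g : FokkerPlanck.Phase d → ℝ,
                FokkerPlanck.IsWeakXDeriv α (u t) g ∧ MemLp g 2 volume ∧
                eLpNorm g 2 volume ^ 2 ≤ ENNReal.ofReal C * R) := by
  refine ⟨FokkerPlanck.exists_unique_solution, FokkerPlanck.isWeakSolution_duhamel, fun q hq1 hq2 m => ?_⟩
  obtain ⟨C₁, h₁, H₁⟩ := FokkerPlanck.exists_decay_homogeneous (d := d) hq1 hq2 m
  obtain ⟨C₂, h₂, H₂⟩ := FokkerPlanck.exists_decay_duhamel (d := d) hq1 hq2 m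
  refine ⟨C₁ + C₂, by positivity, ?_, ?_⟩
  · intro α β hβα hm f₀ fα fβ hα hα2 hβ hfin t ht
    obtain ⟨g, hg, hg2, hle⟩ := H₁ α β hβα hm f₀ fα fβ hα hα2 hβ hfin t ht
    refine ⟨g, hg, hg2, hle.trans ?_⟩
    gcongr
    linarith
  · intro α β hβα hm h hα hβ hmα _ hae hmom u hu t ht R hR hRfin
    obtain ⟨g, hg, hg2, hle⟩ := H₂ α β hβα hm h hα hβ hmα hae hmom u hu t ht R hR hRfin
    refine ⟨g, hg, hg2, hle.trans ?_⟩
    gcongr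
    linarith
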